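/- **Setting.** Let $\Omega\subset\mathbb R^2$ be a simply connected (not necessarily convex) polygon that can be subdivided into rectangles with sides parallel to the axes. A *rectangular grid* $\mathcal G_h$ of $\Omega$ is a finite set of closed non-degenerate axis-parallel rectangles (cells) such that $\Omega$ is the interior of their union and any two different cells are disjoint or meet exactly in a common vertex or a common edge. For a cell $K$ with side lengths $L_K,H_K$ let $h_K=\max\{L_K,H_K\}$ and let $\rho_K$ be its inscribed circle radius; $h=\max_K h_K$. The grid is shape regular with constant $\gamma_0$ if $h_K/\rho_K\le\gamma_0$ for all $K$. A cell is *interior*, $K\in\mathcal K_h^i$, if none of its vertices is on $\partial\Omega$; it is then the centre of a unique $3\times3$ patch $\mathcal M_K$ of cells of $\mathcal G_h$, with column widths $L_{K,-1},L_K,L_{K,1}$ and row heights $H_{K,-1},H_K,H_{K,1}$. The reduced rectangular Morley space $V_{h0}^{R}(\mathcal G_h)$ consists of the functions that are polynomials of total degree at most $2$ on each cell, are continuous at the interior vertices and zero at the boundary vertices, and whose mean normal derivative $\frac1{|e|}\int_e\partial_n w$ is continuous across the interior edges and zero on the boundary edges. For $K\in\mathcal K_h^i$ let $\varphi_K$ be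 the function that vanishes outside $\mathcal M_K$, whose restriction to $\mathcal M_K$ is in $V^R_{h0}(\mathcal M_K)$, and whose value at the lower left vertex of $K$ is $\frac{L_{K,-1}}{L_{K,-1}+L_K}\cdot\frac{H_{K,-1}}{H_{K,-1}+H_K}$. With $S_1,S_2,S_3,S_4$ the left, right, lower and upper neighbours of $K$, $S_5=K$, and $$w_1=\tfrac{-L_K^2}{(L_{K,-1}+L_K)(L_{K,-1}+L_K+L_{K,1})},\quad w_2=\tfrac{-L_K^2}{(L_K+L_{K,1})(L_{K,-1}+L_K+L_{K,1})},$$ $$w_3=\tfrac{-H_K^2}{(H_{K,-1}+H_K)(H_{K,-1}+H_K+H_{K,1})},\quad w_4=\tfrac{-H_K^2}{(H_K+H_{K,1})(H_{K,-1}+H_K+H_{K,1})},\quad w_5=1-(w_1+w_2+w_3+w_4),$$ put $$\lambda_K(v)=\sum_{\mu=1}^5 w_\mu\,\frac1{|S_\mu|}\int_{S_\mu}v\,dx\,dy,\qquad \Pi_{h0}v=\sum_{K\in\mathcal K_h^i}\lambda_K(v)\,\varphi_K .$$ For real $s=m+\sigma\ge0$ with $m$ an integer and $0\le\sigma<1$,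 $|v|_{s,U}^2=\sum_{|\alpha|=m}|\partial^\alpha v|_{\sigma,U}^2$, where $|g|_{0,U}=\|g\|_{L^2(U)}$ and $|g|_{\sigma,U}^2=\int_U\int_U\frac{|g(z)-g(w)|^2}{|z-w|^{2+2\sigma}}\,dz\,dw$ for $0<\sigma<1$; $H^s(U)$ is the corresponding Sobolev space, $H^2_0(\Omega)$ is the closure of $C_c^\infty(\Omega)$ in $H^2(\Omega)$, and $|w|_{k,h}^2=\sum_{K\in\mathcal G_h}|w|_{k,\mathring K}^2$. **Theorem.** Let $\gamma_0$, $s$, $k$ be real numbers with $2\le s\le3$ and $0\le k\le s$. There is a constant $C>0$, depending only on $\Omega,\gamma_0,s,k$, such that for every rectangular grid $\mathcal G_h$ of $\Omega$ that is shape regular with constant $\gamma_0$ and every $v\in H^2_0(\Omega)\cap H^s(\Omega)$, $$\Pi_{h0}v\in V_{h0}^R(\mathcal G_h)\qquad\text{and}\qquad |v-\Pi_{h0}v|_{k,h}\le C\,h^{s-k}\,|v|_{s,\Omega}.$$ -/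

import Mathlib

open MeasureTheory Set
open scoped ENNReal ContDiff

namespace RRM

/-! ### Sobolev spaces on open subsets of the plane -/

/-- Partial derivative in the first variable. -/
noncomputable def pdx (f : ℝ × ℝ → ℝ) (z : ℝ × ℝ) : ℝ := fderiv ℝ f z (1, 0)

/-- Partial derivative in the second variable. -/
noncomputable def pdy (f : ℝ × ℝ → ℝ) (z : ℝ × ℝ) : ℝ := fderiv ℝ f z (0, 1)

/-- The classical derivative `∂ₓ^i ∂ᵧ^j f`. -/
noncomputable def pderiv (α : ℕ × ℕ) (f : ℝ × ℝ → ℝ) : ℝ × ℝ → ℝ :=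
  pdx^[α.1] (pdy^[α.2] f)

/-- Test functions: smooth functions with compact support contained in `U`. -/
def IsTest (U : Set (ℝ × ℝ)) (φ : ℝ × ℝ → ℝ) : Prop :=
  ContDiff ℝ ∞ φ ∧ HasCompactSupport φ ∧ tsupport φ ⊆ U

/-- `g` is the weak derivative `∂^α v` on the open set `U`. -/
def IsWeakDeriv (U : Set (ℝ × ℝ)) (α : ℕ × ℕ) (v g : ℝ × ℝ → ℝ) : Prop :=
  LocallyIntegrableOn v U ∧ LocallyIntegrableOn g U ∧
    ∀ φ, IsTest U φ →
      ∫ z in U, v z * pderiv α φ z = (-1) ^ (α.1 + α.2) * ∫ z in U, g z * φ z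

/-- Euclidean distance in the plane (the product type `ℝ × ℝ` carries the maximum distance). -/
noncomputable def eucl (z w : ℝ × ℝ) : ℝ := √((z.1 - w.1) ^ 2 + (z.2 - w.2) ^ 2)

/-- The square of the `L²(U)` norm of `g` if `σ = 0`, and of the Slobodeckij (Gagliardo) seminorm
of `g` of order `σ` on `U` if `0 < σ < 1`. -/
noncomputable def fracSq (σ : ℝ) (U : Set (ℝ × ℝ)) (g : ℝ × ℝ → ℝ) : ℝ≥0∞ :=
  if σ = 0 then ∫⁻ z in U, ‖g z‖ₑ ^ 2
  else ∫⁻ z in U, ∫⁻ w in U, ‖g z - g w‖ₑ ^ 2 / ENNReal.ofReal (eucl z w ^ (2 + 2 * σ))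

/-- The square of the Sobolev seminorm `|v|_{s,U}`, for a real order `s = m + σ ≥ 0` with `m` an
integer and `0 ≤ σ < 1`: the sum over `|α| = m` of `|∂^α v|²_{σ,U}`. Weak derivatives are unique
almost everywhere, so the infimum is over one value; it is `⊤` if some `∂^α v`, `|α| = m`, does not
exist. -/
noncomputable def seminormSq (s : ℝ) (U : Set (ℝ × ℝ)) (v : ℝ × ℝ → ℝ) : ℝ≥0∞ :=
  ⨅ (g : ℕ × ℕ → ℝ × ℝ → ℝ)
    (_ : ∀ α ∈ Finset.HasAntidiagonal.antidiagonal ⌊s⌋₊, IsWeakDeriv U α v (g α)),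
    ∑ α ∈ Finset.HasAntidiagonal.antidiagonal ⌊s⌋₊, fracSq (s - ⌊s⌋₊) U (g α)

/-- The Sobolev seminorm `|v|_{s,U}`, with value `⊤` where it is not finite. -/
noncomputable def seminorm (s : ℝ) (U : Set (ℝ × ℝ)) (v : ℝ × ℝ → ℝ) : ℝ≥0∞ :=
  seminormSq s U v ^ (1 / 2 : ℝ)

/-- `v ∈ H^s(U)`: weak derivatives up to order `⌊s⌋` are in `L²(U)`, and those of order `⌊s⌋` have
finite Slobodeckij seminorm if `s` is not an integer. -/
def MemH (s : ℝ) (U : Set (ℝ × ℝ)) (v : ℝ × ℝ → ℝ) : Prop :=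
  (∀ m : ℕ, m ≤ ⌊s⌋₊ → seminorm m U v < ⊤) ∧ seminorm s U v < ⊤

/-- `v ∈ H^m_0(U)`: the closure of the test functions in `H^m(U)`. -/
def MemHZero (m : ℕ) (U : Set (ℝ × ℝ)) (v : ℝ × ℝ → ℝ) : Prop :=
  MemH m U v ∧ ∀ ε : ℝ≥0∞, 0 < ε → ∃ φ, IsTest U φ ∧ ∀ j : ℕ, j ≤ m → seminorm j U (v - φ) ≤ ε

/-! ### Rectangular grids -/

/-- A non-degenerate rectangle `[x₀, x₁] × [y₀, y₁]`. -/
@[ext]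
structure Rect where
  x₀ : ℝ
  x₁ : ℝ
  y₀ : ℝ
  y₁ : ℝ
  hx : x₀ < x₁
  hy : y₀ < y₁

/-- The four sides of a rectangle. -/
inductive Side
  | left
  | right
  | bottom
  | top

namespace Rect

/-- The closed rectangle. -/
def closed (K : Rect) : Set (ℝ × ℝ) := Icc K.x₀ K.x₁ ×ˢ Icc K.y₀ K.y₁

/-- The open rectangle. -/
def inner (K : Rect) : Set (ℝ × ℝ) := Ioo K.x₀ K.x₁ ×ˢ Ioo K.y₀ K.y₁

/-- The four vertices. -/
def vertices (K : Rect) : Set (ℝ × ℝ) :=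
  {(K.x₀, K.y₀), (K.x₁, K.y₀), (K.x₀, K.y₁), (K.x₁, K.y₁)}

/-- The (closed) edges. -/
def edge (K : Rect) : Side → Set (ℝ × ℝ)
  | .left => {K.x₀} ×ˢ Icc K.y₀ K.y₁
  | .right => {K.x₁} ×ˢ Icc K.y₀ K.y₁
  | .bottom => Icc K.x₀ K.x₁ ×ˢ {K.y₀}
  | .top => Icc K.x₀ K.x₁ ×ˢ {K.y₁}

/-- Length `L_K`. -/
def len (K : Rect) : ℝ := K.x₁ - K.x₀

/-- Height `H_K`. -/
def hgt (K : Rect) : ℝ := K.y₁ - K.y₀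

/-- The size `h_K`. -/
noncomputable def size (K : Rect) : ℝ := max K.len K.hgt

/-- The radius `ρ_K` of the largest inscribed circle. -/
noncomputable def inradius (K : Rect) : ℝ := min K.len K.hgt / 2

/-- The mean value of `∂ₙ q` over an edge, where the normal `n` is `(1, 0)` on vertical edges and
`(0, 1)` on horizontal edges. -/
noncomputable def normalMean (K : Rect) (q : ℝ × ℝ → ℝ) : Side → ℝ
  | .left => (∫ t in K.y₀..K.y₁, deriv (fun x => q (x, t)) K.x₀) / K.hgt
  | .right => (∫ t in K.y₀..K.y₁, deriv (fun x => q (x, t)) K.x₁) / K.hgt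
  | .bottom => (∫ t in K.x₀..K.x₁, deriv (fun y => q (t, y)) K.y₀) / K.len
  | .top => (∫ t in K.x₀..K.x₁, deriv (fun y => q (t, y)) K.y₁) / K.len

end Rect

/-- The open region subdivided by a set of cells. -/
def domain (G : Set Rect) : Set (ℝ × ℝ) := interior (⋃ K ∈ G, K.closed)

/-- `G` is a rectangular grid of `Ω`: the cells fill `Ω`, and two different cells are disjoint or
meet exactly in a common vertex or in a common edge. -/
structure IsGrid (Ω : Set (ℝ × ℝ)) (G : Finset Rect) : Prop where
  fill : Ω = domain G
  conforming : ∀ K ∈ G, ∀ K' ∈ G, K ≠ K' →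
    K.closed ∩ K'.closed = ∅ ∨
    (∃ a, a ∈ K.vertices ∧ a ∈ K'.vertices ∧ K.closed ∩ K'.closed = {a}) ∨
    (∃ e e', K.closed ∩ K'.closed = K.edge e ∧ K.closed ∩ K'.closed = K'.edge e')

/-- Shape regularity with constant `γ₀`. -/
def IsShapeRegular (γ₀ : ℝ) (G : Finset Rect) : Prop :=
  ∀ K ∈ G, K.size / K.inradius ≤ γ₀

/-- The mesh size `h`, the maximum of the `h_K`. -/
noncomputable def meshSize (G : Finset Rect) : ℝ := sSup (Rect.size '' (G : Set Rect))

open Classical in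
/-- The interior cells: no vertex is on the boundary of the domain. -/
noncomputable def interiorCells (G : Finset Rect) : Finset Rect :=
  G.filter fun K => ∀ a ∈ K.vertices, a ∉ frontier (domain (G : Set Rect))

/-- The broken seminorm `|w|_{k,h}`, taken cell by cell. -/
noncomputable def brokenSeminorm (k : ℝ) (G : Finset Rect) (w : ℝ × ℝ → ℝ) : ℝ≥0∞ :=
  (∑ K ∈ G, seminormSq k K.inner w) ^ (1 / 2 : ℝ)

/-! ### The reduced rectangular Morley space -/

/-- The polynomials of total degree at most two. -/
def quad (c : Fin 6 → ℝ) (z : ℝ × ℝ) : ℝ :=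
  c 0 + c 1 * z.1 + c 2 * z.2 + c 3 * z.1 ^ 2 + c 4 * (z.1 * z.2) + c 5 * z.2 ^ 2

/-- `w ∈ V_{h0}^R(G)`, where `quad (c K)` is the restriction of `w` to the cell `K`: a piecewise
quadratic function, continuous at the interior vertices and zero at the boundary vertices, whose
mean normal derivative is continuous across the interior edges and zero on the boundary edges. -/
structure IsRRMZeroRep (G : Set Rect) (w : ℝ × ℝ → ℝ) (c : Rect → Fin 6 → ℝ) : Prop where
  restrict : ∀ K ∈ G, ∀ z ∈ K.inner, w z = quad (c K) z
  vertex : ∀ K ∈ G, ∀ K' ∈ G, ∀ a, a ∈ K.vertices → a ∈ K'.vertices → a ∈ domain G →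
    quad (c K) a = quad (c K') a
  edge : ∀ K ∈ G, ∀ K' ∈ G, ∀ e e', K.edge e = K'.edge e' →
    K.normalMean (quad (c K)) e = K'.normalMean (quad (c K')) e'
  boundary_vertex : ∀ K ∈ G, ∀ a ∈ K.vertices, a ∈ frontier (domain G) → quad (c K) a = 0
  boundary_edge : ∀ K ∈ G, ∀ e, K.edge e ⊆ frontier (domain G) →
    K.normalMean (quad (c K)) e = 0

/-- The reduced rectangular Morley space `V_{h0}^R(G)`. -/
def rrmZero (G : Set Rect) : Set (ℝ × ℝ → ℝ) := {w | ∃ c, IsRRMZeroRep G w c}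

/-! ### Patches and the basis functions -/

/-- A `3 × 3` patch of rectangles, given by its grid lines. -/
structure Patch where
  X : Fin 4 → ℝ
  Y : Fin 4 → ℝ
  hX : StrictMono X
  hY : StrictMono Y

namespace Patch

/-- The cell in column `i` and row `j`; the centre is the cell `1 1`. -/
def cell (p : Patch) (i j : Fin 3) : Rect where
  x₀ := p.X i.castSucc
  x₁ := p.X i.succ
  y₀ := p.Y j.castSucc
  y₁ := p.Y j.succ
  hx := p.hX Fin.castSucc_lt_succ
  hy := p.hY Fin.castSucc_lt_succ

/-- The nine cells. -/
def cells (p : Patch) : Set Rect := {K | ∃ i j, K = p.cell i j}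

/-- Column lengths `L_{K,-1}, L_K, L_{K,1}`. -/
def L (p : Patch) (i : Fin 3) : ℝ := p.X i.succ - p.X i.castSucc

/-- Row heights `H_{K,-1}, H_K, H_{K,1}`. -/
def H (p : Patch) (j : Fin 3) : ℝ := p.Y j.succ - p.Y j.castSucc

end Patch

/-- `φ` is the normalised basis function of a patch: it vanishes outside the patch, its restriction
to the patch is in `V_{h0}^R` of the patch, and its value at the lower left vertex of the centre
cell is prescribed. -/
def IsPatchBasis (p : Patch) (φ : ℝ × ℝ → ℝ) : Prop :=
  (∀ z, z ∉ Icc (p.X 0) (p.X 3) ×ˢ Icc (p.Y 0) (p.Y 3) → φ z = 0) ∧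
  ∃ c, IsRRMZeroRep p.cells φ c ∧
    quad (c (p.cell 1 1)) (p.X 1, p.Y 1) =
      p.L 0 / (p.L 0 + p.L 1) * (p.H 0 / (p.H 0 + p.H 1))

/-! ### Existence of the normalised basis function -/

theorem mean_deriv_fst (c : Fin 6 → ℝ) (x : ℝ) {a b : ℝ} (h : a < b) :
    (∫ t in a..b, deriv (fun x => quad c (x, t)) x) / (b - a) =
      c 1 + 2 * c 3 * x + c 4 * ((a + b) / 2) := by
  have h1 : ∀ t, deriv (fun x => quad c (x, t)) x = (c 1 + 2 * c 3 * x) + c 4 * t := by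
    intro t
    have hid := hasDerivAt_id' x
    have h := ((((hid.const_mul (c 1)).const_add (c 0)).add_const (c 2 * t)).add
        ((hid.pow 2).const_mul (c 3))).add ((hid.mul_const t).const_mul (c 4)) |>.add_const
          (c 5 * t ^ 2)
    refine h.deriv.trans ?_
    push_cast
    ring
  simp only [h1]
  rw [intervalIntegral.integral_add (by simp) (Continuous.intervalIntegrable (by fun_prop) _ _),
    intervalIntegral.integral_const, intervalIntegral.integral_const_mul, integral_id,
    div_eq_iff (sub_pos.2 h).ne']
  simp only [smul_eq_mul]
  ring

theorem mean_deriv_snd (c : Fin 6 → ℝ) (y : ℝ) {a b : ℝ} (h : a < b) :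
    (∫ t in a..b, deriv (fun y => quad c (t, y)) y) / (b - a) =
      c 2 + 2 * c 5 * y + c 4 * ((a + b) / 2) := by
  have h1 : ∀ t, deriv (fun y => quad c (t, y)) y = (c 2 + 2 * c 5 * y) + c 4 * t := by
    intro t
    have hid := hasDerivAt_id' y
    have h := ((((hid.const_mul (c 2)).const_add (c 0 + c 1 * t)).add_const (c 3 * t ^ 2)).add
        ((hid.const_mul t).const_mul (c 4))).add ((hid.pow 2).const_mul (c 5))
    refine h.deriv.trans ?_
    push_cast
    ring
  simp only [h1]
  rw [intervalIntegral.integral_add (by simp) (Continuous.intervalIntegrable (by fun_prop) _ _),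
    intervalIntegral.integral_const, intervalIntegral.integral_const_mul, integral_id,
    div_eq_iff (sub_pos.2 h).ne']
  simp only [smul_eq_mul]
  ring

/-- Nodal values of the quadratic B-spline with knots `t`. -/
noncomputable def node (t : Fin 4 → ℝ) : Fin 4 → ℝ :=
  ![0, (t 1 - t 0) / (t 2 - t 0), (t 3 - t 2) / (t 3 - t 1), 0]

/-- Half the second derivatives of the quadratic B-spline with knots `t`. -/
noncomputable def bend (t : Fin 4 → ℝ) : Fin 3 → ℝ :=
  ![1 / ((t 1 - t 0) * (t 2 - t 0)), -(1 / (t 2 - t 0) + 1 / (t 3 - t 1)) / (t 2 - t 1),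
    1 / ((t 3 - t 2) * (t 3 - t 1))]

/-- Slope of the linear interpolant of the B-spline. -/
noncomputable def slope (t : Fin 4 → ℝ) (i : Fin 3) : ℝ :=
  (node t i.succ - node t i.castSucc) / (t i.succ - t i.castSucc)

/-- Mean of the two nodal values. -/
noncomputable def avg (t : Fin 4 → ℝ) (i : Fin 3) : ℝ := (node t i.castSucc + node t i.succ) / 2

/-- Derivative of the B-spline at a knot. -/
noncomputable def dnode (t : Fin 4 → ℝ) : Fin 4 → ℝ := ![0, 2 / (t 2 - t 0), -2 / (t 3 - t 1), 0]

theorem slope_left {t : Fin 4 → ℝ} (ht : StrictMono t) (i : Fin 3) :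
    slope t i - bend t i * (t i.succ - t i.castSucc) = dnode t i.castSucc := by
  have h0 : t 0 < t 1 := ht (by decide)
  have h1 : t 1 < t 2 := ht (by decide)
  have h2 : t 2 < t 3 := ht (by decide)
  have a0 : t 1 - t 0 ≠ 0 := (sub_pos.2 h0).ne'
  have a1 : t 2 - t 1 ≠ 0 := (sub_pos.2 h1).ne'
  have a2 : t 3 - t 2 ≠ 0 := (sub_pos.2 h2).ne'
  have a3 : t 2 - t 0 ≠ 0 := (sub_pos.2 (h0.trans h1)).ne'
  have a4 : t 3 - t 1 ≠ 0 := (sub_pos.2 (h1.trans h2)).ne'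
  fin_cases i <;> simp [slope, node, bend, dnode] <;> field_simp <;> ring

theorem slope_right {t : Fin 4 → ℝ} (ht : StrictMono t) (i : Fin 3) :
    slope t i + bend t i * (t i.succ - t i.castSucc) = dnode t i.succ := by
  have h0 : t 0 < t 1 := ht (by decide)
  have h1 : t 1 < t 2 := ht (by decide)
  have h2 : t 2 < t 3 := ht (by decide)
  have a0 : t 1 - t 0 ≠ 0 := (sub_pos.2 h0).ne'
  have a1 : t 2 - t 1 ≠ 0 := (sub_pos.2 h1).ne'
  have a2 : t 3 - t 2 ≠ 0 := (sub_pos.2 h2).ne'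
  have a3 : t 2 - t 0 ≠ 0 := (sub_pos.2 (h0.trans h1)).ne'
  have a4 : t 3 - t 1 ≠ 0 := (sub_pos.2 (h1.trans h2)).ne'
  fin_cases i <;> simp [slope, node, bend, dnode] <;> field_simp <;> ring

namespace Patch

/-- Coefficients of the basis function on the cell `i j`. -/
noncomputable def coef (p : Patch) (i j : Fin 3) : Fin 6 → ℝ :=
  ![(node p.X i.castSucc - slope p.X i * p.X i.castSucc) *
        (node p.Y j.castSucc - slope p.Y j * p.Y j.castSucc)
      + avg p.Y j * bend p.X i * (p.X i.castSucc * p.X i.succ)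
      + avg p.X i * bend p.Y j * (p.Y j.castSucc * p.Y j.succ),
    slope p.X i * (node p.Y j.castSucc - slope p.Y j * p.Y j.castSucc)
      - avg p.Y j * bend p.X i * (p.X i.castSucc + p.X i.succ),
    slope p.Y j * (node p.X i.castSucc - slope p.X i * p.X i.castSucc)
      - avg p.X i * bend p.Y j * (p.Y j.castSucc + p.Y j.succ),
    avg p.Y j * bend p.X i, slope p.X i * slope p.Y j, avg p.X i * bend p.Y j]

theorem slope_mul {t : Fin 4 → ℝ} (ht : StrictMono t) (i : Fin 3) :
    slope t i * (t i.succ - t i.castSucc) = node t i.succ - node t i.castSucc :=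
  div_mul_cancel₀ _ (sub_pos.2 (ht Fin.castSucc_lt_succ)).ne'

theorem quad_coef (p : Patch) (i j : Fin 3) (u v : Fin 4)
    (hu : u = i.castSucc ∨ u = i.succ) (hv : v = j.castSucc ∨ v = j.succ) :
    quad (p.coef i j) (p.X u, p.Y v) = node p.X u * node p.Y v := by
  have hx := slope_mul p.hX i
  have hy := slope_mul p.hY j
  have h : quad (p.coef i j) (p.X u, p.Y v) =
      (node p.X i.castSucc + slope p.X i * (p.X u - p.X i.castSucc)) *
      (node p.Y j.castSucc + slope p.Y j * (p.Y v - p.Y j.castSucc)) +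
      avg p.Y j * bend p.X i * ((p.X u - p.X i.castSucc) * (p.X u - p.X i.succ)) +
      avg p.X i * bend p.Y j * ((p.Y v - p.Y j.castSucc) * (p.Y v - p.Y j.succ)) := by
    simp [quad, coef]
    ring
  rw [h]
  rcases hu with rfl | rfl <;> rcases hv with rfl | rfl <;> simp [hx, hy]

theorem mean_left (p : Patch) (i j : Fin 3) :
    (p.cell i j).normalMean (quad (p.coef i j)) .left = dnode p.X i.castSucc * avg p.Y j := by
  have hy := slope_mul p.hY j
  rw [← slope_left p.hX i]
  refine (mean_deriv_fst _ _ (p.cell i j).hy).trans ?_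
  simp only [coef, cell, avg]
  simp
  linear_combination (slope p.X i) / 2 * hy

theorem mean_right (p : Patch) (i j : Fin 3) :
    (p.cell i j).normalMean (quad (p.coef i j)) .right = dnode p.X i.succ * avg p.Y j := by
  have hy := slope_mul p.hY j
  rw [← slope_right p.hX i]
  refine (mean_deriv_fst _ _ (p.cell i j).hy).trans ?_
  simp only [coef, cell, avg]
  simp
  linear_combination (slope p.X i) / 2 * hy

theorem mean_bottom (p : Patch) (i j : Fin 3) :
    (p.cell i j).normalMean (quad (p.coef i j)) .bottom = dnode p.Y j.castSucc * avg p.X i := by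
  have hx := slope_mul p.hX i
  rw [← slope_left p.hY j]
  refine (mean_deriv_snd _ _ (p.cell i j).hx).trans ?_
  simp only [coef, cell, avg]
  simp
  linear_combination (slope p.Y j) / 2 * hx

theorem mean_top (p : Patch) (i j : Fin 3) :
    (p.cell i j).normalMean (quad (p.coef i j)) .top = dnode p.Y j.succ * avg p.X i := by
  have hx := slope_mul p.hX i
  rw [← slope_right p.hY j]
  refine (mean_deriv_snd _ _ (p.cell i j).hx).trans ?_
  simp only [coef, cell, avg]
  simp
  linear_combination (slope p.Y j) / 2 * hx

theorem cell_inj (p : Patch) {i j i' j' : Fin 3} (h : p.cell i j = p.cell i' j') :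
    i = i' ∧ j = j' := by
  have hx := congrArg Rect.x₀ h
  have hy := congrArg Rect.y₀ h
  exact ⟨Fin.castSucc_injective _ (p.hX.injective hx), Fin.castSucc_injective _ (p.hY.injective hy)⟩

theorem mem_vertices (p : Patch) {i j : Fin 3} {a : ℝ × ℝ} (h : a ∈ (p.cell i j).vertices) :
    ∃ u v, (u = i.castSucc ∨ u = i.succ) ∧ (v = j.castSucc ∨ v = j.succ) ∧
      a = (p.X u, p.Y v) := by
  simp only [Rect.vertices, cell, mem_insert_iff, mem_singleton_iff] at h
  rcases h with rfl | rfl | rfl | rfl <;> exact ⟨_, _, by simp, by simp, rfl⟩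

/-- The interval between the first and the last knot is covered by the three pieces. -/
theorem exists_piece {t : Fin 4 → ℝ} {x : ℝ} (h : x ∈ Icc (t 0) (t 3)) :
    ∃ i : Fin 3, x ∈ Icc (t i.castSucc) (t i.succ) := by
  rcases le_total x (t 1) with h1 | h1
  · exact ⟨0, h.1, h1⟩
  rcases le_total x (t 2) with h2 | h2
  · exact ⟨1, h1, h2⟩
  · exact ⟨2, h2, h.2⟩

theorem domain_cells (p : Patch) :
    domain p.cells = Ioo (p.X 0) (p.X 3) ×ˢ Ioo (p.Y 0) (p.Y 3) := by
  have h : (⋃ K ∈ p.cells, K.closed) = Icc (p.X 0) (p.X 3) ×ˢ Icc (p.Y 0) (p.Y 3) := by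
    ext z
    simp only [mem_iUnion, exists_prop]
    constructor
    · rintro ⟨_, ⟨i, j, rfl⟩, hz⟩
      have e0 := p.hX.monotone (Fin.zero_le i.castSucc)
      have e1 := p.hX.monotone (Fin.le_last i.succ)
      have e2 := p.hY.monotone (Fin.zero_le j.castSucc)
      have e3 := p.hY.monotone (Fin.le_last j.succ)
      exact ⟨⟨e0.trans hz.1.1, hz.1.2.trans e1⟩, ⟨e2.trans hz.2.1, hz.2.2.trans e3⟩⟩
    · rintro ⟨hx, hy⟩
      obtain ⟨i, hi⟩ := exists_piece hx
      obtain ⟨j, hj⟩ := exists_piece hy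
      exact ⟨_, ⟨i, j, rfl⟩, hi, hj⟩
  rw [domain, h, interior_prod_eq, interior_Icc, interior_Icc]

theorem not_mem_frontier (p : Patch) {z : ℝ × ℝ} (h : z ∈ frontier (domain p.cells)) :
    ¬ (z.1 ∈ Ioo (p.X 0) (p.X 3) ∧ z.2 ∈ Ioo (p.Y 0) (p.Y 3)) := by
  intro hz
  have ho : IsOpen (domain p.cells) := isOpen_interior
  rw [ho.frontier_eq] at h
  exact h.2 (by rw [domain_cells]; exact hz)

theorem inner_knot {t : Fin 4 → ℝ} (ht : StrictMono t) (u : Fin 4) (h0 : u ≠ 0) (h3 : u ≠ 3) :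
    t u ∈ Ioo (t 0) (t 3) :=
  ⟨ht (Fin.pos_iff_ne_zero.2 h0), ht (lt_of_le_of_ne (Fin.le_last u) h3)⟩

theorem mid_mem {t : Fin 4 → ℝ} (ht : StrictMono t) (i : Fin 3) :
    (t i.castSucc + t i.succ) / 2 ∈ Ioo (t 0) (t 3) ∩ Icc (t i.castSucc) (t i.succ) := by
  have e0 := ht.monotone (Fin.zero_le i.castSucc)
  have e1 : t i.succ ≤ t 3 := ht.monotone (Fin.le_last i.succ)
  have e2 : t i.castSucc < t i.succ := ht Fin.castSucc_lt_succ
  refine ⟨⟨?_, ?_⟩, ?_, ?_⟩ <;> linarith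

theorem box_inj {a b c d a' b' c' d' : ℝ} (h1 : a ≤ b) (h2 : c ≤ d)
    (h : Icc a b ×ˢ Icc c d = Icc a' b' ×ˢ Icc c' d') : a = a' ∧ b = b' ∧ c = c' ∧ d = d' := by
  have hn : (Icc a b ×ˢ Icc c d).Nonempty := (nonempty_Icc.2 h1).prod (nonempty_Icc.2 h2)
  obtain ⟨e1, e2⟩ := (prod_eq_prod_iff_of_nonempty hn).1 h
  obtain ⟨e3, e4⟩ := (Icc_eq_Icc_iff h1).1 e1
  obtain ⟨e5, e6⟩ := (Icc_eq_Icc_iff h2).1 e2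
  exact ⟨e3, e4, e5, e6⟩

/-- Every edge of a cell is vertical or horizontal on a grid line, with the mean normal derivative
prescribed by the grid line. -/
theorem edge_cases (p : Patch) (i j : Fin 3) (e : Side) :
    (∃ u, (p.cell i j).edge e = Icc (p.X u) (p.X u) ×ˢ Icc (p.Y j.castSucc) (p.Y j.succ) ∧
      (p.cell i j).normalMean (quad (p.coef i j)) e = dnode p.X u * avg p.Y j) ∨
    (∃ v, (p.cell i j).edge e = Icc (p.X i.castSucc) (p.X i.succ) ×ˢ Icc (p.Y v) (p.Y v) ∧
      (p.cell i j).normalMean (quad (p.coef i j)) e = dnode p.Y v * avg p.X i) := by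
  cases e
  · exact .inl ⟨_, by simp [Rect.edge, cell], p.mean_left i j⟩
  · exact .inl ⟨_, by simp [Rect.edge, cell], p.mean_right i j⟩
  · exact .inr ⟨_, by simp [Rect.edge, cell], p.mean_bottom i j⟩
  · exact .inr ⟨_, by simp [Rect.edge, cell], p.mean_top i j⟩

open Classical in
/-- The coefficients of the basis function, as a function of the cell. -/
noncomputable def coefs (p : Patch) (K : Rect) : Fin 6 → ℝ :=
  if h : ∃ ij : Fin 3 × Fin 3, K = p.cell ij.1 ij.2 then p.coef h.choose.1 h.choose.2 else 0

theorem coefs_cell (p : Patch) (i j : Fin 3) : p.coefs (p.cell i j) = p.coef i j := by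
  have h : ∃ ij : Fin 3 × Fin 3, p.cell i j = p.cell ij.1 ij.2 := ⟨(i, j), rfl⟩
  obtain ⟨h1, h2⟩ := p.cell_inj h.choose_spec
  rw [coefs, dif_pos h, ← h1, ← h2]

theorem eq_of_mem_inner (p : Patch) {i j i' j' : Fin 3} {z : ℝ × ℝ}
    (h : z ∈ (p.cell i j).inner) (h' : z ∈ (p.cell i' j').inner) : i = i' ∧ j = j' := by
  have key : ∀ (t : Fin 4 → ℝ), StrictMono t → ∀ (x : ℝ) (a b : Fin 3),
      x ∈ Ioo (t a.castSucc) (t a.succ) → x ∈ Ioo (t b.castSucc) (t b.succ) → a = b := by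
    intro t ht x a b ha hb
    have h1 := ht.lt_iff_lt.1 (ha.1.trans hb.2)
    have h2 := ht.lt_iff_lt.1 (hb.1.trans ha.2)
    simp only [Fin.lt_def, Fin.val_castSucc, Fin.val_succ] at h1 h2
    omega
  exact ⟨key _ p.hX _ _ _ h.1 h'.1, key _ p.hY _ _ _ h.2 h'.2⟩

open Classical in
theorem exists_basis (p : Patch) : ∃ φ, IsPatchBasis p φ := by
  refine ⟨fun z => if h : ∃ ij : Fin 3 × Fin 3, z ∈ (p.cell ij.1 ij.2).inner then
    quad (p.coef h.choose.1 h.choose.2) z else 0, ?_, p.coefs, ?_, ?_⟩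
  · intro z hz
    refine dif_neg ?_
    rintro ⟨⟨i, j⟩, h⟩
    have e0 := p.hX.monotone (Fin.zero_le i.castSucc)
    have e1 := p.hX.monotone (Fin.le_last i.succ)
    have e2 := p.hY.monotone (Fin.zero_le j.castSucc)
    have e3 := p.hY.monotone (Fin.le_last j.succ)
    exact hz ⟨⟨e0.trans h.1.1.le, h.1.2.le.trans e1⟩, ⟨e2.trans h.2.1.le, h.2.2.le.trans e3⟩⟩
  · constructor
    · rintro _ ⟨i, j, rfl⟩ z hz
      have h : ∃ ij : Fin 3 × Fin 3, z ∈ (p.cell ij.1 ij.2).inner := ⟨(i, j), hz⟩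
      obtain ⟨h1, h2⟩ := p.eq_of_mem_inner hz h.choose_spec
      simp only [dif_pos h, coefs_cell]
      rw [← h1, ← h2]
    · rintro _ ⟨i, j, rfl⟩ _ ⟨i', j', rfl⟩ a ha ha' -
      obtain ⟨u, v, hu, hv, rfl⟩ := p.mem_vertices ha
      obtain ⟨u', v', hu', hv', he⟩ := p.mem_vertices ha'
      have e1 := p.hX.injective (congrArg Prod.fst he)
      have e2 := p.hY.injective (congrArg Prod.snd he)
      subst e1 e2
      rw [coefs_cell, coefs_cell, p.quad_coef i j _ _ hu hv, p.quad_coef i' j' _ _ hu' hv']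
    · rintro _ ⟨i, j, rfl⟩ _ ⟨i', j', rfl⟩ e e' hee
      rw [coefs_cell, coefs_cell]
      have hX := fun k : Fin 3 => p.hX (Fin.castSucc_lt_succ (i := k))
      have hY := fun k : Fin 3 => p.hY (Fin.castSucc_lt_succ (i := k))
      rcases p.edge_cases i j e with ⟨u, h1, h2⟩ | ⟨u, h1, h2⟩ <;>
      rcases p.edge_cases i' j' e' with ⟨u', h1', h2'⟩ | ⟨u', h1', h2'⟩ <;>
      rw [h1, h1'] at hee <;> rw [h2, h2']
      · obtain ⟨a1, -, a3, -⟩ := box_inj le_rfl (hY j).le hee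
        rw [p.hX.injective a1, Fin.castSucc_injective _ (p.hY.injective a3)]
      · obtain ⟨a1, a2, -, -⟩ := box_inj le_rfl (hY j).le hee
        exact absurd (hX i') (by rw [← a1, ← a2]; exact lt_irrefl _)
      · obtain ⟨a1, a2, -, -⟩ := box_inj (hX i).le le_rfl hee
        exact absurd (hX i) (by rw [a1, a2]; exact lt_irrefl _)
      · obtain ⟨a1, -, a3, -⟩ := box_inj (hX i).le le_rfl hee
        rw [p.hY.injective a3, Fin.castSucc_injective _ (p.hX.injective a1)]
    · rintro _ ⟨i, j, rfl⟩ a ha hf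
      obtain ⟨u, v, hu, hv, rfl⟩ := p.mem_vertices ha
      rw [coefs_cell, p.quad_coef i j _ _ hu hv]
      have hn := p.not_mem_frontier hf
      by_contra hne
      have hu0 : u ≠ 0 := by rintro rfl; simp [node] at hne
      have hu3 : u ≠ 3 := by rintro rfl; simp [node] at hne
      have hv0 : v ≠ 0 := by rintro rfl; simp [node] at hne
      have hv3 : v ≠ 3 := by rintro rfl; simp [node] at hne
      exact hn ⟨inner_knot p.hX u hu0 hu3, inner_knot p.hY v hv0 hv3⟩
    · rintro _ ⟨i, j, rfl⟩ e he
      rw [coefs_cell]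
      by_contra hne
      rcases p.edge_cases i j e with ⟨u, h1, h2⟩ | ⟨u, h1, h2⟩ <;> rw [h1] at he <;>
        rw [h2] at hne
      · have hu0 : u ≠ 0 := by rintro rfl; simp [dnode] at hne
        have hu3 : u ≠ 3 := by rintro rfl; simp [dnode] at hne
        obtain ⟨m1, m2⟩ := mid_mem p.hY j
        exact p.not_mem_frontier (he (mk_mem_prod (left_mem_Icc.2 le_rfl) m2))
          ⟨inner_knot p.hX u hu0 hu3, m1⟩
      · have hu0 : u ≠ 0 := by rintro rfl; simp [dnode] at hne
        have hu3 : u ≠ 3 := by rintro rfl; simp [dnode] at hne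
        obtain ⟨m1, m2⟩ := mid_mem p.hX i
        exact p.not_mem_frontier (he (mk_mem_prod m2 (left_mem_Icc.2 le_rfl)))
          ⟨m1, inner_knot p.hY u hu0 hu3⟩
  · rw [coefs_cell]
    refine (p.quad_coef 1 1 1 1 (.inl rfl) (.inl rfl)).trans ?_
    simp [node, L, H]

/-- The basis function `φ_K` of a patch; `IsPatchBasis` determines it on the open cells. -/
noncomputable def basis (p : Patch) : ℝ × ℝ → ℝ := p.exists_basis.choose

theorem basis_spec (p : Patch) : IsPatchBasis p p.basis := p.exists_basis.choose_spec

/-- Mean value of `v` over the cell `i j` of the patch. -/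
noncomputable def mean (p : Patch) (v : ℝ × ℝ → ℝ) (i j : Fin 3) : ℝ :=
  ⨍ z in (p.cell i j).inner, v z

/-- Weight of the cell to the left of the centre. -/
noncomputable def w₁ (p : Patch) : ℝ :=
  -p.L 1 ^ 2 / ((p.L 0 + p.L 1) * (p.L 0 + p.L 1 + p.L 2))

/-- Weight of the cell to the right of the centre. -/
noncomputable def w₂ (p : Patch) : ℝ :=
  -p.L 1 ^ 2 / ((p.L 1 + p.L 2) * (p.L 0 + p.L 1 + p.L 2))

/-- Weight of the cell below the centre. -/
noncomputable def w₃ (p : Patch) : ℝ :=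
  -p.H 1 ^ 2 / ((p.H 0 + p.H 1) * (p.H 0 + p.H 1 + p.H 2))

/-- Weight of the cell above the centre. -/
noncomputable def w₄ (p : Patch) : ℝ :=
  -p.H 1 ^ 2 / ((p.H 1 + p.H 2) * (p.H 0 + p.H 1 + p.H 2))

/-- The local averaging functional `λ_K`. -/
noncomputable def lam (p : Patch) (v : ℝ × ℝ → ℝ) : ℝ :=
  p.w₁ * p.mean v 0 1 + p.w₂ * p.mean v 2 1 + p.w₃ * p.mean v 1 0 + p.w₄ * p.mean v 1 2 +
    (1 - (p.w₁ + p.w₂ + p.w₃ + p.w₄)) * p.mean v 1 1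

/-- `p` is the patch in the grid `G` centred at the cell `K`. -/
def IsPatchOf (p : Patch) (G : Finset Rect) (K : Rect) : Prop :=
  p.cell 1 1 = K ∧ p.cells ⊆ (G : Set Rect)

end Patch

open Classical in
/-- The quasi-interpolant `Π_{h0} v`, the sum of `λ_K(v) φ_K` over the interior cells `K`. An
interior cell of a grid is the centre of exactly one patch in the grid, so that the alternative `0`
does not occur. -/
noncomputable def quasiInterp (G : Finset Rect) (v : ℝ × ℝ → ℝ) (z : ℝ × ℝ) : ℝ :=
  ∑ K ∈ interiorCells G,
    if h : ∃ p : Patch, p.IsPatchOf G K then h.choose.lam v * h.choose.basis z else 0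

end RRM

namespace RRM

/-! ### Classical partial derivatives -/

/-! The operator reproduces quadratic polynomials locally, it needs no correction at the boundary
because the coefficients missing there are negligible for functions in `H^2_0`, and the resulting
error on a cell is controlled by the oscillation of the second derivatives on nearby cells.

Algebra. At the vertices of its patch, `φ_K` takes the values of a tensor product of two quadratic
B-splines whose knots are the grid lines, and its mean normal derivative on an edge is the spline
derivative at a knot times the average of two nodal values. The conditions on a patch leave one
degree of freedom, fixed by the normalisation (`rep_eq_coef`). On a given cell `K` at most nine
basis functions are nonzero. To describe them uniformly, `K` is put at the centre of a frame of nine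
cells, virtual ones standing in for missing neighbours (`exists_frame`), and the basis functions
restricted to `K` depend only on the grid lines of the frame. A tensor form of Marsden's identity
(`sum_blossom_loc`) writes a quadratic `q` on `K` as the combination of the nine restrictions with
coefficients `blossom R q`, a polar form of `q` at the sides of `R`. The weights `w_μ` are such that
`λ_R q = blossom R q` (`lam_quad`). Membership in the Morley space follows because a patch basis
function has zero boundary data and can be extended by zero (`basis_rep_grid`).

Boundary. If a cell `R` of the frame carries no basis function that acts on `K`, then a cell near
`K` has an edge without neighbour on a line through a side of `R` (`frame_cell_of_noWall`). That
edge lies outside `Ω`, so a test function and its gradient vanish on it, and the function is close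
to `a (x - l)² / 2` there, or to the same in `y` (`small_of_wallX`, `small_of_wallY`). The polar
form of this profile is a multiple of `(x₀ - l) (x₁ - l)`, which is zero for `R`. Hence `blossom R`
of the local Taylor polynomial is small, and using the coefficient zero in its place is harmless
(`sq_blossom_le_of_wall`).

Analysis. No compactness argument is used. Closeness to a quadratic means scaled `L²` bounds for all
derivatives up to order two (`Small`). The data are the double integrals of squared differences of
second derivatives, which do not change when a quadratic is subtracted. The averaged Taylor
polynomial is close to the function on its cell (`taylor_small`), and closeness passes from a cell
to an edge neighbour (`Small.step`), because the union of the two is a rectangle, on which the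
gradient controls oscillations (`osc_le_of_joined`, a consequence of the fractional estimate
`fracSq_le_of_contDiff`). This gives `small_sub_interp` for test functions.

Passage to Sobolev functions. The bound for test functions involves second derivatives only, so
approximation in `H²` and Fatou's lemma suffice, and density in `H^s` is not needed
(`l2Sq_interp_le`). The oscillation is then bounded by `h^(2s-2)` times the local part of `|v|_s²`
(`oscSq_le_cellDens`). A fractional order `k` is reached either through the gradient of the error or
by comparing kernels (`seminormSq_error_le`). The neighbourhoods used have at most 125 cells and are
symmetric, so the local estimates can be summed. -/

theorem contDiff_pdx {f : ℝ × ℝ → ℝ} (hf : ContDiff ℝ ∞ f) : ContDiff ℝ ∞ (pdx f) :=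
  (hf.fderiv_right (m := ∞) (by simp)).clm_apply contDiff_const

theorem contDiff_pdy {f : ℝ × ℝ → ℝ} (hf : ContDiff ℝ ∞ f) : ContDiff ℝ ∞ (pdy f) :=
  (hf.fderiv_right (m := ∞) (by simp)).clm_apply contDiff_const

theorem contDiff_pdy_iterate {f : ℝ × ℝ → ℝ} (hf : ContDiff ℝ ∞ f) (n : ℕ) :
    ContDiff ℝ ∞ (pdy^[n] f) := by
  induction n with
  | zero => exact hf
  | succ n ih => rw [Function.iterate_succ_apply']; exact contDiff_pdy ih

theorem contDiff_pdx_iterate {f : ℝ × ℝ → ℝ} (hf : ContDiff ℝ ∞ f) (n : ℕ) :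
    ContDiff ℝ ∞ (pdx^[n] f) := by
  induction n with
  | zero => exact hf
  | succ n ih => rw [Function.iterate_succ_apply']; exact contDiff_pdx ih

theorem contDiff_pderiv {f : ℝ × ℝ → ℝ} (hf : ContDiff ℝ ∞ f) (α : ℕ × ℕ) :
    ContDiff ℝ ∞ (pderiv α f) :=
  contDiff_pdx_iterate (contDiff_pdy_iterate hf _) _

theorem pdx_pdy_comm {f : ℝ × ℝ → ℝ} (hf : ContDiff ℝ ∞ f) : pdx (pdy f) = pdy (pdx f) := by
  have h1 : Differentiable ℝ (fderiv ℝ f) :=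
    (hf.fderiv_right (m := ∞) (by simp)).differentiable (by simp)
  funext z
  have hs : IsSymmSndFDerivAt ℝ f z := hf.contDiffAt.isSymmSndFDerivAt (by
    rw [minSmoothness_of_isRCLikeNormedField]; exact WithTop.coe_le_coe.2 le_top)
  have key : ∀ a b : ℝ × ℝ, fderiv ℝ (fun z => fderiv ℝ f z a) z b = fderiv ℝ (fderiv ℝ f) z b a := by
    intro a b
    rw [fderiv_clm_apply (h1 z) (differentiableAt_const a)]
    simp
  refine (key (0, 1) (1, 0)).trans ((hs.eq _ _).trans (key (1, 0) (0, 1)).symm)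

theorem pdy_pdx_iterate {f : ℝ × ℝ → ℝ} (hf : ContDiff ℝ ∞ f) (n : ℕ) :
    pdx^[n] (pdy f) = pdy (pdx^[n] f) := by
  induction n with
  | zero => rfl
  | succ n ih =>
    rw [Function.iterate_succ_apply', Function.iterate_succ_apply', ih,
      pdx_pdy_comm (contDiff_pdx_iterate hf n)]

theorem pdx_pdy_iterate {f : ℝ × ℝ → ℝ} (hf : ContDiff ℝ ∞ f) (n : ℕ) :
    pdx (pdy^[n] f) = pdy^[n] (pdx f) := by
  induction n with
  | zero => rfl
  | succ n ih =>
    rw [Function.iterate_succ_apply', Function.iterate_succ_apply',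
      pdx_pdy_comm (contDiff_pdy_iterate hf n), ih]

theorem pderiv_pdx {f : ℝ × ℝ → ℝ} (hf : ContDiff ℝ ∞ f) (α : ℕ × ℕ) :
    pderiv α (pdx f) = pderiv (α + (1, 0)) f := by
  simp only [pderiv, Prod.fst_add, Prod.snd_add, add_zero, Function.iterate_add_apply,
    Function.iterate_one]
  rw [pdx_pdy_iterate hf]

theorem pderiv_pdy {f : ℝ × ℝ → ℝ} (α : ℕ × ℕ) :
    pderiv α (pdy f) = pderiv (α + (0, 1)) f := by
  simp only [pderiv, Prod.fst_add, Prod.snd_add, add_zero, Function.iterate_add_apply,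
    Function.iterate_one]

theorem pdx_pderiv (f : ℝ × ℝ → ℝ) (α : ℕ × ℕ) :
    pdx (pderiv α f) = pderiv (α + (1, 0)) f := by
  simp only [pderiv, Prod.fst_add, Prod.snd_add, add_zero, Function.iterate_succ_apply']

theorem pdy_pderiv {f : ℝ × ℝ → ℝ} (hf : ContDiff ℝ ∞ f) (α : ℕ × ℕ) :
    pdy (pderiv α f) = pderiv (α + (0, 1)) f := by
  simp only [pderiv, Prod.fst_add, Prod.snd_add, add_zero, Function.iterate_succ_apply']
  rw [pdy_pdx_iterate (contDiff_pdy_iterate hf _)]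

theorem pdx_sub {f g : ℝ × ℝ → ℝ} (hf : ContDiff ℝ ∞ f) (hg : ContDiff ℝ ∞ g) :
    pdx (f - g) = pdx f - pdx g := by
  funext z
  simp only [pdx, Pi.sub_apply]
  rw [fderiv_sub (hf.differentiable (by simp) z) (hg.differentiable (by simp) z)]
  rfl

theorem pdy_sub {f g : ℝ × ℝ → ℝ} (hf : ContDiff ℝ ∞ f) (hg : ContDiff ℝ ∞ g) :
    pdy (f - g) = pdy f - pdy g := by
  funext z
  simp only [pdy, Pi.sub_apply]
  rw [fderiv_sub (hf.differentiable (by simp) z) (hg.differentiable (by simp) z)]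
  rfl

theorem pderiv_sub {f g : ℝ × ℝ → ℝ} (hf : ContDiff ℝ ∞ f) (hg : ContDiff ℝ ∞ g) (α : ℕ × ℕ) :
    pderiv α (f - g) = pderiv α f - pderiv α g := by
  have hy : ∀ n, pdy^[n] (f - g) = pdy^[n] f - pdy^[n] g := by
    intro n
    induction n with
    | zero => rfl
    | succ n ih =>
      rw [Function.iterate_succ_apply', ih, pdy_sub (contDiff_pdy_iterate hf n)
        (contDiff_pdy_iterate hg n), ← Function.iterate_succ_apply' pdy,
        ← Function.iterate_succ_apply' pdy]
  have hx : ∀ n, pdx^[n] (pdy^[α.2] f - pdy^[α.2] g) =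
      pdx^[n] (pdy^[α.2] f) - pdx^[n] (pdy^[α.2] g) := by
    intro n
    induction n with
    | zero => rfl
    | succ n ih =>
      rw [Function.iterate_succ_apply', ih,
        pdx_sub (contDiff_pdx_iterate (contDiff_pdy_iterate hf _) n)
        (contDiff_pdx_iterate (contDiff_pdy_iterate hg _) n), ← Function.iterate_succ_apply' pdx,
        ← Function.iterate_succ_apply' pdx]
  rw [pderiv, hy, hx]
  rfl

/-! ### Test functions -/

theorem IsTest.pdx {U : Set (ℝ × ℝ)} {φ : ℝ × ℝ → ℝ} (h : IsTest U φ) : IsTest U (pdx φ) :=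
  ⟨contDiff_pdx h.1, h.2.1.fderiv_apply (𝕜 := ℝ) (1, 0),
    (tsupport_fderiv_apply_subset ℝ (1, 0)).trans h.2.2⟩

theorem IsTest.pdy {U : Set (ℝ × ℝ)} {φ : ℝ × ℝ → ℝ} (h : IsTest U φ) : IsTest U (pdy φ) :=
  ⟨contDiff_pdy h.1, h.2.1.fderiv_apply (𝕜 := ℝ) (0, 1),
    (tsupport_fderiv_apply_subset ℝ (0, 1)).trans h.2.2⟩

theorem IsTest.pderiv {U : Set (ℝ × ℝ)} {φ : ℝ × ℝ → ℝ} (h : IsTest U φ) (α : ℕ × ℕ) :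
    IsTest U (pderiv α φ) := by
  have hy : ∀ n, IsTest U (RRM.pdy^[n] φ) := by
    intro n
    induction n with
    | zero => exact h
    | succ n ih => rw [Function.iterate_succ_apply']; exact ih.pdy
  have hx : ∀ n, IsTest U (RRM.pdx^[n] (RRM.pdy^[α.2] φ)) := by
    intro n
    induction n with
    | zero => exact hy _
    | succ n ih => rw [Function.iterate_succ_apply']; exact ih.pdx
  exact hx _

theorem IsTest.mono {U V : Set (ℝ × ℝ)} {φ : ℝ × ℝ → ℝ} (h : IsTest U φ) (hUV : U ⊆ V) :
    IsTest V φ :=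
  ⟨h.1, h.2.1, h.2.2.trans hUV⟩

theorem IsTest.eq_zero {U : Set (ℝ × ℝ)} {φ : ℝ × ℝ → ℝ} (h : IsTest U φ) {z : ℝ × ℝ}
    (hz : z ∉ U) : φ z = 0 :=
  image_eq_zero_of_notMem_tsupport fun h' => hz (h.2.2 h')

theorem IsTest.setIntegral {U : Set (ℝ × ℝ)} {φ : ℝ × ℝ → ℝ} (h : IsTest U φ)
    (f : ℝ × ℝ → ℝ) : ∫ z in U, f z * φ z = ∫ z, f z * φ z :=
  setIntegral_eq_integral_of_forall_compl_eq_zero fun z hz => by rw [h.eq_zero hz, mul_zero]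

theorem IsTest.integrable {U : Set (ℝ × ℝ)} {φ : ℝ × ℝ → ℝ} (h : IsTest U φ) {f : ℝ × ℝ → ℝ}
    (hf : LocallyIntegrableOn f U) : IntegrableOn (fun z => f z * φ z) U := by
  have h1 : IntegrableOn f (tsupport φ) := hf.integrableOn_compact_subset h.2.2 h.2.1
  obtain ⟨C, hC⟩ := h.2.1.exists_bound_of_continuous h.1.continuous
  have h2 : IntegrableOn (fun z => f z * φ z) (tsupport φ) :=
    Integrable.mul_bdd h1 h.1.continuous.aestronglyMeasurable (Filter.Eventually.of_forall hC)
  refine ((integrableOn_iff_integrable_of_support_subset ?_).1 h2).integrableOn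
  intro z hz
  exact subset_tsupport φ fun h0 => hz (by simp [h0])

theorem integral_mul_pdx {f φ : ℝ × ℝ → ℝ} (hf : ContDiff ℝ ∞ f) {U : Set (ℝ × ℝ)}
    (h : IsTest U φ) : ∫ z, f z * pdx φ z = -∫ z, pdx f z * φ z := by
  refine integral_mul_fderiv_eq_neg_fderiv_mul_of_integrable (μ := volume) ?_ ?_ ?_
    (fun z _ => hf.differentiable (by simp) z) (fun z _ => h.1.differentiable (by simp) z)
  · exact ((contDiff_pdx hf).continuous.mul h.1.continuous).integrable_of_hasCompactSupport
      h.2.1.mul_left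
  · exact (hf.continuous.mul h.pdx.1.continuous).integrable_of_hasCompactSupport
      h.pdx.2.1.mul_left
  · exact (hf.continuous.mul h.1.continuous).integrable_of_hasCompactSupport h.2.1.mul_left

theorem integral_mul_pdy {f φ : ℝ × ℝ → ℝ} (hf : ContDiff ℝ ∞ f) {U : Set (ℝ × ℝ)}
    (h : IsTest U φ) : ∫ z, f z * pdy φ z = -∫ z, pdy f z * φ z := by
  refine integral_mul_fderiv_eq_neg_fderiv_mul_of_integrable (μ := volume) ?_ ?_ ?_
    (fun z _ => hf.differentiable (by simp) z) (fun z _ => h.1.differentiable (by simp) z)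
  · exact ((contDiff_pdy hf).continuous.mul h.1.continuous).integrable_of_hasCompactSupport
      h.2.1.mul_left
  · exact (hf.continuous.mul h.pdy.1.continuous).integrable_of_hasCompactSupport
      h.pdy.2.1.mul_left
  · exact (hf.continuous.mul h.1.continuous).integrable_of_hasCompactSupport h.2.1.mul_left

/-! ### Weak derivatives -/

theorem isWeakDeriv_zero {U : Set (ℝ × ℝ)} {v : ℝ × ℝ → ℝ} (hv : LocallyIntegrableOn v U) :
    IsWeakDeriv U (0, 0) v v :=
  ⟨hv, hv, fun φ _ => by simp [pderiv]⟩

theorem isWeakDeriv_of_contDiff (U : Set (ℝ × ℝ)) {f : ℝ × ℝ → ℝ} (hf : ContDiff ℝ ∞ f)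
    (α : ℕ × ℕ) : IsWeakDeriv U α f (pderiv α f) := by
  refine ⟨hf.continuous.locallyIntegrable.locallyIntegrableOn _,
    (contDiff_pderiv hf α).continuous.locallyIntegrable.locallyIntegrableOn _, ?_⟩
  intro φ hφ
  rw [(hφ.pderiv α).setIntegral, hφ.setIntegral]
  obtain ⟨a, b⟩ := α
  induction a generalizing φ with
  | succ a ih =>
    have e : pderiv (a + 1, b) φ = pderiv (a, b) (pdx φ) := (pderiv_pdx hφ.1 (a, b)).symm
    have e' : pderiv (a + 1, b) f = pdx (pderiv (a, b) f) := (pdx_pderiv f (a, b)).symm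
    rw [e, ih _ hφ.pdx, integral_mul_pdx (contDiff_pderiv hf _) hφ, e']
    simp only
    ring
  | zero =>
    induction b generalizing φ with
    | zero => simp [pderiv]
    | succ b ih =>
      have e : pderiv (0, b + 1) φ = pderiv (0, b) (pdy φ) := (pderiv_pdy (0, b)).symm
      have e' : pderiv (0, b + 1) f = pdy (pderiv (0, b) f) := (pdy_pderiv hf (0, b)).symm
      rw [e, ih _ hφ.pdy, integral_mul_pdy (contDiff_pderiv hf _) hφ, e']
      simp only
      ring

theorem IsWeakDeriv.sub {U : Set (ℝ × ℝ)} {α : ℕ × ℕ} {v v' g g' : ℝ × ℝ → ℝ}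
    (h : IsWeakDeriv U α v g) (h' : IsWeakDeriv U α v' g') :
    IsWeakDeriv U α (v - v') (g - g') := by
  refine ⟨h.1.sub h'.1, h.2.1.sub h'.2.1, fun φ hφ => ?_⟩
  simp only [Pi.sub_apply, sub_mul]
  rw [integral_sub ((hφ.pderiv α).integrable h.1) ((hφ.pderiv α).integrable h'.1),
    integral_sub (hφ.integrable h.2.1) (hφ.integrable h'.2.1), h.2.2 φ hφ, h'.2.2 φ hφ, mul_sub]

theorem IsWeakDeriv.mono {U V : Set (ℝ × ℝ)} {α : ℕ × ℕ} {v g : ℝ × ℝ → ℝ}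
    (h : IsWeakDeriv V α v g) (hUV : U ⊆ V) : IsWeakDeriv U α v g := by
  refine ⟨h.1.mono_set hUV, h.2.1.mono_set hUV, fun φ hφ => ?_⟩
  have := h.2.2 φ (hφ.mono hUV)
  rwa [((hφ.mono hUV).pderiv α).setIntegral, (hφ.mono hUV).setIntegral,
    ← (hφ.pderiv α).setIntegral, ← hφ.setIntegral] at this

theorem IsWeakDeriv.congr {U : Set (ℝ × ℝ)} (hU : IsOpen U) {α : ℕ × ℕ} {v v' g : ℝ × ℝ → ℝ}
    (h : IsWeakDeriv U α v g) (hv : EqOn v' v U) : IsWeakDeriv U α v' g := by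
  refine ⟨?_, h.2.1, fun φ hφ => ?_⟩
  · refine h.1.congr ?_
    exact (ae_restrict_iff' hU.measurableSet).2 (Filter.Eventually.of_forall fun z hz => (hv hz).symm)
  · rw [← h.2.2 φ hφ]
    exact setIntegral_congr_fun hU.measurableSet fun z hz => by simp only [hv hz]

theorem IsWeakDeriv.ae_eq {U : Set (ℝ × ℝ)} (hU : IsOpen U) {α : ℕ × ℕ} {v g g' : ℝ × ℝ → ℝ}
    (h : IsWeakDeriv U α v g) (h' : IsWeakDeriv U α v g') : g =ᵐ[volume.restrict U] g' := by
  have h1 := hU.ae_eq_zero_of_integral_contDiff_smul_eq_zero (μ := volume) (h.2.1.sub h'.2.1) ?_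
  · rw [Filter.EventuallyEq, ae_restrict_iff' hU.measurableSet]
    filter_upwards [h1] with z hz hzU
    exact sub_eq_zero.1 (hz hzU)
  · intro φ h1 h2 h3
    have hφ : IsTest U φ := ⟨h1, h2, h3⟩
    have e := (h.2.2 φ hφ).symm.trans (h'.2.2 φ hφ)
    have e2 := mul_left_cancel₀ (pow_ne_zero _ (by norm_num)) e
    have e3 : ∫ z in U, (g - g') z * φ z = 0 := by
      simp only [Pi.sub_apply, sub_mul]
      rw [integral_sub (hφ.integrable h.2.1) (hφ.integrable h'.2.1), e2, sub_self]
    rw [hφ.setIntegral] at e3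
    simpa only [smul_eq_mul, mul_comm] using e3

/-- Test the identity for `α` with `pdx φ`. In this form the gradient estimates below apply to the
derivatives of `v` themselves. -/
theorem IsWeakDeriv.fst {U : Set (ℝ × ℝ)} {α : ℕ × ℕ} {v g g' : ℝ × ℝ → ℝ}
    (h : IsWeakDeriv U α v g) (h' : IsWeakDeriv U (α + (1, 0)) v g') :
    IsWeakDeriv U (1, 0) g g' := by
  refine ⟨h.2.1, h'.2.1, fun φ hφ => ?_⟩
  have e1 := h.2.2 _ hφ.pdx
  have e2 := h'.2.2 _ hφ
  rw [pderiv_pdx hφ.1] at e1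
  rw [e2] at e1
  have e3 : pderiv (1, 0) φ = pdx φ := rfl
  rw [e3]
  refine mul_left_cancel₀ (pow_ne_zero (α.1 + α.2) (by norm_num : (-1 : ℝ) ≠ 0)) ?_
  rw [← e1]
  simp only [Prod.fst_add, Prod.snd_add]
  ring

theorem IsWeakDeriv.snd {U : Set (ℝ × ℝ)} {α : ℕ × ℕ} {v g g' : ℝ × ℝ → ℝ}
    (h : IsWeakDeriv U α v g) (h' : IsWeakDeriv U (α + (0, 1)) v g') :
    IsWeakDeriv U (0, 1) g g' := by
  refine ⟨h.2.1, h'.2.1, fun φ hφ => ?_⟩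
  have e1 := h.2.2 _ hφ.pdy
  have e2 := h'.2.2 _ hφ
  rw [pderiv_pdy] at e1
  rw [e2] at e1
  have e3 : pderiv (0, 1) φ = pdy φ := rfl
  rw [e3]
  refine mul_left_cancel₀ (pow_ne_zero (α.1 + α.2) (by norm_num : (-1 : ℝ) ≠ 0)) ?_
  rw [← e1]
  simp only [Prod.fst_add, Prod.snd_add]
  ring

/-! ### Seminorms in terms of given weak derivatives -/

theorem fracSq_congr {σ : ℝ} {U : Set (ℝ × ℝ)} {g g' : ℝ × ℝ → ℝ}
    (h : g =ᵐ[volume.restrict U] g') : fracSq σ U g = fracSq σ U g' := by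
  unfold fracSq
  split_ifs
  · exact lintegral_congr_ae (h.mono fun z hz => by simp only [hz])
  · refine lintegral_congr_ae (h.mono fun z hz => ?_)
    exact lintegral_congr_ae (h.mono fun w hw => by simp only [hz, hw])

theorem seminormSq_eq {s : ℝ} {U : Set (ℝ × ℝ)} (hU : IsOpen U) {v : ℝ × ℝ → ℝ}
    {g : ℕ × ℕ → ℝ × ℝ → ℝ}
    (h : ∀ α ∈ Finset.HasAntidiagonal.antidiagonal ⌊s⌋₊, IsWeakDeriv U α v (g α)) :
    seminormSq s U v =
      ∑ α ∈ Finset.HasAntidiagonal.antidiagonal ⌊s⌋₊, fracSq (s - ⌊s⌋₊) U (g α) := by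
  refine le_antisymm (iInf₂_le g h) (le_iInf₂ fun g' h' => le_of_eq ?_)
  exact Finset.sum_congr rfl fun α hα => fracSq_congr ((h α hα).ae_eq hU (h' α hα))

theorem seminormSq_lt_top {s : ℝ} {U : Set (ℝ × ℝ)} {v : ℝ × ℝ → ℝ} (h : seminorm s U v < ⊤) :
    seminormSq s U v < ⊤ := by
  by_contra hc
  rw [not_lt, top_le_iff] at hc
  rw [seminorm, hc] at h
  simp at h

theorem exists_weakDeriv {s : ℝ} {U : Set (ℝ × ℝ)} {v : ℝ × ℝ → ℝ} (h : seminorm s U v < ⊤) :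
    ∃ g : ℕ × ℕ → ℝ × ℝ → ℝ,
      (∀ α ∈ Finset.HasAntidiagonal.antidiagonal ⌊s⌋₊, IsWeakDeriv U α v (g α)) ∧
      ∑ α ∈ Finset.HasAntidiagonal.antidiagonal ⌊s⌋₊, fracSq (s - ⌊s⌋₊) U (g α) < ⊤ := by
  have h1 := seminormSq_lt_top h
  simp only [seminormSq, iInf_lt_iff] at h1
  obtain ⟨g, hg, h2⟩ := h1
  exact ⟨g, hg, h2⟩

/-! ### The Slobodeckij seminorm is controlled by the gradient -/

theorem lintegral_mul_sq_le {α : Type*} [MeasurableSpace α] {μ : Measure α} {f g : α → ℝ≥0∞}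
    (hf : AEMeasurable f μ) (hg : AEMeasurable g μ) :
    (∫⁻ x, f x * g x ∂μ) ^ 2 ≤ (∫⁻ x, f x ^ 2 ∂μ) * ∫⁻ x, g x ^ 2 ∂μ := by
  have h := ENNReal.lintegral_mul_le_Lp_mul_Lq μ Real.HolderConjugate.two_two hf hg
  have h2 := pow_le_pow_left' h 2
  rw [mul_pow, ← ENNReal.rpow_natCast (_ ^ _), ← ENNReal.rpow_natCast (_ ^ _),
    ← ENNReal.rpow_mul, ← ENNReal.rpow_mul] at h2
  simpa using h2

theorem sq_lintegral_le {α : Type*} [MeasurableSpace α] {μ : Measure α} {f : α → ℝ≥0∞}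
    (hf : AEMeasurable f μ) : (∫⁻ x, f x ∂μ) ^ 2 ≤ μ univ * ∫⁻ x, f x ^ 2 ∂μ := by
  have h := lintegral_mul_sq_le (aemeasurable_const (b := (1 : ℝ≥0∞))) hf
  simpa using h

theorem Rect.isOpen_inner (K : Rect) : IsOpen K.inner := isOpen_Ioo.prod isOpen_Ioo

theorem Rect.convex_inner (K : Rect) : Convex ℝ K.inner := (convex_Ioo _ _).prod (convex_Ioo _ _)

theorem eucl_sq (z w : ℝ × ℝ) : eucl z w ^ 2 = (z.1 - w.1) ^ 2 + (z.2 - w.2) ^ 2 :=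
  Real.sq_sqrt (by positivity)

theorem continuous_eucl : Continuous fun p : (ℝ × ℝ) × ℝ × ℝ => eucl p.1 p.2 := by
  unfold eucl
  fun_prop

theorem hasDerivAt_segment {f : ℝ × ℝ → ℝ} (hf : ContDiff ℝ ∞ f) (z ζ : ℝ × ℝ) (t : ℝ) :
    HasDerivAt (fun t : ℝ => f (z + t • ζ)) (pdx f (z + t • ζ) * ζ.1 + pdy f (z + t • ζ) * ζ.2)
      t := by
  have h1 : HasFDerivAt f (fderiv ℝ f (z + t • ζ)) (z + t • ζ) :=
    (hf.differentiable (by simp) _).hasFDerivAt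
  have h2 : HasDerivAt (fun t : ℝ => z + t • ζ) ζ t := by
    simpa using ((hasDerivAt_id' t).smul_const ζ).const_add z
  have h3 := h1.comp_hasDerivAt t h2
  have e : ζ = ζ.1 • ((1 : ℝ), (0 : ℝ)) + ζ.2 • ((0 : ℝ), (1 : ℝ)) := by ext <;> simp
  have e2 : fderiv ℝ f (z + t • ζ) ζ = pdx f (z + t • ζ) * ζ.1 + pdy f (z + t • ζ) * ζ.2 := by
    simp only [pdx, pdy]
    generalize fderiv ℝ f (z + t • ζ) = A
    conv_lhs => rw [e]
    rw [map_add, map_smul, map_smul, smul_eq_mul, smul_eq_mul]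
    ring
  rw [← e2]
  exact h3

/-- The fundamental theorem of calculus along the segment, then Cauchy–Schwarz twice: in `t`, and
for the scalar product of the gradient with `w - z`. -/
theorem sq_sub_le_segment {f : ℝ × ℝ → ℝ} (hf : ContDiff ℝ ∞ f) (z w : ℝ × ℝ) :
    ‖f z - f w‖ₑ ^ 2 ≤ ENNReal.ofReal (eucl z w ^ 2) *
      ∫⁻ t in Ioc (0 : ℝ) 1, (‖pdx f (z + t • (w - z))‖ₑ ^ 2 + ‖pdy f (z + t • (w - z))‖ₑ ^ 2) := by
  set ζ := w - z with hζ
  have cx := (contDiff_pdx hf).continuous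
  have cy := (contDiff_pdy hf).continuous
  have hc : Continuous fun t : ℝ => pdx f (z + t • ζ) * ζ.1 + pdy f (z + t • ζ) * ζ.2 := by
    fun_prop
  have h1 : f w - f z = ∫ t in Ioc (0 : ℝ) 1, (pdx f (z + t • ζ) * ζ.1 + pdy f (z + t • ζ) * ζ.2) := by
    rw [← intervalIntegral.integral_of_le zero_le_one,
      intervalIntegral.integral_eq_sub_of_hasDerivAt (fun t _ => hasDerivAt_segment hf z ζ t)
        (hc.intervalIntegrable _ _)]
    simp [hζ]
  rw [← neg_sub, enorm_neg, h1]
  refine (pow_le_pow_left' (enorm_integral_le_lintegral_enorm _) 2).trans ?_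
  refine (sq_lintegral_le hc.enorm.aemeasurable).trans ?_
  simp only [Measure.restrict_apply MeasurableSet.univ, univ_inter, Real.volume_Ioc, sub_zero,
    ENNReal.ofReal_one, one_mul]
  rw [← lintegral_const_mul _ (by fun_prop)]
  refine lintegral_mono fun t => ?_
  have e : ∀ x : ℝ, ‖x‖ₑ ^ 2 = ENNReal.ofReal (x ^ 2) := fun x => by
    rw [← ofReal_norm, ← ENNReal.ofReal_pow (norm_nonneg _), Real.norm_eq_abs, sq_abs]
  simp only [e]
  rw [← ENNReal.ofReal_add (by positivity) (by positivity), ← ENNReal.ofReal_mul (by positivity)]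
  refine ENNReal.ofReal_le_ofReal ?_
  rw [eucl_sq]
  have : (z.1 - w.1) = -ζ.1 ∧ (z.2 - w.2) = -ζ.2 := by simp [hζ]
  rw [this.1, this.2]
  nlinarith [sq_nonneg (pdx f (z + t • ζ) * ζ.2 - pdy f (z + t • ζ) * ζ.1)]

/-- The quotient is `|ζ|^(-2σ) = |ζ|^(-σ) |ζ|^(-σ)`, and each coordinate is at most `|ζ|` in
absolute value. A product kernel reduces the integral over a square to one-dimensional integrals,
which converge for `σ < 1`. -/
theorem kernel_le {σ : ℝ} (hσ : 0 < σ) (z ζ : ℝ × ℝ) :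
    ENNReal.ofReal (eucl z (z + ζ) ^ 2) / ENNReal.ofReal (eucl z (z + ζ) ^ (2 + 2 * σ)) ≤
      ‖ζ.1‖ₑ ^ (-σ) * ‖ζ.2‖ₑ ^ (-σ) := by
  have he : eucl z (z + ζ) = √(ζ.1 ^ 2 + ζ.2 ^ 2) := by simp [eucl]
  rw [he]
  set e := √(ζ.1 ^ 2 + ζ.2 ^ 2) with hedef
  rcases (Real.sqrt_nonneg (ζ.1 ^ 2 + ζ.2 ^ 2)).eq_or_lt with h0 | h0
  · rw [← hedef] at h0
    simp [← h0]
  rw [← hedef] at h0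
  rw [← ENNReal.ofReal_div_of_pos (by positivity)]
  have e1 : e ^ 2 / e ^ (2 + 2 * σ) = e ^ (-σ) * e ^ (-σ) := by
    rw [← Real.rpow_natCast, ← Real.rpow_sub h0, ← Real.rpow_add h0]
    congr 1
    push_cast
    ring
  rw [e1, ENNReal.ofReal_mul (by positivity), ← ENNReal.ofReal_rpow_of_pos h0]
  have b1 : ‖ζ.1‖ₑ ≤ ENNReal.ofReal e := by
    rw [← ofReal_norm]
    exact ENNReal.ofReal_le_ofReal (Real.abs_le_sqrt (by nlinarith [sq_nonneg ζ.2]))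
  have b2 : ‖ζ.2‖ₑ ≤ ENNReal.ofReal e := by
    rw [← ofReal_norm]
    exact ENNReal.ofReal_le_ofReal (Real.abs_le_sqrt (by nlinarith [sq_nonneg ζ.1]))
  simp only [ENNReal.rpow_neg]
  exact mul_le_mul' (ENNReal.inv_le_inv.2 (ENNReal.rpow_le_rpow b1 hσ.le))
    (ENNReal.inv_le_inv.2 (ENNReal.rpow_le_rpow b2 hσ.le))

theorem lintegral_rpow_neg {σ d : ℝ} (hσ' : σ < 1) (hd : 0 < d) :
    ∫⁻ x in Icc (-d) d, ‖x‖ₑ ^ (-σ) = ENNReal.ofReal (2 * d ^ (1 - σ) / (1 - σ)) := by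
  have hpos : ∫⁻ x in Ioc 0 d, ‖x‖ₑ ^ (-σ) = ENNReal.ofReal (d ^ (1 - σ) / (1 - σ)) := by
    have h1 : IntervalIntegrable (fun x : ℝ => x ^ (-σ)) volume 0 d :=
      intervalIntegral.intervalIntegrable_rpow' (by linarith)
    have h2 := integral_rpow (a := 0) (b := d) (r := -σ) (.inl (by linarith))
    rw [Real.zero_rpow (by linarith), sub_zero, intervalIntegral.integral_of_le hd.le] at h2
    rw [show 1 - σ = -σ + 1 by ring, ← h2, ofReal_integral_eq_lintegral_ofReal]
    · refine setLIntegral_congr_fun measurableSet_Ioc fun x hx => ?_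
      rw [← ENNReal.ofReal_rpow_of_pos hx.1, ← ofReal_norm, Real.norm_of_nonneg hx.1.le]
    · exact (intervalIntegrable_iff_integrableOn_Ioc_of_le hd.le).1 h1
    · exact (ae_restrict_iff' measurableSet_Ioc).2 (Filter.Eventually.of_forall fun x hx =>
        Real.rpow_nonneg hx.1.le _)
  have hneg : ∫⁻ x in Ico (-d) 0, ‖x‖ₑ ^ (-σ) = ∫⁻ x in Ioc 0 d, ‖x‖ₑ ^ (-σ) := by
    have := (Measure.measurePreserving_neg (volume : Measure ℝ)).setLIntegral_comp_preimage_emb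
      (MeasurableEquiv.neg ℝ).measurableEmbedding (fun x => ‖x‖ₑ ^ (-σ)) (Ico (-d) 0)
    rw [← this]
    simp
  have hu : Icc (-d) d = Ico (-d) 0 ∪ Icc 0 d := (Ico_union_Icc_eq_Icc (by linarith) hd.le).symm
  rw [hu, lintegral_union measurableSet_Icc, hneg, setLIntegral_congr Ioc_ae_eq_Icc.symm, hpos,
    ← ENNReal.ofReal_add]
  · congr 1
    ring
  · exact div_nonneg (Real.rpow_nonneg hd.le _) (by linarith)
  · exact div_nonneg (Real.rpow_nonneg hd.le _) (by linarith)
  · exact Set.disjoint_left.2 fun x hx hx' => absurd hx.2 (not_lt.2 hx'.1)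

theorem Rect.len_pos (K : Rect) : 0 < K.len := sub_pos.2 K.hx
theorem Rect.hgt_pos (K : Rect) : 0 < K.hgt := sub_pos.2 K.hy
theorem Rect.size_pos (K : Rect) : 0 < K.size := lt_max_of_lt_left K.len_pos
theorem Rect.len_le_size (K : Rect) : K.len ≤ K.size := le_max_left _ _
theorem Rect.hgt_le_size (K : Rect) : K.hgt ≤ K.size := le_max_right _ _

/-- The constant in the estimate of the Slobodeckij seminorm by the gradient. -/
noncomputable def gradConst (σ : ℝ) : ℝ := (2 / (1 - σ)) ^ 2

theorem gradConst_pos {σ : ℝ} (hσ : σ < 1) : 0 < gradConst σ := by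
  unfold gradConst
  have : 0 < 1 - σ := by linarith
  positivity

/-- Bound the difference quotient by the gradient on the segment from `z` to `z + ζ`, which stays in
the convex set `K.inner`. Extended by zero, the squared gradient may be integrated over the whole
plane, where translations do not matter; what is left is the integral of the kernel in `ζ`. -/
theorem fracSq_le_of_contDiff {σ : ℝ} (hσ : 0 < σ) (hσ' : σ < 1) (K : Rect) {d : ℝ}
    (hd : K.size ≤ d) {f : ℝ × ℝ → ℝ} (hf : ContDiff ℝ ∞ f) :
    fracSq σ K.inner f ≤ ENNReal.ofReal (gradConst σ * d ^ (2 - 2 * σ)) *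
      ((∫⁻ z in K.inner, ‖pdx f z‖ₑ ^ 2) + ∫⁻ z in K.inner, ‖pdy f z‖ₑ ^ 2) := by
  have cx := (contDiff_pdx hf).continuous
  have cy := (contDiff_pdy hf).continuous
  have hd0 : 0 < d := K.size_pos.trans_le hd
  have hS : MeasurableSet K.inner := K.isOpen_inner.measurableSet
  set D : ℝ × ℝ → ℝ≥0∞ := K.inner.indicator fun z => ‖pdx f z‖ₑ ^ 2 + ‖pdy f z‖ₑ ^ 2 with hD
  have hDm : Measurable D := Measurable.indicator (by fun_prop) hS
  -- If `z` and `z + ζ` are both in `K`, the coordinates of `ζ` have absolute value at most `K.size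
  -- ≤ d`; so the kernel can be cut off to this square.
  set Q : Set (ℝ × ℝ) := Icc (-d) d ×ˢ Icc (-d) d with hQ
  have hQm : MeasurableSet Q := measurableSet_Icc.prod measurableSet_Icc
  set κ : ℝ × ℝ → ℝ≥0∞ := Q.indicator fun ζ => ‖ζ.1‖ₑ ^ (-σ) * ‖ζ.2‖ₑ ^ (-σ) with hκ
  have hκm : Measurable κ := Measurable.indicator (by fun_prop) hQm
  have hκint : ∫⁻ ζ, κ ζ = ENNReal.ofReal (gradConst σ * d ^ (2 - 2 * σ)) := by
    rw [hκ, lintegral_indicator hQm, hQ, Measure.volume_eq_prod, ← Measure.prod_restrict,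
      lintegral_prod_mul (f := fun x : ℝ => ‖x‖ₑ ^ (-σ)) (g := fun x : ℝ => ‖x‖ₑ ^ (-σ))
        (by fun_prop) (by fun_prop), lintegral_rpow_neg hσ' hd0,
      ← ENNReal.ofReal_mul (div_nonneg (by positivity) (by linarith))]
    congr 1
    have : d ^ (2 - 2 * σ) = d ^ (1 - σ) * d ^ (1 - σ) := by
      rw [← Real.rpow_add hd0]
      congr 1
      ring
    rw [gradConst, this]
    ring
  have hpt : ∀ z ∈ K.inner, ∫⁻ w in K.inner,
      ‖f z - f w‖ₑ ^ 2 / ENNReal.ofReal (eucl z w ^ (2 + 2 * σ)) ≤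
        ∫⁻ ζ, κ ζ * ∫⁻ t in Ioc (0 : ℝ) 1, D (z + t • ζ) := by
    intro z hz
    -- The substitution `w = z + ζ`.
    rw [← lintegral_indicator hS, ← lintegral_add_left_eq_self _ z]
    refine lintegral_mono fun ζ => ?_
    by_cases hw : z + ζ ∈ K.inner
    swap
    · rw [indicator_of_notMem hw]
      exact zero_le
    rw [indicator_of_mem hw]
    have hζQ : ζ ∈ Q := by
      have a1 := K.len_le_size
      have a2 := K.hgt_le_size
      simp only [Rect.len, Rect.hgt] at a1 a2
      obtain ⟨⟨b1, b2⟩, b3, b4⟩ := hz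
      obtain ⟨⟨c1, c2⟩, c3, c4⟩ := hw
      simp only [Prod.fst_add, Prod.snd_add] at c1 c2 c3 c4
      refine ⟨⟨?_, ?_⟩, ?_, ?_⟩ <;> linarith
    rw [hκ, indicator_of_mem hζQ]
    have hseg := sq_sub_le_segment hf z (z + ζ)
    rw [add_sub_cancel_left] at hseg
    have hI : ∫⁻ t in Ioc (0 : ℝ) 1, (‖pdx f (z + t • ζ)‖ₑ ^ 2 + ‖pdy f (z + t • ζ)‖ₑ ^ 2) =
        ∫⁻ t in Ioc (0 : ℝ) 1, D (z + t • ζ) := by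
      refine setLIntegral_congr_fun measurableSet_Ioc fun t ht => ?_
      have hmem : z + t • ζ ∈ K.inner := by
        have := K.convex_inner.add_smul_sub_mem hz hw ⟨ht.1.le, ht.2⟩
        rwa [add_sub_cancel_left] at this
      simp only [hD]
      rw [indicator_of_mem hmem]
    rw [hI] at hseg
    refine (ENNReal.div_le_div_right hseg _).trans ?_
    rw [mul_comm, mul_div_assoc, mul_comm]
    exact mul_le_mul_left (kernel_le hσ z ζ) _
  have hm3 : Measurable fun p : (ℝ × ℝ) × ℝ × ℝ => ∫⁻ t in Ioc (0 : ℝ) 1, D (p.1 + t • p.2) :=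
    Measurable.lintegral_prod_right' (f := fun q : ((ℝ × ℝ) × ℝ × ℝ) × ℝ => D (q.1.1 + q.2 • q.1.2))
      (hDm.comp (by fun_prop))
  rw [fracSq, if_neg hσ.ne']
  calc ∫⁻ z in K.inner, ∫⁻ w in K.inner,
        ‖f z - f w‖ₑ ^ 2 / ENNReal.ofReal (eucl z w ^ (2 + 2 * σ))
      ≤ ∫⁻ z in K.inner, ∫⁻ ζ, κ ζ * ∫⁻ t in Ioc (0 : ℝ) 1, D (z + t • ζ) :=
        setLIntegral_mono' hS hpt
    _ ≤ ∫⁻ z, ∫⁻ ζ, κ ζ * ∫⁻ t in Ioc (0 : ℝ) 1, D (z + t • ζ) := setLIntegral_le_lintegral _ _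
    _ = ∫⁻ ζ, ∫⁻ z, κ ζ * ∫⁻ t in Ioc (0 : ℝ) 1, D (z + t • ζ) :=
        lintegral_lintegral_swap ((hκm.comp measurable_snd).mul hm3).aemeasurable
    _ = ∫⁻ ζ, κ ζ * ∫⁻ z, D z := by
        refine lintegral_congr fun ζ => ?_
        have hm4 : Measurable fun z : ℝ × ℝ => ∫⁻ t in Ioc (0 : ℝ) 1, D (z + t • ζ) :=
          hm3.comp (measurable_id.prodMk measurable_const)
        rw [lintegral_const_mul _ hm4,
          lintegral_lintegral_swap (f := fun (z : ℝ × ℝ) (t : ℝ) => D (z + t • ζ))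
            (hDm.comp (f := fun p : (ℝ × ℝ) × ℝ => p.1 + p.2 • ζ) (by fun_prop)).aemeasurable]
        -- For fixed `t` and `ζ` the shift by `t • ζ` leaves the integral of `D` unchanged, and the
        -- `t`-interval has length one.
        simp only [lintegral_add_right_eq_self D]
        simp
    _ = _ := by
        rw [lintegral_mul_const _ hκm, hκint, hD, lintegral_indicator hS,
          lintegral_add_left (by fun_prop)]

/-! ### Mollification, and the gradient bound for weak derivatives -/

/-- The rectangle with all sides moved inwards by `δ`. -/
def Rect.shrink (K : Rect) (δ : ℝ) (h1 : 2 * δ < K.len) (h2 : 2 * δ < K.hgt) : Rect where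
  x₀ := K.x₀ + δ
  x₁ := K.x₁ - δ
  y₀ := K.y₀ + δ
  y₁ := K.y₁ - δ
  hx := by unfold Rect.len at h1; linarith
  hy := by unfold Rect.hgt at h2; linarith

/-- Convolution of `g` with the bump function `η`. -/
noncomputable def mollify (η : ContDiffBump (0 : ℝ × ℝ)) (g : ℝ × ℝ → ℝ) (z : ℝ × ℝ) : ℝ :=
  ∫ t, g t * η.normed volume (z - t)

theorem contDiff_mollify (η : ContDiffBump (0 : ℝ × ℝ)) {g : ℝ × ℝ → ℝ}
    (hg : LocallyIntegrable g) : ContDiff ℝ ∞ (mollify η g) :=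
  η.hasCompactSupport_normed.contDiff_convolution_right (ContinuousLinearMap.mul ℝ ℝ) hg
    (η.contDiff_normed (n := ⊤))

theorem fderiv_mollify (η : ContDiffBump (0 : ℝ × ℝ)) {g : ℝ × ℝ → ℝ}
    (hg : LocallyIntegrable g) (z v : ℝ × ℝ) :
    fderiv ℝ (mollify η g) z v = ∫ t, g t * fderiv ℝ (η.normed volume) (z - t) v := by
  have h1 : HasCompactSupport (η.normed volume) := η.hasCompactSupport_normed
  have hc : ContDiff ℝ 1 (η.normed volume) := η.contDiff_normed (n := 1)
  have h := h1.hasFDerivAt_convolution_right (ContinuousLinearMap.mul ℝ ℝ) (μ := volume) hg hc z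
  have h2 : HasFDerivAt (mollify η g) _ z := h
  rw [h2.fderiv, convolution_def, ContinuousLinearMap.integral_apply]
  · rfl
  · exact ((h1.fderiv ℝ).convolutionExists_right _ hg (hc.continuous_fderiv (by simp)) z)

theorem isTest_bump (η : ContDiffBump (0 : ℝ × ℝ)) {U : Set (ℝ × ℝ)} {z : ℝ × ℝ}
    (h : Metric.closedBall z η.rOut ⊆ U) : IsTest U fun t => η.normed volume (z - t) := by
  have hs : Function.support (fun t => η.normed volume (z - t)) ⊆ Metric.closedBall z η.rOut := by
    intro t ht
    have : z - t ∈ Function.support (η.normed volume) := ht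
    rw [η.support_normed_eq] at this
    rw [Metric.mem_closedBall', dist_eq_norm]
    simpa using (mem_ball_zero_iff.1 this).le
  have ht : tsupport (fun t => η.normed volume (z - t)) ⊆ Metric.closedBall z η.rOut :=
    closure_minimal hs Metric.isClosed_closedBall
  refine ⟨(η.contDiff_normed (n := ⊤)).comp (contDiff_const.sub contDiff_id), ?_, ht.trans h⟩
  exact (isCompact_closedBall z η.rOut).of_isClosed_subset (isClosed_tsupport _) ht

/-- Away from the boundary the derivative of a mollified function is the mollified weak
derivative. -/
theorem fderiv_mollify_eq (η : ContDiffBump (0 : ℝ × ℝ)) {U : Set (ℝ × ℝ)}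
    {w w' g : ℝ × ℝ → ℝ} (v : ℝ × ℝ)
    (hw : ∀ φ, IsTest U φ → ∫ z in U, w z * fderiv ℝ φ z v = -∫ z in U, w' z * φ z)
    (hg : LocallyIntegrable g) {z : ℝ × ℝ} (hz : Metric.closedBall z η.rOut ⊆ U)
    (hgw : EqOn g w (Metric.closedBall z η.rOut)) :
    fderiv ℝ (mollify η g) z v = ∫ t in U, w' t * η.normed volume (z - t) := by
  -- The reflected and translated bump serves as the test function; the sign from differentiating `z
  -- - t` cancels the sign in the definition of the weak derivative.
  have hψ := isTest_bump η hz
  have h1 := hw _ hψ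
  rw [eq_comm, neg_eq_iff_eq_neg] at h1
  rw [h1, fderiv_mollify η hg, ← integral_neg]
  have hd : ∀ t, fderiv ℝ (fun t => η.normed volume (z - t)) t v =
      -fderiv ℝ (η.normed volume) (z - t) v := by
    intro t
    have hc : DifferentiableAt ℝ (η.normed volume) (z - t) :=
      (η.contDiff_normed (n := 1)).differentiable (by simp) _
    have h3 : HasFDerivAt (fun t => z - t) (-ContinuousLinearMap.id ℝ (ℝ × ℝ)) t := by
      simpa using (hasFDerivAt_id t).const_sub z
    have h4 := hc.hasFDerivAt.comp t h3
    have h5 : HasFDerivAt (fun t => η.normed volume (z - t)) _ t := h4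
    rw [h5.fderiv]
    simp
  have hzero : ∀ t, t ∉ Metric.closedBall z η.rOut → fderiv ℝ (η.normed volume) (z - t) = 0 := by
    intro t ht
    have : z - t ∉ tsupport (η.normed volume) := by
      rw [η.tsupport_normed_eq, Metric.mem_closedBall, dist_zero_right, ← dist_eq_norm,
        dist_comm]
      exact ht
    exact image_eq_zero_of_notMem_tsupport fun h => this (tsupport_fderiv_subset ℝ h)
  rw [setIntegral_eq_integral_of_forall_compl_eq_zero]
  · refine integral_congr_ae (Filter.Eventually.of_forall fun t => ?_)
    simp only [hd]
    by_cases ht : t ∈ Metric.closedBall z η.rOut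
    · rw [hgw ht]
      ring
    · rw [hzero t ht]
      simp
  · intro t ht
    rw [hd, hzero t fun h => ht (hz h)]
    simp

/-- Young's inequality for a kernel of mass one: split the kernel as `ρ^(1/2) ρ^(1/2)`, apply
Cauchy–Schwarz for each `z`, and exchange the order of integration. -/
theorem sq_mollify_le (η : ContDiffBump (0 : ℝ × ℝ)) {U : Set (ℝ × ℝ)} {w' : ℝ × ℝ → ℝ}
    (hw' : AEMeasurable w' (volume.restrict U)) :
    ∫⁻ z, ‖∫ t in U, w' t * η.normed volume (z - t)‖ₑ ^ 2 ≤ ∫⁻ t in U, ‖w' t‖ₑ ^ 2 := by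
  set ρ : ℝ × ℝ → ℝ≥0∞ := fun z => ENNReal.ofReal (η.normed volume z) with hρ
  have hρm : Measurable ρ := η.continuous_normed.measurable.ennreal_ofReal
  have hρ1 : ∫⁻ z, ρ z = 1 := by
    rw [hρ, ← ofReal_integral_eq_lintegral_ofReal η.integrable_normed
      (Filter.Eventually.of_forall η.nonneg_normed), η.integral_normed, ENNReal.ofReal_one]
  have hpt : ∀ z, ‖∫ t in U, w' t * η.normed volume (z - t)‖ₑ ^ 2 ≤
      ∫⁻ t in U, ‖w' t‖ₑ ^ 2 * ρ (z - t) := by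
    intro z
    have hρz : Measurable fun t => ρ (z - t) := hρm.comp (by fun_prop)
    have e1 : ∫⁻ t in U, ‖w' t * η.normed volume (z - t)‖ₑ =
        ∫⁻ t in U, (‖w' t‖ₑ * ρ (z - t) ^ (1 / 2 : ℝ)) * ρ (z - t) ^ (1 / 2 : ℝ) := by
      refine lintegral_congr fun t => ?_
      rw [enorm_mul, mul_assoc, ← ENNReal.rpow_add_of_nonneg _ _ (by norm_num) (by norm_num)]
      norm_num
      simp only [hρ, Real.enorm_eq_ofReal (η.nonneg_normed _)]
    refine (pow_le_pow_left' (enorm_integral_le_lintegral_enorm _) 2).trans ?_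
    rw [e1]
    refine (lintegral_mul_sq_le (hw'.enorm.mul (hρz.pow_const _).aemeasurable)
      (hρz.pow_const _).aemeasurable).trans ?_
    have e2 : ∀ x : ℝ≥0∞, (x ^ (1 / 2 : ℝ)) ^ 2 = x := fun x => by
      rw [← ENNReal.rpow_natCast, ← ENNReal.rpow_mul]
      norm_num
    simp only [Pi.mul_apply, mul_pow, e2]
    refine mul_le_of_le_one_right' ((setLIntegral_le_lintegral _ _).trans ?_)
    rw [lintegral_sub_left_eq_self ρ z, hρ1]
  calc _ ≤ ∫⁻ z, ∫⁻ t in U, ‖w' t‖ₑ ^ 2 * ρ (z - t) := lintegral_mono hpt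
    _ = ∫⁻ t in U, ∫⁻ z, ‖w' t‖ₑ ^ 2 * ρ (z - t) := by
        refine lintegral_lintegral_swap ?_
        exact (hw'.enorm.pow_const 2).comp_snd.mul (hρm.comp (by fun_prop)).aemeasurable
    _ = _ := by
        refine lintegral_congr fun t => ?_
        have hρt : Measurable fun z => ρ (z - t) := hρm.comp (by fun_prop)
        rw [lintegral_const_mul _ hρt, lintegral_sub_right_eq_self ρ t, hρ1, mul_one]

/-- Fatou's lemma in both variables; the integrand converges for almost all `z` and `w`, and on the
diagonal the numerator vanishes. -/
theorem lintegral_kernel_le_liminf {σ : ℝ} {S : Set (ℝ × ℝ)} {f : ℕ → ℝ × ℝ → ℝ}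
    {g : ℝ × ℝ → ℝ} (hf : ∀ n, Continuous (f n))
    (hg : ∀ᵐ z ∂volume.restrict S, Filter.Tendsto (fun n => f n z) Filter.atTop (nhds (g z)))
    {B : ℝ≥0∞}
    (hB : ∀ n, ∫⁻ z in S, ∫⁻ w in S,
      ‖f n z - f n w‖ₑ ^ 2 / ENNReal.ofReal (eucl z w ^ (2 + 2 * σ)) ≤ B) :
    ∫⁻ z in S, ∫⁻ w in S, ‖g z - g w‖ₑ ^ 2 / ENNReal.ofReal (eucl z w ^ (2 + 2 * σ)) ≤ B := by
  have hm : ∀ n, Measurable fun p : (ℝ × ℝ) × ℝ × ℝ =>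
      ‖f n p.1 - f n p.2‖ₑ ^ 2 / ENNReal.ofReal (eucl p.1 p.2 ^ (2 + 2 * σ)) := by
    intro n
    have h1 := (hf n).measurable
    have h2 := continuous_eucl.measurable
    refine Measurable.div ?_ (h2.pow_const _).ennreal_ofReal
    exact (((h1.comp measurable_fst).sub (h1.comp measurable_snd)).enorm.pow_const 2)
  calc _ ≤ ∫⁻ z in S, ∫⁻ w in S, Filter.liminf (fun n =>
        ‖f n z - f n w‖ₑ ^ 2 / ENNReal.ofReal (eucl z w ^ (2 + 2 * σ))) Filter.atTop := by
        refine lintegral_mono_ae (hg.mono fun z hz => lintegral_mono_ae (hg.mono fun w hw => ?_))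
        have ht : Filter.Tendsto (fun n => ‖f n z - f n w‖ₑ ^ 2) Filter.atTop
            (nhds (‖g z - g w‖ₑ ^ 2)) :=
          (ENNReal.continuous_pow 2).continuousAt.tendsto.comp ((hz.sub hw).enorm)
        by_cases h0 : ENNReal.ofReal (eucl z w ^ (2 + 2 * σ)) = 0
        · by_cases hzw : z = w
          · subst hzw
            simp
          · exfalso
            have he : 0 < eucl z w := by
              refine Real.sqrt_pos.2 ?_
              by_contra hc
              refine hzw (Prod.ext ?_ ?_) <;> nlinarith [sq_nonneg (z.1 - w.1), sq_nonneg (z.2 - w.2)]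
            have := Real.rpow_pos_of_pos he (2 + 2 * σ)
            rw [ENNReal.ofReal_eq_zero] at h0
            linarith
        · exact (ENNReal.Tendsto.div_const ht (.inr h0)).liminf_eq.ge
    _ ≤ ∫⁻ z in S, Filter.liminf (fun n => ∫⁻ w in S,
        ‖f n z - f n w‖ₑ ^ 2 / ENNReal.ofReal (eucl z w ^ (2 + 2 * σ))) Filter.atTop :=
        lintegral_mono fun z => lintegral_liminf_le fun n =>
          (hm n).comp (measurable_const.prodMk measurable_id)
    _ ≤ Filter.liminf (fun n => ∫⁻ z in S, ∫⁻ w in S,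
        ‖f n z - f n w‖ₑ ^ 2 / ENNReal.ofReal (eucl z w ^ (2 + 2 * σ))) Filter.atTop :=
        lintegral_liminf_le fun n => (hm n).lintegral_prod_right'
    _ ≤ B := by
        refine (Filter.liminf_le_liminf (Filter.Eventually.of_forall hB)).trans ?_
        simp

theorem Rect.closedBall_subset_shrink (K : Rect) {δ : ℝ} (h1 : 2 * δ < K.len)
    (h2 : 2 * δ < K.hgt) (h1' : 2 * (δ / 2) < K.len) (h2' : 2 * (δ / 2) < K.hgt) {r : ℝ}
    (hr : r ≤ δ / 2) {z : ℝ × ℝ} (hz : z ∈ (K.shrink δ h1 h2).inner) :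
    Metric.closedBall z r ⊆ (K.shrink (δ / 2) h1' h2').closed := by
  obtain ⟨a, b⟩ := z
  rw [← closedBall_prod_same, Real.closedBall_eq_Icc, Real.closedBall_eq_Icc]
  obtain ⟨⟨c1, c2⟩, c3, c4⟩ := hz
  simp only [Rect.shrink] at c1 c2 c3 c4
  exact prod_mono (Icc_subset_Icc (by simp only [Rect.shrink]; linarith)
    (by simp only [Rect.shrink]; linarith)) (Icc_subset_Icc (by simp only [Rect.shrink]; linarith)
    (by simp only [Rect.shrink]; linarith))

theorem Rect.shrink_closed_subset (K : Rect) {δ : ℝ} (hδ : 0 < δ) (h1 : 2 * δ < K.len)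
    (h2 : 2 * δ < K.hgt) : (K.shrink δ h1 h2).closed ⊆ K.inner := by
  rintro z ⟨⟨c1, c2⟩, c3, c4⟩
  simp only [Rect.shrink] at c1 c2 c3 c4
  refine ⟨⟨?_, ?_⟩, ?_, ?_⟩ <;> linarith

theorem Rect.inner_subset_closed (K : Rect) : K.inner ⊆ K.closed :=
  prod_mono Ioo_subset_Icc_self Ioo_subset_Icc_self

theorem Rect.isCompact_closed (K : Rect) : IsCompact K.closed := isCompact_Icc.prod isCompact_Icc

/-- Mollify `w` at a scale below the distance to the boundary. On the smaller rectangle the gradient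
of the mollified function is the mollified weak gradient, so the smooth estimate and Young's
inequality bound all approximations alike; then let the scale tend to zero. -/
theorem fracSq_shrink_le {σ : ℝ} (hσ : 0 < σ) (hσ' : σ < 1) (K : Rect) {w wx wy : ℝ × ℝ → ℝ}
    (hx : IsWeakDeriv K.inner (1, 0) w wx) (hy : IsWeakDeriv K.inner (0, 1) w wy)
    {δ : ℝ} (hδ : 0 < δ) (h1 : 2 * δ < K.len) (h2 : 2 * δ < K.hgt) :
    fracSq σ (K.shrink δ h1 h2).inner w ≤ ENNReal.ofReal (gradConst σ * K.size ^ (2 - 2 * σ)) *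
      ((∫⁻ z in K.inner, ‖wx z‖ₑ ^ 2) + ∫⁻ z in K.inner, ‖wy z‖ₑ ^ 2) := by
  have h1' : 2 * (δ / 2) < K.len := by linarith
  have h2' : 2 * (δ / 2) < K.hgt := by linarith
  set B := (K.shrink (δ / 2) h1' h2').closed with hB
  have hBK : B ⊆ K.inner := K.shrink_closed_subset (by linarith) h1' h2'
  set g := B.indicator w with hg
  have hgi : LocallyIntegrable g := by
    refine Integrable.locallyIntegrable ?_
    rw [hg, integrable_indicator_iff (Rect.isCompact_closed _).measurableSet]
    exact hx.1.integrableOn_compact_subset hBK (Rect.isCompact_closed _)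
  -- The outer radius is always twice the inner one, since the theorem on almost everywhere
  -- convergence requires a bounded ratio. The outer radius stays below `δ / 2`, the distance
  -- between the rectangles shrunk by `δ` and by `δ / 2`.
  let η : ℕ → ContDiffBump (0 : ℝ × ℝ) := fun n =>
    ⟨δ / 4 * (1 / ((n : ℝ) + 1)), δ / 2 * (1 / ((n : ℝ) + 1)), by positivity,
      mul_lt_mul_of_pos_right (by linarith) (by positivity)⟩
  have hr : ∀ n, (η n).rOut ≤ δ / 2 := fun n => by
    refine mul_le_of_le_one_right (by positivity) ?_
    rw [div_le_one (by positivity)]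
    have : (0 : ℝ) ≤ n := n.cast_nonneg
    linarith
  have hball : ∀ n, ∀ z ∈ (K.shrink δ h1 h2).inner, Metric.closedBall z (η n).rOut ⊆ B :=
    fun n z hz => K.closedBall_subset_shrink h1 h2 h1' h2' (hr n) hz
  have hS : MeasurableSet (K.shrink δ h1 h2).inner := (Rect.isOpen_inner _).measurableSet
  rw [fracSq, if_neg hσ.ne']
  refine lintegral_kernel_le_liminf (f := fun n => mollify (η n) g)
    (fun n => (contDiff_mollify _ hgi).continuous) ?_ fun n => ?_
  · have hconv := ContDiffBump.ae_convolution_tendsto_right_of_locallyIntegrable (μ := volume)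
      (φ := η) (l := Filter.atTop) (K := 2) ?_ ?_ hgi
    · rw [ae_restrict_iff' hS]
      filter_upwards [hconv] with z hz hzS
      have hgz : g z = w z := indicator_of_mem
        (hball 0 z hzS (Metric.mem_closedBall_self (η 0).rOut_pos.le)) _
      rw [hgz] at hz
      refine hz.congr fun n => ?_
      rw [convolution_eq_swap]
      simp only [ContinuousLinearMap.lsmul_apply, smul_eq_mul, mollify, mul_comm]
    · have := (tendsto_one_div_add_atTop_nhds_zero_nat (𝕜 := ℝ)).const_mul (δ / 2)
      rwa [mul_zero] at this
    · refine Filter.Eventually.of_forall fun n => le_of_eq ?_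
      change δ / 2 * (1 / ((n : ℝ) + 1)) = 2 * (δ / 4 * (1 / ((n : ℝ) + 1)))
      ring
  · have hd : (K.shrink δ h1 h2).size ≤ K.size := by
      refine max_le_max ?_ ?_ <;> simp only [Rect.len, Rect.hgt, Rect.shrink] <;> linarith
    have h := fracSq_le_of_contDiff hσ hσ' (K.shrink δ h1 h2) hd (contDiff_mollify (η n) hgi)
    rw [fracSq, if_neg hσ.ne'] at h
    refine h.trans (mul_le_mul_right (add_le_add ?_ ?_) _)
    · refine le_trans ?_ (sq_mollify_le (η n) hx.2.1.aestronglyMeasurable.aemeasurable)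
      refine (setLIntegral_mono' hS fun z hz => le_of_eq ?_).trans (setLIntegral_le_lintegral _ _)
      rw [pdx, fderiv_mollify_eq (w := w) (w' := wx) (η n) (1, 0) ?_ hgi ((hball n z hz).trans hBK)
        fun t ht => indicator_of_mem (hball n z hz ht) _]
      intro φ hφ
      simpa [pderiv, pdx] using hx.2.2 φ hφ
    · refine le_trans ?_ (sq_mollify_le (η n) hy.2.1.aestronglyMeasurable.aemeasurable)
      refine (setLIntegral_mono' hS fun z hz => le_of_eq ?_).trans (setLIntegral_le_lintegral _ _)
      rw [pdy, fderiv_mollify_eq (w := w) (w' := wy) (η n) (0, 1) ?_ hgi ((hball n z hz).trans hBK)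
        fun t ht => indicator_of_mem (hball n z hz ht) _]
      intro φ hφ
      simpa [pderiv, pdy] using hy.2.2 φ hφ

/-- On a rectangle the Slobodeckij seminorm of order `σ < 1` is bounded by the gradient. -/
theorem fracSq_le_grad {σ : ℝ} (hσ : 0 < σ) (hσ' : σ < 1) (K : Rect) {w wx wy : ℝ × ℝ → ℝ}
    (hx : IsWeakDeriv K.inner (1, 0) w wx) (hy : IsWeakDeriv K.inner (0, 1) w wy) :
    fracSq σ K.inner w ≤ ENNReal.ofReal (gradConst σ * K.size ^ (2 - 2 * σ)) *
      ((∫⁻ z in K.inner, ‖wx z‖ₑ ^ 2) + ∫⁻ z in K.inner, ‖wy z‖ₑ ^ 2) := by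
  -- A measurable representative makes the seminorm one integral over a product set; `K.inner ×
  -- K.inner` is then exhausted by the squares of the shrunk rectangles, where the estimate is
  -- already known.
  have hwm : AEStronglyMeasurable w (volume.restrict K.inner) := hx.1.aestronglyMeasurable
  set w' := hwm.mk w with hw'
  have hw'm : Measurable w' := hwm.stronglyMeasurable_mk.measurable
  have hae : w =ᵐ[volume.restrict K.inner] w' := hwm.ae_eq_mk
  rw [fracSq_congr hae]
  set δ₀ := min K.len K.hgt / 4 with hδ₀
  have hm := lt_min K.len_pos K.hgt_pos
  have hδ₀pos : 0 < δ₀ := by positivity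
  set δ : ℕ → ℝ := fun n => δ₀ * (1 / ((n : ℝ) + 1)) with hδ
  have hδpos : ∀ n, 0 < δ n := fun n => by positivity
  have hδle : ∀ n, δ n ≤ δ₀ := fun n => by
    refine mul_le_of_le_one_right (by positivity) ?_
    rw [div_le_one (by positivity)]
    have : (0 : ℝ) ≤ n := n.cast_nonneg
    linarith
  have h1 : ∀ n, 2 * δ n < K.len := fun n => by
    have := hδle n
    have := min_le_left K.len K.hgt
    linarith
  have h2 : ∀ n, 2 * δ n < K.hgt := fun n => by
    have := hδle n
    have := min_le_right K.len K.hgt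
    linarith
  set S : ℕ → Set (ℝ × ℝ) := fun n => (K.shrink (δ n) (h1 n) (h2 n)).inner with hSdef
  have hSK : ∀ n, S n ⊆ K.inner := fun n =>
    (Rect.inner_subset_closed _).trans (K.shrink_closed_subset (hδpos n) (h1 n) (h2 n))
  have hanti : Antitone δ := fun m n hmn =>
    mul_le_mul_of_nonneg_left (one_div_le_one_div_of_le (by positivity) (by gcongr)) hδ₀pos.le
  have hSmono : Monotone S := by
    intro m n hmn z hz
    have := hanti hmn
    obtain ⟨⟨c1, c2⟩, c3, c4⟩ := hz
    simp only [Rect.shrink] at c1 c2 c3 c4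
    refine ⟨⟨?_, ?_⟩, ?_, ?_⟩ <;> simp only [Rect.shrink] <;> linarith
  have hSU : ⋃ n, S n = K.inner := by
    refine subset_antisymm (iUnion_subset hSK) fun z hz => ?_
    have ht : Filter.Tendsto δ Filter.atTop (nhds 0) := by
      have := (tendsto_one_div_add_atTop_nhds_zero_nat (𝕜 := ℝ)).const_mul δ₀
      rwa [mul_zero] at this
    obtain ⟨⟨c1, c2⟩, c3, c4⟩ := hz
    have e1 := ht.eventually (gt_mem_nhds (sub_pos.2 c1))
    have e2 := ht.eventually (gt_mem_nhds (sub_pos.2 c2))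
    have e3 := ht.eventually (gt_mem_nhds (sub_pos.2 c3))
    have e4 := ht.eventually (gt_mem_nhds (sub_pos.2 c4))
    obtain ⟨n, d1, d2, d3, d4⟩ := (e1.and (e2.and (e3.and e4))).exists
    refine mem_iUnion.2 ⟨n, ⟨?_, ?_⟩, ?_, ?_⟩ <;> simp only [Rect.shrink] <;> linarith
  set F : (ℝ × ℝ) × ℝ × ℝ → ℝ≥0∞ := fun p =>
    ‖w' p.1 - w' p.2‖ₑ ^ 2 / ENNReal.ofReal (eucl p.1 p.2 ^ (2 + 2 * σ)) with hF
  have hFm : Measurable F :=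
    (((hw'm.comp measurable_fst).sub (hw'm.comp measurable_snd)).enorm.pow_const 2).div
      (continuous_eucl.measurable.pow_const _).ennreal_ofReal
  have hprod : ∀ T : Set (ℝ × ℝ), fracSq σ T w' = ∫⁻ p in T ×ˢ T, F p := by
    intro T
    rw [fracSq, if_neg hσ.ne', Measure.volume_eq_prod (ℝ × ℝ) (ℝ × ℝ), ← Measure.prod_restrict,
      lintegral_prod _ hFm.aemeasurable]
  have hSS : K.inner ×ˢ K.inner = ⋃ n, S n ×ˢ S n := by
    rw [← hSU, ← iUnion_prod_of_monotone hSmono hSmono]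
  rw [hprod, hSS, setLIntegral_iUnion_of_directed]
  · refine iSup_le fun n => ?_
    rw [← hprod, ← fracSq_congr (ae_restrict_of_ae_restrict_of_subset (hSK n) hae)]
    exact fracSq_shrink_le hσ hσ' K hx hy (hδpos n) (h1 n) (h2 n)
  · exact (hSmono.set_prod hSmono).directed_le

/-! ### Square integrals and oscillation of continuous functions on rectangles -/

namespace Rect

/-- Area of a rectangle. -/
def area (K : Rect) : ℝ := K.len * K.hgt

theorem area_pos (K : Rect) : 0 < K.area := mul_pos K.len_pos K.hgt_pos

theorem measurableSet_closed (K : Rect) : MeasurableSet K.closed := K.isCompact_closed.measurableSet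

theorem volume_closed (K : Rect) : volume.real K.closed = K.area := by
  rw [closed, Measure.volume_eq_prod, measureReal_prod_prod, Real.volume_real_Icc_of_le K.hx.le,
    Real.volume_real_Icc_of_le K.hy.le]
  rfl

theorem inner_ae_eq_closed (K : Rect) : (K.inner : Set (ℝ × ℝ)) =ᵐ[volume] K.closed := by
  rw [inner, closed, Measure.volume_eq_prod]
  exact Measure.set_prod_ae_eq Ioo_ae_eq_Icc Ioo_ae_eq_Icc

/-- The integral of the square. -/
noncomputable def sq (K : Rect) (f : ℝ × ℝ → ℝ) : ℝ := ∫ z in K.closed, f z ^ 2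

/-- The integral. -/
noncomputable def int (K : Rect) (f : ℝ × ℝ → ℝ) : ℝ := ∫ z in K.closed, f z

/-- The double integral of the squared difference. -/
noncomputable def osc (K K' : Rect) (f : ℝ × ℝ → ℝ) : ℝ :=
  ∫ z in K.closed, ∫ w in K'.closed, (f z - f w) ^ 2

theorem integrableOn (K : Rect) {f : ℝ × ℝ → ℝ} (hf : Continuous f) : IntegrableOn f K.closed :=
  hf.continuousOn.integrableOn_compact K.isCompact_closed

theorem sq_nonneg (K : Rect) (f : ℝ × ℝ → ℝ) : 0 ≤ K.sq f :=
  integral_nonneg fun _ => _root_.sq_nonneg _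

theorem osc_nonneg (K K' : Rect) (f : ℝ × ℝ → ℝ) : 0 ≤ osc K K' f :=
  integral_nonneg fun _ => integral_nonneg fun _ => _root_.sq_nonneg _

theorem int_sub (K : Rect) {f g : ℝ × ℝ → ℝ} (hf : Continuous f) (hg : Continuous g) :
    K.int (f - g) = K.int f - K.int g := integral_sub (K.integrableOn hf) (K.integrableOn hg)

theorem osc_eq (K K' : Rect) {f : ℝ × ℝ → ℝ} (hf : Continuous f) :
    osc K K' f = K'.area * K.sq f + K.area * K'.sq f - 2 * K.int f * K'.int f := by
  have h1 : ∀ z, ∫ w in K'.closed, (f z - f w) ^ 2 =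
      K'.area * f z ^ 2 - 2 * K'.int f * f z + K'.sq f := by
    intro z
    have e : ∀ w, (f z - f w) ^ 2 = (f z ^ 2 - 2 * f z * f w) + f w ^ 2 := fun w => by ring
    simp only [e]
    rw [integral_add, integral_sub, integral_const_mul, setIntegral_const, volume_closed]
    · simp only [int, sq, smul_eq_mul]
      ring
    · exact K'.integrableOn continuous_const
    · exact K'.integrableOn (by fun_prop)
    · exact K'.integrableOn (by fun_prop)
    · exact K'.integrableOn (by fun_prop)
  simp only [osc, h1]
  rw [integral_add, integral_sub, integral_const_mul, integral_const_mul, setIntegral_const,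
    volume_closed]
  · simp only [int, sq, smul_eq_mul]
    ring
  · exact K.integrableOn (by fun_prop)
  · exact K.integrableOn (by fun_prop)
  · exact K.integrableOn (by fun_prop)
  · exact K.integrableOn continuous_const

/-- Cauchy–Schwarz, read off from the nonnegativity of the oscillation of `K` against itself. -/
theorem int_sq_le (K : Rect) {f : ℝ × ℝ → ℝ} (hf : Continuous f) :
    K.int f ^ 2 ≤ K.area * K.sq f := by
  have h := osc_nonneg K K f
  rw [osc_eq K K hf] at h
  nlinarith

/-- Carries an `L²` bound from `K'` to `K` at the price of the oscillation between them. In the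
expansion of `osc` the product of the two integrals is absorbed by Cauchy–Schwarz on each rectangle
and a weighted arithmetic-geometric mean inequality. -/
theorem area_mul_sq_le (K K' : Rect) {f : ℝ × ℝ → ℝ} (hf : Continuous f) :
    K'.area * K.sq f ≤ 2 * osc K K' f + 2 * (K.area * K'.sq f) := by
  rw [osc_eq K K' hf]
  have a1 := K.area_pos
  have a2 := K'.area_pos
  have h1 := K.int_sq_le hf
  have h2 := K'.int_sq_le hf
  have h3 : K.int f ^ 2 / K.area ≤ K.sq f := by rw [div_le_iff₀ a1]; linarith
  have h4 : K'.int f ^ 2 / K'.area ≤ K'.sq f := by rw [div_le_iff₀ a2]; linarith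
  have h5 : 4 * K.int f * K'.int f ≤
      K'.area * (K.int f ^ 2 / K.area) + 4 * (K.area * (K'.int f ^ 2 / K'.area)) := by
    have e : K'.area * (K.int f ^ 2 / K.area) + 4 * (K.area * (K'.int f ^ 2 / K'.area)) -
        4 * K.int f * K'.int f = (K'.area * K.int f - 2 * K.area * K'.int f) ^ 2 /
          (K.area * K'.area) := by
      field_simp
      ring
    have : 0 ≤ (K'.area * K.int f - 2 * K.area * K'.int f) ^ 2 / (K.area * K'.area) := by
      positivity
    linarith
  have h6 := mul_le_mul_of_nonneg_left h3 a2.le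
  have h7 := mul_le_mul_of_nonneg_left h4 a1.le
  linarith

theorem sq_sub_const (K : Rect) {f : ℝ × ℝ → ℝ} (hf : Continuous f) :
    K.sq (fun z => f z - K.int f / K.area) = K.sq f - K.int f ^ 2 / K.area := by
  have a1 := K.area_pos
  set c := K.int f / K.area with hc
  have e : ∀ z, (f z - c) ^ 2 = (f z ^ 2 - 2 * c * f z) + c ^ 2 := fun z => by ring
  simp only [sq, e]
  rw [integral_add, integral_sub, integral_const_mul, setIntegral_const, volume_closed]
  · change K.sq f - 2 * c * K.int f + K.area • c ^ 2 = K.sq f - _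
    rw [hc, smul_eq_mul]
    field_simp
    ring
  · exact K.integrableOn (by fun_prop)
  · exact K.integrableOn (by fun_prop)
  · exact K.integrableOn (by fun_prop)
  · exact K.integrableOn continuous_const

theorem area_mul_sq_sub_const (K : Rect) {f : ℝ × ℝ → ℝ} (hf : Continuous f) :
    2 * (K.area * K.sq (fun z => f z - K.int f / K.area)) = osc K K f := by
  have a1 := K.area_pos
  rw [sq_sub_const K hf, osc_eq K K hf]
  field_simp
  ring

theorem osc_sub_const (K K' : Rect) (f : ℝ × ℝ → ℝ) (c : ℝ) :
    osc K K' (fun z => f z - c) = osc K K' f := by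
  simp only [osc, sub_sub_sub_cancel_right]

theorem int_mul_sq_le (K : Rect) {f g : ℝ × ℝ → ℝ} (hf : Continuous f) (hg : Continuous g) :
    K.int (fun z => f z * g z) ^ 2 ≤ K.sq f * K.sq g := by
  have key : ∀ t : ℝ, 0 ≤ K.sq f * (t * t) + (-2 * K.int fun z => f z * g z) * t + K.sq g := by
    intro t
    have e : ∀ z, (t * f z - g z) ^ 2 = (t * t * f z ^ 2 - 2 * t * (f z * g z)) + g z ^ 2 :=
      fun z => by ring
    have h : 0 ≤ K.sq (fun z => t * f z - g z) := K.sq_nonneg _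
    simp only [sq, e] at h
    rw [integral_add, integral_sub, integral_const_mul, integral_const_mul] at h
    · simp only [sq, int]
      linarith
    · exact K.integrableOn (by fun_prop)
    · exact K.integrableOn (by fun_prop)
    · exact K.integrableOn (by fun_prop)
    · exact K.integrableOn (by fun_prop)
  have h := discrim_le_zero key
  simp only [discrim] at h
  nlinarith

theorem integral_closed (K : Rect) {f : ℝ × ℝ → ℝ} (hf : Continuous f) :
    K.int f = ∫ x in K.x₀..K.x₁, ∫ y in K.y₀..K.y₁, f (x, y) := by
  have h := K.integrableOn hf
  rw [int, closed, Measure.volume_eq_prod, setIntegral_prod]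
  · rw [intervalIntegral.integral_of_le K.hx.le, integral_Icc_eq_integral_Ioc]
    refine integral_congr_ae (Filter.Eventually.of_forall fun x => ?_)
    simp only
    rw [intervalIntegral.integral_of_le K.hy.le, integral_Icc_eq_integral_Ioc]
  · exact h

theorem integral_closed' (K : Rect) {f : ℝ × ℝ → ℝ} (hf : Continuous f) :
    K.int f = ∫ y in K.y₀..K.y₁, ∫ x in K.x₀..K.x₁, f (x, y) := by
  have h := K.integrableOn hf
  rw [int, closed, Measure.volume_eq_prod, ← Measure.prod_restrict, integral_prod_symm]
  · rw [intervalIntegral.integral_of_le K.hy.le, integral_Icc_eq_integral_Ioc]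
    refine integral_congr_ae (Filter.Eventually.of_forall fun y => ?_)
    simp only
    rw [intervalIntegral.integral_of_le K.hx.le, integral_Icc_eq_integral_Ioc]
  · rw [Measure.prod_restrict]
    exact h

/-- The rectangle with the two coordinates exchanged. -/
def swap (K : Rect) : Rect := ⟨K.y₀, K.y₁, K.x₀, K.x₁, K.hy, K.hx⟩

theorem int_swap (K : Rect) (f : ℝ × ℝ → ℝ) : K.swap.int (f ∘ Prod.swap) = K.int f := by
  have h := (Measure.measurePreserving_swap (μ := (volume : Measure ℝ))
    (ν := (volume : Measure ℝ))).setIntegral_preimage_emb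
    MeasurableEquiv.prodComm.measurableEmbedding f K.closed
  have e : Prod.swap ⁻¹' K.closed = K.swap.closed := preimage_swap_prod _ _
  rw [e] at h
  exact h

theorem sq_swap (K : Rect) (f : ℝ × ℝ → ℝ) : K.swap.sq (f ∘ Prod.swap) = K.sq f :=
  K.int_swap fun z => f z ^ 2

theorem osc_swap (K K' : Rect) (f : ℝ × ℝ → ℝ) :
    osc K.swap K'.swap (f ∘ Prod.swap) = osc K K' f := by
  have h : ∀ c, ∫ w in K'.swap.closed, (c - (f ∘ Prod.swap) w) ^ 2 =
      ∫ w in K'.closed, (c - f w) ^ 2 := fun c => K'.int_swap fun w => (c - f w) ^ 2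
  simp only [osc, h]
  exact K.int_swap fun z => ∫ w in K'.closed, (f z - f w) ^ 2

end Rect

theorem pdx_swap {f : ℝ × ℝ → ℝ} (hf : ContDiff ℝ ∞ f) :
    pdx (f ∘ Prod.swap) = pdy f ∘ Prod.swap := by
  funext z
  have h := (hf.differentiable (by simp) z.swap).hasFDerivAt.comp z
    (ContinuousLinearEquiv.prodComm ℝ ℝ ℝ).hasFDerivAt
  have h2 : HasFDerivAt (f ∘ Prod.swap) _ z := h
  rw [pdx, h2.fderiv]
  rfl

theorem pdy_swap {f : ℝ × ℝ → ℝ} (hf : ContDiff ℝ ∞ f) :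
    pdy (f ∘ Prod.swap) = pdx f ∘ Prod.swap := by
  funext z
  have h := (hf.differentiable (by simp) z.swap).hasFDerivAt.comp z
    (ContinuousLinearEquiv.prodComm ℝ ℝ ℝ).hasFDerivAt
  have h2 : HasFDerivAt (f ∘ Prod.swap) _ z := h
  rw [pdy, h2.fderiv]
  rfl

theorem contDiff_swap {f : ℝ × ℝ → ℝ} (hf : ContDiff ℝ ∞ f) : ContDiff ℝ ∞ (f ∘ Prod.swap) :=
  hf.comp (contDiff_snd.prodMk contDiff_fst)

/-! ### Estimates next to a line on which the function vanishes -/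

theorem interval_sq_le {g : ℝ → ℝ} (hg : Continuous g) {a b : ℝ} (hab : a ≤ b) :
    (∫ t in a..b, g t) ^ 2 ≤ (b - a) * ∫ t in a..b, g t ^ 2 := by
  set m := ∫ t in a..b, g t with hm
  have h : 0 ≤ ∫ t in a..b, ((b - a) * g t - m) ^ 2 :=
    intervalIntegral.integral_nonneg hab fun _ _ => sq_nonneg _
  have e : ∀ t, ((b - a) * g t - m) ^ 2 =
      ((b - a) ^ 2 * g t ^ 2 - 2 * (b - a) * m * g t) + m ^ 2 := fun t => by ring
  simp only [e] at h
  rw [intervalIntegral.integral_add, intervalIntegral.integral_sub,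
    intervalIntegral.integral_const_mul, intervalIntegral.integral_const_mul,
    intervalIntegral.integral_const, ← hm, smul_eq_mul] at h
  · rcases hab.eq_or_lt with rfl | hlt
    · simp [hm]
    · have h0 : 0 < b - a := sub_pos.2 hlt
      have h2 : 0 ≤ (b - a) * ((b - a) * (∫ t in a..b, g t ^ 2) - m ^ 2) := by nlinarith
      have := nonneg_of_mul_nonneg_right h2 h0
      linarith
  all_goals exact Continuous.intervalIntegrable (by fun_prop) _ _

theorem interval_friedrichs {f f' : ℝ → ℝ} (hf : ∀ t, HasDerivAt f (f' t) t) (hc : Continuous f')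
    {a b l : ℝ} (hl : l ∈ Icc a b) (h0 : f l = 0) :
    ∫ t in a..b, f t ^ 2 ≤ (b - a) ^ 2 * ∫ t in a..b, f' t ^ 2 := by
  have hab : a ≤ b := hl.1.trans hl.2
  have hcf : Continuous f := continuous_iff_continuousAt.2 fun t => (hf t).continuousAt
  have hI : 0 ≤ ∫ t in a..b, f' t ^ 2 :=
    intervalIntegral.integral_nonneg hab fun _ _ => sq_nonneg _
  have hii : ∀ c d, IntervalIntegrable (fun t => f' t ^ 2) volume c d := fun c d =>
    Continuous.intervalIntegrable (by fun_prop) _ _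
  have hpt : ∀ x ∈ Icc a b, f x ^ 2 ≤ (b - a) * ∫ t in a..b, f' t ^ 2 := by
    intro x hx
    have e : f x = ∫ t in l..x, f' t := by
      rw [intervalIntegral.integral_eq_sub_of_hasDerivAt (fun t _ => hf t)
        (hc.intervalIntegrable _ _), h0, sub_zero]
    rcases le_total l x with hlx | hlx
    · rw [e]
      refine (interval_sq_le hc hlx).trans (mul_le_mul (by linarith [hx.2, hl.1]) ?_ ?_ (by linarith))
      · exact intervalIntegral.integral_mono_interval hl.1 hlx hx.2
          (Filter.Eventually.of_forall fun _ => sq_nonneg _) (hii _ _)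
      · exact intervalIntegral.integral_nonneg hlx fun _ _ => sq_nonneg _
    · rw [e, intervalIntegral.integral_symm, neg_sq]
      refine (interval_sq_le hc hlx).trans (mul_le_mul (by linarith [hx.1, hl.2]) ?_ ?_ (by linarith))
      · exact intervalIntegral.integral_mono_interval hx.1 hlx hl.2
          (Filter.Eventually.of_forall fun _ => sq_nonneg _) (hii _ _)
      · exact intervalIntegral.integral_nonneg hlx fun _ _ => sq_nonneg _
  have h := intervalIntegral.integral_mono_on (μ := volume) hab
    (Continuous.intervalIntegrable (by fun_prop : Continuous fun t => f t ^ 2) a b)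
    (continuous_const.intervalIntegrable a b) hpt
  rw [intervalIntegral.integral_const, smul_eq_mul] at h
  linarith

theorem hasDerivAt_fst {f : ℝ × ℝ → ℝ} (hf : ContDiff ℝ ∞ f) (x y : ℝ) :
    HasDerivAt (fun x => f (x, y)) (pdx f (x, y)) x := by
  have h := (hf.differentiable (by simp) (x, y)).hasFDerivAt
  exact h.comp_hasDerivAt x ((hasDerivAt_id' x).prodMk (hasDerivAt_const x y))

theorem hasDerivAt_snd {f : ℝ × ℝ → ℝ} (hf : ContDiff ℝ ∞ f) (x y : ℝ) :
    HasDerivAt (fun y => f (x, y)) (pdy f (x, y)) y := by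
  have h := (hf.differentiable (by simp) (x, y)).hasFDerivAt
  exact h.comp_hasDerivAt y ((hasDerivAt_const y x).prodMk (hasDerivAt_id' y))

theorem Rect.sq_le_of_wall (K : Rect) {f : ℝ × ℝ → ℝ} (hf : ContDiff ℝ ∞ f) {l : ℝ}
    (hl : l ∈ Icc K.x₀ K.x₁) (h0 : ∀ y ∈ Icc K.y₀ K.y₁, f (l, y) = 0) :
    K.sq f ≤ K.len ^ 2 * K.sq (pdx f) := by
  have c1 := hf.continuous
  have c2 := (contDiff_pdx hf).continuous
  have e1 : K.sq f = ∫ y in K.y₀..K.y₁, ∫ x in K.x₀..K.x₁, f (x, y) ^ 2 :=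
    K.integral_closed' (f := fun z => f z ^ 2) (by fun_prop)
  have e2 : K.sq (pdx f) = ∫ y in K.y₀..K.y₁, ∫ x in K.x₀..K.x₁, pdx f (x, y) ^ 2 :=
    K.integral_closed' (f := fun z => pdx f z ^ 2) (by fun_prop)
  rw [e1, e2, ← intervalIntegral.integral_const_mul]
  refine intervalIntegral.integral_mono_on K.hy.le ?_ ?_ fun y hy => ?_
  · exact (intervalIntegral.continuous_parametric_intervalIntegral_of_continuous'
      (f := fun y x => f (x, y) ^ 2) (by fun_prop) _ _).intervalIntegrable _ _
  · exact ((intervalIntegral.continuous_parametric_intervalIntegral_of_continuous'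
      (f := fun y x => pdx f (x, y) ^ 2) (by fun_prop) _ _).const_mul _).intervalIntegrable _ _
  · exact interval_friedrichs (fun t => hasDerivAt_fst hf t y) (by fun_prop) hl (h0 y hy)

/-! ### Controlling a derivative by the function and the oscillation of the derivative -/

namespace Rect

theorem sq_le_of_abs_le (K : Rect) {f : ℝ × ℝ → ℝ} (hf : Continuous f) {M : ℝ}
    (h : ∀ z ∈ K.closed, |f z| ≤ M) : K.sq f ≤ K.area * M ^ 2 := by
  have h1 : K.sq f ≤ ∫ z in K.closed, M ^ 2 := by
    refine setIntegral_mono_on (K.integrableOn (by fun_prop)) (K.integrableOn continuous_const)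
      K.measurableSet_closed fun z hz => ?_
    rw [← sq_abs]
    exact pow_le_pow_left₀ (abs_nonneg _) (h z hz) 2
  rwa [setIntegral_const, volume_closed, smul_eq_mul] at h1

/-- Integration by parts on vertical lines. The weight vanishes at both ends, so there are no
boundary terms. -/
theorem int_pdy_mul (K : Rect) {f : ℝ × ℝ → ℝ} (hf : ContDiff ℝ ∞ f) :
    K.int (fun z => pdy f z * ((z.2 - K.y₀) * (K.y₁ - z.2))) =
      -K.int (fun z => f z * (K.y₀ + K.y₁ - 2 * z.2)) := by
  have c1 := hf.continuous
  have c2 := (contDiff_pdy hf).continuous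
  rw [K.integral_closed (by fun_prop), K.integral_closed (by fun_prop),
    ← intervalIntegral.integral_neg]
  refine intervalIntegral.integral_congr fun x _ => ?_
  simp only
  have h := intervalIntegral.integral_mul_deriv_eq_deriv_mul (a := K.y₀) (b := K.y₁)
    (u := fun y => (y - K.y₀) * (K.y₁ - y)) (u' := fun y => K.y₀ + K.y₁ - 2 * y)
    (v := fun y => f (x, y)) (v' := fun y => pdy f (x, y)) ?_
    (fun y _ => hasDerivAt_snd hf x y) (Continuous.intervalIntegrable (by fun_prop) _ _)
    (Continuous.intervalIntegrable (by fun_prop) _ _)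
  · simp only [sub_self, zero_mul, mul_zero, zero_sub] at h
    simpa only [mul_comm] using h
  · intro y _
    have h1 := ((hasDerivAt_id' y).sub_const K.y₀).mul ((hasDerivAt_id' y).const_sub K.y₁)
    refine h1.congr_deriv ?_
    ring

theorem integral_quadratic (a b p q r : ℝ) :
    ∫ t in a..b, (p + q * t + r * t ^ 2) =
      (b - a) * (p + q * ((a + b) / 2) + r * ((a ^ 2 + a * b + b ^ 2) / 3)) := by
  rw [intervalIntegral.integral_add, intervalIntegral.integral_add,
    intervalIntegral.integral_const_mul, intervalIntegral.integral_const_mul,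
    intervalIntegral.integral_const, integral_id, integral_pow, smul_eq_mul]
  · push_cast
    ring
  all_goals exact Continuous.intervalIntegrable (by fun_prop) _ _

theorem continuous_quad (c : Fin 6 → ℝ) : Continuous (quad c) := by
  unfold quad
  fun_prop

theorem contDiff_quad (c : Fin 6 → ℝ) : ContDiff ℝ ∞ (quad c) := by
  unfold quad
  fun_prop

theorem int_quad (K : Rect) (c : Fin 6 → ℝ) :
    K.int (quad c) = K.area * (c 0 + c 1 * ((K.x₀ + K.x₁) / 2) + c 2 * ((K.y₀ + K.y₁) / 2) +
      c 3 * ((K.x₀ ^ 2 + K.x₀ * K.x₁ + K.x₁ ^ 2) / 3) +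
      c 4 * ((K.x₀ + K.x₁) / 2 * ((K.y₀ + K.y₁) / 2)) +
      c 5 * ((K.y₀ ^ 2 + K.y₀ * K.y₁ + K.y₁ ^ 2) / 3)) := by
  rw [K.integral_closed (continuous_quad c)]
  have h : ∀ x, ∫ y in K.y₀..K.y₁, quad c (x, y) =
      (K.hgt * (c 0 + c 2 * ((K.y₀ + K.y₁) / 2) + c 5 * ((K.y₀ ^ 2 + K.y₀ * K.y₁ + K.y₁ ^ 2) / 3)))
      + (K.hgt * (c 1 + c 4 * ((K.y₀ + K.y₁) / 2))) * x + (K.hgt * c 3) * x ^ 2 := by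
    intro x
    have e : ∀ y, quad c (x, y) = (c 0 + c 1 * x + c 3 * x ^ 2) + (c 2 + c 4 * x) * y +
        c 5 * y ^ 2 := fun y => by simp only [quad]; ring
    simp only [e]
    rw [integral_quadratic, hgt]
    ring
  simp only [h]
  rw [integral_quadratic, area, len]
  ring

/-- Split `pdy f` into its mean `c` and a remainder, whose square integral is exactly an
oscillation. Testing with the bubble `ψ` and integrating by parts bounds `c` by `f` and the
remainder. Next to a vertical wall this is how derivatives in the direction of the wall are
recovered, for which the vanishing on the wall gives nothing directly. -/
theorem sq_pdy_le (K : Rect) {f : ℝ × ℝ → ℝ} (hf : ContDiff ℝ ∞ f) :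
    K.sq (pdy f) ≤ 72 * K.sq f / K.hgt ^ 2 + 3 * osc K K (pdy f) / K.area := by
  have c1 := hf.continuous
  have c2 := (contDiff_pdy hf).continuous
  have hL := K.len_pos
  have hH := K.hgt_pos
  set L := K.len with hLdef
  set H := K.hgt with hHdef
  have ha : K.area = L * H := rfl
  set ψ : ℝ × ℝ → ℝ := fun z => (z.2 - K.y₀) * (K.y₁ - z.2) with hψ
  set ψ' : ℝ × ℝ → ℝ := fun z => K.y₀ + K.y₁ - 2 * z.2 with hψ'
  have cψ : Continuous ψ := by fun_prop
  have cψ' : Continuous ψ' := by fun_prop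
  set c := K.int (pdy f) / K.area with hc
  have hHy : H = K.y₁ - K.y₀ := rfl
  have hLx : L = K.x₁ - K.x₀ := rfl
  have iψ : K.int ψ = L * H ^ 3 / 6 := by
    have e : ψ = quad ![-(K.y₀ * K.y₁), 0, K.y₀ + K.y₁, 0, 0, -1] := by
      funext z
      simp [hψ, quad]
      ring
    rw [e, int_quad, ha, hHy]
    simp
    ring
  have bψ : K.sq ψ ≤ L * H * (H ^ 2 / 4) ^ 2 := by
    rw [← ha]
    refine K.sq_le_of_abs_le cψ fun z hz => abs_le.2 ⟨?_, ?_⟩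
    · have := mul_nonneg (sub_nonneg.2 hz.2.1) (sub_nonneg.2 hz.2.2)
      have h2 : 0 ≤ H ^ 2 / 4 := by positivity
      simp only [hψ]
      linarith
    · simp only [hψ]
      rw [hHy]
      nlinarith [_root_.sq_nonneg ((z.2 - K.y₀) - (K.y₁ - z.2))]
  have bψ' : K.sq ψ' ≤ L * H * H ^ 2 := by
    rw [← ha]
    refine K.sq_le_of_abs_le cψ' fun z hz => abs_le.2 ⟨?_, ?_⟩ <;> simp only [hψ'] <;> rw [hHy] <;>
      linarith [hz.2.1, hz.2.2]
  set g0 : ℝ × ℝ → ℝ := fun z => pdy f z - c with hg0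
  have cg0 : Continuous g0 := by fun_prop
  have hosc : 2 * (L * H * K.sq g0) = osc K K (pdy f) := K.area_mul_sq_sub_const c2
  have hsq : K.sq g0 = K.sq (pdy f) - c ^ 2 * (L * H) := by
    have := K.sq_sub_const c2
    rw [← hc] at this
    rw [hg0, this, hc, ha]
    field_simp
  have e1 : c * (L * H ^ 3 / 6) = K.int (fun z => pdy f z * ψ z) - K.int (fun z => g0 z * ψ z) := by
    rw [← int_sub K (by fun_prop) (by fun_prop), ← iψ, int, int, ← integral_const_mul]
    refine integral_congr_ae (Filter.Eventually.of_forall fun z => ?_)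
    simp only [hg0, Pi.sub_apply]
    ring
  rw [K.int_pdy_mul hf] at e1
  have b1 : K.int (fun z => f z * ψ' z) ^ 2 ≤ K.sq f * (L * H * H ^ 2) :=
    (K.int_mul_sq_le c1 cψ').trans (mul_le_mul_of_nonneg_left bψ' (K.sq_nonneg _))
  have b2 : K.int (fun z => g0 z * ψ z) ^ 2 ≤ K.sq g0 * (L * H * (H ^ 2 / 4) ^ 2) :=
    (K.int_mul_sq_le cg0 cψ).trans (mul_le_mul_of_nonneg_left bψ (K.sq_nonneg _))
  have b3 : (c * (L * H ^ 3 / 6)) ^ 2 ≤ 2 * (K.sq f * (L * H * H ^ 2)) +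
      2 * (K.sq g0 * (L * H * (H ^ 2 / 4) ^ 2)) := by
    rw [e1]
    nlinarith [_root_.sq_nonneg (K.int (fun z => f z * ψ' z) - K.int (fun z => g0 z * ψ z))]
  -- Divide by the square of `∫ ψ = L H³ / 6`: `72 = 2 · 36`, and `9 / 2 = 2 · 36 / 16` since `0 ≤ ψ
  -- ≤ H² / 4`.
  have b4 : c ^ 2 * (L * H) ≤ 72 * K.sq f / H ^ 2 + 9 / 2 * K.sq g0 := by
    have e : (c * (L * H ^ 3 / 6)) ^ 2 = c ^ 2 * (L * H) * (L * H ^ 5 / 36) := by ring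
    rw [e] at b3
    have e' : 2 * (K.sq f * (L * H * H ^ 2)) + 2 * (K.sq g0 * (L * H * (H ^ 2 / 4) ^ 2)) =
        (72 * K.sq f / H ^ 2 + 9 / 2 * K.sq g0) * (L * H ^ 5 / 36) := by
      field_simp
      ring
    rw [e'] at b3
    exact le_of_mul_le_mul_right b3 (by positivity)
  have b5 : K.sq g0 = osc K K (pdy f) / (2 * K.area) := by
    rw [← hosc, ha]
    field_simp
  -- `11 / 2 = 1 + 9 / 2`. The oscillation is twice the area times the square integral of the
  -- remainder, so the final factor is `11 / 4 ≤ 3`.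
  have b6 : K.sq (pdy f) ≤ 72 * K.sq f / H ^ 2 + 11 / 2 * K.sq g0 := by linarith
  rw [b5] at b6
  refine b6.trans ?_
  have h0 := osc_nonneg K K (pdy f)
  have h1 : 11 / 2 * (osc K K (pdy f) / (2 * K.area)) = 11 / 4 * (osc K K (pdy f) / K.area) := by
    field_simp
    ring
  have h2 : 0 ≤ osc K K (pdy f) / K.area := div_nonneg h0 K.area_pos.le
  rw [h1, mul_div_assoc 3]
  linarith

/-! ### Passage between real and extended real integrals -/

theorem enorm_sq (x : ℝ) : ‖x‖ₑ ^ 2 = ENNReal.ofReal (x ^ 2) := by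
  rw [← ofReal_norm, ← ENNReal.ofReal_pow (norm_nonneg _), Real.norm_eq_abs, sq_abs]

theorem lintegral_inner (K : Rect) (f : ℝ × ℝ → ℝ≥0∞) :
    ∫⁻ z in K.inner, f z = ∫⁻ z in K.closed, f z :=
  setLIntegral_congr K.inner_ae_eq_closed

theorem ofReal_sq (K : Rect) {f : ℝ × ℝ → ℝ} (hf : Continuous f) :
    ENNReal.ofReal (K.sq f) = ∫⁻ z in K.inner, ‖f z‖ₑ ^ 2 := by
  simp only [enorm_sq]
  rw [lintegral_inner, sq, ofReal_integral_eq_lintegral_ofReal]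
  · exact K.integrableOn (by fun_prop)
  · exact Filter.Eventually.of_forall fun _ => _root_.sq_nonneg _

theorem ofReal_osc (K K' : Rect) {f : ℝ × ℝ → ℝ} (hf : Continuous f) :
    ENNReal.ofReal (osc K K' f) = ∫⁻ z in K.inner, ∫⁻ w in K'.inner, ‖f z - f w‖ₑ ^ 2 := by
  have h : ∀ z, ∫⁻ w in K'.inner, ‖f z - f w‖ₑ ^ 2 =
      ENNReal.ofReal (∫ w in K'.closed, (f z - f w) ^ 2) := fun z =>
    (K'.ofReal_sq (f := fun w => f z - f w) (by fun_prop)).symm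
  simp only [h]
  rw [lintegral_inner, osc, ofReal_integral_eq_lintegral_ofReal]
  · refine K.integrableOn ?_
    exact continuous_parametric_integral_of_continuous (by fun_prop) K'.isCompact_closed
  · exact Filter.Eventually.of_forall fun _ => integral_nonneg fun _ => _root_.sq_nonneg _

end Rect

theorem eucl_le {z w : ℝ × ℝ} {d : ℝ} (h1 : |z.1 - w.1| ≤ d) (h2 : |z.2 - w.2| ≤ d) :
    eucl z w ≤ 2 * d := by
  have hd : 0 ≤ d := (abs_nonneg _).trans h1
  refine Real.sqrt_le_iff.2 ⟨by positivity, ?_⟩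
  nlinarith [sq_le_sq' (abs_le.1 h1).1 (abs_le.1 h1).2, sq_le_sq' (abs_le.1 h2).1 (abs_le.1 h2).2]

theorem sq_le_kernel {σ d : ℝ} (hσ : 0 ≤ σ) {g : ℝ × ℝ → ℝ} {z w : ℝ × ℝ} (h : eucl z w ≤ 2 * d) :
    ‖g z - g w‖ₑ ^ 2 ≤ ENNReal.ofReal ((2 * d) ^ (2 + 2 * σ)) *
      (‖g z - g w‖ₑ ^ 2 / ENNReal.ofReal (eucl z w ^ (2 + 2 * σ))) := by
  by_cases hzw : z = w
  · subst hzw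
    simp
  have he : 0 < eucl z w := by
    refine Real.sqrt_pos.2 ?_
    by_contra hc
    refine hzw (Prod.ext ?_ ?_) <;> nlinarith [sq_nonneg (z.1 - w.1), sq_nonneg (z.2 - w.2)]
  have h1 := Real.rpow_le_rpow he.le h (by linarith : 0 ≤ 2 + 2 * σ)
  have h2 := Real.rpow_pos_of_pos he (2 + 2 * σ)
  calc ‖g z - g w‖ₑ ^ 2 = ENNReal.ofReal (eucl z w ^ (2 + 2 * σ)) *
      (‖g z - g w‖ₑ ^ 2 / ENNReal.ofReal (eucl z w ^ (2 + 2 * σ))) :=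
        (ENNReal.mul_div_cancel (by simpa using h2) ENNReal.ofReal_ne_top).symm
    _ ≤ _ := mul_le_mul_left (ENNReal.ofReal_le_ofReal h1) _

namespace Rect

theorem abs_sub_le_size (R : Rect) {z w : ℝ × ℝ} (hz : z ∈ R.closed) (hw : w ∈ R.closed) :
    |z.1 - w.1| ≤ R.size ∧ |z.2 - w.2| ≤ R.size := by
  have a1 := R.len_le_size
  have a2 := R.hgt_le_size
  simp only [len, hgt] at a1 a2
  obtain ⟨⟨b1, b2⟩, b3, b4⟩ := hz
  obtain ⟨⟨c1, c2⟩, c3, c4⟩ := hw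
  refine ⟨abs_le.2 ⟨?_, ?_⟩, abs_le.2 ⟨?_, ?_⟩⟩ <;> linarith

/-- The union of the two rectangles is a rectangle of size at most `d`. -/
def Joined (K K' : Rect) (d : ℝ) : Prop :=
  ∃ R : Rect, K.closed ⊆ R.closed ∧ K'.closed ⊆ R.closed ∧ R.closed ⊆ K.closed ∪ K'.closed ∧
    R.size ≤ d

theorem joined_self (K : Rect) {d : ℝ} (h : K.size ≤ d) : Joined K K d :=
  ⟨K, subset_rfl, subset_rfl, by simp, h⟩

theorem Joined.symm {K K' : Rect} {d : ℝ} (h : Joined K K' d) : Joined K' K d := by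
  obtain ⟨R, h1, h2, h3, h4⟩ := h
  exact ⟨R, h2, h1, by rwa [union_comm], h4⟩

/-- A Poincaré inequality across two adjacent cells. On the convex union the oscillation is at most
`(2d)³` times the squared Slobodeckij seminorm of order `1/2`, which the gradient controls. The
order `1/2` is an arbitrary choice in `(0, 1)`; it gives `128 = 2³ · gradConst (1/2)`. -/
theorem osc_le_of_joined {K K' : Rect} {d : ℝ} (h : Joined K K' d) {f : ℝ × ℝ → ℝ}
    (hf : ContDiff ℝ ∞ f) :
    osc K K' f ≤ 128 * d ^ 4 *
      ((K.sq (pdx f) + K'.sq (pdx f)) + (K.sq (pdy f) + K'.sq (pdy f))) := by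
  obtain ⟨R, h1, h2, h3, h4⟩ := h
  have cx := (contDiff_pdx hf).continuous
  have cy := (contDiff_pdy hf).continuous
  have hd : 0 < d := R.size_pos.trans_le h4
  have hR : ∀ g : ℝ × ℝ → ℝ, Continuous g →
      ∫⁻ z in R.inner, ‖g z‖ₑ ^ 2 ≤ ENNReal.ofReal (K.sq g + K'.sq g) := by
    intro g hg
    rw [ENNReal.ofReal_add (K.sq_nonneg g) (K'.sq_nonneg g), K.ofReal_sq hg, K'.ofReal_sq hg,
      R.lintegral_inner, K.lintegral_inner, K'.lintegral_inner]
    exact (lintegral_mono_set h3).trans (lintegral_union_le _ _ _)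
  have hF := fracSq_le_of_contDiff (σ := 1 / 2) (by norm_num) (by norm_num) R h4 hf
  rw [fracSq, if_neg (by norm_num)] at hF
  have n1 := K.sq_nonneg (pdx f)
  have n2 := K'.sq_nonneg (pdx f)
  have n3 := K.sq_nonneg (pdy f)
  have n4 := K'.sq_nonneg (pdy f)
  rw [← ENNReal.ofReal_le_ofReal_iff (by positivity), ofReal_osc K K' hf.continuous]
  calc ∫⁻ z in K.inner, ∫⁻ w in K'.inner, ‖f z - f w‖ₑ ^ 2
      ≤ ∫⁻ z in R.inner, ∫⁻ w in R.inner, ‖f z - f w‖ₑ ^ 2 := by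
        simp only [lintegral_inner]
        exact (lintegral_mono_set h1).trans (lintegral_mono fun z => lintegral_mono_set h2)
    _ ≤ ∫⁻ z in R.inner, ∫⁻ w in R.inner, ENNReal.ofReal ((2 * d) ^ (2 + 2 * (1 / 2 : ℝ))) *
          (‖f z - f w‖ₑ ^ 2 / ENNReal.ofReal (eucl z w ^ (2 + 2 * (1 / 2 : ℝ)))) := by
        refine setLIntegral_mono' R.isOpen_inner.measurableSet fun z hz =>
          setLIntegral_mono' R.isOpen_inner.measurableSet fun w hw => ?_
        have := R.abs_sub_le_size (R.inner_subset_closed hz) (R.inner_subset_closed hw)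
        exact sq_le_kernel (by norm_num) (eucl_le (this.1.trans h4) (this.2.trans h4))
    _ = ENNReal.ofReal ((2 * d) ^ (2 + 2 * (1 / 2 : ℝ))) * ∫⁻ z in R.inner, ∫⁻ w in R.inner,
          (‖f z - f w‖ₑ ^ 2 / ENNReal.ofReal (eucl z w ^ (2 + 2 * (1 / 2 : ℝ)))) := by
        simp_rw [lintegral_const_mul' _ _ ENNReal.ofReal_ne_top]
    _ ≤ ENNReal.ofReal ((2 * d) ^ (2 + 2 * (1 / 2 : ℝ))) * (ENNReal.ofReal
          (gradConst (1 / 2) * d ^ (2 - 2 * (1 / 2 : ℝ))) * (ENNReal.ofReal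
            (K.sq (pdx f) + K'.sq (pdx f)) + ENNReal.ofReal (K.sq (pdy f) + K'.sq (pdy f)))) := by
        gcongr
        exact hF.trans (mul_le_mul_right (add_le_add (hR _ cx) (hR _ cy)) _)
    _ = _ := by
        rw [← ENNReal.ofReal_add (by positivity) (by positivity), ← ENNReal.ofReal_mul
          (mul_nonneg (gradConst_pos (by norm_num)).le (by positivity)), ← ENNReal.ofReal_mul (by positivity)]
        congr 1
        norm_num [gradConst]
        ring

end Rect

/-! ### Derivatives of quadratic polynomials -/

/-- Coefficients of the first partial derivative. -/
def coefDx (c : Fin 6 → ℝ) : Fin 6 → ℝ := ![c 1, 2 * c 3, c 4, 0, 0, 0]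

/-- Coefficients of the second partial derivative. -/
def coefDy (c : Fin 6 → ℝ) : Fin 6 → ℝ := ![c 2, c 4, 2 * c 5, 0, 0, 0]

theorem pdx_quad (c : Fin 6 → ℝ) : pdx (quad c) = quad (coefDx c) := by
  funext ⟨x, y⟩
  refine (hasDerivAt_fst (Rect.contDiff_quad c) x y).unique ?_
  have hid := hasDerivAt_id' x
  have h := ((((hid.const_mul (c 1)).const_add (c 0)).add_const (c 2 * y)).add
    ((hid.pow 2).const_mul (c 3))).add ((hid.mul_const y).const_mul (c 4)) |>.add_const
      (c 5 * y ^ 2)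
  refine h.congr_deriv ?_
  simp [quad, coefDx]
  ring

theorem pdy_quad (c : Fin 6 → ℝ) : pdy (quad c) = quad (coefDy c) := by
  funext ⟨x, y⟩
  refine (hasDerivAt_snd (Rect.contDiff_quad c) x y).unique ?_
  have hid := hasDerivAt_id' y
  have h := ((((hid.const_mul (c 2)).const_add (c 0 + c 1 * x)).add_const (c 3 * x ^ 2)).add
    ((hid.const_mul x).const_mul (c 4))).add ((hid.pow 2).const_mul (c 5))
  refine h.congr_deriv ?_
  simp [quad, coefDy]
  ring

/-! ### Smallness of a function together with its derivatives -/

/-- The sides of `K` are comparable with `h`. -/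
structure Rect.Sized (K : Rect) (h κ : ℝ) : Prop where
  le_len : h ≤ κ * K.len
  le_hgt : h ≤ κ * K.hgt
  len_le : K.len ≤ κ * h
  hgt_le : K.hgt ≤ κ * h

theorem Rect.Sized.swap {K : Rect} {h κ : ℝ} (hK : K.Sized h κ) : K.swap.Sized h κ :=
  ⟨hK.le_hgt, hK.le_len, hK.hgt_le, hK.len_le⟩

/-- Scaled bounds for the derivatives up to order two. -/
structure Small (K : Rect) (e : ℝ × ℝ → ℝ) (h B : ℝ) : Prop where
  s00 : K.sq e ≤ B * h ^ 2
  s10 : K.sq (pdx e) ≤ B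
  s01 : K.sq (pdy e) ≤ B
  s20 : h ^ 2 * K.sq (pdx (pdx e)) ≤ B
  s11 : h ^ 2 * K.sq (pdx (pdy e)) ≤ B
  s02 : h ^ 2 * K.sq (pdy (pdy e)) ≤ B

/-- Bounds for the oscillation of the second derivatives. -/
structure OscBound (K K' : Rect) (e : ℝ × ℝ → ℝ) (A : ℝ) : Prop where
  o20 : Rect.osc K K' (pdx (pdx e)) ≤ A
  o11 : Rect.osc K K' (pdx (pdy e)) ≤ A
  o02 : Rect.osc K K' (pdy (pdy e)) ≤ A

theorem OscBound.swap {K K' : Rect} {e : ℝ × ℝ → ℝ} (he : ContDiff ℝ ∞ e) {A : ℝ}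
    (h : OscBound K K' e A) : OscBound K.swap K'.swap (e ∘ Prod.swap) A := by
  refine ⟨?_, ?_, ?_⟩
  · rw [pdx_swap he, pdx_swap (contDiff_pdy he), Rect.osc_swap]
    exact h.o02
  · rw [pdy_swap he, pdx_swap (contDiff_pdx he), Rect.osc_swap, ← pdx_pdy_comm he]
    exact h.o11
  · rw [pdy_swap he, pdy_swap (contDiff_pdx he), Rect.osc_swap]
    exact h.o20

theorem Small.of_swap {K : Rect} {e : ℝ × ℝ → ℝ} (he : ContDiff ℝ ∞ e) {h B : ℝ}
    (hs : Small K.swap (e ∘ Prod.swap) h B) : Small K e h B := by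
  obtain ⟨h1, h2, h3, h4, h5, h6⟩ := hs
  rw [pdx_swap he] at h2 h4
  rw [pdy_swap he] at h3 h5 h6
  rw [pdx_swap (contDiff_pdy he), Rect.sq_swap] at h4
  rw [pdx_swap (contDiff_pdx he), Rect.sq_swap, ← pdx_pdy_comm he] at h5
  rw [pdy_swap (contDiff_pdx he), Rect.sq_swap] at h6
  rw [Rect.sq_swap] at h1 h2 h3
  exact ⟨h1, h3, h2, h6, h5, h4⟩

/-- The second derivatives of a quadratic polynomial are constants, which differences do not see. So
one bound `A` serves for `φ` minus any quadratic. -/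
theorem osc_sub_quad (K K' : Rect) {φ : ℝ × ℝ → ℝ} (hφ : ContDiff ℝ ∞ φ) (c : Fin 6 → ℝ) {A : ℝ}
    (h : OscBound K K' φ A) : OscBound K K' (φ - quad c) A := by
  have hq := Rect.contDiff_quad
  have key : ∀ (f : ℝ × ℝ → ℝ) (d : ℝ) (g : ℝ × ℝ → ℝ), (∀ z, g z = d) →
      Rect.osc K K' (f - g) = Rect.osc K K' f := by
    intro f d g hg
    rw [show f - g = fun z => f z - d from funext fun z => by rw [Pi.sub_apply, hg]]
    exact Rect.osc_sub_const K K' f d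
  refine ⟨?_, ?_, ?_⟩
  · rw [pdx_sub hφ (hq c), pdx_sub (contDiff_pdx hφ) (contDiff_pdx (hq c)), pdx_quad, pdx_quad,
      key _ (2 * c 3) _ (by simp [quad, coefDx])]
    exact h.o20
  · rw [pdy_sub hφ (hq c), pdx_sub (contDiff_pdy hφ) (contDiff_pdy (hq c)), pdy_quad, pdx_quad,
      key _ (c 4) _ (by simp [quad, coefDx, coefDy])]
    exact h.o11
  · rw [pdy_sub hφ (hq c), pdy_sub (contDiff_pdy hφ) (contDiff_pdy (hq c)), pdy_quad, pdy_quad,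
      key _ (2 * c 5) _ (by simp [quad, coefDy])]
    exact h.o02

section

variable {h κ : ℝ}

theorem Rect.Sized.area_le {K : Rect} (hK : K.Sized h κ) (hh : 0 < h) (hκ : 1 ≤ κ) :
    K.area ≤ κ ^ 2 * h ^ 2 := by
  have := mul_le_mul hK.len_le hK.hgt_le K.hgt_pos.le (by positivity)
  simp only [Rect.area]
  nlinarith

theorem Rect.Sized.le_area {K : Rect} (hK : K.Sized h κ) (hh : 0 < h) (hκ : 1 ≤ κ) :
    h ^ 2 ≤ κ ^ 2 * K.area := by
  have := mul_le_mul hK.le_len hK.le_hgt hh.le (mul_nonneg (by linarith) K.len_pos.le)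
  simp only [Rect.area]
  nlinarith

theorem Rect.Sized.size_le {K : Rect} (hK : K.Sized h κ) : K.size ≤ κ * h :=
  max_le hK.len_le hK.hgt_le

theorem sq_step {K K' : Rect} (hh : 0 < h) (hκ : 1 ≤ κ) (hK : K.Sized h κ) (hK' : K'.Sized h κ)
    {f : ℝ × ℝ → ℝ} (hf : Continuous f) :
    h ^ 2 * K.sq f ≤ 2 * κ ^ 2 * Rect.osc K K' f + 2 * κ ^ 4 * (h ^ 2 * K'.sq f) := by
  have h1 := Rect.area_mul_sq_le K K' hf
  have h2 := hK.area_le hh hκ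
  have h3 := hK'.le_area hh hκ
  have n1 := K.sq_nonneg f
  have n2 := K'.sq_nonneg f
  have e1 := mul_le_mul_of_nonneg_right h3 n1
  have e2 := mul_le_mul_of_nonneg_right h2 n2
  have e3 := mul_le_mul_of_nonneg_left h1 (sq_nonneg κ)
  have e4 := mul_le_mul_of_nonneg_left e2 (sq_nonneg κ)
  nlinarith

/-- The constant in the propagation of smallness. -/
def stepConst (κ : ℝ) : ℝ := 10 ^ 9 * κ ^ 16

/-- Work from the second derivatives downwards. Those are carried from `K'` to `K` by their own
oscillation. The oscillation of a first derivative is bounded by second derivatives on both cells,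
which are now known, so the first derivatives follow, and then the function in the same way. -/
theorem Small.step {K K' : Rect} (hh : 0 < h) (hκ : 1 ≤ κ) (hK : K.Sized h κ)
    (hK' : K'.Sized h κ) (hJ : Rect.Joined K K' (2 * κ * h)) {e : ℝ × ℝ → ℝ} (he : ContDiff ℝ ∞ e)
    {A B : ℝ} (hA : OscBound K K' e A) (hB : Small K' e h B) :
    Small K e h (stepConst κ * (A + B)) := by
  have cx := contDiff_pdx he
  have cy := contDiff_pdy he
  have cxx := contDiff_pdx cx
  have cxy := contDiff_pdx cy
  have cyy := contDiff_pdy cy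
  have hA0 : 0 ≤ A := (Rect.osc_nonneg _ _ _).trans hA.o20
  have hB0 : 0 ≤ B := (K'.sq_nonneg _).trans hB.s10
  set S := A + B with hS
  have hS0 : 0 ≤ S := add_nonneg hA0 hB0
  have hAS : A ≤ S := by linarith
  have hBS : B ≤ S := by linarith
  have p2 : (1 : ℝ) ≤ κ ^ 2 := one_le_pow₀ hκ
  have p4 : (1 : ℝ) ≤ κ ^ 4 := one_le_pow₀ hκ
  have q24 : κ ^ 2 ≤ κ ^ 4 := pow_le_pow_right₀ hκ (by norm_num)
  have q410 : κ ^ 4 ≤ κ ^ 10 := pow_le_pow_right₀ hκ (by norm_num)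
  have q416 : κ ^ 4 ≤ κ ^ 16 := pow_le_pow_right₀ hκ (by norm_num)
  have q1016 : κ ^ 10 ≤ κ ^ 16 := pow_le_pow_right₀ hκ (by norm_num)
  have hh2 : 0 < h ^ 2 := by positivity
  have D2 : ∀ f : ℝ × ℝ → ℝ, Continuous f → Rect.osc K K' f ≤ A → h ^ 2 * K'.sq f ≤ B →
      h ^ 2 * K.sq f ≤ 2 * κ ^ 4 * S := by
    intro f hf h1 h2
    have := sq_step hh hκ hK hK' hf
    have e1 := mul_le_mul_of_nonneg_left h1 (by positivity : 0 ≤ 2 * κ ^ 2)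
    have e2 := mul_le_mul_of_nonneg_left h2 (by positivity : 0 ≤ 2 * κ ^ 4)
    have e3 := mul_le_mul_of_nonneg_right q24 hA0
    nlinarith
  have d20 := D2 _ cxx.continuous hA.o20 hB.s20
  have d11 := D2 _ cxy.continuous hA.o11 hB.s11
  have d02 := D2 _ cyy.continuous hA.o02 hB.s02
  have hBS4 : B ≤ 2 * κ ^ 4 * S := by nlinarith
  have D1 : ∀ f : ℝ × ℝ → ℝ, ContDiff ℝ ∞ f → K'.sq f ≤ B → h ^ 2 * K.sq (pdx f) ≤ 2 * κ ^ 4 * S →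
      h ^ 2 * K'.sq (pdx f) ≤ B → h ^ 2 * K.sq (pdy f) ≤ 2 * κ ^ 4 * S →
      h ^ 2 * K'.sq (pdy f) ≤ B → K.sq f ≤ 32770 * κ ^ 10 * S := by
    intro f hf h0 h1 h2 h3 h4
    have e0 := Rect.osc_le_of_joined hJ hf
    have e1 := sq_step hh hκ hK hK' hf.continuous
    -- `2048 κ⁴ h⁴` is `128 d⁴` for `d = 2 κ h`.
    have e2 : Rect.osc K K' f ≤ 2048 * κ ^ 4 * h ^ 2 * (4 * (2 * κ ^ 4 * S)) := by
      refine e0.trans ?_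
      have : h ^ 2 * ((K.sq (pdx f) + K'.sq (pdx f)) + (K.sq (pdy f) + K'.sq (pdy f))) ≤
        4 * (2 * κ ^ 4 * S) := by linarith
      have e3 := mul_le_mul_of_nonneg_left this (by positivity : 0 ≤ 2048 * κ ^ 4 * h ^ 2)
      calc _ = 2048 * κ ^ 4 * h ^ 2 * (h ^ 2 * ((K.sq (pdx f) + K'.sq (pdx f)) +
            (K.sq (pdy f) + K'.sq (pdy f)))) := by ring
        _ ≤ _ := e3
    have e4 := mul_le_mul_of_nonneg_left e2 (by positivity : 0 ≤ 2 * κ ^ 2)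
    have e5 : h ^ 2 * K.sq f ≤ h ^ 2 * (32768 * κ ^ 10 * S + 2 * κ ^ 4 * B) := by
      have := mul_le_mul_of_nonneg_left h0 (by positivity : 0 ≤ 2 * κ ^ 4 * h ^ 2)
      nlinarith
    have e6 := le_of_mul_le_mul_left e5 hh2
    have e7 := mul_le_mul q410 hBS hB0 (by positivity : 0 ≤ κ ^ 10)
    linarith
  have d10 := D1 _ cx hB.s10 d20 hB.s20 (by rw [← pdx_pdy_comm he]; exact d11)
    (by rw [← pdx_pdy_comm he]; exact hB.s11)
  have d01 := D1 _ cy hB.s01 d11 hB.s11 d02 hB.s02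
  -- `536903680 = 2 · 2048 · 4 · 32770`; the term in `B` adds `2`.
  have D0 : K.sq e ≤ 536903682 * κ ^ 16 * S * h ^ 2 := by
    have e0 := Rect.osc_le_of_joined hJ he
    have e1 := sq_step hh hκ hK hK' he.continuous
    have hBS10 : B ≤ 32770 * κ ^ 10 * S := by nlinarith
    have e2 : Rect.osc K K' e ≤ 2048 * κ ^ 4 * h ^ 4 * (4 * (32770 * κ ^ 10 * S)) := by
      refine e0.trans ?_
      have : ((K.sq (pdx e) + K'.sq (pdx e)) + (K.sq (pdy e) + K'.sq (pdy e))) ≤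
        4 * (32770 * κ ^ 10 * S) := by linarith [hB.s10, hB.s01]
      have e3 := mul_le_mul_of_nonneg_left this (by positivity : 0 ≤ 2048 * κ ^ 4 * h ^ 4)
      calc _ = 2048 * κ ^ 4 * h ^ 4 * (((K.sq (pdx e) + K'.sq (pdx e)) +
            (K.sq (pdy e) + K'.sq (pdy e)))) := by ring
        _ ≤ _ := e3
    have e4 := mul_le_mul_of_nonneg_left e2 (by positivity : 0 ≤ 2 * κ ^ 2)
    have e5 : h ^ 2 * K.sq e ≤ h ^ 2 * (536903680 * κ ^ 16 * S * h ^ 2 + 2 * κ ^ 4 * (B * h ^ 2)) := by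
      have := mul_le_mul_of_nonneg_left hB.s00 (by positivity : 0 ≤ 2 * κ ^ 4 * h ^ 2)
      nlinarith
    have e6 := le_of_mul_le_mul_left e5 hh2
    have e7 := mul_le_mul_of_nonneg_right (mul_le_mul q416 hBS hB0 (by positivity : 0 ≤ κ ^ 16))
      hh2.le
    linarith
  have k1 : 2 * κ ^ 4 * S ≤ stepConst κ * S :=
    mul_le_mul_of_nonneg_right (by unfold stepConst; nlinarith) hS0
  have k2 : 32770 * κ ^ 10 * S ≤ stepConst κ * S :=
    mul_le_mul_of_nonneg_right (by unfold stepConst; nlinarith) hS0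
  have k3 : 536903682 * κ ^ 16 * S * h ^ 2 ≤ stepConst κ * S * h ^ 2 :=
    mul_le_mul_of_nonneg_right (mul_le_mul_of_nonneg_right (by unfold stepConst; nlinarith) hS0)
      hh2.le
  exact ⟨D0.trans k3, d10.trans k2, d01.trans k2, d20.trans k1, d11.trans k1, d02.trans k1⟩

/-! ### The averaged Taylor polynomial -/

/-- Coefficients of the quadratic polynomial with coefficients `d` in the coordinates centred at
`(a, b)`. -/
def centered (a b : ℝ) (d : Fin 6 → ℝ) : Fin 6 → ℝ :=
  ![d 0 - d 1 * a - d 2 * b + d 3 * a ^ 2 + d 4 * (a * b) + d 5 * b ^ 2,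
    d 1 - 2 * d 3 * a - d 4 * b, d 2 - 2 * d 5 * b - d 4 * a, d 3, d 4, d 5]

namespace Rect

/-- Mean value. -/
noncomputable def avg (K : Rect) (f : ℝ × ℝ → ℝ) : ℝ := K.int f / K.area

/-- Centred coefficients of the averaged Taylor polynomial. -/
noncomputable def taylorCoef (K : Rect) (φ : ℝ × ℝ → ℝ) : Fin 6 → ℝ :=
  ![K.avg φ - (K.avg (pdx (pdx φ)) * K.len ^ 2 + K.avg (pdy (pdy φ)) * K.hgt ^ 2) / 24,
    K.avg (pdx φ), K.avg (pdy φ), K.avg (pdx (pdx φ)) / 2, K.avg (pdx (pdy φ)),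
    K.avg (pdy (pdy φ)) / 2]

/-- The averaged Taylor polynomial of degree two. -/
noncomputable def taylor (K : Rect) (φ : ℝ × ℝ → ℝ) : Fin 6 → ℝ :=
  centered ((K.x₀ + K.x₁) / 2) ((K.y₀ + K.y₁) / 2) (K.taylorCoef φ)

theorem avg_sub (K : Rect) {f g : ℝ × ℝ → ℝ} (hf : Continuous f) (hg : Continuous g) :
    K.avg (f - g) = K.avg f - K.avg g := by
  simp only [avg, K.int_sub hf hg, sub_div]

theorem avg_quad (K : Rect) (c : Fin 6 → ℝ) :
    K.avg (quad c) = (c 0 + c 1 * ((K.x₀ + K.x₁) / 2) + c 2 * ((K.y₀ + K.y₁) / 2) +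
      c 3 * ((K.x₀ ^ 2 + K.x₀ * K.x₁ + K.x₁ ^ 2) / 3) +
      c 4 * ((K.x₀ + K.x₁) / 2 * ((K.y₀ + K.y₁) / 2)) +
      c 5 * ((K.y₀ ^ 2 + K.y₀ * K.y₁ + K.y₁ ^ 2) / 3)) := by
  rw [avg, int_quad, mul_div_cancel_left₀ _ K.area_pos.ne']

/-- The construction matches the means of all derivatives up to order two. The mean of `(x - a)²`
over a side of length `L` centred at `a` is `L² / 12`, whence the correction by `1 / 24` in the
constant coefficient. Together with linearity this makes `taylor` a projection onto the quadratics.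
-/
theorem taylor_quad (K : Rect) (c : Fin 6 → ℝ) : K.taylor (quad c) = c := by
  funext i
  fin_cases i <;> simp [taylor, taylorCoef, centered, pdx_quad, pdy_quad, avg_quad, coefDx, coefDy,
    len, hgt] <;> ring

theorem taylor_sub (K : Rect) {f g : ℝ × ℝ → ℝ} (hf : ContDiff ℝ ∞ f) (hg : ContDiff ℝ ∞ g) :
    K.taylor (f - g) = K.taylor f - K.taylor g := by
  have fx := contDiff_pdx hf
  have fy := contDiff_pdy hf
  have gx := contDiff_pdx hg
  have gy := contDiff_pdy hg
  have e0 := K.avg_sub hf.continuous hg.continuous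
  have e1 := K.avg_sub fx.continuous gx.continuous
  have e2 := K.avg_sub fy.continuous gy.continuous
  have e3 := K.avg_sub (contDiff_pdx fx).continuous (contDiff_pdx gx).continuous
  have e4 := K.avg_sub (contDiff_pdx fy).continuous (contDiff_pdx gy).continuous
  have e5 := K.avg_sub (contDiff_pdy fy).continuous (contDiff_pdy gy).continuous
  funext i
  fin_cases i <;> simp [taylor, taylorCoef, centered, pdx_sub hf hg, pdy_sub hf hg, pdx_sub fx gx,
    pdx_sub fy gy, pdy_sub fy gy, e0, e1, e2, e3, e4, e5] <;> ring

end Rect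

/-- Scaled bounds for centred coefficients. -/
structure SmallCoef (d : Fin 6 → ℝ) (h B : ℝ) : Prop where
  c0 : d 0 ^ 2 ≤ B
  c1 : h ^ 2 * d 1 ^ 2 ≤ B
  c2 : h ^ 2 * d 2 ^ 2 ≤ B
  c3 : h ^ 4 * d 3 ^ 2 ≤ B
  c4 : h ^ 4 * d 4 ^ 2 ≤ B
  c5 : h ^ 4 * d 5 ^ 2 ≤ B

theorem Rect.Sized.sq_avg_le {K : Rect} (hK : K.Sized h κ) (hh : 0 < h) (hκ : 1 ≤ κ)
    {f : ℝ × ℝ → ℝ} (hf : Continuous f) : h ^ 2 * K.avg f ^ 2 ≤ κ ^ 2 * K.sq f := by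
  have h1 := K.int_sq_le hf
  have h2 := hK.le_area hh hκ
  have ha := K.area_pos
  have e : K.area * K.avg f ^ 2 ≤ K.sq f := by
    rw [Rect.avg, div_pow, ← mul_div_assoc, div_le_iff₀ (by positivity)]
    nlinarith
  have e2 := mul_le_mul_of_nonneg_right h2 (_root_.sq_nonneg (K.avg f))
  have e3 := mul_le_mul_of_nonneg_left e (_root_.sq_nonneg κ)
  linarith

theorem Small.taylorCoef {K : Rect} (hh : 0 < h) (hκ : 1 ≤ κ) (hK : K.Sized h κ)
    {e : ℝ × ℝ → ℝ} (he : ContDiff ℝ ∞ e) {B : ℝ} (hB : Small K e h B) :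
    SmallCoef (K.taylorCoef e) h (3 * κ ^ 6 * B) := by
  have cx := contDiff_pdx he
  have cy := contDiff_pdy he
  have hB0 : 0 ≤ B := (K.sq_nonneg _).trans hB.s10
  have m0 := hK.sq_avg_le hh hκ he.continuous
  have m1 := hK.sq_avg_le hh hκ cx.continuous
  have m2 := hK.sq_avg_le hh hκ cy.continuous
  have m3 := hK.sq_avg_le hh hκ (contDiff_pdx cx).continuous
  have m4 := hK.sq_avg_le hh hκ (contDiff_pdx cy).continuous
  have m5 := hK.sq_avg_le hh hκ (contDiff_pdy cy).continuous
  have hh2 : 0 < h ^ 2 := by positivity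
  have q26 : κ ^ 2 ≤ κ ^ 6 := pow_le_pow_right₀ hκ (by norm_num)
  have q2B : κ ^ 2 * B ≤ κ ^ 6 * B := mul_le_mul_of_nonneg_right q26 hB0
  have hκ2 : 0 ≤ κ ^ 2 := by positivity
  have t0 : K.avg e ^ 2 ≤ κ ^ 2 * B := by
    have := mul_le_mul_of_nonneg_left hB.s00 hκ2
    exact le_of_mul_le_mul_left (by nlinarith : h ^ 2 * K.avg e ^ 2 ≤ h ^ 2 * (κ ^ 2 * B)) hh2
  have second : ∀ f : ℝ × ℝ → ℝ, h ^ 2 * K.avg f ^ 2 ≤ κ ^ 2 * K.sq f → h ^ 2 * K.sq f ≤ B →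
      h ^ 4 * K.avg f ^ 2 ≤ κ ^ 2 * B := by
    intro f h1 h2
    have e1 := mul_le_mul_of_nonneg_left h1 hh2.le
    have e2 := mul_le_mul_of_nonneg_left h2 hκ2
    nlinarith
  have t3 := second _ m3 hB.s20
  have t4 := second _ m4 hB.s11
  have t5 := second _ m5 hB.s02
  have lenp : ∀ (a l : ℝ), 0 ≤ l → l ≤ κ * h → h ^ 4 * a ^ 2 ≤ κ ^ 2 * B →
      (a * l ^ 2) ^ 2 ≤ κ ^ 6 * B := by
    intro a l hl0 hl ha
    have e1 : l ^ 4 ≤ (κ * h) ^ 4 := pow_le_pow_left₀ hl0 hl 4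
    have e2 := mul_le_mul_of_nonneg_right e1 (sq_nonneg a)
    have e3 := mul_le_mul_of_nonneg_left ha (by positivity : 0 ≤ κ ^ 4)
    nlinarith
  have l3 := lenp _ _ K.len_pos.le hK.len_le t3
  have l5 := lenp _ _ K.hgt_pos.le hK.hgt_le t5
  refine ⟨?_, ?_, ?_, ?_, ?_, ?_⟩ <;> simp only [Rect.taylorCoef]
  · simp
    set p := K.avg e
    set q := K.avg (pdx (pdx e)) * K.len ^ 2
    set r := K.avg (pdy (pdy e)) * K.hgt ^ 2
    nlinarith [sq_nonneg (p + (q + r) / 24), sq_nonneg (q - r)]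
  · simp
    nlinarith [mul_le_mul_of_nonneg_left hB.s10 hκ2]
  · simp
    nlinarith [mul_le_mul_of_nonneg_left hB.s01 hκ2]
  · simp
    nlinarith
  · simp
    nlinarith
  · simp
    nlinarith

/-- All derivatives of the error up to order two have mean zero, so the square integral of each is
bounded by its oscillation. For the second derivatives the oscillation is given; for the lower ones
it is bounded by the derivatives of the next order. -/
theorem taylor_small {K : Rect} (hh : 0 < h) (hκ : 1 ≤ κ) (hK : K.Sized h κ)
    {φ : ℝ × ℝ → ℝ} (hφ : ContDiff ℝ ∞ φ) {A : ℝ} (hA : OscBound K K φ A) :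
    Small K (φ - quad (K.taylor φ)) h (stepConst κ * A) := by
  set c := K.taylor φ with hc
  set e := φ - quad c with he
  have hq := Rect.contDiff_quad c
  have ce : ContDiff ℝ ∞ e := hφ.sub hq
  have cx := contDiff_pdx ce
  have cy := contDiff_pdy ce
  -- The projection annihilates the error; solving the coefficients from the top degree down shows
  -- that every mean is zero.
  have ht : K.taylor e = 0 := by rw [he, K.taylor_sub hφ hq, K.taylor_quad, hc, sub_self]
  have hO := osc_sub_quad K K hφ c hA
  rw [← he] at hO
  have hcoef : K.avg e = 0 ∧ K.avg (pdx e) = 0 ∧ K.avg (pdy e) = 0 ∧ K.avg (pdx (pdx e)) = 0 ∧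
      K.avg (pdx (pdy e)) = 0 ∧ K.avg (pdy (pdy e)) = 0 := by
    have h0 := congrFun ht 0
    have h1 := congrFun ht 1
    have h2 := congrFun ht 2
    have h3 := congrFun ht 3
    have h4 := congrFun ht 4
    have h5 := congrFun ht 5
    simp [Rect.taylor, Rect.taylorCoef, centered] at h0 h1 h2 h3 h4 h5
    rw [h3, h4] at h1
    rw [h5, h4] at h2
    simp at h1 h2
    rw [h1, h2, h3, h4, h5] at h0
    simp at h0
    exact ⟨h0, h1, h2, h3, h4, h5⟩
  have mean0 : ∀ f : ℝ × ℝ → ℝ, Continuous f → K.avg f = 0 →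
      h ^ 2 * K.sq f ≤ κ ^ 2 * Rect.osc K K f := by
    intro f hf h0
    have hi : K.int f = 0 := by
      rw [Rect.avg, div_eq_zero_iff] at h0
      exact h0.resolve_right K.area_pos.ne'
    have h1 := Rect.osc_eq K K hf
    rw [hi] at h1
    have h2 := mul_le_mul_of_nonneg_right (hK.le_area hh hκ) (K.sq_nonneg f)
    have h3 := K.sq_nonneg f
    have h4 : 0 ≤ κ ^ 2 * (K.area * K.sq f) := by have := K.area_pos; positivity
    rw [h1]
    linarith
  obtain ⟨z0, z1, z2, z3, z4, z5⟩ := hcoef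
  have hκ2 : 0 ≤ κ ^ 2 := by positivity
  have hA0 : 0 ≤ A := (Rect.osc_nonneg _ _ _).trans hA.o20
  have hh2 : 0 < h ^ 2 := by positivity
  have d20 := (mean0 _ (contDiff_pdx cx).continuous z3).trans (mul_le_mul_of_nonneg_left hO.o20 hκ2)
  have d11 := (mean0 _ (contDiff_pdx cy).continuous z4).trans (mul_le_mul_of_nonneg_left hO.o11 hκ2)
  have d02 := (mean0 _ (contDiff_pdy cy).continuous z5).trans (mul_le_mul_of_nonneg_left hO.o02 hκ2)
  have hJ : Rect.Joined K K (κ * h) := K.joined_self hK.size_le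
  have D1 : ∀ f : ℝ × ℝ → ℝ, ContDiff ℝ ∞ f → K.avg f = 0 → h ^ 2 * K.sq (pdx f) ≤ κ ^ 2 * A →
      h ^ 2 * K.sq (pdy f) ≤ κ ^ 2 * A → K.sq f ≤ 512 * κ ^ 8 * A := by
    intro f hf h0 h1 h2
    have e0 := Rect.osc_le_of_joined hJ hf
    have e1 := mean0 f hf.continuous h0
    have e3 := mul_le_mul_of_nonneg_left (add_le_add h1 h2)
      (by positivity : 0 ≤ 256 * κ ^ 6 * h ^ 2)
    have e4 := mul_le_mul_of_nonneg_left e0 hκ2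
    refine le_of_mul_le_mul_left (?_ : h ^ 2 * K.sq f ≤ h ^ 2 * (512 * κ ^ 8 * A)) hh2
    nlinarith
  have d10 := D1 _ cx z1 d20 (by rw [← pdx_pdy_comm ce]; exact d11)
  have d01 := D1 _ cy z2 d11 d02
  have d00 : K.sq e ≤ 262144 * κ ^ 14 * A * h ^ 2 := by
    have e0 := Rect.osc_le_of_joined hJ ce
    have e1 := mean0 e ce.continuous z0
    have e3 := mul_le_mul_of_nonneg_left (add_le_add d10 d01)
      (by positivity : 0 ≤ 256 * κ ^ 6 * h ^ 4)
    have e4 := mul_le_mul_of_nonneg_left e0 hκ2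
    refine le_of_mul_le_mul_left (?_ : h ^ 2 * K.sq e ≤ h ^ 2 * (262144 * κ ^ 14 * A * h ^ 2)) hh2
    nlinarith
  have p16 : (1 : ℝ) ≤ κ ^ 16 := one_le_pow₀ hκ
  have q2 : κ ^ 2 ≤ κ ^ 16 := pow_le_pow_right₀ hκ (by norm_num)
  have q8 : κ ^ 8 ≤ κ ^ 16 := pow_le_pow_right₀ hκ (by norm_num)
  have q14 : κ ^ 14 ≤ κ ^ 16 := pow_le_pow_right₀ hκ (by norm_num)
  have k1 : κ ^ 2 * A ≤ stepConst κ * A :=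
    mul_le_mul_of_nonneg_right (by unfold stepConst; linarith) hA0
  have k2 : 512 * κ ^ 8 * A ≤ stepConst κ * A :=
    mul_le_mul_of_nonneg_right (by unfold stepConst; linarith) hA0
  have k3 : 262144 * κ ^ 14 * A * h ^ 2 ≤ stepConst κ * A * h ^ 2 :=
    mul_le_mul_of_nonneg_right (mul_le_mul_of_nonneg_right (by unfold stepConst; linarith) hA0)
      hh2.le
  exact ⟨d00.trans k3, d10.trans k2, d01.trans k2, d20.trans k1, d11.trans k1, d02.trans k1⟩

/-! ### Approximation next to a wall -/

/-- Coefficients of `a (x - l)² / 2`. -/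
noncomputable def wallX (a l : ℝ) : Fin 6 → ℝ := ![a / 2 * l ^ 2, -(a * l), 0, a / 2, 0, 0]

/-- Coefficients of `a (y - l)² / 2`. -/
noncomputable def wallY (a l : ℝ) : Fin 6 → ℝ := ![a / 2 * l ^ 2, 0, -(a * l), 0, 0, a / 2]

/-- The profile `a (x - l)² / 2` vanishes with its gradient on the wall, hence so does the error
`e`. The bounds are obtained in the order `∂ₓₓ` (mean zero), `∂ₓ` and `e` (Friedrichs from the
wall), `∂ₓ∂ᵧ` (`sq_pdy_le` applied to `∂ₓ e`), `∂ᵧ` (Friedrichs), `∂ᵧᵧ` (`sq_pdy_le` applied to `∂ᵧ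
e`). -/
theorem small_of_wallX {K : Rect} (hh : 0 < h) (hκ : 1 ≤ κ) (hK : K.Sized h κ)
    {φ : ℝ × ℝ → ℝ} (hφ : ContDiff ℝ ∞ φ) {l : ℝ} (hl : l ∈ Icc K.x₀ K.x₁)
    (h0 : ∀ y ∈ Icc K.y₀ K.y₁, φ (l, y) = 0 ∧ pdx φ (l, y) = 0 ∧ pdy φ (l, y) = 0)
    {A : ℝ} (hA : OscBound K K φ A) :
    ∃ a, Small K (φ - quad (wallX a l)) h (stepConst κ * A) := by
  -- With this choice `∂ₓₓ` of the error has mean zero.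
  set a := K.avg (pdx (pdx φ)) with ha
  refine ⟨a, ?_⟩
  set c := wallX a l with hc
  set e := φ - quad c with he
  have hq := Rect.contDiff_quad c
  have ce : ContDiff ℝ ∞ e := hφ.sub hq
  have cx := contDiff_pdx ce
  have cy := contDiff_pdy ce
  have cxx := contDiff_pdx (contDiff_pdx hφ)
  have hO := osc_sub_quad K K hφ c hA
  rw [← he] at hO
  have hA0 : 0 ≤ A := (Rect.osc_nonneg _ _ _).trans hA.o20
  have hh2 : 0 < h ^ 2 := by positivity
  have hκ2 : 0 ≤ κ ^ 2 := by positivity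
  have ex : pdx e = pdx φ - quad (coefDx c) := by rw [he, pdx_sub hφ hq, pdx_quad]
  have ey : pdy e = pdy φ - quad (coefDy c) := by rw [he, pdy_sub hφ hq, pdy_quad]
  have exx : pdx (pdx e) = fun z => pdx (pdx φ) z - K.int (pdx (pdx φ)) / K.area := by
    rw [ex, pdx_sub (contDiff_pdx hφ) (Rect.contDiff_quad _), pdx_quad]
    funext z
    simp [quad, coefDx, hc, wallX, ha, Rect.avg]
    ring
  have w0 : ∀ y ∈ Icc K.y₀ K.y₁, e (l, y) = 0 := fun y hy => by
    rw [he, Pi.sub_apply, (h0 y hy).1]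
    simp [quad, hc, wallX]
    ring
  have w1 : ∀ y ∈ Icc K.y₀ K.y₁, pdx e (l, y) = 0 := fun y hy => by
    rw [ex, Pi.sub_apply, (h0 y hy).2.1]
    simp [quad, coefDx, hc, wallX]
    ring
  have w2 : ∀ y ∈ Icc K.y₀ K.y₁, pdy e (l, y) = 0 := fun y hy => by
    rw [ey, Pi.sub_apply, (h0 y hy).2.2]
    simp [quad, coefDy, hc, wallX]
  have hlen : K.len ^ 2 ≤ κ ^ 2 * h ^ 2 := by
    rw [← mul_pow]
    exact pow_le_pow_left₀ K.len_pos.le hK.len_le 2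
  have hwall : ∀ f : ℝ × ℝ → ℝ, ContDiff ℝ ∞ f → (∀ y ∈ Icc K.y₀ K.y₁, f (l, y) = 0) →
      K.sq f ≤ κ ^ 2 * (h ^ 2 * K.sq (pdx f)) := by
    intro f hf hz
    refine (K.sq_le_of_wall hf hl hz).trans ?_
    have := mul_le_mul_of_nonneg_right hlen (K.sq_nonneg (pdx f))
    linarith
  have hibp : ∀ f : ℝ × ℝ → ℝ, ContDiff ℝ ∞ f → Rect.osc K K (pdy f) ≤ A →
      h ^ 2 * K.sq (pdy f) ≤ κ ^ 2 * (72 * K.sq f + 3 * A) := by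
    intro f hf hoA
    have h1 := K.sq_pdy_le hf
    have h2 := hK.le_area hh hκ
    have hH : h ^ 2 ≤ κ ^ 2 * K.hgt ^ 2 := by
      rw [← mul_pow]
      exact pow_le_pow_left₀ hh.le hK.le_hgt 2
    have e1 : h ^ 2 * (72 * K.sq f / K.hgt ^ 2) ≤ κ ^ 2 * (72 * K.sq f) := by
      rw [← mul_div_assoc, div_le_iff₀ (pow_pos K.hgt_pos 2)]
      have := mul_le_mul_of_nonneg_right hH (K.sq_nonneg f)
      linarith
    have e2 : h ^ 2 * (3 * Rect.osc K K (pdy f) / K.area) ≤ κ ^ 2 * (3 * A) := by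
      rw [← mul_div_assoc, div_le_iff₀ K.area_pos]
      have t1 := mul_le_mul_of_nonneg_right h2 hA0
      have t2 := mul_le_mul_of_nonneg_left hoA hh2.le
      linarith
    have := mul_le_mul_of_nonneg_left h1 hh2.le
    linarith
  have d20 : h ^ 2 * K.sq (pdx (pdx e)) ≤ κ ^ 2 * A := by
    have h1 := K.area_mul_sq_sub_const cxx.continuous
    rw [← exx] at h1
    have h2 := mul_le_mul_of_nonneg_right (hK.le_area hh hκ) (K.sq_nonneg (pdx (pdx e)))
    have h3 := mul_le_mul_of_nonneg_left hA.o20 hκ2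
    have h4 : 0 ≤ κ ^ 2 * (K.area * K.sq (pdx (pdx e))) := by
      have := K.area_pos
      have := K.sq_nonneg (pdx (pdx e))
      positivity
    rw [← h1] at h3
    linarith
  have q : ∀ m n : ℕ, m ≤ n → κ ^ m ≤ κ ^ n := fun m n hmn => pow_le_pow_right₀ hκ hmn
  have qA : ∀ m n : ℕ, m ≤ n → κ ^ m * A ≤ κ ^ n * A := fun m n hmn =>
    mul_le_mul_of_nonneg_right (q m n hmn) hA0
  have d10 : K.sq (pdx e) ≤ κ ^ 4 * A := by
    have := mul_le_mul_of_nonneg_left d20 hκ2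
    have h1 := hwall _ cx w1
    linarith [show κ ^ 2 * (κ ^ 2 * A) = κ ^ 4 * A by ring]
  have d00 : K.sq e ≤ κ ^ 6 * A * h ^ 2 := by
    have h1 := hwall _ ce w0
    have h2 := mul_le_mul_of_nonneg_left d10 (by positivity : 0 ≤ κ ^ 2 * h ^ 2)
    linarith [show κ ^ 2 * h ^ 2 * (κ ^ 4 * A) = κ ^ 6 * A * h ^ 2 by ring]
  have d11 : h ^ 2 * K.sq (pdx (pdy e)) ≤ 75 * κ ^ 6 * A := by
    rw [pdx_pdy_comm ce]
    have h1 := hibp _ cx (by rw [← pdx_pdy_comm ce]; exact hO.o11)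
    have h2 := mul_le_mul_of_nonneg_left d10 (by positivity : 0 ≤ 72 * κ ^ 2)
    linarith [show 72 * κ ^ 2 * (κ ^ 4 * A) = 72 * (κ ^ 6 * A) by ring, qA 2 6 (by norm_num)]
  have d01 : K.sq (pdy e) ≤ 75 * κ ^ 8 * A := by
    have h1 := hwall _ cy w2
    have h2 := mul_le_mul_of_nonneg_left d11 hκ2
    linarith [show κ ^ 2 * (75 * κ ^ 6 * A) = 75 * κ ^ 8 * A by ring]
  have d02 : h ^ 2 * K.sq (pdy (pdy e)) ≤ 5403 * κ ^ 10 * A := by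
    have h1 := hibp _ cy hO.o02
    have h2 := mul_le_mul_of_nonneg_left d01 (by positivity : 0 ≤ 72 * κ ^ 2)
    linarith [show 72 * κ ^ 2 * (75 * κ ^ 8 * A) = 5400 * (κ ^ 10 * A) by ring,
      qA 2 10 (by norm_num)]
  have k : ∀ (C : ℝ) (m : ℕ), 0 ≤ C → C ≤ 10 ^ 9 → m ≤ 16 → C * κ ^ m * A ≤ stepConst κ * A := by
    intro C m hC0 hC hm
    refine mul_le_mul_of_nonneg_right (mul_le_mul hC (q m 16 hm) (by positivity) (by norm_num)) hA0
  have k2 := k 1 2 (by norm_num) (by norm_num) (by norm_num)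
  have k4 := k 1 4 (by norm_num) (by norm_num) (by norm_num)
  have k6 := k 1 6 (by norm_num) (by norm_num) (by norm_num)
  rw [one_mul] at k2 k4 k6
  exact ⟨d00.trans (mul_le_mul_of_nonneg_right k6 hh2.le), d10.trans k4,
    d01.trans (k 75 8 (by norm_num) (by norm_num) (by norm_num)), d20.trans k2,
    d11.trans (k 75 6 (by norm_num) (by norm_num) (by norm_num)),
    d02.trans (k 5403 10 (by norm_num) (by norm_num) (by norm_num))⟩

theorem small_of_wallY {K : Rect} (hh : 0 < h) (hκ : 1 ≤ κ) (hK : K.Sized h κ)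
    {φ : ℝ × ℝ → ℝ} (hφ : ContDiff ℝ ∞ φ) {l : ℝ} (hl : l ∈ Icc K.y₀ K.y₁)
    (h0 : ∀ x ∈ Icc K.x₀ K.x₁, φ (x, l) = 0 ∧ pdx φ (x, l) = 0 ∧ pdy φ (x, l) = 0)
    {A : ℝ} (hA : OscBound K K φ A) :
    ∃ a, Small K (φ - quad (wallY a l)) h (stepConst κ * A) := by
  obtain ⟨a, ha⟩ := small_of_wallX (l := l) hh hκ hK.swap (contDiff_swap hφ) hl (fun y hy => by
    rw [pdx_swap hφ, pdy_swap hφ]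
    exact ⟨(h0 y hy).1, (h0 y hy).2.2, (h0 y hy).2.1⟩) (hA.swap hφ)
  refine ⟨a, Small.of_swap (hφ.sub (Rect.contDiff_quad _)) ?_⟩
  have e : (φ - quad (wallY a l)) ∘ Prod.swap = φ ∘ Prod.swap - quad (wallX a l) := by
    funext z
    simp [quad, wallX, wallY]
  exact e ▸ ha

end

/-! ### Uniqueness of the basis functions -/

/-- For a quadratic in `x` the average of the end slopes is the difference quotient, and the
increment in `x` of a quadratic is affine in `y`, so its mean is the average of its end values. This
relation between edge means and vertex values couples the cells of a row. -/
theorem Rect.mean_left_add_right (K : Rect) (c : Fin 6 → ℝ) :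
    K.normalMean (quad c) .left + K.normalMean (quad c) .right =
      (quad c (K.x₁, K.y₀) + quad c (K.x₁, K.y₁) - quad c (K.x₀, K.y₀) - quad c (K.x₀, K.y₁)) /
        K.len := by
  have hL := K.len_pos.ne'
  have e1 : K.normalMean (quad c) .left = _ := mean_deriv_fst c K.x₀ K.hy
  have e2 : K.normalMean (quad c) .right = _ := mean_deriv_fst c K.x₁ K.hy
  rw [e1, e2, eq_div_iff hL]
  simp only [quad, len]
  ring

theorem Rect.mean_bottom_add_top (K : Rect) (c : Fin 6 → ℝ) :
    K.normalMean (quad c) .bottom + K.normalMean (quad c) .top =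
      (quad c (K.x₀, K.y₁) + quad c (K.x₁, K.y₁) - quad c (K.x₀, K.y₀) - quad c (K.x₁, K.y₀)) /
        K.hgt := by
  have hL := K.hgt_pos.ne'
  have e1 : K.normalMean (quad c) .bottom = _ := mean_deriv_snd c K.y₀ K.hx
  have e2 : K.normalMean (quad c) .top = _ := mean_deriv_snd c K.y₁ K.hx
  rw [e1, e2, eq_div_iff hL]
  simp only [quad, hgt]
  ring

/-- The vertex values and two mean normal derivatives determine a quadratic polynomial. -/
theorem Rect.coef_unique (K : Rect) {c d : Fin 6 → ℝ}
    (h00 : quad c (K.x₀, K.y₀) = quad d (K.x₀, K.y₀))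
    (h10 : quad c (K.x₁, K.y₀) = quad d (K.x₁, K.y₀))
    (h01 : quad c (K.x₀, K.y₁) = quad d (K.x₀, K.y₁))
    (h11 : quad c (K.x₁, K.y₁) = quad d (K.x₁, K.y₁))
    (hl : K.normalMean (quad c) .left = K.normalMean (quad d) .left)
    (hb : K.normalMean (quad c) .bottom = K.normalMean (quad d) .bottom) : c = d := by
  have hL : K.x₁ - K.x₀ ≠ 0 := K.len_pos.ne'
  have hH : K.y₁ - K.y₀ ≠ 0 := K.hgt_pos.ne'
  have e1 : ∀ c, K.normalMean (quad c) .left = _ := fun c => mean_deriv_fst c K.x₀ K.hy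
  have e2 : ∀ c, K.normalMean (quad c) .bottom = _ := fun c => mean_deriv_snd c K.y₀ K.hx
  rw [e1, e1] at hl
  rw [e2, e2] at hb
  simp only [quad] at h00 h10 h01 h11
  have k4 : c 4 = d 4 := by
    have : (c 4 - d 4) * ((K.x₁ - K.x₀) * (K.y₁ - K.y₀)) = 0 := by
      linear_combination h11 - h10 - h01 + h00
    have := (mul_eq_zero.1 this).resolve_right (mul_ne_zero hL hH)
    linarith
  have k3 : c 3 = d 3 := by
    have : (c 3 - d 3) * ((K.x₁ - K.x₀) * (K.x₁ - K.x₀)) = 0 := by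
      rw [k4] at hl h10 h00
      linear_combination h10 - h00 - (K.x₁ - K.x₀) * hl
    have := (mul_eq_zero.1 this).resolve_right (mul_ne_zero hL hL)
    linarith
  have k5 : c 5 = d 5 := by
    have : (c 5 - d 5) * ((K.y₁ - K.y₀) * (K.y₁ - K.y₀)) = 0 := by
      rw [k4] at hb h01 h00
      linear_combination h01 - h00 - (K.y₁ - K.y₀) * hb
    have := (mul_eq_zero.1 this).resolve_right (mul_ne_zero hH hH)
    linarith
  have k1 : c 1 = d 1 := by rw [k3, k4] at hl; linarith
  have k2 : c 2 = d 2 := by rw [k5, k4] at hb; linarith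
  have k0 : c 0 = d 0 := by rw [k1, k2, k3, k4, k5] at h00; linarith
  funext i
  fin_cases i <;> assumption

namespace Patch

theorem mem_frontier (p : Patch) {z : ℝ × ℝ} (h1 : z ∈ Icc (p.X 0) (p.X 3) ×ˢ Icc (p.Y 0) (p.Y 3))
    (h2 : z ∉ Ioo (p.X 0) (p.X 3) ×ˢ Ioo (p.Y 0) (p.Y 3)) : z ∈ frontier (domain p.cells) := by
  have ho : IsOpen (domain p.cells) := isOpen_interior
  rw [ho.frontier_eq, domain_cells, closure_prod_eq, closure_Ioo (p.hX (by decide)).ne,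
    closure_Ioo (p.hY (by decide)).ne]
  exact ⟨h1, h2⟩

theorem knot_mem {t : Fin 4 → ℝ} (ht : StrictMono t) (u : Fin 4) : t u ∈ Icc (t 0) (t 3) :=
  ⟨ht.monotone (Fin.zero_le u), ht.monotone (Fin.le_last u)⟩

theorem knot_not_mem {t : Fin 4 → ℝ} {u : Fin 4} (hu : u = 0 ∨ u = 3) :
    t u ∉ Ioo (t 0) (t 3) := by
  rcases hu with rfl | rfl
  · exact fun h => lt_irrefl _ h.1
  · exact fun h => lt_irrefl _ h.2

theorem vertex_mem (p : Patch) (i j : Fin 3) {u v : Fin 4} (hu : u = i.castSucc ∨ u = i.succ)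
    (hv : v = j.castSucc ∨ v = j.succ) : (p.X u, p.Y v) ∈ (p.cell i j).vertices := by
  simp only [Rect.vertices, cell, mem_insert_iff, mem_singleton_iff]
  rcases hu with rfl | rfl <;> rcases hv with rfl | rfl <;> simp

theorem spline_ratio {l0 l1 l2 a b : ℝ} (h0 : 0 < l0) (h1 : 0 < l1) (h2 : 0 < l2)
    (h : a / l0 - b / l2 = (b - a) / l1) : b * (l0 * (l1 + l2)) = a * (l2 * (l0 + l1)) := by
  field_simp at h
  linear_combination -h

/-- A function in the reduced Morley space of a patch is determined by one vertex value. -/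
theorem rep_eq_coef (p : Patch) {φ : ℝ × ℝ → ℝ} {c : Rect → Fin 6 → ℝ}
    (hc : IsRRMZeroRep p.cells φ c)
    (hv : quad (c (p.cell 1 1)) (p.X 1, p.Y 1) =
      p.L 0 / (p.L 0 + p.L 1) * (p.H 0 / (p.H 0 + p.H 1))) (i j : Fin 3) :
    c (p.cell i j) = p.coef i j := by
  have hmem : ∀ i j, p.cell i j ∈ p.cells := fun i j => ⟨i, j, rfl⟩
  have hL : ∀ i, 0 < p.L i := fun i => sub_pos.2 (p.hX Fin.castSucc_lt_succ)
  have hH : ∀ i, 0 < p.H i := fun i => sub_pos.2 (p.hY Fin.castSucc_lt_succ)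
  -- vertex values
  have vz : ∀ i j u v, (u = Fin.castSucc i ∨ u = Fin.succ i) → (v = Fin.castSucc j ∨ v = Fin.succ j) →
      ((u = 0 ∨ u = 3) ∨ (v = 0 ∨ v = 3)) → quad (c (p.cell i j)) (p.X u, p.Y v) = 0 := by
    intro i j u v hu hv' h
    refine hc.boundary_vertex _ (hmem i j) _ (p.vertex_mem i j hu hv') ?_
    refine p.mem_frontier ⟨knot_mem p.hX u, knot_mem p.hY v⟩ fun hz => ?_
    rcases h with h | h
    · exact knot_not_mem h hz.1
    · exact knot_not_mem h hz.2
  have vc : ∀ i j i' j' u v, (u = Fin.castSucc i ∨ u = Fin.succ i) →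
      (v = Fin.castSucc j ∨ v = Fin.succ j) → (u = Fin.castSucc i' ∨ u = Fin.succ i') →
      (v = Fin.castSucc j' ∨ v = Fin.succ j') → u ≠ 0 → u ≠ 3 → v ≠ 0 → v ≠ 3 →
      quad (c (p.cell i j)) (p.X u, p.Y v) = quad (c (p.cell i' j')) (p.X u, p.Y v) := by
    intro i j i' j' u v h1 h2 h3 h4 h5 h6 h7 h8
    refine hc.vertex _ (hmem i j) _ (hmem i' j') _ (p.vertex_mem i j h1 h2)
      (p.vertex_mem i' j' h3 h4) ?_
    rw [domain_cells]
    exact ⟨inner_knot p.hX u h5 h6, inner_knot p.hY v h7 h8⟩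
  -- mean normal derivatives
  have el : ∀ j, (p.cell 0 j).normalMean (quad (c (p.cell 0 j))) .left = 0 := fun j =>
    hc.boundary_edge _ (hmem 0 j) _ fun z hz => by
      obtain ⟨h1, h2⟩ := hz
      have h1' : z.1 = p.X 0 := h1
      refine p.mem_frontier ⟨by rw [h1']; exact knot_mem p.hX 0, ?_⟩ fun h => ?_
      · exact ⟨(knot_mem p.hY _).1.trans h2.1, h2.2.trans (knot_mem p.hY _).2⟩
      · rw [mem_prod, h1'] at h
        exact lt_irrefl _ h.1.1
  have er : ∀ j, (p.cell 2 j).normalMean (quad (c (p.cell 2 j))) .right = 0 := fun j =>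
    hc.boundary_edge _ (hmem 2 j) _ fun z hz => by
      obtain ⟨h1, h2⟩ := hz
      have h1' : z.1 = p.X 3 := h1
      refine p.mem_frontier ⟨by rw [h1']; exact knot_mem p.hX 3, ?_⟩ fun h => ?_
      · exact ⟨(knot_mem p.hY _).1.trans h2.1, h2.2.trans (knot_mem p.hY _).2⟩
      · rw [mem_prod, h1'] at h
        exact lt_irrefl _ h.1.2
  have eb : ∀ i, (p.cell i 0).normalMean (quad (c (p.cell i 0))) .bottom = 0 := fun i =>
    hc.boundary_edge _ (hmem i 0) _ fun z hz => by
      obtain ⟨h2, h1⟩ := hz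
      have h1' : z.2 = p.Y 0 := h1
      refine p.mem_frontier ⟨?_, by rw [h1']; exact knot_mem p.hY 0⟩ fun h => ?_
      · exact ⟨(knot_mem p.hX _).1.trans h2.1, h2.2.trans (knot_mem p.hX _).2⟩
      · rw [mem_prod, h1'] at h
        exact lt_irrefl _ h.2.1
  have et : ∀ i, (p.cell i 2).normalMean (quad (c (p.cell i 2))) .top = 0 := fun i =>
    hc.boundary_edge _ (hmem i 2) _ fun z hz => by
      obtain ⟨h2, h1⟩ := hz
      have h1' : z.2 = p.Y 3 := h1
      refine p.mem_frontier ⟨?_, by rw [h1']; exact knot_mem p.hY 3⟩ fun h => ?_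
      · exact ⟨(knot_mem p.hX _).1.trans h2.1, h2.2.trans (knot_mem p.hX _).2⟩
      · rw [mem_prod, h1'] at h
        exact lt_irrefl _ h.2.2
  have e01 : ∀ j, (p.cell 0 j).normalMean (quad (c (p.cell 0 j))) .right =
      (p.cell 1 j).normalMean (quad (c (p.cell 1 j))) .left := fun j =>
    hc.edge _ (hmem _ _) _ (hmem _ _) _ _ rfl
  have e12 : ∀ j, (p.cell 1 j).normalMean (quad (c (p.cell 1 j))) .right =
      (p.cell 2 j).normalMean (quad (c (p.cell 2 j))) .left := fun j =>
    hc.edge _ (hmem _ _) _ (hmem _ _) _ _ rfl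
  have f01 : ∀ i, (p.cell i 0).normalMean (quad (c (p.cell i 0))) .top =
      (p.cell i 1).normalMean (quad (c (p.cell i 1))) .bottom := fun i =>
    hc.edge _ (hmem _ _) _ (hmem _ _) _ _ rfl
  have f12 : ∀ i, (p.cell i 1).normalMean (quad (c (p.cell i 1))) .top =
      (p.cell i 2).normalMean (quad (c (p.cell i 2))) .bottom := fun i =>
    hc.edge _ (hmem _ _) _ (hmem _ _) _ _ rfl
  have sx : ∀ i j, (p.cell i j).normalMean (quad (c (p.cell i j))) .left +
      (p.cell i j).normalMean (quad (c (p.cell i j))) .right =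
      (quad (c (p.cell i j)) (p.X i.succ, p.Y j.castSucc) +
        quad (c (p.cell i j)) (p.X i.succ, p.Y j.succ) -
        quad (c (p.cell i j)) (p.X i.castSucc, p.Y j.castSucc) -
        quad (c (p.cell i j)) (p.X i.castSucc, p.Y j.succ)) / p.L i := fun i j =>
    (p.cell i j).mean_left_add_right _
  have sy : ∀ i j, (p.cell i j).normalMean (quad (c (p.cell i j))) .bottom +
      (p.cell i j).normalMean (quad (c (p.cell i j))) .top =
      (quad (c (p.cell i j)) (p.X i.castSucc, p.Y j.succ) +
        quad (c (p.cell i j)) (p.X i.succ, p.Y j.succ) -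
        quad (c (p.cell i j)) (p.X i.castSucc, p.Y j.castSucc) -
        quad (c (p.cell i j)) (p.X i.succ, p.Y j.castSucc)) / p.H j := fun i j =>
    (p.cell i j).mean_bottom_add_top _
  -- the four inner vertex values
  set A := quad (c (p.cell 1 1)) (p.X 1, p.Y 1) with hA
  set B := quad (c (p.cell 1 1)) (p.X 2, p.Y 1) with hB
  set C := quad (c (p.cell 1 1)) (p.X 1, p.Y 2) with hC
  set D := quad (c (p.cell 1 1)) (p.X 2, p.Y 2) with hD
  have vA : ∀ i j, ((1 : Fin 4) = Fin.castSucc i ∨ (1 : Fin 4) = Fin.succ i) →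
      ((1 : Fin 4) = Fin.castSucc j ∨ (1 : Fin 4) = Fin.succ j) →
      quad (c (p.cell i j)) (p.X 1, p.Y 1) = A := fun i j h h' =>
    vc i j 1 1 1 1 h h' (by decide) (by decide) (by decide) (by decide) (by decide) (by decide)
  have vB : ∀ i j, ((2 : Fin 4) = Fin.castSucc i ∨ (2 : Fin 4) = Fin.succ i) →
      ((1 : Fin 4) = Fin.castSucc j ∨ (1 : Fin 4) = Fin.succ j) →
      quad (c (p.cell i j)) (p.X 2, p.Y 1) = B := fun i j h h' =>
    vc i j 1 1 2 1 h h' (by decide) (by decide) (by decide) (by decide) (by decide) (by decide)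
  have vC : ∀ i j, ((1 : Fin 4) = Fin.castSucc i ∨ (1 : Fin 4) = Fin.succ i) →
      ((2 : Fin 4) = Fin.castSucc j ∨ (2 : Fin 4) = Fin.succ j) →
      quad (c (p.cell i j)) (p.X 1, p.Y 2) = C := fun i j h h' =>
    vc i j 1 1 1 2 h h' (by decide) (by decide) (by decide) (by decide) (by decide) (by decide)
  have vD : ∀ i j, ((2 : Fin 4) = Fin.castSucc i ∨ (2 : Fin 4) = Fin.succ i) →
      ((2 : Fin 4) = Fin.castSucc j ∨ (2 : Fin 4) = Fin.succ j) →
      quad (c (p.cell i j)) (p.X 2, p.Y 2) = D := fun i j h h' =>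
    vc i j 1 1 2 2 h h' (by decide) (by decide) (by decide) (by decide) (by decide) (by decide)
  -- Take the alternating sum of the relation over the three cells of the bottom row: the means on
  -- inner edges cancel, those on the outer edges vanish, and one equation between `A` and `B`
  -- remains.
  have rowAB : A / p.L 0 - B / p.L 2 = (B - A) / p.L 1 := by
    have r0 := sx 0 0
    have r1 := sx 1 0
    have r2 := sx 2 0
    rw [vz 0 0 _ _ (.inr rfl) (.inl rfl) (by decide), vz 0 0 _ _ (.inl rfl) (.inl rfl) (by decide),
      vz 0 0 _ _ (.inl rfl) (.inr rfl) (by decide), show quad (c (p.cell 0 0)) (p.X (Fin.succ 0), p.Y (Fin.succ 0)) = A from vA 0 0 (by decide) (by decide)] at r0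
    rw [vz 1 0 _ _ (.inr rfl) (.inl rfl) (by decide), vz 1 0 _ _ (.inl rfl) (.inl rfl) (by decide),
      show quad (c (p.cell 1 0)) (p.X (Fin.succ 1), p.Y (Fin.succ 0)) = B from vB 1 0 (by decide) (by decide),
      show quad (c (p.cell 1 0)) (p.X (Fin.castSucc 1), p.Y (Fin.succ 0)) = A from vA 1 0 (by decide) (by decide)] at r1
    rw [vz 2 0 _ _ (.inr rfl) (.inl rfl) (by decide), vz 2 0 _ _ (.inl rfl) (.inl rfl) (by decide),
      vz 2 0 _ _ (.inr rfl) (.inr rfl) (by decide), show quad (c (p.cell 2 0)) (p.X (Fin.castSucc 2), p.Y (Fin.succ 0)) = B from vB 2 0 (by decide) (by decide)] at r2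
    linear_combination -r0 + r1 - r2 + el 0 + e01 0 - e12 0 + er 0
  have rowCD : C / p.L 0 - D / p.L 2 = (D - C) / p.L 1 := by
    have r0 := sx 0 2
    have r1 := sx 1 2
    have r2 := sx 2 2
    rw [vz 0 2 _ _ (.inr rfl) (.inr rfl) (by decide), vz 0 2 _ _ (.inl rfl) (.inl rfl) (by decide),
      vz 0 2 _ _ (.inl rfl) (.inr rfl) (by decide), show quad (c (p.cell 0 2)) (p.X (Fin.succ 0), p.Y (Fin.castSucc 2)) = C from vC 0 2 (by decide) (by decide)] at r0
    rw [vz 1 2 _ _ (.inr rfl) (.inr rfl) (by decide), vz 1 2 _ _ (.inl rfl) (.inr rfl) (by decide),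
      show quad (c (p.cell 1 2)) (p.X (Fin.succ 1), p.Y (Fin.castSucc 2)) = D from vD 1 2 (by decide) (by decide),
      show quad (c (p.cell 1 2)) (p.X (Fin.castSucc 1), p.Y (Fin.castSucc 2)) = C from vC 1 2 (by decide) (by decide)] at r1
    rw [vz 2 2 _ _ (.inr rfl) (.inl rfl) (by decide), vz 2 2 _ _ (.inl rfl) (.inr rfl) (by decide),
      vz 2 2 _ _ (.inr rfl) (.inr rfl) (by decide), show quad (c (p.cell 2 2)) (p.X (Fin.castSucc 2), p.Y (Fin.castSucc 2)) = D from vD 2 2 (by decide) (by decide)] at r2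
    linear_combination -r0 + r1 - r2 + el 2 + e01 2 - e12 2 + er 2
  have colAC : A / p.H 0 - C / p.H 2 = (C - A) / p.H 1 := by
    have r0 := sy 0 0
    have r1 := sy 0 1
    have r2 := sy 0 2
    rw [vz 0 0 _ _ (.inr rfl) (.inl rfl) (by decide), vz 0 0 _ _ (.inl rfl) (.inl rfl) (by decide),
      vz 0 0 _ _ (.inl rfl) (.inr rfl) (by decide), show quad (c (p.cell 0 0)) (p.X (Fin.succ 0), p.Y (Fin.succ 0)) = A from vA 0 0 (by decide) (by decide)] at r0
    rw [vz 0 1 _ _ (.inl rfl) (.inr rfl) (by decide), vz 0 1 _ _ (.inl rfl) (.inl rfl) (by decide),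
      show quad (c (p.cell 0 1)) (p.X (Fin.succ 0), p.Y (Fin.succ 1)) = C from vC 0 1 (by decide) (by decide),
      show quad (c (p.cell 0 1)) (p.X (Fin.succ 0), p.Y (Fin.castSucc 1)) = A from vA 0 1 (by decide) (by decide)] at r1
    rw [vz 0 2 _ _ (.inl rfl) (.inr rfl) (by decide), vz 0 2 _ _ (.inl rfl) (.inl rfl) (by decide),
      vz 0 2 _ _ (.inr rfl) (.inr rfl) (by decide), show quad (c (p.cell 0 2)) (p.X (Fin.succ 0), p.Y (Fin.castSucc 2)) = C from vC 0 2 (by decide) (by decide)] at r2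
    linear_combination -r0 + r1 - r2 + eb 0 + f01 0 - f12 0 + et 0
  have hB' := spline_ratio (hL 0) (hL 1) (hL 2) rowAB
  have hD' := spline_ratio (hL 0) (hL 1) (hL 2) rowCD
  have hC' := spline_ratio (hH 0) (hH 1) (hH 2) colAC
  have l0 := hL 0
  have l1 := hL 1
  have l2 := hL 2
  have m0 := hH 0
  have m1 := hH 1
  have m2 := hH 2
  have nX1 : node p.X 1 = p.L 0 / (p.L 0 + p.L 1) := by simp [node, L]
  have nX2 : node p.X 2 = p.L 2 / (p.L 1 + p.L 2) := by simp [node, L]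
  have nY1 : node p.Y 1 = p.H 0 / (p.H 0 + p.H 1) := by simp [node, H]
  have nY2 : node p.Y 2 = p.H 2 / (p.H 1 + p.H 2) := by simp [node, H]
  have tA : A = node p.X 1 * node p.Y 1 := by rw [hv, nX1, nY1]
  have tB : B = node p.X 2 * node p.Y 1 := by
    refine mul_right_cancel₀ (mul_pos l0 (add_pos l1 l2)).ne' (hB'.trans ?_)
    rw [tA, nX1, nX2]
    field_simp
  have tC : C = node p.X 1 * node p.Y 2 := by
    refine mul_right_cancel₀ (mul_pos m0 (add_pos m1 m2)).ne' (hC'.trans ?_)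
    rw [tA, nY1, nY2]
    field_simp
  have tD : D = node p.X 2 * node p.Y 2 := by
    refine mul_right_cancel₀ (mul_pos l0 (add_pos l1 l2)).ne' (hD'.trans ?_)
    rw [tC, nX1, nX2]
    field_simp
  have vall : ∀ i j u v, (u = Fin.castSucc i ∨ u = Fin.succ i) →
      (v = Fin.castSucc j ∨ v = Fin.succ j) →
      quad (c (p.cell i j)) (p.X u, p.Y v) = quad (p.coef i j) (p.X u, p.Y v) := by
    intro i j u v hu hv'
    rw [p.quad_coef i j u v hu hv']
    by_cases hb : (u = 0 ∨ u = 3) ∨ (v = 0 ∨ v = 3)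
    · rw [vz i j u v hu hv' hb]
      rcases hb with (rfl | rfl) | (rfl | rfl) <;> simp [node]
    · have key : ∀ u : Fin 4, ¬(u = 0 ∨ u = 3) → u = 1 ∨ u = 2 := by decide
      have hu' := key u (not_or.1 hb).1
      have hv'' := key v (not_or.1 hb).2
      rcases hu' with rfl | rfl <;> rcases hv'' with rfl | rfl
      · rw [vA i j hu hv', tA]
      · rw [vC i j hu hv', tC]
      · rw [vB i j hu hv', tB]
      · rw [vD i j hu hv', tD]
  have sx' : ∀ i j, (p.cell i j).normalMean (quad (c (p.cell i j))) .left +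
      (p.cell i j).normalMean (quad (c (p.cell i j))) .right =
      (p.cell i j).normalMean (quad (p.coef i j)) .left +
      (p.cell i j).normalMean (quad (p.coef i j)) .right := fun i j => by
    rw [Rect.mean_left_add_right, Rect.mean_left_add_right]
    congr 1
    have a1 := vall i j _ _ (.inr rfl) (.inl rfl)
    have a2 := vall i j _ _ (.inr rfl) (.inr rfl)
    have a3 := vall i j _ _ (.inl rfl) (.inl rfl)
    have a4 := vall i j _ _ (.inl rfl) (.inr rfl)
    simp only [cell] at a1 a2 a3 a4 ⊢
    rw [a1, a2, a3, a4]
  have sy' : ∀ i j, (p.cell i j).normalMean (quad (c (p.cell i j))) .bottom +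
      (p.cell i j).normalMean (quad (c (p.cell i j))) .top =
      (p.cell i j).normalMean (quad (p.coef i j)) .bottom +
      (p.cell i j).normalMean (quad (p.coef i j)) .top := fun i j => by
    rw [Rect.mean_bottom_add_top, Rect.mean_bottom_add_top]
    congr 1
    have a1 := vall i j _ _ (.inr rfl) (.inl rfl)
    have a2 := vall i j _ _ (.inr rfl) (.inr rfl)
    have a3 := vall i j _ _ (.inl rfl) (.inl rfl)
    have a4 := vall i j _ _ (.inl rfl) (.inr rfl)
    simp only [cell] at a1 a2 a3 a4 ⊢
    rw [a1, a2, a3, a4]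
  -- The sum of the left and right means is known from the vertex values, and the outermost left
  -- mean is zero; so the means propagate through the row from left to right.
  have left : ∀ i j, (p.cell i j).normalMean (quad (c (p.cell i j))) .left =
      (p.cell i j).normalMean (quad (p.coef i j)) .left := by
    have g0 : ∀ j, (p.cell 0 j).normalMean (quad (c (p.cell 0 j))) .left =
        (p.cell 0 j).normalMean (quad (p.coef 0 j)) .left := fun j => by
      rw [el, p.mean_left]; simp [dnode]
    have g1 : ∀ j, (p.cell 1 j).normalMean (quad (c (p.cell 1 j))) .left =
        (p.cell 1 j).normalMean (quad (p.coef 1 j)) .left := fun j => by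
      have h1 := sx' 0 j
      rw [g0 j, e01 j, p.mean_right] at h1
      rw [p.mean_left]
      simpa using h1
    have g2 : ∀ j, (p.cell 2 j).normalMean (quad (c (p.cell 2 j))) .left =
        (p.cell 2 j).normalMean (quad (p.coef 2 j)) .left := fun j => by
      have h1 := sx' 1 j
      rw [g1 j, e12 j, p.mean_right] at h1
      rw [p.mean_left]
      simpa using h1
    intro i j
    fin_cases i
    · exact g0 j
    · exact g1 j
    · exact g2 j
  have bottom : ∀ i j, (p.cell i j).normalMean (quad (c (p.cell i j))) .bottom =
      (p.cell i j).normalMean (quad (p.coef i j)) .bottom := by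
    have g0 : ∀ i, (p.cell i 0).normalMean (quad (c (p.cell i 0))) .bottom =
        (p.cell i 0).normalMean (quad (p.coef i 0)) .bottom := fun i => by
      rw [eb, p.mean_bottom]; simp [dnode]
    have g1 : ∀ i, (p.cell i 1).normalMean (quad (c (p.cell i 1))) .bottom =
        (p.cell i 1).normalMean (quad (p.coef i 1)) .bottom := fun i => by
      have h1 := sy' i 0
      rw [g0 i, f01 i, p.mean_top] at h1
      rw [p.mean_bottom]
      simpa using h1
    have g2 : ∀ i, (p.cell i 2).normalMean (quad (c (p.cell i 2))) .bottom =
        (p.cell i 2).normalMean (quad (p.coef i 2)) .bottom := fun i => by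
      have h1 := sy' i 1
      rw [g1 i, f12 i, p.mean_top] at h1
      rw [p.mean_bottom]
      simpa using h1
    intro i j
    fin_cases j
    · exact g0 i
    · exact g1 i
    · exact g2 i
  exact (p.cell i j).coef_unique (vall i j _ _ (.inl rfl) (.inl rfl))
    (vall i j _ _ (.inr rfl) (.inl rfl)) (vall i j _ _ (.inl rfl) (.inr rfl))
    (vall i j _ _ (.inr rfl) (.inr rfl)) (left i j) (bottom i j)

end Patch

/-! ### Reproduction of quadratic polynomials -/

/-- Coefficients on `[x₀, x₁] × [y₀, y₁]` of the reduced Morley interpolant of the product of two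
quadratics, each given by its end values and half its second derivative. -/
noncomputable def tens (x₀ x₁ y₀ y₁ : ℝ) (f g : Fin 3 → ℝ) : Fin 6 → ℝ :=
  ![(f 0 - (f 1 - f 0) / (x₁ - x₀) * x₀) * (g 0 - (g 1 - g 0) / (y₁ - y₀) * y₀) +
      (g 0 + g 1) / 2 * f 2 * (x₀ * x₁) + (f 0 + f 1) / 2 * g 2 * (y₀ * y₁),
    (f 1 - f 0) / (x₁ - x₀) * (g 0 - (g 1 - g 0) / (y₁ - y₀) * y₀) -
      (g 0 + g 1) / 2 * f 2 * (x₀ + x₁),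
    (g 1 - g 0) / (y₁ - y₀) * (f 0 - (f 1 - f 0) / (x₁ - x₀) * x₀) -
      (f 0 + f 1) / 2 * g 2 * (y₀ + y₁),
    (g 0 + g 1) / 2 * f 2, (f 1 - f 0) / (x₁ - x₀) * ((g 1 - g 0) / (y₁ - y₀)),
    (f 0 + f 1) / 2 * g 2]

/-- The restrictions to the middle interval `[t 1, t 2]` of the three B-splines that do not vanish
there. -/
noncomputable def hat (t : Fin 4 → ℝ) : Fin 3 → Fin 3 → ℝ :=
  ![![(t 2 - t 1) / (t 2 - t 0), 0, 1 / ((t 2 - t 1) * (t 2 - t 0))],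
    ![(t 1 - t 0) / (t 2 - t 0), (t 3 - t 2) / (t 3 - t 1),
      -(1 / (t 2 - t 0) + 1 / (t 3 - t 1)) / (t 2 - t 1)],
    ![0, (t 2 - t 1) / (t 3 - t 1), 1 / ((t 2 - t 1) * (t 3 - t 1))]]

/-- The value on quadratic polynomials of the functional dual to the B-spline of the cell `K`. -/
noncomputable def blossom (K : Rect) (c : Fin 6 → ℝ) : ℝ :=
  c 0 + c 1 * ((K.x₀ + K.x₁) / 2) + c 2 * ((K.y₀ + K.y₁) / 2) + c 3 * (K.x₀ * K.x₁) +
    c 4 * ((K.x₀ + K.x₁) / 2 * ((K.y₀ + K.y₁) / 2)) + c 5 * (K.y₀ * K.y₁)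

theorem tens_sum (x₀ x₁ y₀ y₁ : ℝ) (f g : Fin 3 → Fin 3 → ℝ) (a b : Fin 3 → ℝ) (k : Fin 6) :
    ∑ i, ∑ j, a i * b j * tens x₀ x₁ y₀ y₁ (f i) (g j) k =
      tens x₀ x₁ y₀ y₁ (fun m => ∑ i, a i * f i m) (fun m => ∑ j, b j * g j m) k := by
  fin_cases k <;> simp only [Fin.sum_univ_three, tens, div_eq_mul_inv] <;> simp <;> ring

/-- This and the next two lemmas are Marsden's identity on the middle interval: with the polar forms
of `1`, `x` and `x²` at the two inner knots of each spline as coefficients, the splines sum to `1`,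
`x` and `x²`, described by end values and half the second derivative. -/
theorem hat_sum_one {t : Fin 4 → ℝ} (ht : StrictMono t) : (fun m => ∑ i, 1 * hat t i m) = ![1, 1, 0] := by
  have h1 : t 2 - t 1 ≠ 0 := (sub_pos.2 (ht (by decide))).ne'
  have h2 : t 2 - t 0 ≠ 0 := (sub_pos.2 (ht (by decide))).ne'
  have h3 : t 3 - t 1 ≠ 0 := (sub_pos.2 (ht (by decide))).ne'
  funext m
  fin_cases m <;> simp [Fin.sum_univ_three, hat] <;> field_simp <;> ring

theorem hat_sum_mid {t : Fin 4 → ℝ} (ht : StrictMono t) :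
    (fun m => ∑ i : Fin 3, (t i.castSucc + t i.succ) / 2 * hat t i m) = ![t 1, t 2, 0] := by
  have h1 : t 2 - t 1 ≠ 0 := (sub_pos.2 (ht (by decide))).ne'
  have h2 : t 2 - t 0 ≠ 0 := (sub_pos.2 (ht (by decide))).ne'
  have h3 : t 3 - t 1 ≠ 0 := (sub_pos.2 (ht (by decide))).ne'
  funext m
  fin_cases m <;> simp [Fin.sum_univ_three, hat] <;> field_simp <;> ring

theorem hat_sum_mul {t : Fin 4 → ℝ} (ht : StrictMono t) :
    (fun m => ∑ i : Fin 3, (t i.castSucc * t i.succ) * hat t i m) =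
      ![t 1 ^ 2, t 2 ^ 2, 1] := by
  have h1 : t 2 - t 1 ≠ 0 := (sub_pos.2 (ht (by decide))).ne'
  have h2 : t 2 - t 0 ≠ 0 := (sub_pos.2 (ht (by decide))).ne'
  have h3 : t 3 - t 1 ≠ 0 := (sub_pos.2 (ht (by decide))).ne'
  funext m
  fin_cases m <;> simp [Fin.sum_univ_three, hat] <;> field_simp <;> ring

namespace Patch

/-- Coefficients on the centre of the patch of the basis function belonging to the cell `i j`. -/
noncomputable def loc (P : Patch) (i j : Fin 3) : Fin 6 → ℝ :=
  tens (P.X 1) (P.X 2) (P.Y 1) (P.Y 2) (hat P.X i) (hat P.Y j)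

/-- The local basis functions reproduce quadratic polynomials. -/
theorem sum_blossom_loc (P : Patch) (c : Fin 6 → ℝ) (k : Fin 6) :
    ∑ i, ∑ j, blossom (P.cell i j) c * P.loc i j k = c k := by
  have hx : P.X 2 - P.X 1 ≠ 0 := (sub_pos.2 (P.hX (by decide))).ne'
  have hy : P.Y 2 - P.Y 1 ≠ 0 := (sub_pos.2 (P.hY (by decide))).ne'
  set T := tens (P.X 1) (P.X 2) (P.Y 1) (P.Y 2) with hT
  -- Every term of `blossom` is a product of a function of the column and a function of the row, so
  -- each double sum factors into one-dimensional Marsden identities.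
  have e : ∀ i j, blossom (P.cell i j) c * P.loc i j k =
      c 0 * (1 * 1 * T (hat P.X i) (hat P.Y j) k) +
      c 1 * ((P.X i.castSucc + P.X i.succ) / 2 * 1 * T (hat P.X i) (hat P.Y j) k) +
      c 2 * (1 * ((P.Y j.castSucc + P.Y j.succ) / 2) * T (hat P.X i) (hat P.Y j) k) +
      c 3 * ((P.X i.castSucc * P.X i.succ) * 1 * T (hat P.X i) (hat P.Y j) k) +
      c 4 * ((P.X i.castSucc + P.X i.succ) / 2 * ((P.Y j.castSucc + P.Y j.succ) / 2) *
        T (hat P.X i) (hat P.Y j) k) +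
      c 5 * (1 * (P.Y j.castSucc * P.Y j.succ) * T (hat P.X i) (hat P.Y j) k) := by
    intro i j
    simp only [blossom, loc, cell]
    ring
  have key : ∀ a b : Fin 3 → ℝ, ∑ i, ∑ j, a i * b j * T (hat P.X i) (hat P.Y j) k =
      T (fun m => ∑ i, a i * hat P.X i m) (fun m => ∑ j, b j * hat P.Y j m) k := fun a b =>
    tens_sum _ _ _ _ _ _ a b k
  have split : ∀ A₀ A₁ A₂ A₃ A₄ A₅ : Fin 3 → Fin 3 → ℝ,
      ∑ i, ∑ j, (c 0 * A₀ i j + c 1 * A₁ i j + c 2 * A₂ i j + c 3 * A₃ i j + c 4 * A₄ i j +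
        c 5 * A₅ i j) = c 0 * ∑ i, ∑ j, A₀ i j + c 1 * ∑ i, ∑ j, A₁ i j +
        c 2 * ∑ i, ∑ j, A₂ i j + c 3 * ∑ i, ∑ j, A₃ i j + c 4 * ∑ i, ∑ j, A₄ i j +
        c 5 * ∑ i, ∑ j, A₅ i j := by
    intros
    simp only [Finset.sum_add_distrib, Finset.mul_sum]
  simp only [e]
  rw [split, key (fun _ => 1) (fun _ => 1), key (fun i => (P.X i.castSucc + P.X i.succ) / 2) (fun _ => 1),
    key (fun _ => 1) (fun j => (P.Y j.castSucc + P.Y j.succ) / 2),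
    key (fun i => P.X i.castSucc * P.X i.succ) (fun _ => 1),
    key (fun i => (P.X i.castSucc + P.X i.succ) / 2) (fun j => (P.Y j.castSucc + P.Y j.succ) / 2),
    key (fun _ => 1) (fun j => P.Y j.castSucc * P.Y j.succ),
    hat_sum_one P.hX, hat_sum_one P.hY, hat_sum_mid P.hX, hat_sum_mid P.hY, hat_sum_mul P.hX,
    hat_sum_mul P.hY]
  fin_cases k <;> simp [hT, tens] <;> field_simp <;> ring

/-- The knots `t` and `s` agree where they overlap if `[t 1, t 2]` is the `i`-th interval of `s`. -/
def KnotMatch (t s : Fin 4 → ℝ) (i : Fin 3) : Prop :=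
  ∀ a b : Fin 4, (a : ℕ) + i = b + 1 → t a = s b

/-- The knots `t` are centred at the `i`-th interval of `s`. Seen from there, the middle interval of
`s` has position `2 - i`, which explains `Fin.rev`. -/
theorem hat_of_match {t s : Fin 4 → ℝ} {i : Fin 3} (h : KnotMatch t s i) :
    hat t i.rev = ![node s i.castSucc, node s i.succ, bend s i] := by
  fin_cases i
  · have h1 : t 1 = s 0 := h 1 0 rfl
    have h2 : t 2 = s 1 := h 2 1 rfl
    have h3 : t 3 = s 2 := h 3 2 rfl
    funext m
    fin_cases m <;> simp [hat, node, bend, h1, h2, h3, Fin.rev]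
  · have h0 : t 0 = s 0 := h 0 0 rfl
    have h1 : t 1 = s 1 := h 1 1 rfl
    have h2 : t 2 = s 2 := h 2 2 rfl
    have h3 : t 3 = s 3 := h 3 3 rfl
    funext m
    fin_cases m <;> simp [hat, node, bend, h0, h1, h2, h3, Fin.rev]
  · have h0 : t 0 = s 1 := h 0 1 rfl
    have h1 : t 1 = s 2 := h 1 2 rfl
    have h2 : t 2 = s 3 := h 2 3 rfl
    funext m
    fin_cases m <;> simp [hat, node, bend, h0, h1, h2, Fin.rev]

theorem match_mid {t s : Fin 4 → ℝ} {i : Fin 3} (h : KnotMatch t s i) :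
    t 1 = s i.castSucc ∧ t 2 = s i.succ :=
  ⟨h _ _ (by simp [add_comm]), h _ _ (by simp; omega)⟩

theorem match_rev {t s : Fin 4 → ℝ} {i : Fin 3} (h : KnotMatch t s i) :
    t i.rev.castSucc = s 1 ∧ t i.rev.succ = s 2 := by
  constructor <;> refine h _ _ ?_ <;> fin_cases i <;> rfl

theorem coef_eq_loc {P p : Patch} {i j : Fin 3} (hX : KnotMatch P.X p.X i)
    (hY : KnotMatch P.Y p.Y j) : p.coef i j = P.loc i.rev j.rev := by
  rw [loc, hat_of_match hX, hat_of_match hY, (match_mid hX).1, (match_mid hX).2, (match_mid hY).1,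
    (match_mid hY).2]
  funext k
  fin_cases k <;> simp [coef, tens, slope, RRM.avg]

theorem cell_eq_of_match {P p : Patch} {i j : Fin 3} (hX : KnotMatch P.X p.X i)
    (hY : KnotMatch P.Y p.Y j) : P.cell i.rev j.rev = p.cell 1 1 := by
  have h1 := match_rev hX
  have h2 := match_rev hY
  ext
  · exact h1.1
  · exact h1.2
  · exact h2.1
  · exact h2.2

theorem mean_eq_avg (p : Patch) (v : ℝ × ℝ → ℝ) (i j : Fin 3) :
    p.mean v i j = (p.cell i j).avg v := by
  rw [mean, setAverage_eq, measureReal_congr (p.cell i j).inner_ae_eq_closed,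
    setIntegral_congr_set (p.cell i j).inner_ae_eq_closed, Rect.volume_closed, Rect.avg, Rect.int,
    smul_eq_mul, div_eq_inv_mul]

/-- A one-dimensional computation in each direction: the weighted differences of the neighbouring
means have first moment zero, and they change the mean of `x²` over the centre into the product of
the two inner knots. No mixed term is affected, as the neighbours lie in the same row or column. -/
theorem lam_quad (p : Patch) (c : Fin 6 → ℝ) : p.lam (quad c) = blossom (p.cell 1 1) c := by
  have aux : ∀ t : Fin 4 → ℝ, StrictMono t →
      (let w := -(t 2 - t 1) ^ 2 / ((t 2 - t 0) * (t 3 - t 0))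
       let w' := -(t 2 - t 1) ^ 2 / ((t 3 - t 1) * (t 3 - t 0))
       w * ((t 0 + t 1) / 2 - (t 1 + t 2) / 2) + w' * ((t 2 + t 3) / 2 - (t 1 + t 2) / 2) = 0 ∧
       w * ((t 0 ^ 2 + t 0 * t 1 + t 1 ^ 2) / 3 - (t 1 ^ 2 + t 1 * t 2 + t 2 ^ 2) / 3) +
        w' * ((t 2 ^ 2 + t 2 * t 3 + t 3 ^ 2) / 3 - (t 1 ^ 2 + t 1 * t 2 + t 2 ^ 2) / 3) +
        (t 1 ^ 2 + t 1 * t 2 + t 2 ^ 2) / 3 = t 1 * t 2) := by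
    intro t ht
    have h1 : t 3 - t 0 ≠ 0 := (sub_pos.2 (ht (by decide))).ne'
    have h2 : t 2 - t 0 ≠ 0 := (sub_pos.2 (ht (by decide))).ne'
    have h3 : t 3 - t 1 ≠ 0 := (sub_pos.2 (ht (by decide))).ne'
    intro w w'
    constructor <;> simp only [w, w'] <;> field_simp <;> ring
  obtain ⟨x1, x2⟩ := aux p.X p.hX
  obtain ⟨y1, y2⟩ := aux p.Y p.hY
  have e1 : p.w₁ = -(p.X 2 - p.X 1) ^ 2 / ((p.X 2 - p.X 0) * (p.X 3 - p.X 0)) := by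
    simp [w₁, L]
  have e2 : p.w₂ = -(p.X 2 - p.X 1) ^ 2 / ((p.X 3 - p.X 1) * (p.X 3 - p.X 0)) := by
    simp [w₂, L]
  have e3 : p.w₃ = -(p.Y 2 - p.Y 1) ^ 2 / ((p.Y 2 - p.Y 0) * (p.Y 3 - p.Y 0)) := by
    simp [w₃, H]
  have e4 : p.w₄ = -(p.Y 2 - p.Y 1) ^ 2 / ((p.Y 3 - p.Y 1) * (p.Y 3 - p.Y 0)) := by
    simp [w₄, H]
  rw [← e1, ← e2] at x1 x2
  rw [← e3, ← e4] at y1 y2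
  simp only [lam, mean_eq_avg, Rect.avg_quad, blossom]
  have c0 : (Fin.castSucc 0 : Fin 4) = 0 := rfl
  have c1 : (Fin.castSucc 1 : Fin 4) = 1 := rfl
  have c2 : (Fin.castSucc 2 : Fin 4) = 2 := rfl
  have s0 : (Fin.succ 0 : Fin 4) = 1 := rfl
  have s1 : (Fin.succ 1 : Fin 4) = 2 := rfl
  have s2 : (Fin.succ 2 : Fin 4) = 3 := rfl
  simp only [cell, c0, c1, c2, s0, s1, s2]
  linear_combination (c 1 + c 4 * ((p.Y 1 + p.Y 2) / 2)) * x1 + c 3 * x2 +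
    (c 2 + c 4 * ((p.X 1 + p.X 2) / 2)) * y1 + c 5 * y2

end Patch

/-! ### Combining small functions -/

theorem Rect.sq_sub_le (K : Rect) {f g : ℝ × ℝ → ℝ} (hf : Continuous f) (hg : Continuous g) :
    K.sq (f - g) ≤ 2 * (K.sq f + K.sq g) := by
  rw [sq, sq, sq, ← integral_add (K.integrableOn (by fun_prop)) (K.integrableOn (by fun_prop)),
    ← integral_const_mul]
  refine setIntegral_mono (K.integrableOn (by fun_prop)) (K.integrableOn (by fun_prop)) fun z => ?_
  simp only [Pi.sub_apply]
  nlinarith [_root_.sq_nonneg (f z + g z)]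

theorem Small.sub {K : Rect} {e e' : ℝ × ℝ → ℝ} (he : ContDiff ℝ ∞ e) (he' : ContDiff ℝ ∞ e')
    {h B B' : ℝ} (hs : Small K e h B) (hs' : Small K e' h B') :
    Small K (e - e') h (2 * (B + B')) := by
  have x := contDiff_pdx he
  have y := contDiff_pdy he
  have x' := contDiff_pdx he'
  have y' := contDiff_pdy he'
  have n := sq_nonneg h
  have k := fun {f g : ℝ × ℝ → ℝ} (hf : ContDiff ℝ ∞ f) (hg : ContDiff ℝ ∞ g) =>
    K.sq_sub_le hf.continuous hg.continuous
  obtain ⟨h1, h2, h3, h4, h5, h6⟩ := hs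
  obtain ⟨i1, i2, i3, i4, i5, i6⟩ := hs'
  constructor
  · linarith [k he he']
  · rw [pdx_sub he he']
    linarith [k x x']
  · rw [pdy_sub he he']
    linarith [k y y']
  · rw [pdx_sub he he', pdx_sub x x']
    linarith [mul_le_mul_of_nonneg_left (k (contDiff_pdx x) (contDiff_pdx x')) n]
  · rw [pdy_sub he he', pdx_sub y y']
    linarith [mul_le_mul_of_nonneg_left (k (contDiff_pdx y) (contDiff_pdx y')) n]
  · rw [pdy_sub he he', pdy_sub y y']
    linarith [mul_le_mul_of_nonneg_left (k (contDiff_pdy y) (contDiff_pdy y')) n]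

theorem Small.mono {K : Rect} {e : ℝ × ℝ → ℝ} {h B B' : ℝ} (hs : Small K e h B) (hB : B ≤ B') :
    Small K e h B' :=
  ⟨hs.s00.trans (mul_le_mul_of_nonneg_right hB (sq_nonneg h)), hs.s10.trans hB, hs.s01.trans hB,
    hs.s20.trans hB, hs.s11.trans hB, hs.s02.trans hB⟩

theorem quad_centered (a b : ℝ) (d : Fin 6 → ℝ) (z : ℝ × ℝ) :
    quad (centered a b d) z = d 0 + d 1 * (z.1 - a) + d 2 * (z.2 - b) + d 3 * (z.1 - a) ^ 2 +
      d 4 * ((z.1 - a) * (z.2 - b)) + d 5 * (z.2 - b) ^ 2 := by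
  simp [quad, centered]
  ring

theorem sq_add_six_le (a b c d e f : ℝ) :
    (a + b + c + d + e + f) ^ 2 ≤ 6 * (a ^ 2 + b ^ 2 + c ^ 2 + d ^ 2 + e ^ 2 + f ^ 2) := by
  have h := sq_sum_le_card_mul_sum_sq (s := Finset.univ) (f := ![a, b, c, d, e, f])
  simpa [Fin.sum_univ_six] using h

theorem blossom_centered (R : Rect) (a b : ℝ) (d : Fin 6 → ℝ) :
    blossom R (centered a b d) =
      d 0 + d 1 * ((R.x₀ + R.x₁) / 2 - a) + d 2 * ((R.y₀ + R.y₁) / 2 - b) +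
        d 3 * ((R.x₀ - a) * (R.x₁ - a)) +
        d 4 * (((R.x₀ + R.x₁) / 2 - a) * ((R.y₀ + R.y₁) / 2 - b)) +
        d 5 * ((R.y₀ - b) * (R.y₁ - b)) := by
  simp [blossom, centered]
  ring

/-- Coefficient times a monomial of matching size. -/
theorem sq_mul_le {d m h ρ B : ℝ} (n : ℕ) (hρ : 1 ≤ ρ) (hB : h ^ (2 * n) * d ^ 2 ≤ B)
    (hn : n ≤ 2) (hm : |m| ≤ (ρ * h) ^ n) : (d * m) ^ 2 ≤ ρ ^ 4 * B := by
  have h1 : m ^ 2 ≤ ((ρ * h) ^ n) ^ 2 := sq_le_sq' (abs_le.1 hm).1 (abs_le.1 hm).2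
  have h2 : (d * m) ^ 2 ≤ d ^ 2 * ((ρ * h) ^ n) ^ 2 := by
    rw [mul_pow]
    exact mul_le_mul_of_nonneg_left h1 (sq_nonneg d)
  have h3 : d ^ 2 * ((ρ * h) ^ n) ^ 2 = ρ ^ (2 * n) * (h ^ (2 * n) * d ^ 2) := by
    rw [← pow_mul, mul_pow, mul_comm n 2]
    ring
  have h4 : ρ ^ (2 * n) ≤ ρ ^ 4 := pow_le_pow_right₀ hρ (by omega)
  have h5 : 0 ≤ h ^ (2 * n) * d ^ 2 := mul_nonneg (by rw [pow_mul]; positivity) (sq_nonneg d)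
  calc (d * m) ^ 2 ≤ ρ ^ (2 * n) * (h ^ (2 * n) * d ^ 2) := h2.trans h3.le
    _ ≤ ρ ^ 4 * B := mul_le_mul h4 hB h5 (by positivity)

theorem SmallCoef.sq_le {d : Fin 6 → ℝ} {h ρ B : ℝ} (hd : SmallCoef d h B) (hρ : 1 ≤ ρ)
    {m₁ m₂ m₃ m₄ m₅ : ℝ} (h1 : |m₁| ≤ ρ * h) (h2 : |m₂| ≤ ρ * h) (h3 : |m₃| ≤ (ρ * h) ^ 2)
    (h4 : |m₄| ≤ (ρ * h) ^ 2) (h5 : |m₅| ≤ (ρ * h) ^ 2) :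
    (d 0 + d 1 * m₁ + d 2 * m₂ + d 3 * m₃ + d 4 * m₄ + d 5 * m₅) ^ 2 ≤ 36 * ρ ^ 4 * B := by
  have k0 := sq_mul_le (m := 1) (h := h) 0 hρ (by simpa using hd.c0) (by norm_num) (by simp)
  have k1 := sq_mul_le 1 hρ (by simpa using hd.c1) (by norm_num) (by simpa using h1)
  have k2 := sq_mul_le 1 hρ (by simpa using hd.c2) (by norm_num) (by simpa using h2)
  have k3 := sq_mul_le 2 hρ (by simpa using hd.c3) (by norm_num) h3
  have k4 := sq_mul_le 2 hρ (by simpa using hd.c4) (by norm_num) h4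
  have k5 := sq_mul_le 2 hρ (by simpa using hd.c5) (by norm_num) h5
  have := sq_add_six_le (d 0) (d 1 * m₁) (d 2 * m₂) (d 3 * m₃) (d 4 * m₄) (d 5 * m₅)
  rw [mul_one] at k0
  linarith

theorem abs_mul_le_sq {x y r : ℝ} (hx : |x| ≤ r) (hy : |y| ≤ r) : |x * y| ≤ r ^ 2 := by
  rw [abs_mul, pow_two]
  exact mul_le_mul hx hy (abs_nonneg _) ((abs_nonneg _).trans hx)

theorem SmallCoef.sq_blossom_le {d : Fin 6 → ℝ} {h ρ B a b : ℝ} (hd : SmallCoef d h B)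
    (hρ : 1 ≤ ρ) (R : Rect) (hx₀ : |R.x₀ - a| ≤ ρ * h) (hx₁ : |R.x₁ - a| ≤ ρ * h)
    (hy₀ : |R.y₀ - b| ≤ ρ * h) (hy₁ : |R.y₁ - b| ≤ ρ * h) :
    blossom R (centered a b d) ^ 2 ≤ 36 * ρ ^ 4 * B := by
  have hx : |(R.x₀ + R.x₁) / 2 - a| ≤ ρ * h := by
    rw [abs_le] at *
    constructor <;> linarith
  have hy : |(R.y₀ + R.y₁) / 2 - b| ≤ ρ * h := by
    rw [abs_le] at *
    constructor <;> linarith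
  rw [blossom_centered]
  exact hd.sq_le hρ hx hy (abs_mul_le_sq hx₀ hx₁) (abs_mul_le_sq hx hy) (abs_mul_le_sq hy₀ hy₁)

theorem pdx_quad_centered (a b : ℝ) (d : Fin 6 → ℝ) :
    pdx (quad (centered a b d)) = quad (centered a b (coefDx d)) := by
  rw [pdx_quad]
  congr 1
  funext i
  fin_cases i <;> simp [centered, coefDx]

theorem pdy_quad_centered (a b : ℝ) (d : Fin 6 → ℝ) :
    pdy (quad (centered a b d)) = quad (centered a b (coefDy d)) := by
  rw [pdy_quad]
  congr 1
  funext i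
  fin_cases i <;> simp [centered, coefDy]
  ring

theorem Rect.sq_quad_le {K : Rect} {h κ B a b : ℝ} {d : Fin 6 → ℝ} (hh : 0 < h) (hκ : 1 ≤ κ)
    (hK : K.Sized h κ) (hd : SmallCoef d h B) (ha : a ∈ Icc K.x₀ K.x₁) (hb : b ∈ Icc K.y₀ K.y₁) :
    K.sq (quad (centered a b d)) ≤ 36 * κ ^ 6 * B * h ^ 2 := by
  have hB : 0 ≤ B := (_root_.sq_nonneg _).trans hd.c0
  have h1 : K.sq (quad (centered a b d)) ≤ K.area * (√(36 * κ ^ 4 * B)) ^ 2 := by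
    refine K.sq_le_of_abs_le (continuous_quad _) fun z hz => Real.abs_le_sqrt ?_
    have l1 := hK.len_le
    have l2 := hK.hgt_le
    simp only [len, hgt] at l1 l2
    obtain ⟨⟨z1, z2⟩, z3, z4⟩ := hz
    have hx : |z.1 - a| ≤ κ * h := abs_le.2 ⟨by linarith [ha.2], by linarith [ha.1]⟩
    have hy : |z.2 - b| ≤ κ * h := abs_le.2 ⟨by linarith [hb.2], by linarith [hb.1]⟩
    rw [quad_centered]
    refine hd.sq_le hκ hx hy ?_ (abs_mul_le_sq hx hy) ?_
    · rw [pow_two]; exact abs_mul_le_sq hx hx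
    · rw [pow_two]; exact abs_mul_le_sq hy hy
  rw [Real.sq_sqrt (by positivity)] at h1
  have h2 := mul_le_mul_of_nonneg_right (hK.area_le hh hκ)
    (by positivity : 0 ≤ 36 * κ ^ 4 * B)
  calc _ ≤ _ := h1
    _ ≤ _ := h2
    _ = _ := by ring

theorem SmallCoef.small {K : Rect} {h κ B a b : ℝ} {d : Fin 6 → ℝ} (hh : 0 < h) (hκ : 1 ≤ κ)
    (hK : K.Sized h κ) (hd : SmallCoef d h B) (ha : a ∈ Icc K.x₀ K.x₁) (hb : b ∈ Icc K.y₀ K.y₁) :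
    Small K (quad (centered a b d)) h (144 * κ ^ 6 * B) := by
  have hB : 0 ≤ B := (sq_nonneg _).trans hd.c0
  have hz := hh.le
  obtain ⟨c0, c1, c2, c3, c4, c5⟩ := hd
  have p2 : 0 < h ^ 2 := by positivity
  have p4 : 0 < h ^ 4 := by positivity
  have dx : SmallCoef (coefDx d) h (4 * B / h ^ 2) := by
    constructor <;> rw [le_div_iff₀ p2] <;> simp [coefDx] <;> nlinarith
  have dy : SmallCoef (coefDy d) h (4 * B / h ^ 2) := by
    constructor <;> rw [le_div_iff₀ p2] <;> simp [coefDy] <;> nlinarith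
  have dxx : SmallCoef (coefDx (coefDx d)) h (4 * B / h ^ 4) := by
    constructor <;> rw [le_div_iff₀ p4] <;> simp [coefDx] <;> nlinarith
  have dxy : SmallCoef (coefDx (coefDy d)) h (4 * B / h ^ 4) := by
    constructor <;> rw [le_div_iff₀ p4] <;> simp [coefDx, coefDy] <;> nlinarith
  have dyy : SmallCoef (coefDy (coefDy d)) h (4 * B / h ^ 4) := by
    constructor <;> rw [le_div_iff₀ p4] <;> simp [coefDy] <;> nlinarith
  have k := fun {d : Fin 6 → ℝ} {B : ℝ} (hd : SmallCoef d h B) => Rect.sq_quad_le hh hκ hK hd ha hb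
  have κ6 : 0 ≤ κ ^ 6 * B := by positivity
  constructor
  · refine (k ⟨c0, c1, c2, c3, c4, c5⟩).trans ?_
    nlinarith [mul_nonneg κ6 p2.le]
  · rw [pdx_quad_centered]
    refine (k dx).trans (le_of_eq ?_)
    field_simp
    ring
  · rw [pdy_quad_centered]
    refine (k dy).trans (le_of_eq ?_)
    field_simp
    ring
  · rw [pdx_quad_centered, pdx_quad_centered]
    refine (mul_le_mul_of_nonneg_left (k dxx) p2.le).trans (le_of_eq ?_)
    field_simp
    ring
  · rw [pdy_quad_centered, pdx_quad_centered]
    refine (mul_le_mul_of_nonneg_left (k dxy) p2.le).trans (le_of_eq ?_)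
    field_simp
    ring
  · rw [pdy_quad_centered, pdy_quad_centered]
    refine (mul_le_mul_of_nonneg_left (k dyy) p2.le).trans (le_of_eq ?_)
    field_simp
    ring

/-! ### Size of the local basis functions and of the functionals -/

/-- The coefficients `tens` in coordinates centred at the lower left vertex. -/
noncomputable def tensCentered (L H : ℝ) (f g : Fin 3 → ℝ) : Fin 6 → ℝ :=
  ![f 0 * g 0, (f 1 - f 0) / L * g 0 - (g 0 + g 1) / 2 * f 2 * L,
    (g 1 - g 0) / H * f 0 - (f 0 + f 1) / 2 * g 2 * H, (g 0 + g 1) / 2 * f 2,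
    (f 1 - f 0) / L * ((g 1 - g 0) / H), (f 0 + f 1) / 2 * g 2]

theorem tens_eq_centered (x₀ x₁ y₀ y₁ : ℝ) (f g : Fin 3 → ℝ) :
    tens x₀ x₁ y₀ y₁ f g = centered x₀ y₀ (tensCentered (x₁ - x₀) (y₁ - y₀) f g) := by
  funext k
  fin_cases k <;> simp [tens, centered, tensCentered] <;> ring

theorem hat_bounds {t : Fin 4 → ℝ} (ht : StrictMono t) (i : Fin 3) :
    0 ≤ hat t i 0 ∧ hat t i 0 ≤ 1 ∧ 0 ≤ hat t i 1 ∧ hat t i 1 ≤ 1 ∧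
      |hat t i 2| * (t 2 - t 1) ^ 2 ≤ 2 := by
  have h1 : 0 < t 1 - t 0 := sub_pos.2 (ht (by decide))
  have h2 : 0 < t 2 - t 1 := sub_pos.2 (ht (by decide))
  have h3 : 0 < t 3 - t 2 := sub_pos.2 (ht (by decide))
  have h4 : 0 < t 2 - t 0 := by linarith
  have h5 : 0 < t 3 - t 1 := by linarith
  have q1 : (t 2 - t 1) / (t 2 - t 0) ≤ 1 := (div_le_one h4).2 (by linarith)
  have q2 : (t 2 - t 1) / (t 3 - t 1) ≤ 1 := (div_le_one h5).2 (by linarith)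
  have r1 : (t 1 - t 0) / (t 2 - t 0) ≤ 1 := (div_le_one h4).2 (by linarith)
  have r2 : (t 3 - t 2) / (t 3 - t 1) ≤ 1 := (div_le_one h5).2 (by linarith)
  have e1 : |1 / ((t 2 - t 1) * (t 2 - t 0))| * (t 2 - t 1) ^ 2 =
      (t 2 - t 1) / (t 2 - t 0) := by
    rw [abs_of_pos (by positivity)]
    field_simp
  have e2 : |1 / ((t 2 - t 1) * (t 3 - t 1))| * (t 2 - t 1) ^ 2 =
      (t 2 - t 1) / (t 3 - t 1) := by
    rw [abs_of_pos (by positivity)]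
    field_simp
  have e3 : |-(1 / (t 2 - t 0) + 1 / (t 3 - t 1)) / (t 2 - t 1)| * (t 2 - t 1) ^ 2 =
      (t 2 - t 1) / (t 2 - t 0) + (t 2 - t 1) / (t 3 - t 1) := by
    rw [neg_div, abs_neg, abs_of_pos (by positivity)]
    field_simp
  fin_cases i
  · simp only [hat]
    simp only [Fin.zero_eta, Matrix.cons_val]
    exact ⟨by positivity, q1, le_rfl, zero_le_one, by rw [e1]; linarith⟩
  · simp only [hat]
    simp only [Fin.mk_one, Matrix.cons_val]
    exact ⟨by positivity, r1, by positivity, r2, by rw [e3]; linarith⟩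
  · simp only [hat]
    simp only [Fin.reduceFinMk, Matrix.cons_val]
    exact ⟨le_rfl, zero_le_one, by positivity, q2, by rw [e2]; linarith⟩

theorem tensCentered_small {L H h κ : ℝ} (hL : 0 < L) (hH : 0 < H) (hh : 0 < h) (hκ : 1 ≤ κ)
    (h1 : h ≤ κ * L) (h2 : h ≤ κ * H) {f g : Fin 3 → ℝ}
    (hf : 0 ≤ f 0 ∧ f 0 ≤ 1 ∧ 0 ≤ f 1 ∧ f 1 ≤ 1 ∧ |f 2| * L ^ 2 ≤ 2)
    (hg : 0 ≤ g 0 ∧ g 0 ≤ 1 ∧ 0 ≤ g 1 ∧ g 1 ≤ 1 ∧ |g 2| * H ^ 2 ≤ 2) :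
    SmallCoef (tensCentered L H f g) h (9 * κ ^ 4) := by
  obtain ⟨f1, f2, f3, f4, f5⟩ := hf
  obtain ⟨g1, g2, g3, g4, g5⟩ := hg
  have hκ0 : 0 < κ := by linarith
  have p24 : κ ^ 2 ≤ κ ^ 4 := pow_le_pow_right₀ hκ (by norm_num)
  have p04 : 1 ≤ κ ^ 4 := one_le_pow₀ hκ
  have af : |(f 0 + f 1) / 2| ≤ 1 := abs_le.2 ⟨by linarith, by linarith⟩
  have ag : |(g 0 + g 1) / 2| ≤ 1 := abs_le.2 ⟨by linarith, by linarith⟩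
  have df : |f 1 - f 0| ≤ 1 := abs_le.2 ⟨by linarith, by linarith⟩
  have dg : |g 1 - g 0| ≤ 1 := abs_le.2 ⟨by linarith, by linarith⟩
  have sf : |(f 1 - f 0) / L| * h ≤ κ := by
    rw [abs_div, abs_of_pos hL, div_mul_eq_mul_div, div_le_iff₀ hL]
    nlinarith [abs_nonneg (f 1 - f 0)]
  have sg : |(g 1 - g 0) / H| * h ≤ κ := by
    rw [abs_div, abs_of_pos hH, div_mul_eq_mul_div, div_le_iff₀ hH]
    nlinarith [abs_nonneg (g 1 - g 0)]
  have bend : ∀ {x a l : ℝ}, |a| ≤ 1 → 0 < l → h ≤ κ * l → |x| * l ^ 2 ≤ 2 →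
      |a * x| * h ^ 2 ≤ 2 * κ ^ 2 ∧ |a * x * l| * h ≤ 2 * κ := by
    intro x a l ha hl hk hx
    have k1 : |a * x| ≤ |x| := by
      rw [abs_mul]
      exact mul_le_of_le_one_left (abs_nonneg _) ha
    have k2 : h ^ 2 ≤ κ ^ 2 * l ^ 2 := by rw [← mul_pow]; gcongr
    have n := abs_nonneg x
    constructor
    · calc |a * x| * h ^ 2 ≤ |x| * (κ ^ 2 * l ^ 2) := mul_le_mul k1 k2 (by positivity) n
        _ = κ ^ 2 * (|x| * l ^ 2) := by ring
        _ ≤ κ ^ 2 * 2 := by gcongr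
        _ = _ := by ring
    · rw [abs_mul (a * x), abs_of_pos hl]
      calc |a * x| * l * h ≤ |x| * l * (κ * l) := by gcongr
        _ = κ * (|x| * l ^ 2) := by ring
        _ ≤ κ * 2 := by gcongr
        _ = _ := by ring
  obtain ⟨b1, b2⟩ := bend ag hL h1 f5
  obtain ⟨b3, b4⟩ := bend af hH h2 g5
  have sqb : ∀ {x y c : ℝ}, |x| * y ≤ c → 0 ≤ y → y ^ 2 * x ^ 2 ≤ c ^ 2 := by
    intro x y c hx hy
    calc y ^ 2 * x ^ 2 = (|x| * y) ^ 2 := by rw [mul_pow, sq_abs]; ring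
      _ ≤ c ^ 2 := pow_le_pow_left₀ (by positivity) hx 2
  have q : ∀ {a b : ℝ}, |a| ≤ 1 → |b| ≤ 1 → |a * b| ≤ 1 := fun ha hb => by
    rw [abs_mul]; exact mul_le_one₀ ha (abs_nonneg _) hb
  have lin : ∀ {s u x : ℝ}, |s| * h ≤ κ → |u| ≤ 1 → |x| * h ≤ 2 * κ →
      |s * u - x| * h ≤ 3 * κ := by
    intro s u x hs hu hx
    have k1 : |s * u - x| ≤ |s| + |x| := by
      refine (abs_sub _ _).trans (add_le_add ?_ le_rfl)
      rw [abs_mul]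
      exact mul_le_of_le_one_right (abs_nonneg _) hu
    nlinarith
  have u0 : |f 0| ≤ 1 := abs_le.2 ⟨by linarith, f2⟩
  have v0 : |g 0| ≤ 1 := abs_le.2 ⟨by linarith, g2⟩
  constructor <;> simp only [tensCentered, Matrix.cons_val]
  · have := sqb (y := 1) ((mul_one _).trans_le (q u0 v0)) zero_le_one
    linarith
  · have := sqb (lin sf v0 b2) hh.le
    linarith
  · have := sqb (lin sg u0 b4) hh.le
    linarith
  · have := sqb b1 (by positivity)
    linarith
  · have : |(f 1 - f 0) / L * ((g 1 - g 0) / H)| * h ^ 2 ≤ κ ^ 2 := by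
      rw [abs_mul]
      have := mul_le_mul sf sg (by positivity) hκ0.le
      linarith
    have := sqb this (by positivity)
    linarith
  · have := sqb b3 (by positivity)
    linarith

namespace Patch

/-- The coefficients of the local basis functions relative to the lower left vertex. -/
noncomputable def locCentered (P : Patch) (i j : Fin 3) : Fin 6 → ℝ :=
  tensCentered (P.X 2 - P.X 1) (P.Y 2 - P.Y 1) (hat P.X i) (hat P.Y j)

theorem loc_eq (P : Patch) (i j : Fin 3) :
    P.loc i j = centered (P.X 1) (P.Y 1) (P.locCentered i j) :=
  tens_eq_centered _ _ _ _ _ _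

theorem smallCoef_loc (P : Patch) {h κ : ℝ} (hh : 0 < h) (hκ : 1 ≤ κ)
    (hP : (P.cell 1 1).Sized h κ) (i j : Fin 3) : SmallCoef (P.locCentered i j) h (9 * κ ^ 4) :=
  tensCentered_small (P.cell 1 1).len_pos (P.cell 1 1).hgt_pos hh hκ hP.le_len hP.le_hgt
    (hat_bounds P.hX i) (hat_bounds P.hY j)

theorem smallCoef_sum_loc (P : Patch) {h κ : ℝ} (hh : 0 < h) (hκ : 1 ≤ κ)
    (hP : (P.cell 1 1).Sized h κ) {β : Fin 3 → Fin 3 → ℝ} {B : ℝ} (hβ : ∀ i j, β i j ^ 2 ≤ B) :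
    SmallCoef (fun k => ∑ i, ∑ j, β i j * P.locCentered i j k) h (729 * κ ^ 4 * B) := by
  have hd := P.smallCoef_loc hh hκ hP
  have hB : 0 ≤ B := (sq_nonneg _).trans (hβ 0 0)
  have key : ∀ (H : ℝ) (k : Fin 6), 0 ≤ H → (∀ i j, H * P.locCentered i j k ^ 2 ≤ 9 * κ ^ 4) →
      H * (∑ i, ∑ j, β i j * P.locCentered i j k) ^ 2 ≤ 729 * κ ^ 4 * B := by
    intro H k hH hk
    have h1 := sq_sum_le_card_mul_sum_sq (s := (Finset.univ : Finset (Fin 3 × Fin 3)))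
      (f := fun x => β x.1 x.2 * P.locCentered x.1 x.2 k)
    rw [Fintype.sum_prod_type] at h1
    have h2 : H * ∑ x : Fin 3 × Fin 3, (β x.1 x.2 * P.locCentered x.1 x.2 k) ^ 2 ≤
        ∑ x : Fin 3 × Fin 3, 9 * κ ^ 4 * B := by
      rw [Finset.mul_sum]
      refine Finset.sum_le_sum fun x _ => ?_
      calc H * (β x.1 x.2 * P.locCentered x.1 x.2 k) ^ 2 =
          H * P.locCentered x.1 x.2 k ^ 2 * β x.1 x.2 ^ 2 := by ring
        _ ≤ _ := mul_le_mul (hk _ _) (hβ _ _) (sq_nonneg _) (by positivity)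
    simp only [Finset.sum_const, Finset.card_univ, Fintype.card_prod, Fintype.card_fin,
      nsmul_eq_mul] at h1 h2
    have h3 := mul_le_mul_of_nonneg_left h1 hH
    push_cast at h2 h3
    linarith
  constructor
  · simpa using key 1 0 zero_le_one fun i j => by simpa using (hd i j).c0
  · exact key _ 1 (by positivity) fun i j => (hd i j).c1
  · exact key _ 2 (by positivity) fun i j => (hd i j).c2
  · exact key _ 3 (by positivity) fun i j => (hd i j).c3
  · exact key _ 4 (by positivity) fun i j => (hd i j).c4
  · exact key _ 5 (by positivity) fun i j => (hd i j).c5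

theorem centered_sum (a b : ℝ) (β : Fin 3 → Fin 3 → ℝ) (d : Fin 3 → Fin 3 → Fin 6 → ℝ) (k : Fin 6) :
    centered a b (fun k => ∑ i, ∑ j, β i j * d i j k) k =
      ∑ i, ∑ j, β i j * centered a b (d i j) k := by
  simp only [Fin.sum_univ_three]
  fin_cases k <;> simp [centered] <;> ring

/-- If the coefficients `α` are close to those of the quadratic polynomial `q`, then the
combination of the local basis functions is as close to `φ` as `q`. -/
theorem small_sub_combination (P : Patch) {h κ : ℝ} (hh : 0 < h) (hκ : 1 ≤ κ)
    (hP : (P.cell 1 1).Sized h κ) {φ : ℝ × ℝ → ℝ} (hφ : ContDiff ℝ ∞ φ) {q c : Fin 6 → ℝ}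
    {α : Fin 3 → Fin 3 → ℝ} (hc : ∀ k, c k = ∑ i, ∑ j, α i j * P.loc i j k) {B : ℝ}
    (hα : ∀ i j, (α i j - blossom (P.cell i j) q) ^ 2 ≤ B)
    (hq : Small (P.cell 1 1) (φ - quad q) h B) :
    Small (P.cell 1 1) (φ - quad c) h (10 ^ 6 * κ ^ 10 * B) := by
  set β := fun i j => α i j - blossom (P.cell i j) q with hβ
  -- By reproduction, `c - q` is the combination of the local basis functions with the coefficient
  -- errors `β`.
  have e : c - q = centered (P.X 1) (P.Y 1) (fun k => ∑ i, ∑ j, β i j * P.locCentered i j k) := by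
    funext k
    rw [centered_sum, Pi.sub_apply, hc k, ← P.sum_blossom_loc q k]
    simp only [hβ, sub_mul, Finset.sum_sub_distrib, loc_eq]
  have hs := (P.smallCoef_sum_loc hh hκ hP hα).small (a := P.X 1) (b := P.Y 1) hh hκ hP
    ⟨le_rfl, (P.cell 1 1).hx.le⟩ ⟨le_rfl, (P.cell 1 1).hy.le⟩
  rw [← e] at hs
  have hB : 0 ≤ B := (sq_nonneg _).trans (hα 0 0)
  have hκ10 : 1 ≤ κ ^ 10 := one_le_pow₀ hκ
  have h1 := (hq.sub (hφ.sub (Rect.contDiff_quad q)) (Rect.contDiff_quad _) hs).mono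
    (B' := 10 ^ 6 * κ ^ 10 * B) (by nlinarith [mul_nonneg (sub_nonneg.2 hκ10) hB])
  have e2 : φ - quad q - quad (c - q) = φ - quad c := by
    funext z
    simp [quad]
    ring
  exact e2 ▸ h1

theorem sq_lam_le (p : Patch) {h κ : ℝ} (hh : 0 < h) (hκ : 1 ≤ κ) {f : ℝ × ℝ → ℝ}
    (hf : Continuous f) {B : ℝ} (hp : ∀ i j, i = 1 ∨ j = 1 → (p.cell i j).Sized h κ)
    (hB : ∀ i j, i = 1 ∨ j = 1 → (p.cell i j).sq f ≤ B * h ^ 2) :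
    p.lam f ^ 2 ≤ 200 * κ ^ 2 * B := by
  have m : ∀ i j, i = 1 ∨ j = 1 → p.mean f i j ^ 2 ≤ κ ^ 2 * B := by
    intro i j hij
    have h1 := (hp i j hij).sq_avg_le hh hκ hf
    have h2 := mul_le_mul_of_nonneg_left (hB i j hij) (sq_nonneg κ)
    rw [mean_eq_avg]
    have hh2 : 0 < h ^ 2 := by positivity
    refine le_of_mul_le_mul_left ?_ hh2
    linarith
  have wt : ∀ {a b c : ℝ}, 0 < a → 0 < b → 0 < c →
      |-b ^ 2 / ((a + b) * (a + b + c))| ≤ 1 ∧ |-b ^ 2 / ((b + c) * (a + b + c))| ≤ 1 := by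
    intro a b c ha hb hc
    constructor
    · rw [neg_div, abs_neg, abs_of_pos (by positivity), div_le_one (by positivity)]
      nlinarith [mul_pos ha hb, mul_pos hb hc, mul_pos ha hc]
    · rw [neg_div, abs_neg, abs_of_pos (by positivity), div_le_one (by positivity)]
      nlinarith [mul_pos ha hb, mul_pos hb hc, mul_pos ha hc]
  have L : ∀ i, 0 < p.L i := fun i => (p.cell i 0).len_pos
  have H : ∀ i, 0 < p.H i := fun i => (p.cell 0 i).hgt_pos
  obtain ⟨w1, w2⟩ : |p.w₁| ≤ 1 ∧ |p.w₂| ≤ 1 := wt (L 0) (L 1) (L 2)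
  obtain ⟨w3, w4⟩ : |p.w₃| ≤ 1 ∧ |p.w₄| ≤ 1 := wt (H 0) (H 1) (H 2)
  have w5 : |1 - (p.w₁ + p.w₂ + p.w₃ + p.w₄)| ≤ 5 := by
    rw [abs_le] at *
    constructor <;> linarith
  have hmul : ∀ {w x M : ℝ} (n : ℝ), |w| ≤ n → x ^ 2 ≤ M → (w * x) ^ 2 ≤ n ^ 2 * M := by
    intro w x M n hw hx
    rw [mul_pow]
    exact mul_le_mul (sq_le_sq' (abs_le.1 hw).1 (abs_le.1 hw).2) hx (sq_nonneg _) (sq_nonneg _)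
  have k1 := hmul 1 w1 (m 0 1 (.inr rfl))
  have k2 := hmul 1 w2 (m 2 1 (.inr rfl))
  have k3 := hmul 1 w3 (m 1 0 (.inl rfl))
  have k4 := hmul 1 w4 (m 1 2 (.inl rfl))
  have k5 := hmul 5 w5 (m 1 1 (.inl rfl))
  -- Four weights are at most `1` and the central one at most `5`, so the factor is `6 · (4 + 25) =
  -- 174`; the sixth summand is a dummy zero.
  have := sq_add_six_le (p.w₁ * p.mean f 0 1) (p.w₂ * p.mean f 2 1) (p.w₃ * p.mean f 1 0)
    (p.w₄ * p.mean f 1 2) ((1 - (p.w₁ + p.w₂ + p.w₃ + p.w₄)) * p.mean f 1 1) 0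
  rw [add_zero] at this
  have nn : 0 ≤ κ ^ 2 * B := (sq_nonneg _).trans (m 1 1 (.inl rfl))
  rw [lam]
  linarith

end Patch

theorem blossom_sub (R : Rect) (c c' : Fin 6 → ℝ) : blossom R (c - c') = blossom R c - blossom R c' := by
  simp only [blossom, Pi.sub_apply]
  ring

/-- The polar form of `(x - l)²` at the sides of `R` is `(x₀ - l) (x₁ - l)`. This is why the
interpolant may simply omit the functionals of cells whose side lines carry a wall. -/
theorem blossom_wallX {R : Rect} {l : ℝ} (h : l = R.x₀ ∨ l = R.x₁) (a : ℝ) :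
    blossom R (wallX a l) = 0 := by
  rcases h with rfl | rfl <;> simp [blossom, wallX] <;> ring

theorem blossom_wallY {R : Rect} {l : ℝ} (h : l = R.y₀ ∨ l = R.y₁) (a : ℝ) :
    blossom R (wallY a l) = 0 := by
  rcases h with rfl | rfl <;> simp [blossom, wallY] <;> ring

/-- If `φ` is close on `K` to a quadratic polynomial annihilated by the functional of the cell `R`,
then the functional is small on the averaged Taylor polynomial. -/
theorem sq_blossom_taylor_le {K R : Rect} {h κ ρ : ℝ} (hh : 0 < h) (hκ : 1 ≤ κ) (hρ : 1 ≤ ρ)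
    (hK : K.Sized h κ) {φ : ℝ × ℝ → ℝ} (hφ : ContDiff ℝ ∞ φ) {w : Fin 6 → ℝ} {B : ℝ}
    (hs : Small K (φ - quad w) h B) (hw : blossom R w = 0)
    (hx : ∀ x ∈ Icc K.x₀ K.x₁, |R.x₀ - x| ≤ ρ * h ∧ |R.x₁ - x| ≤ ρ * h)
    (hy : ∀ y ∈ Icc K.y₀ K.y₁, |R.y₀ - y| ≤ ρ * h ∧ |R.y₁ - y| ≤ ρ * h) :
    blossom R (K.taylor φ) ^ 2 ≤ 108 * ρ ^ 4 * κ ^ 6 * B := by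
  have hq := Rect.contDiff_quad w
  -- Since `taylor` reproduces `w` and `blossom R w = 0`, the function may be replaced by its small
  -- difference to `w`.
  have h1 : blossom R (K.taylor φ) = blossom R (K.taylor (φ - quad w)) := by
    rw [K.taylor_sub hφ hq, K.taylor_quad, blossom_sub, hw, sub_zero]
  have mx : (K.x₀ + K.x₁) / 2 ∈ Icc K.x₀ K.x₁ :=
    ⟨by linarith [K.hx], by linarith [K.hx]⟩
  have my : (K.y₀ + K.y₁) / 2 ∈ Icc K.y₀ K.y₁ :=
    ⟨by linarith [K.hy], by linarith [K.hy]⟩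
  rw [h1]
  refine ((hs.taylorCoef hh hκ hK (hφ.sub hq)).sq_blossom_le hρ R (hx _ mx).1 (hx _ mx).2
    (hy _ my).1 (hy _ my).2).trans (le_of_eq ?_)
  ring

/-! ### Neighbours in a grid -/

/-- The point with coordinate `u` along the axis `c` and coordinate `v` along the other axis. -/
def pt (c : Bool) (u v : ℝ) : ℝ × ℝ := cond c (v, u) (u, v)

namespace Rect

/-- The end points of the projections of a rectangle to the axes. -/
def side (K : Rect) : Bool → Bool → ℝ
  | false, false => K.x₀
  | false, true => K.x₁
  | true, false => K.y₀
  | true, true => K.y₁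

theorem side_lt (K : Rect) (c : Bool) : K.side c false < K.side c true := by
  cases c
  · exact K.hx
  · exact K.hy

theorem ext_side {K K' : Rect} (h : ∀ c b, K.side c b = K'.side c b) : K = K' :=
  Rect.ext (h false false) (h false true) (h true false) (h true true)

theorem ext_axis {K K' : Rect} {c : Bool} (h : ∀ b, K.side c b = K'.side c b)
    (h' : ∀ b, K.side (!c) b = K'.side (!c) b) : K = K' := by
  refine ext_side fun c' b => ?_
  cases c <;> cases c' <;> first | exact h b | exact h' b

theorem pt_mem_closed {K : Rect} {c : Bool} {u v : ℝ} : pt c u v ∈ K.closed ↔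
    u ∈ Icc (K.side c false) (K.side c true) ∧ v ∈ Icc (K.side (!c) false) (K.side (!c) true) := by
  cases c
  · exact Iff.rfl
  · exact and_comm

theorem isClosed_closed (K : Rect) : IsClosed K.closed := isClosed_Icc.prod isClosed_Icc

theorem closure_inner (K : Rect) : closure K.inner = K.closed := by
  rw [inner, closure_prod_eq, closure_Ioo K.hx.ne, closure_Ioo K.hy.ne, closed]

theorem not_mem_inner_of_mem_vertices {K : Rect} {a : ℝ × ℝ} (h : a ∈ K.vertices) :
    a ∉ K.inner := by
  simp only [vertices, mem_insert_iff, mem_singleton_iff] at h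
  rcases h with rfl | rfl | rfl | rfl <;> simp [inner]

theorem not_mem_inner_of_mem_edge {K : Rect} {a : ℝ × ℝ} {e : Side} (h : a ∈ K.edge e) :
    a ∉ K.inner := by
  obtain ⟨x, y⟩ := a
  cases e <;> simp only [edge, mem_prod, mem_singleton_iff] at h <;> simp [inner, h]

end Rect

/-- The axis to which a side is orthogonal. -/
def Side.axis : Side → Bool
  | .left | .right => false
  | .bottom | .top => true

/-- Whether the side is the upper one along its axis. -/
def Side.upper : Side → Bool
  | .left | .bottom => false
  | .right | .top => true

namespace Rect

theorem edge_eq_edge {K K' : Rect} {e e' : Side} (h : K.edge e = K'.edge e') :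
    e.axis = e'.axis ∧ K.side e.axis e.upper = K'.side e.axis e'.upper ∧
      ∀ b, K.side (!e.axis) b = K'.side (!e.axis) b := by
  have hx := K.hx
  have hy := K.hy
  have hx' := K'.hx
  have hy' := K'.hy
  cases e <;> cases e' <;> simp only [edge, ← Icc_self] at h <;>
    obtain ⟨a1, a2, a3, a4⟩ := Patch.box_inj (by linarith) (by linarith) h <;>
    first
    | (refine ⟨rfl, by assumption, ?_⟩; rintro (_ | _) <;> assumption)
    | (exfalso; linarith)

theorem pt_mem_edge {K : Rect} {c b : Bool} {t : ℝ}
    (ht : t ∈ Ioo (K.side (!c) false) (K.side (!c) true)) {e : Side}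
    (h : pt c (K.side c b) t ∈ K.edge e) : e.axis = c ∧ e.upper = b := by
  have hx := K.hx
  have hy := K.hy
  obtain ⟨h1, h2⟩ := ht
  cases c <;> cases b <;> cases e <;> simp only [side, Bool.not_false, Bool.not_true] at h1 h2 <;>
    simp only [side, pt, edge, mem_prod, mem_singleton_iff, cond_true, cond_false] at h <;>
    first
    | exact ⟨rfl, rfl⟩
    | (exfalso; obtain ⟨h3, h4⟩ := h; linarith)

theorem pt_not_mem_vertices {K : Rect} {c b : Bool} {t : ℝ}
    (ht : t ∈ Ioo (K.side (!c) false) (K.side (!c) true)) : pt c (K.side c b) t ∉ K.vertices := by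
  intro h
  obtain ⟨h1, h2⟩ := ht
  simp only [vertices, mem_insert_iff, mem_singleton_iff] at h
  cases c <;> simp only [side, pt, Bool.not_false, Bool.not_true, cond_true, cond_false,
    Prod.mk.injEq] at h1 h2 h <;> rcases h with h | h | h | h <;>
    obtain ⟨h3, h4⟩ := h <;> linarith

end Rect

/-- `K'` is the neighbour of `K` in the upper (`b = true`) or lower direction of the axis `c`. -/
def Nbr (c b : Bool) (K K' : Rect) : Prop :=
  K.side c b = K'.side c (!b) ∧ ∀ b', K.side (!c) b' = K'.side (!c) b'

theorem Nbr.symm {c b : Bool} {K K' : Rect} (h : Nbr c b K K') : Nbr c (!b) K' K :=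
  ⟨by rw [Bool.not_not]; exact h.1.symm, fun b' => (h.2 b').symm⟩

/-- Points slightly displaced from `z` are covered, and there are finitely many closed cells. Those
not containing `z` are avoided by small displacements, so some cell contains both `z` and a
displaced point. -/
theorem exists_cell_direction {G : Finset Rect} {z : ℝ × ℝ} (hz : z ∈ domain (G : Set Rect))
    (d : ℝ × ℝ) : ∃ K ∈ G, z ∈ K.closed ∧ ∃ ε : ℝ, 0 < ε ∧ z + ε • d ∈ K.closed := by
  have hlim : Filter.Tendsto (fun ε : ℝ => z + ε • d) (nhdsWithin 0 (Ioi 0)) (nhds z) := by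
    have h : Continuous fun ε : ℝ => z + ε • d := by fun_prop
    have := h.tendsto 0
    simp only [zero_smul, add_zero] at this
    exact this.mono_left nhdsWithin_le_nhds
  have hev : ∀ᶠ ε : ℝ in nhdsWithin 0 (Ioi 0), ∃ K ∈ G, z + ε • d ∈ K.closed := by
    filter_upwards [hlim (isOpen_interior.mem_nhds hz)] with ε hε
    simpa using interior_subset hε
  by_contra hcon
  push Not at hcon
  have hall : ∀ K ∈ G, ∀ᶠ ε : ℝ in nhdsWithin 0 (Ioi 0), z + ε • d ∉ K.closed := by
    intro K hK
    by_cases hzK : z ∈ K.closed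
    · filter_upwards [self_mem_nhdsWithin] with ε hε
      exact hcon K hK hzK ε hε
    · exact hlim (K.isClosed_closed.isOpen_compl.mem_nhds hzK)
  obtain ⟨ε, ⟨K, hK, h1⟩, h2⟩ := (hev.and ((Finset.eventually_all G).2 hall)).exists
  exact h2 K hK h1

namespace IsGrid

variable {Ω : Set (ℝ × ℝ)} {G : Finset Rect}

theorem eq_of_mem_inner (hG : IsGrid Ω G) {K K' : Rect} (hK : K ∈ G) (hK' : K' ∈ G) {z : ℝ × ℝ}
    (hz : z ∈ K.inner) (hz' : z ∈ K'.closed) : K = K' := by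
  by_contra hne
  have hm : z ∈ K.closed ∩ K'.closed := ⟨K.inner_subset_closed hz, hz'⟩
  rcases hG.conforming K hK K' hK' hne with h | ⟨a, ha, -, h⟩ | ⟨e, e', h, -⟩
  · rw [h] at hm
    exact hm
  · rw [h, mem_singleton_iff] at hm
    exact Rect.not_mem_inner_of_mem_vertices ha (hm ▸ hz)
  · rw [h] at hm
    exact Rect.not_mem_inner_of_mem_edge hm hz

/-- Two cells that overlap next to a common corner are equal. -/
theorem eq_of_corner (hG : IsGrid Ω G) {K K' : Rect} (hK : K ∈ G) (hK' : K' ∈ G) {a b : Bool}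
    (ha : K.side false a = K'.side false a) (hb : K.side true b = K'.side true b) : K = K' := by
  have key : ∀ (c a : Bool), K.side c a = K'.side c a →
      ∃ u, u ∈ Ioo (K.side c false) (K.side c true) ∧ u ∈ Icc (K'.side c false) (K'.side c true) := by
    intro c a h
    have h1 := K.side_lt c
    have h2 := K'.side_lt c
    cases a
    · obtain ⟨u, hu⟩ := exists_between (lt_min h1 (h ▸ h2 : K.side c false < K'.side c true))
      obtain ⟨h3, h4⟩ := lt_min_iff.1 hu.2
      exact ⟨u, ⟨hu.1, h3⟩, h ▸ hu.1.le, h4.le⟩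
    · obtain ⟨u, hu⟩ := exists_between (max_lt h1 (h ▸ h2 : K'.side c false < K.side c true))
      obtain ⟨h3, h4⟩ := max_lt_iff.1 hu.1
      exact ⟨u, ⟨h3, hu.2⟩, h4.le, h ▸ hu.2.le⟩
  obtain ⟨u, u1, u2⟩ := key false a ha
  obtain ⟨v, v1, v2⟩ := key true b hb
  exact hG.eq_of_mem_inner (z := (u, v)) hK hK' ⟨u1, v1⟩ ⟨u2, v2⟩

theorem nbr_unique (hG : IsGrid Ω G) {c b : Bool} {K E E' : Rect} (hE : E ∈ G) (hE' : E' ∈ G)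
    (h : Nbr c b K E) (h' : Nbr c b K E') : E = E' := by
  have h1 := h.1.symm.trans h'.1
  have h2 := fun b' => (h.2 b').symm.trans (h'.2 b')
  cases c
  · exact hG.eq_of_corner hE hE' h1 (h2 false)
  · exact hG.eq_of_corner hE hE' (h2 false) h1

/-- Step across the edge from a point in its relative interior. The cell reached contains that
point, which is not a vertex of `K`; by conformity the two cells share the full edge. -/
theorem exists_nbr (hG : IsGrid Ω G) {c b : Bool} {K : Rect} (hK : K ∈ G) {t : ℝ}
    (ht : t ∈ Ioo (K.side (!c) false) (K.side (!c) true)) (hz : pt c (K.side c b) t ∈ Ω) :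
    ∃ E ∈ G, Nbr c b K E := by
  rw [hG.fill] at hz
  obtain ⟨E, hE, h1, ε, hε, h2⟩ := exists_cell_direction hz (pt c (cond b 1 (-1)) 0)
  have e : pt c (K.side c b) t + ε • pt c (cond b 1 (-1)) 0 =
      pt c (K.side c b + cond b ε (-ε)) t := by
    cases c <;> cases b <;> simp [pt]
  rw [e] at h2
  have hlt := K.side_lt c
  have hne : K ≠ E := by
    rintro rfl
    have h3 := (Rect.pt_mem_closed.1 h2).1
    cases b
    · have := h3.1
      simp only [cond_false] at this
      linarith
    · have := h3.2
      simp only [cond_true] at this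
      linarith
  have hzK : pt c (K.side c b) t ∈ K.closed := by
    refine Rect.pt_mem_closed.2 ⟨?_, Ioo_subset_Icc_self ht⟩
    cases b
    · exact left_mem_Icc.2 hlt.le
    · exact right_mem_Icc.2 hlt.le
  have hm : pt c (K.side c b) t ∈ K.closed ∩ E.closed := ⟨hzK, h1⟩
  rcases hG.conforming K hK E hE hne with h | ⟨a, ha, -, h⟩ | ⟨f, f', h, h'⟩
  · rw [h] at hm
    exact hm.elim
  · rw [h, mem_singleton_iff] at hm
    exact absurd (hm ▸ ha) (Rect.pt_not_mem_vertices ht)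
  · obtain ⟨rfl, rfl⟩ := Rect.pt_mem_edge ht (h ▸ hm)
    obtain ⟨-, k1, k2⟩ := Rect.edge_eq_edge (h.symm.trans h')
    refine ⟨E, hE, ?_, k2⟩
    have h3 := (Rect.pt_mem_closed.1 h2).1
    rw [k1] at h3 ⊢
    congr 1
    -- The common edge must be the opposite side of `E`: otherwise `E` would lie on the same side of
    -- the line as `K` and miss the displaced point.
    generalize f.upper = b at h3
    cases b <;> cases hu : f'.upper <;> rw [hu] at h3 <;> simp only [Bool.not_true, Bool.not_false]
    · have := h3.1
      simp only [cond_false] at this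
      linarith
    · have := h3.2
      simp only [cond_true] at this
      linarith

/-- The closed edges without neighbour do not meet the domain. -/
theorem not_mem_of_wall (hG : IsGrid Ω G) {c b : Bool} {K : Rect} (hK : K ∈ G)
    (hw : ∀ E ∈ G, ¬ Nbr c b K E) {t : ℝ}
    (ht : t ∈ Icc (K.side (!c) false) (K.side (!c) true)) : pt c (K.side c b) t ∉ Ω := by
  have ho : IsOpen Ω := hG.fill ▸ isOpen_interior
  have hcl : IsClosed {t : ℝ | pt c (K.side c b) t ∉ Ω} := by
    have hc : Continuous fun t : ℝ => pt c (K.side c b) t := by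
      cases c <;> simp only [pt, cond_true, cond_false] <;> fun_prop
    exact ho.isClosed_compl.preimage hc
  have hsub : Ioo (K.side (!c) false) (K.side (!c) true) ⊆ {t : ℝ | pt c (K.side c b) t ∉ Ω} := by
    intro s hs hz
    obtain ⟨E, hE, h⟩ := hG.exists_nbr hK hs hz
    exact hw E hE h
  -- The domain is open, so the end points of the edge are also excluded.
  have := hcl.closure_subset_iff.2 hsub
  rw [closure_Ioo (K.side_lt _).ne] at this
  exact this ht

theorem inner_subset (hG : IsGrid Ω G) {K : Rect} (hK : K ∈ G) : K.inner ⊆ Ω := by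
  rw [hG.fill]
  refine interior_maximal (fun z hz => ?_) K.isOpen_inner
  exact mem_biUnion (Finset.mem_coe.2 hK) (K.inner_subset_closed hz)

end IsGrid

/-- The end point of a union of two adjacent intervals is interior. -/
theorem union_mem_nhds {K E : Rect} {c b : Bool} (h : K.side c b = E.side c (!b)) :
    Icc (K.side c false) (K.side c true) ∪ Icc (E.side c false) (E.side c true) ∈
      nhds (K.side c b) := by
  have h1 := K.side_lt c
  have h2 := E.side_lt c
  cases b
  · rw [Bool.not_false] at h
    rw [union_comm, h, Icc_union_Icc_eq_Icc h2.le (h ▸ h1.le)]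
    exact Icc_mem_nhds h2 (h ▸ h1)
  · rw [Bool.not_true] at h
    rw [h, Icc_union_Icc_eq_Icc (h ▸ h1.le) h2.le]
    exact Icc_mem_nhds (h ▸ h1) h2

namespace IsGrid

variable {Ω : Set (ℝ × ℝ)} {G : Finset Rect}

/-- If a cell has neighbours on both sides of a corner, and these have neighbours around the
corner, then the latter coincide and the corner belongs to the domain. -/
theorem corner (hG : IsGrid Ω G) {K E N D D' : Rect} (hK : K ∈ G) (hE : E ∈ G) (hN : N ∈ G)
    (hD : D ∈ G) (hD' : D' ∈ G) {a b : Bool} (hKE : Nbr false a K E) (hKN : Nbr true b K N)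
    (hED : Nbr true b E D) (hND : Nbr false a N D') :
    D = D' ∧ (K.side false a, K.side true b) ∈ Ω := by
  have kE : ∀ b', K.side true b' = E.side true b' := hKE.2
  have kN : ∀ b', K.side false b' = N.side false b' := hKN.2
  have kD : ∀ b', E.side false b' = D.side false b' := hED.2
  have kD' : ∀ b', N.side true b' = D'.side true b' := hND.2
  have e1 : D.side false (!a) = D'.side false (!a) := by
    rw [← hND.1, ← kD (!a), ← hKE.1]
    exact kN a
  have e2 : D.side true (!b) = D'.side true (!b) := by
    rw [← hED.1, ← kD' (!b), ← hKN.1]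
    exact (kE b).symm
  have hDD : D = D' := hG.eq_of_corner hD hD' e1 e2
  subst hDD
  refine ⟨rfl, ?_⟩
  -- The four cells around the corner cover a neighbourhood of it.
  have hmem := prod_mem_nhds (union_mem_nhds hKE.1) (union_mem_nhds hKN.1)
  rw [hG.fill, domain, mem_interior_iff_mem_nhds]
  refine Filter.mem_of_superset hmem ?_
  rintro ⟨x, y⟩ ⟨hx, hy⟩
  have m : ∀ {F : Rect}, F ∈ G → x ∈ Icc (F.side false false) (F.side false true) →
      y ∈ Icc (F.side true false) (F.side true true) → (x, y) ∈ ⋃ K ∈ (G : Set Rect), K.closed :=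
    fun hF h1 h2 => mem_biUnion (Finset.mem_coe.2 hF) ⟨h1, h2⟩
  rcases hx with hx | hx <;> rcases hy with hy | hy
  · exact m hK hx hy
  · refine m hN ?_ hy
    rw [← kN false, ← kN true]
    exact hx
  · refine m hE hx ?_
    rw [← kE false, ← kE true]
    exact hy
  · refine m hD ?_ ?_
    · rw [← kD false, ← kD true]
      exact hx
    · rw [← kD' false, ← kD' true]
      exact hy

end IsGrid

/-! ### Cells near a given cell -/

open Classical in
/-- The cells sharing an edge with `K`, and `K` itself. -/
noncomputable def star (G : Finset Rect) (K : Rect) : Finset Rect :=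
  G.filter fun K' => K = K' ∨ ∃ c b, Nbr c b K K'

open Classical in
/-- The cells at most three steps from `K`. -/
noncomputable def star₃ (G : Finset Rect) (K : Rect) : Finset Rect :=
  (star G K).biUnion fun K₁ => (star G K₁).biUnion (star G)

theorem mem_star {G : Finset Rect} {K K' : Rect} :
    K' ∈ star G K ↔ K' ∈ G ∧ (K = K' ∨ ∃ c b, Nbr c b K K') := by
  classical
  exact Finset.mem_filter

theorem mem_star₃ {G : Finset Rect} {K K' : Rect} :
    K' ∈ star₃ G K ↔ ∃ K₁ ∈ star G K, ∃ K₂ ∈ star G K₁, K' ∈ star G K₂ := by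
  classical
  simp only [star₃, Finset.mem_biUnion]

theorem star_self {G : Finset Rect} {K : Rect} (hK : K ∈ G) : K ∈ star G K :=
  mem_star.2 ⟨hK, .inl rfl⟩

theorem Nbr.mem_star {G : Finset Rect} {c b : Bool} {K K' : Rect} (h : Nbr c b K K')
    (hK' : K' ∈ G) : K' ∈ star G K := RRM.mem_star.2 ⟨hK', .inr ⟨c, b, h⟩⟩

theorem star_symm {G : Finset Rect} {K K' : Rect} (hK : K ∈ G) (h : K' ∈ star G K) :
    K ∈ star G K' := by
  obtain ⟨-, rfl | ⟨c, b, h⟩⟩ := mem_star.1 h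
  · exact star_self hK
  · exact h.symm.mem_star hK

theorem star_subset (G : Finset Rect) (K : Rect) : star G K ⊆ G := fun _ h => (mem_star.1 h).1

theorem star₃_subset (G : Finset Rect) (K : Rect) : star₃ G K ⊆ G := by
  intro K' h
  obtain ⟨_, _, _, _, h⟩ := mem_star₃.1 h
  exact star_subset _ _ h

/-- Reverse the path of neighbours. The symmetry permits exchanging the order of summation in the
global estimate. -/
theorem star₃_symm {G : Finset Rect} {K K' : Rect} (hK : K ∈ G) (h : K' ∈ star₃ G K) :
    K ∈ star₃ G K' := by
  obtain ⟨K₁, h1, K₂, h2, h3⟩ := mem_star₃.1 h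
  have g1 := star_subset _ _ h1
  have g2 := star_subset _ _ h2
  exact mem_star₃.2 ⟨K₂, star_symm g2 h3, K₁, star_symm g1 h2, star_symm hK h1⟩

theorem IsGrid.card_star_le {Ω : Set (ℝ × ℝ)} {G : Finset Rect} (hG : IsGrid Ω G) (K : Rect) :
    (star G K).card ≤ 5 := by
  classical
  have hsub : star G K ⊆
      insert K ((Finset.univ : Finset (Bool × Bool)).biUnion fun x => G.filter (Nbr x.1 x.2 K)) := by
    intro K' h
    obtain ⟨h1, rfl | ⟨c, b, h⟩⟩ := mem_star.1 h
    · exact Finset.mem_insert_self _ _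
    · exact Finset.mem_insert_of_mem (Finset.mem_biUnion.2
        ⟨(c, b), Finset.mem_univ _, Finset.mem_filter.2 ⟨h1, h⟩⟩)
  have hcard : ((Finset.univ : Finset (Bool × Bool)).biUnion
      fun x => G.filter (Nbr x.1 x.2 K)).card ≤ Finset.card (Finset.univ : Finset (Bool × Bool)) * 1 := by
    refine Finset.card_biUnion_le_card_mul _ _ _ fun x _ => Finset.card_le_one.2 ?_
    intro E hE E' hE'
    obtain ⟨h1, h2⟩ := Finset.mem_filter.1 hE
    obtain ⟨h3, h4⟩ := Finset.mem_filter.1 hE'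
    exact hG.nbr_unique h1 h3 h2 h4
  refine (Finset.card_le_card hsub).trans ((Finset.card_insert_le _ _).trans ?_)
  simp only [Finset.card_univ, Fintype.card_prod, Fintype.card_bool] at hcard
  omega

theorem IsGrid.card_star₃_le {Ω : Set (ℝ × ℝ)} {G : Finset Rect} (hG : IsGrid Ω G) (K : Rect) :
    (star₃ G K).card ≤ 125 := by
  classical
  have h2 : ∀ K, ((star G K).biUnion (star G)).card ≤ 25 := fun K =>
    (Finset.card_biUnion_le_card_mul _ _ 5 fun _ _ => hG.card_star_le _).trans
      (Nat.mul_le_mul_right 5 (hG.card_star_le K))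
  exact (Finset.card_biUnion_le_card_mul _ _ 25 fun _ _ => h2 _).trans
    (Nat.mul_le_mul_right 25 (hG.card_star_le K))

/-! ### Patches of actual and virtual neighbours -/

/-- Column or row at the lower or upper end of a patch. -/
def ix (b : Bool) : Fin 3 := cond b 2 0

/-- First or last grid line. -/
def endIx (b : Bool) : Fin 4 := cond b 3 0

/-- Column and row of a neighbour of the centre of a patch. -/
def idx (c b : Bool) : Fin 3 × Fin 3 := cond c (1, ix b) (ix b, 1)

theorem index_cases (i j : Fin 3) : (i = 1 ∧ j = 1) ∨ (∃ c b, i = (idx c b).1 ∧ j = (idx c b).2) ∨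
    ∃ a b, i = ix a ∧ j = ix b := by
  revert i j
  decide

namespace Patch

/-- The grid lines orthogonal to an axis. -/
def knot (p : Patch) (c : Bool) : Fin 4 → ℝ := cond c p.Y p.X

/-- `P` is a patch of rectangles around `K` that contains all the neighbours of `K` in `G`. -/
def IsFrame (P : Patch) (G : Finset Rect) (K : Rect) : Prop :=
  P.cell 1 1 = K ∧ ∀ c b, ∀ E ∈ G, Nbr c b K E → P.knot c (endIx b) = E.side c b

theorem nbr_idx (P : Patch) (c b : Bool) :
    Nbr c b (P.cell 1 1) (P.cell (idx c b).1 (idx c b).2) := by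
  cases c <;> cases b <;> refine ⟨rfl, ?_⟩ <;> rintro (_ | _) <;> rfl

theorem side_idx (P : Patch) (c b : Bool) :
    (P.cell (idx c b).1 (idx c b).2).side c b = P.knot c (endIx b) := by
  cases c <;> cases b <;> rfl

theorem side_corner (P : Patch) (a b : Bool) :
    (P.cell (ix a) (ix b)).side false (!a) = (P.cell 1 1).side false a ∧
    (P.cell (ix a) (ix b)).side false a = P.knot false (endIx a) ∧
    (P.cell (ix a) (ix b)).side true (!b) = (P.cell 1 1).side true b ∧
    (P.cell (ix a) (ix b)).side true b = P.knot true (endIx b) := by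
  cases a <;> cases b <;> exact ⟨rfl, rfl, rfl, rfl⟩

theorem cell_mem_star {p : Patch} {G : Finset Rect} (h : p.cells ⊆ (G : Set Rect)) (i j : Fin 3) :
    p.cell 1 j ∈ star G (p.cell i j) ∧ p.cell i 1 ∈ star G (p.cell i j) := by
  have hm : ∀ i j, p.cell i j ∈ G := fun i j => Finset.mem_coe.1 (h ⟨i, j, rfl⟩)
  constructor
  · fin_cases i
    · refine Nbr.mem_star (c := false) (b := true) ⟨rfl, ?_⟩ (hm _ _)
      rintro (_ | _) <;> rfl
    · exact star_self (hm _ _)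
    · refine Nbr.mem_star (c := false) (b := false) ⟨rfl, ?_⟩ (hm _ _)
      rintro (_ | _) <;> rfl
  · fin_cases j
    · refine Nbr.mem_star (c := true) (b := true) ⟨rfl, ?_⟩ (hm _ _)
      rintro (_ | _) <;> rfl
    · exact star_self (hm _ _)
    · refine Nbr.mem_star (c := true) (b := false) ⟨rfl, ?_⟩ (hm _ _)
      rintro (_ | _) <;> rfl

/-- The cells of the cross of a patch are near every cell of the patch. -/
theorem cell_mem_star₃ {p : Patch} {G : Finset Rect} (h : p.cells ⊆ (G : Set Rect))
    (i j : Fin 3) {i' j' : Fin 3} (h' : i' = 1 ∨ j' = 1) :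
    p.cell i' j' ∈ star₃ G (p.cell i j) := by
  have hm : ∀ i j, p.cell i j ∈ G := fun i j => Finset.mem_coe.1 (h ⟨i, j, rfl⟩)
  refine mem_star₃.2 ⟨_, (cell_mem_star h i j).1, _, (cell_mem_star h 1 j).2, ?_⟩
  rcases h' with rfl | rfl
  · exact star_symm (hm _ _) (cell_mem_star h _ _).2
  · exact star_symm (hm _ _) (cell_mem_star h _ _).1

end Patch

theorem ext_sides {K K' : Rect} {a b : Bool} (h1 : K.side false (!a) = K'.side false (!a))
    (h2 : K.side false a = K'.side false a) (h3 : K.side true (!b) = K'.side true (!b))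
    (h4 : K.side true b = K'.side true b) : K = K' := by
  cases a <;> cases b
  · exact Rect.ext h2 h1 h4 h3
  · exact Rect.ext h2 h1 h3 h4
  · exact Rect.ext h1 h2 h4 h3
  · exact Rect.ext h1 h2 h3 h4

theorem Nbr.eq_of_side {c b : Bool} {K E E' : Rect} (h : Nbr c b K E) (h' : Nbr c b K E')
    (hs : E.side c b = E'.side c b) : E = E' := by
  refine Rect.ext_axis (c := c) ?_ fun b' => (h.2 b').symm.trans (h'.2 b')
  intro b'
  have h1 := h.1.symm.trans h'.1
  cases b <;> cases b' <;> first | exact hs | exact h1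

namespace Patch

theorem IsFrame.nbr {P : Patch} {G : Finset Rect} {K E : Rect} (hP : P.IsFrame G K) (hE : E ∈ G)
    {c b : Bool} (h : Nbr c b K E) : P.cell (idx c b).1 (idx c b).2 = E := by
  have h1 := P.nbr_idx c b
  rw [hP.1] at h1
  exact h1.eq_of_side h ((P.side_idx c b).trans (hP.2 c b E hE h))

theorem IsFrame.corner {P : Patch} {G : Finset Rect} {K E N D : Rect} (hP : P.IsFrame G K)
    (hE : E ∈ G) (hN : N ∈ G) {a b : Bool} (hKE : Nbr false a K E) (hKN : Nbr true b K N)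
    (hED : Nbr true b E D) (hND : Nbr false a N D) : P.cell (ix a) (ix b) = D := by
  obtain ⟨s1, s2, s3, s4⟩ := P.side_corner a b
  rw [hP.1] at s1 s3
  have kE : ∀ b', K.side true b' = E.side true b' := hKE.2
  have kN : ∀ b', K.side false b' = N.side false b' := hKN.2
  have kD : ∀ b', E.side false b' = D.side false b' := hED.2
  have kD' : ∀ b', N.side true b' = D.side true b' := hND.2
  refine ext_sides (a := a) (b := b) ?_ ?_ ?_ ?_
  · rw [s1, kN, hND.1]
  · rw [s2, hP.2 _ _ _ hE hKE, kD]
  · rw [s3, kE, hED.1]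
  · rw [s4, hP.2 _ _ _ hN hKN, kD']

theorem IsPatchOf.isFrame {p : Patch} {Ω : Set (ℝ × ℝ)} {G : Finset Rect} (hG : IsGrid Ω G)
    {K : Rect} (hp : p.IsPatchOf G K) : p.IsFrame G K := by
  refine ⟨hp.1, fun c b E hE h => ?_⟩
  have h1 := p.nbr_idx c b
  rw [hp.1] at h1
  rw [← p.side_idx, hG.nbr_unique (hp.2 ⟨_, _, rfl⟩) hE h1 h]

theorem strictMono_of_lt {a b c d : ℝ} (h1 : a < b) (h2 : b < c) (h3 : c < d) :
    StrictMono ![a, b, c, d] := by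
  refine Fin.strictMono_iff_lt_succ.2 fun i => ?_
  fin_cases i
  · exact h1
  · exact h2
  · exact h3

/-- Use the actual outer grid line where a neighbour exists, and otherwise a virtual one. This
allows Marsden's identity on every cell, including those at the boundary, while the distance of the
lines from `K` stays controlled. -/
theorem exists_frame {Ω : Set (ℝ × ℝ)} {G : Finset Rect} (hG : IsGrid Ω G) (K : Rect) :
    ∃ P : Patch, P.IsFrame G K ∧ ∀ c b, (∃ E ∈ G, Nbr c b K E) ∨
      |P.knot c (endIx b) - K.side c b| ≤ K.side c true - K.side c false := by
  have key : ∀ c b, ∃ v, (∀ E ∈ G, Nbr c b K E → v = E.side c b) ∧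
      (b = false → v < K.side c false) ∧ (b = true → K.side c true < v) ∧
      ((∃ E ∈ G, Nbr c b K E) ∨ |v - K.side c b| ≤ K.side c true - K.side c false) := by
    intro c b
    have hlt := K.side_lt c
    by_cases hE : ∃ E ∈ G, Nbr c b K E
    · obtain ⟨E, hE, h⟩ := hE
      refine ⟨E.side c b, fun E' hE' h' => by rw [hG.nbr_unique hE hE' h h'], ?_, ?_,
        .inl ⟨E, hE, h⟩⟩
      · rintro rfl
        exact (E.side_lt c).trans_eq h.1.symm
      · rintro rfl
        exact h.1.trans_lt (E.side_lt c)
    · push Not at hE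
      -- Without a neighbour, add a virtual column or row with the extent of `K` itself.
      refine ⟨cond b (K.side c true + (K.side c true - K.side c false))
        (K.side c false - (K.side c true - K.side c false)),
        fun E' hE' h' => absurd h' (hE E' hE'), ?_, ?_, .inr ?_⟩
      · rintro rfl
        rw [cond_false]
        linarith
      · rintro rfl
        rw [cond_true]
        linarith
      · cases b
        · rw [cond_false, sub_sub_cancel_left, abs_neg, abs_of_pos (sub_pos.2 hlt)]
        · rw [cond_true, add_sub_cancel_left, abs_of_pos (sub_pos.2 hlt)]
  choose v h1 h2 h3 h4 using key
  refine ⟨⟨![v false false, K.x₀, K.x₁, v false true], ![v true false, K.y₀, K.y₁, v true true],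
    strictMono_of_lt (h2 _ _ rfl) K.hx (h3 false _ rfl),
    strictMono_of_lt (h2 _ _ rfl) K.hy (h3 true _ rfl)⟩, ⟨rfl, fun c b E hE h => ?_⟩, ?_⟩
  · rw [← h1 c b E hE h]
    cases c <;> cases b <;> rfl
  · intro c b
    refine (h4 c b).imp id fun h => ?_
    cases c <;> cases b <;> exact h

/-- The cells of `p` next to `K` in its row and column are neighbours of `K` in the grid, so the
frame passes through the same lines. Thus the basis function of `p` restricted to `K` is a local
basis function of the frame. -/
theorem IsFrame.knotMatch {P p : Patch} {G : Finset Rect} {K : Rect} (hP : P.IsFrame G K)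
    (hp : p.cells ⊆ (G : Set Rect)) {i j : Fin 3} (hK : p.cell i j = K) :
    KnotMatch P.X p.X i ∧ KnotMatch P.Y p.Y j := by
  have hm : ∀ i j, p.cell i j ∈ G := fun i j => Finset.mem_coe.1 (hp ⟨i, j, rfl⟩)
  have hPK := hP.1.trans hK.symm
  have gen : ∀ (t s : Fin 4 → ℝ) (i : Fin 3), t 1 = s i.castSucc → t 2 = s i.succ →
      (∀ i' : Fin 3, i'.succ = i.castSucc → t 0 = s i'.castSucc) →
      (∀ i' : Fin 3, i'.castSucc = i.succ → t 3 = s i'.succ) → KnotMatch t s i := by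
    intro t s i e1 e2 e0 e3 a b hab
    have hi := i.isLt
    have hb := b.isLt
    fin_cases a
    · have hb3 : (b : ℕ) < 3 := by simp at hab; omega
      refine e0 ⟨b, hb3⟩ (Fin.ext ?_)
      simp at hab ⊢
      omega
    · have : b = i.castSucc := Fin.ext (by simp at hab ⊢; omega)
      rw [this]
      exact e1
    · have : b = i.succ := Fin.ext (by simp at hab ⊢; omega)
      rw [this]
      exact e2
    · have hb1 : (b : ℕ) - 1 < 3 := by omega
      have := e3 ⟨b - 1, hb1⟩ (Fin.ext (by simp at hab ⊢; omega))
      refine this.trans (congrArg s (Fin.ext ?_))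
      simp at hab ⊢
      omega
  constructor
  · refine gen _ _ _ (congrArg Rect.x₀ hPK) (congrArg Rect.x₁ hPK) (fun i' h => ?_) fun i' h => ?_
    · refine hP.2 false false _ (hm i' j) ⟨?_, ?_⟩
      · rw [← hK]
        exact congrArg p.X h.symm
      · rw [← hK]
        rintro (_ | _) <;> rfl
    · refine hP.2 false true _ (hm i' j) ⟨?_, ?_⟩
      · rw [← hK]
        exact congrArg p.X h.symm
      · rw [← hK]
        rintro (_ | _) <;> rfl
  · refine gen _ _ _ (congrArg Rect.y₀ hPK) (congrArg Rect.y₁ hPK) (fun j' h => ?_) fun j' h => ?_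
    · refine hP.2 true false _ (hm i j') ⟨?_, ?_⟩
      · rw [← hK]
        exact congrArg p.Y h.symm
      · rw [← hK]
        rintro (_ | _) <;> rfl
    · refine hP.2 true true _ (hm i j') ⟨?_, ?_⟩
      · rw [← hK]
        exact congrArg p.Y h.symm
      · rw [← hK]
        rintro (_ | _) <;> rfl

end Patch

/-! ### Interior cells or walls -/

/-- No cell near `K` has an edge without neighbour on a line through a side of `R`. -/
def NoWall (G : Finset Rect) (K R : Rect) : Prop :=
  ∀ W ∈ star₃ G K, ∀ c b b', W.side c b = R.side c b' → ∃ E ∈ G, Nbr c b W E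

/-- All the eight cells around `F` are in `G`, and its vertices are in `Ω`. -/
def Surrounded (Ω : Set (ℝ × ℝ)) (G : Finset Rect) (F : Rect) : Prop :=
  ∀ a b, (F.side false a, F.side true b) ∈ Ω ∧ ∃ E ∈ G, ∃ N ∈ G, ∃ D ∈ G,
    Nbr false a F E ∧ Nbr true b F N ∧ Nbr true b E D ∧ Nbr false a N D

namespace IsGrid

variable {Ω : Set (ℝ × ℝ)} {G : Finset Rect}

/-- Walk from `F` around a corner in both ways. Each step crosses a line through a side of `F`, so
it never meets a wall; `corner` shows that both walks end in the same cell and that the corner is in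
`Ω`. -/
theorem surrounded_of_noWall (hG : IsGrid Ω G) {K K₁ F : Rect} (h1 : K₁ ∈ star G K)
    (h2 : F ∈ star G K₁) (h : NoWall G K F) : Surrounded Ω G F := by
  intro a b
  have hF := star_subset _ _ h2
  have hm : ∀ W ∈ star G F, W ∈ star₃ G K := fun W hW => mem_star₃.2 ⟨_, h1, _, h2, hW⟩
  obtain ⟨E, hE, hFE⟩ := h F (hm _ (star_self hF)) false a a rfl
  obtain ⟨N, hN, hFN⟩ := h F (hm _ (star_self hF)) true b b rfl
  obtain ⟨D, hD, hED⟩ := h E (hm _ (hFE.mem_star hE)) true b b (hFE.2 b).symm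
  obtain ⟨D', hD', hND⟩ := h N (hm _ (hFN.mem_star hN)) false a a (hFN.2 a).symm
  obtain ⟨rfl, hv⟩ := hG.corner hF hE hN hD hD' hFE hFN hED hND
  exact ⟨hv, E, hE, N, hN, D, hD, hFE, hFN, hED, hND⟩

/-- With all eight surrounding cells present, nothing in the frame of `F` is virtual, and the frame
is the patch. -/
theorem exists_patch (hG : IsGrid Ω G) {F : Rect} (hF : F ∈ G) (h : Surrounded Ω G F) :
    ∃ p : Patch, p.IsPatchOf G F := by
  obtain ⟨P, hP, -⟩ := Patch.exists_frame hG F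
  refine ⟨P, hP.1, ?_⟩
  rintro _ ⟨i, j, rfl⟩
  rw [Finset.mem_coe]
  rcases index_cases i j with ⟨rfl, rfl⟩ | ⟨c, b, rfl, rfl⟩ | ⟨a, b, rfl, rfl⟩
  · rwa [hP.1]
  · obtain ⟨-, E, hE, N, hN, -, -, h1, h2, -⟩ := h b b
    cases c
    · rwa [hP.nbr hE h1]
    · rwa [hP.nbr hN h2]
  · obtain ⟨-, E, hE, N, hN, D, hD, h1, h2, h3, h4⟩ := h a b
    rwa [hP.corner hE hN h1 h2 h3 h4]

theorem mem_interiorCells (hG : IsGrid Ω G) {F : Rect} (hF : F ∈ G) (h : Surrounded Ω G F) :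
    F ∈ interiorCells G := by
  classical
  refine Finset.mem_filter.2 ⟨hF, fun a ha => ?_⟩
  rw [← hG.fill]
  have ho : IsOpen Ω := hG.fill ▸ isOpen_interior
  have ha' : a ∈ Ω := by
    simp only [Rect.vertices, mem_insert_iff, mem_singleton_iff] at ha
    rcases ha with rfl | rfl | rfl | rfl
    · exact (h false false).1
    · exact (h true false).1
    · exact (h false true).1
    · exact (h true true).1
  rw [ho.frontier_eq]
  exact fun h => h.2 ha'

/-- A rectangle of the frame of `K` without walls on its lines is an interior cell of the grid, and
`K` belongs to its patch. -/
theorem frame_cell_of_noWall (hG : IsGrid Ω G) {K : Rect} (hK : K ∈ G) {P : Patch}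
    (hP : P.IsFrame G K) {i j : Fin 3} (h : NoWall G K (P.cell i j)) :
    P.cell i j ∈ G ∧ Surrounded Ω G (P.cell i j) ∧
      ∀ p : Patch, p.IsPatchOf G (P.cell i j) → K ∈ p.cells := by
  have hKK := star_self hK
  have hK3 : ∀ W ∈ star G K, W ∈ star₃ G K := fun W hW => mem_star₃.2 ⟨_, hKK, _, hKK, hW⟩
  rcases index_cases i j with ⟨rfl, rfl⟩ | ⟨c, b, rfl, rfl⟩ | ⟨a, b, rfl, rfl⟩
  · rw [hP.1] at h ⊢
    exact ⟨hK, hG.surrounded_of_noWall hKK hKK h, fun p hp => ⟨1, 1, hp.1.symm⟩⟩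
  · have h1 := P.nbr_idx c b
    rw [hP.1] at h1
    -- The cell of the frame shares a side line with `K`. No wall there means that `K` has a
    -- neighbour across it, and the frame then contains this actual cell.
    obtain ⟨E, hE, hKE⟩ := h K (hK3 _ hKK) c b (!b) h1.1
    rw [hP.nbr hE hKE] at h ⊢
    refine ⟨hE, hG.surrounded_of_noWall hKK (hKE.mem_star hE) h, fun p hp => ?_⟩
    exact ⟨_, _, ((hp.isFrame hG).nbr hK hKE.symm).symm⟩
  · obtain ⟨s1, s2, s3, s4⟩ := P.side_corner a b
    rw [hP.1] at s1 s3
    obtain ⟨E, hE, hKE⟩ := h K (hK3 _ hKK) false a (!a) s1.symm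
    obtain ⟨N, hN, hKN⟩ := h K (hK3 _ hKK) true b (!b) s3.symm
    obtain ⟨D, hD, hED⟩ := h E (hK3 _ (hKE.mem_star hE)) true b (!b)
      (by rw [s3]; exact (hKE.2 b).symm)
    obtain ⟨D', hD', hND⟩ := h N (hK3 _ (hKN.mem_star hN)) false a (!a)
      (by rw [s1]; exact (hKN.2 a).symm)
    -- For a diagonal cell, the walks through `E` and through `N` arrive at the same cell, which is
    -- the one of the frame.
    obtain ⟨rfl, -⟩ := hG.corner hK hE hN hD hD' hKE hKN hED hND
    rw [hP.corner hE hN hKE hKN hED hND] at h ⊢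
    refine ⟨hD, hG.surrounded_of_noWall (hKE.mem_star hE) (hED.mem_star hD) h, fun p hp => ?_⟩
    exact ⟨_, _, ((hp.isFrame hG).corner hN hE hND.symm hED.symm hKN.symm hKE.symm).symm⟩

end IsGrid

/-! ### The quasi-interpolant belongs to the reduced Morley space -/

theorem Rect.normalMean_add_smul (K : Rect) (c c' : Fin 6 → ℝ) (r : ℝ) (e : Side) :
    K.normalMean (quad (r • c + c')) e =
      r * K.normalMean (quad c) e + K.normalMean (quad c') e := by
  have fst := fun (c : Fin 6 → ℝ) (x : ℝ) => mean_deriv_fst c x K.hy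
  have snd := fun (c : Fin 6 → ℝ) (y : ℝ) => mean_deriv_snd c y K.hx
  cases e <;> simp only [normalMean, hgt, len, fst, snd, Pi.add_apply, Pi.smul_apply,
    smul_eq_mul] <;> ring

theorem Rect.normalMean_zero (K : Rect) (e : Side) :
    K.normalMean (quad (0 : Fin 6 → ℝ)) e = 0 := by
  have h := K.normalMean_add_smul 0 0 1 e
  rw [smul_zero, zero_add] at h
  linarith

theorem quad_add_smul (c c' : Fin 6 → ℝ) (r : ℝ) (z : ℝ × ℝ) :
    quad (r • c + c') z = r * quad c z + quad c' z := by
  simp only [quad, Pi.add_apply, Pi.smul_apply, smul_eq_mul]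
  ring

theorem quad_zero (z : ℝ × ℝ) : quad (0 : Fin 6 → ℝ) z = 0 := by
  simp [quad]

theorem IsRRMZeroRep.add_smul {G : Set Rect} {w w' : ℝ × ℝ → ℝ} {c c' : Rect → Fin 6 → ℝ}
    (h : IsRRMZeroRep G w c) (h' : IsRRMZeroRep G w' c') (r : ℝ) :
    IsRRMZeroRep G (fun z => r * w z + w' z) (fun K => r • c K + c' K) where
  restrict K hK z hz := by rw [quad_add_smul, h.restrict K hK z hz, h'.restrict K hK z hz]
  vertex K hK K' hK' a ha ha' hd := by
    rw [quad_add_smul, quad_add_smul, h.vertex K hK K' hK' a ha ha' hd,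
      h'.vertex K hK K' hK' a ha ha' hd]
  edge K hK K' hK' e e' hee := by
    rw [Rect.normalMean_add_smul, Rect.normalMean_add_smul, h.edge K hK K' hK' e e' hee,
      h'.edge K hK K' hK' e e' hee]
  boundary_vertex K hK a ha hf := by
    rw [quad_add_smul, h.boundary_vertex K hK a ha hf, h'.boundary_vertex K hK a ha hf, mul_zero,
      add_zero]
  boundary_edge K hK e he := by
    rw [Rect.normalMean_add_smul, h.boundary_edge K hK e he, h'.boundary_edge K hK e he, mul_zero,
      add_zero]

theorem isRRMZeroRep_zero (G : Set Rect) : IsRRMZeroRep G (fun _ => 0) fun _ => 0 where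
  restrict _ _ z _ := (quad_zero z).symm
  vertex _ _ _ _ _ _ _ _ := by rw [quad_zero]
  edge K _ K' _ e e' _ := by rw [K.normalMean_zero, K'.normalMean_zero]
  boundary_vertex _ _ a _ _ := quad_zero a
  boundary_edge K _ e _ := K.normalMean_zero e

theorem Rect.vertices_subset_closed (K : Rect) : K.vertices ⊆ K.closed := by
  have h1 := K.hx.le
  have h2 := K.hy.le
  intro a ha
  simp only [vertices, mem_insert_iff, mem_singleton_iff] at ha
  rcases ha with rfl | rfl | rfl | rfl <;> simp [closed, h1, h2]

theorem Rect.edge_subset_closed (K : Rect) (e : Side) : K.edge e ⊆ K.closed := by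
  have h1 := K.hx.le
  have h2 := K.hy.le
  rintro ⟨x, y⟩ ha
  cases e <;> simp only [edge, mem_prod, mem_singleton_iff] at ha <;> obtain ⟨a1, a2⟩ := ha
  · exact ⟨by rw [a1]; exact left_mem_Icc.2 h1, a2⟩
  · exact ⟨by rw [a1]; exact right_mem_Icc.2 h1, a2⟩
  · exact ⟨a1, by rw [a2]; exact left_mem_Icc.2 h2⟩
  · exact ⟨a1, by rw [a2]; exact right_mem_Icc.2 h2⟩

/-! ### The basis function of a patch as an element of the space of the whole grid -/

namespace Patch

theorem coefs_eq_zero {p : Patch} {K : Rect} (h : K ∉ p.cells) : p.coefs K = 0 := by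
  refine dif_neg ?_
  rintro ⟨⟨i, j⟩, hij⟩
  exact h ⟨i, j, hij⟩

/-- The chosen basis function is known only through its defining properties; uniqueness identifies
its coefficients with the explicit spline ones. -/
theorem basis_rep (p : Patch) : IsRRMZeroRep p.cells p.basis p.coefs := by
  obtain ⟨-, c, hc, hv⟩ := p.basis_spec
  have e : ∀ K ∈ p.cells, p.coefs K = c K := by
    rintro _ ⟨i, j, rfl⟩
    rw [coefs_cell, p.rep_eq_coef hc hv]
  constructor
  · intro K hK z hz
    rw [e K hK]
    exact hc.restrict K hK z hz
  · intro K hK K' hK' a ha ha' hd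
    rw [e K hK, e K' hK']
    exact hc.vertex K hK K' hK' a ha ha' hd
  · intro K hK K' hK' s s' hs
    rw [e K hK, e K' hK']
    exact hc.edge K hK K' hK' s s' hs
  · intro K hK a ha hf
    rw [e K hK]
    exact hc.boundary_vertex K hK a ha hf
  · intro K hK s hs
    rw [e K hK]
    exact hc.boundary_edge K hK s hs

theorem closed_subset_box (p : Patch) {K : Rect} (hK : K ∈ p.cells) :
    K.closed ⊆ Icc (p.X 0) (p.X 3) ×ˢ Icc (p.Y 0) (p.Y 3) := by
  obtain ⟨i, j, rfl⟩ := hK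
  rintro z ⟨h1, h2⟩
  have e0 := p.hX.monotone (Fin.zero_le i.castSucc)
  have e1 := p.hX.monotone (Fin.le_last i.succ)
  have e2 := p.hY.monotone (Fin.zero_le j.castSucc)
  have e3 := p.hY.monotone (Fin.le_last j.succ)
  exact ⟨⟨e0.trans h1.1, h1.2.trans e1⟩, ⟨e2.trans h2.1, h2.2.trans e3⟩⟩

theorem exists_cell_of_mem_box (p : Patch) {z : ℝ × ℝ}
    (hz : z ∈ Icc (p.X 0) (p.X 3) ×ˢ Icc (p.Y 0) (p.Y 3)) : ∃ K ∈ p.cells, z ∈ K.closed := by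
  obtain ⟨i, hi⟩ := exists_piece hz.1
  obtain ⟨j, hj⟩ := exists_piece hz.2
  exact ⟨_, ⟨i, j, rfl⟩, hi, hj⟩

variable {Ω : Set (ℝ × ℝ)} {G : Finset Rect}

/-- A cell of the grid that meets the interior of the patch belongs to the patch. -/
theorem mem_cells_of_mem_domain (hG : IsGrid Ω G) {p : Patch} (hp : p.cells ⊆ (G : Set Rect))
    {K : Rect} (hK : K ∈ G) {z : ℝ × ℝ} (hz : z ∈ K.closed) (hd : z ∈ domain p.cells) :
    K ∈ p.cells := by
  rw [← K.closure_inner] at hz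
  obtain ⟨y, hy1, hy2⟩ := mem_closure_iff.1 hz _ isOpen_interior hd
  obtain ⟨K', hK', h⟩ := mem_iUnion₂.1 (interior_subset hy1)
  rwa [hG.eq_of_mem_inner hK (Finset.mem_coe.1 (hp hK')) hy2 h]

/-- A grid cell outside the patch meets the patch only on its boundary, where the vertex values and
edge means of the basis function vanish. So extension by zero keeps all continuity conditions. The
boundary of the grid does not enter the interior of the patch, which gives the boundary conditions.
-/
theorem basis_rep_grid (hG : IsGrid Ω G) {p : Patch} (hp : p.cells ⊆ (G : Set Rect)) :
    IsRRMZeroRep (G : Set Rect) p.basis p.coefs := by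
  have hr := p.basis_rep
  have hsub : domain p.cells ⊆ domain (G : Set Rect) :=
    interior_mono (biUnion_subset_biUnion_left hp)
  have hfr : ∀ K ∈ p.cells, ∀ z ∈ K.closed, z ∉ domain p.cells → z ∈ frontier (domain p.cells) := by
    intro K hK z hz hd
    refine p.mem_frontier (p.closed_subset_box hK hz) ?_
    rwa [← p.domain_cells]
  have hout : ∀ z ∈ frontier (domain (G : Set Rect)), z ∉ domain p.cells := by
    intro z hz hd
    have ho : IsOpen (domain (G : Set Rect)) := isOpen_interior
    rw [ho.frontier_eq] at hz
    exact hz.2 (hsub hd)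
  have hv : ∀ K ∈ p.cells, ∀ a ∈ K.vertices, a ∉ domain p.cells → quad (p.coefs K) a = 0 :=
    fun K hK a ha hd => hr.boundary_vertex K hK a ha (hfr K hK a (K.vertices_subset_closed ha) hd)
  have hedge : ∀ K ∈ p.cells, ∀ e, (∀ z ∈ K.edge e, z ∉ domain p.cells) →
      K.normalMean (quad (p.coefs K)) e = 0 :=
    fun K hK e hd => hr.boundary_edge K hK e fun z hz =>
      hfr K hK z (K.edge_subset_closed e hz) (hd z hz)
  constructor
  · intro K hK z hz
    by_cases hKp : K ∈ p.cells
    · exact hr.restrict K hKp z hz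
    · rw [coefs_eq_zero hKp, quad_zero]
      refine p.basis_spec.1 z fun hbox => hKp ?_
      obtain ⟨K', hK', hz'⟩ := p.exists_cell_of_mem_box hbox
      rwa [hG.eq_of_mem_inner hK (Finset.mem_coe.1 (hp hK')) hz hz']
  · have aux : ∀ K ∈ p.cells, ∀ K' ∈ G, K' ∉ p.cells → ∀ a ∈ K.vertices, a ∈ K'.vertices →
        quad (p.coefs K) a = 0 := by
      intro K hK K' hK' hn a ha ha'
      exact hv K hK a ha fun hd => hn (mem_cells_of_mem_domain hG hp hK'
        (K'.vertices_subset_closed ha') hd)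
    intro K hK K' hK' a ha ha' _
    by_cases h1 : K ∈ p.cells <;> by_cases h2 : K' ∈ p.cells
    · by_cases hd : a ∈ domain p.cells
      · exact hr.vertex K h1 K' h2 a ha ha' hd
      · rw [hv K h1 a ha hd, hv K' h2 a ha' hd]
    · rw [aux K h1 K' hK' h2 a ha ha', coefs_eq_zero h2, quad_zero]
    · rw [aux K' h2 K hK h1 a ha' ha, coefs_eq_zero h1, quad_zero]
    · rw [coefs_eq_zero h1, coefs_eq_zero h2]
  · have aux : ∀ K ∈ p.cells, ∀ K' ∈ G, K' ∉ p.cells → ∀ e e', K.edge e = K'.edge e' →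
        K.normalMean (quad (p.coefs K)) e = 0 := by
      intro K hK K' hK' hn e e' hee
      exact hedge K hK e fun z hz hd => hn (mem_cells_of_mem_domain hG hp hK'
        (K'.edge_subset_closed e' (hee ▸ hz)) hd)
    intro K hK K' hK' e e' hee
    by_cases h1 : K ∈ p.cells <;> by_cases h2 : K' ∈ p.cells
    · exact hr.edge K h1 K' h2 e e' hee
    · rw [aux K h1 K' hK' h2 e e' hee, coefs_eq_zero h2, Rect.normalMean_zero]
    · rw [aux K' h2 K hK h1 e' e hee.symm, coefs_eq_zero h1, Rect.normalMean_zero]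
    · rw [coefs_eq_zero h1, coefs_eq_zero h2, Rect.normalMean_zero, Rect.normalMean_zero]
  · intro K hK a ha hf
    by_cases h1 : K ∈ p.cells
    · exact hv K h1 a ha (hout a hf)
    · rw [coefs_eq_zero h1, quad_zero]
  · intro K hK e he
    by_cases h1 : K ∈ p.cells
    · exact hedge K h1 e fun z hz => hout z (he hz)
    · rw [coefs_eq_zero h1, Rect.normalMean_zero]

end Patch

open Classical in
/-- The coefficients of the quasi-interpolant on a cell. -/
noncomputable def interpCoef (G : Finset Rect) (v : ℝ × ℝ → ℝ) (K : Rect) : Fin 6 → ℝ :=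
  ∑ F ∈ interiorCells G,
    if h : ∃ p : Patch, p.IsPatchOf G F then h.choose.lam v • h.choose.coefs K else 0

theorem quasiInterp_rep {Ω : Set (ℝ × ℝ)} {G : Finset Rect} (hG : IsGrid Ω G) (v : ℝ × ℝ → ℝ) :
    IsRRMZeroRep (G : Set Rect) (quasiInterp G v) (interpCoef G v) := by
  classical
  have key : ∀ S : Finset Rect, IsRRMZeroRep (G : Set Rect)
      (fun z => ∑ F ∈ S, if h : ∃ p : Patch, p.IsPatchOf G F then
        h.choose.lam v * h.choose.basis z else 0)
      (fun K => ∑ F ∈ S, if h : ∃ p : Patch, p.IsPatchOf G F then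
        h.choose.lam v • h.choose.coefs K else 0) := by
    intro S
    induction S using Finset.induction_on with
    | empty => exact isRRMZeroRep_zero _
    | insert F S hF ih =>
      simp only [Finset.sum_insert hF]
      by_cases h : ∃ p : Patch, p.IsPatchOf G F
      · simp only [dif_pos h]
        exact (Patch.basis_rep_grid hG h.choose_spec.2).add_smul ih _
      · simp only [dif_neg h, zero_add]
        exact ih
  exact key _

/-! ### Shape regularity near a cell -/

/-- The sides of every cell are comparable. -/
def Regular (κ : ℝ) (G : Finset Rect) : Prop :=
  1 ≤ κ ∧ ∀ K ∈ G, ∀ c, K.size ≤ κ * (K.side c true - K.side c false)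

/-- The inradius is half the shorter side, hence the factor `γ₀ / 2`; the maximum with `1` makes
powers of `κ` monotone. -/
theorem IsShapeRegular.regular {γ₀ : ℝ} {G : Finset Rect} (h : IsShapeRegular γ₀ G) :
    Regular (max 1 (γ₀ / 2)) G := by
  refine ⟨le_max_left _ _, fun K hK c => ?_⟩
  have h1 := h K hK
  have hL := K.len_pos
  have hH := K.hgt_pos
  have hr : 0 < K.inradius := div_pos (lt_min hL hH) two_pos
  rw [div_le_iff₀ hr, Rect.inradius] at h1
  have h2 : min K.len K.hgt ≤ K.side c true - K.side c false := by
    cases c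
    · exact min_le_left _ _
    · exact min_le_right _ _
  have h3 : 0 < min K.len K.hgt := lt_min hL hH
  calc K.size ≤ γ₀ / 2 * min K.len K.hgt := by linarith
    _ ≤ max 1 (γ₀ / 2) * min K.len K.hgt := mul_le_mul_of_nonneg_right (le_max_right _ _) h3.le
    _ ≤ _ := mul_le_mul_of_nonneg_left h2 (by positivity)

theorem Rect.side_sub_le_size (K : Rect) (c : Bool) : K.side c true - K.side c false ≤ K.size := by
  cases c
  · exact K.len_le_size
  · exact K.hgt_le_size

section

variable {κ : ℝ} {G : Finset Rect} {K K' : Rect}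

/-- Neighbours share an edge, and its length is comparable with both sizes. Sizes are compared only
along short paths of neighbours, so the grid need not be quasi-uniform. -/
theorem Regular.size_le (hG : Regular κ G) (hK : K ∈ G) (h : K' ∈ star G K) :
    K.size ≤ κ * K'.size ∧ K'.size ≤ κ * K.size := by
  obtain ⟨hK', rfl | ⟨c, b, -, h⟩⟩ := mem_star.1 h
  · have h1 := K.size_pos
    have := mul_le_mul_of_nonneg_right hG.1 h1.le
    constructor <;> linarith
  · have h1 := hG.2 K hK (!c)
    have h2 := hG.2 K' hK' (!c)
    have h3 := K.side_sub_le_size (!c)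
    have h4 := K'.side_sub_le_size (!c)
    have hκ : 0 ≤ κ := zero_le_one.trans hG.1
    rw [h true, h false] at h1 h3
    exact ⟨h1.trans (mul_le_mul_of_nonneg_left h4 hκ), h2.trans (mul_le_mul_of_nonneg_left h3 hκ)⟩

theorem Regular.size_le₃ (hG : Regular κ G) (hK : K ∈ G) (h : K' ∈ star₃ G K) :
    K.size ≤ κ ^ 3 * K'.size ∧ K'.size ≤ κ ^ 3 * K.size := by
  obtain ⟨K₁, h1, K₂, h2, h3⟩ := mem_star₃.1 h
  have g1 := star_subset _ _ h1
  have g2 := star_subset _ _ h2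
  obtain ⟨a1, b1⟩ := hG.size_le hK h1
  obtain ⟨a2, b2⟩ := hG.size_le g1 h2
  obtain ⟨a3, b3⟩ := hG.size_le g2 h3
  have hκ : 0 ≤ κ := zero_le_one.trans hG.1
  constructor
  · calc K.size ≤ κ * (κ * (κ * K'.size)) := by
          refine a1.trans (mul_le_mul_of_nonneg_left (a2.trans ?_) hκ)
          exact mul_le_mul_of_nonneg_left a3 hκ
      _ = _ := by ring
  · calc K'.size ≤ κ * (κ * (κ * K.size)) := by
          refine b3.trans (mul_le_mul_of_nonneg_left (b2.trans ?_) hκ)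
          exact mul_le_mul_of_nonneg_left b1 hκ
      _ = _ := by ring

theorem Regular.sized (hG : Regular κ G) (hK : K ∈ G) (h : K' ∈ star₃ G K) :
    K'.Sized K.size (κ ^ 4) := by
  have hκ : 0 ≤ κ := zero_le_one.trans hG.1
  obtain ⟨h1, h2⟩ := hG.size_le₃ hK h
  have hK' := star₃_subset _ _ h
  have h3 : κ ^ 3 * K.size ≤ κ ^ 4 * K.size :=
    mul_le_mul_of_nonneg_right (pow_le_pow_right₀ hG.1 (by norm_num)) K.size_pos.le
  have h4 : ∀ c, K.size ≤ κ ^ 4 * (K'.side c true - K'.side c false) := fun c => by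
    calc K.size ≤ κ ^ 3 * (κ * (K'.side c true - K'.side c false)) :=
          h1.trans (mul_le_mul_of_nonneg_left (hG.2 K' hK' c) (by positivity))
      _ = _ := by ring
  exact ⟨h4 false, h4 true, (K'.len_le_size.trans h2).trans h3, (K'.hgt_le_size.trans h2).trans h3⟩

theorem Nbr.joined {c b : Bool} (h : Nbr c b K K') {d : ℝ} (hd : K.size + K'.size ≤ d) :
    Rect.Joined K K' d := by
  wlog hb : b = true generalizing b K K'
  · have hb' : b = false := by simpa using hb
    subst hb'
    exact (this h.symm (by rwa [add_comm]) rfl).symm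
  subst hb
  obtain ⟨h1, h2⟩ := h
  have e1 := h2 false
  have e2 := h2 true
  have s1 := K.len_le_size
  have s2 := K.hgt_le_size
  have s3 := K'.len_le_size
  have s4 := K'.hgt_le_size
  have p1 := K.size_pos
  have p2 := K'.size_pos
  have hx := K.hx
  have hy := K.hy
  have hx' := K'.hx
  have hy' := K'.hy
  cases c <;> simp only [Rect.side, Bool.not_true, Bool.not_false] at h1 e1 e2 <;>
    simp only [Rect.len, Rect.hgt] at s1 s2 s3 s4
  · refine ⟨⟨K.x₀, K'.x₁, K.y₀, K.y₁, by linarith, hy⟩, ?_, ?_, ?_, ?_⟩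
    · rintro z ⟨⟨a1, a2⟩, a3⟩
      exact ⟨⟨a1, by linarith⟩, a3⟩
    · rintro z ⟨⟨a1, a2⟩, a3⟩
      exact ⟨⟨by linarith, a2⟩, by dsimp only; rw [e1, e2]; exact a3⟩
    · rintro z ⟨⟨a1, a2⟩, a3⟩
      rcases le_total z.1 K.x₁ with h | h
      · exact .inl ⟨⟨a1, h⟩, a3⟩
      · exact .inr ⟨⟨by linarith, a2⟩, by rw [← e1, ← e2]; exact a3⟩
    · refine max_le ?_ ?_ <;> simp only [Rect.len, Rect.hgt] <;> linarith
  · refine ⟨⟨K.x₀, K.x₁, K.y₀, K'.y₁, hx, by linarith⟩, ?_, ?_, ?_, ?_⟩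
    · rintro z ⟨a3, a1, a2⟩
      exact ⟨a3, a1, by linarith⟩
    · rintro z ⟨a3, a1, a2⟩
      exact ⟨by dsimp only; rw [e1, e2]; exact a3, by linarith, a2⟩
    · rintro z ⟨a3, a1, a2⟩
      rcases le_total z.2 K.y₁ with h | h
      · exact .inl ⟨a3, a1, h⟩
      · exact .inr ⟨by rw [← e1, ← e2]; exact a3, by linarith, a2⟩
    · refine max_le ?_ ?_ <;> simp only [Rect.len, Rect.hgt] <;> linarith

theorem joined_of_mem_star (h : K' ∈ star G K) {d : ℝ} (hd : K.size + K'.size ≤ d) :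
    Rect.Joined K K' d := by
  obtain ⟨-, rfl | ⟨c, b, h⟩⟩ := mem_star.1 h
  · exact Rect.joined_self K (by linarith [K.size_pos])
  · exact h.joined hd

theorem star_subset_star₃ (hK : K ∈ G) (h : K' ∈ star G K) : K' ∈ star₃ G K :=
  mem_star₃.2 ⟨_, star_self hK, _, star_self hK, h⟩

theorem self_mem_star₃ (hK : K ∈ G) : K ∈ star₃ G K := star_subset_star₃ hK (star_self hK)

theorem mem_star₃_of_two {K₁ : Rect} (hK : K ∈ G) (h : K₁ ∈ star G K) (h' : K' ∈ star G K₁) :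
    K' ∈ star₃ G K :=
  mem_star₃.2 ⟨_, star_self hK, _, h, h'⟩

/-! ### Propagation of smallness -/

/-- The oscillation of the second derivatives near `K` is bounded. -/
def OscNear (G : Finset Rect) (K : Rect) (φ : ℝ × ℝ → ℝ) (A : ℝ) : Prop :=
  ∀ K₁ ∈ star₃ G K, ∀ K₂ ∈ star₃ G K, K₂ ∈ star G K₁ → OscBound K₁ K₂ φ A

theorem OscNear.sub_quad {φ : ℝ × ℝ → ℝ} (hφ : ContDiff ℝ ∞ φ) {A : ℝ} (h : OscNear G K φ A)
    (c : Fin 6 → ℝ) : OscNear G K (φ - quad c) A :=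
  fun K₁ h1 K₂ h2 h3 => osc_sub_quad K₁ K₂ hφ c (h K₁ h1 K₂ h2 h3)

theorem OscNear.nonneg {φ : ℝ × ℝ → ℝ} {A : ℝ} (hK : K ∈ G) (h : OscNear G K φ A) : 0 ≤ A :=
  (Rect.osc_nonneg _ _ _).trans
    (h K (self_mem_star₃ hK) K (self_mem_star₃ hK) (star_self hK)).o20

theorem one_le_stepConst {κ : ℝ} (hκ : 1 ≤ κ) : 1 ≤ stepConst κ := by
  have := one_le_pow₀ hκ (n := 16)
  unfold stepConst
  linarith

theorem OscNear.step (hG : Regular κ G) (hK : K ∈ G) {e : ℝ × ℝ → ℝ} (he : ContDiff ℝ ∞ e)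
    {A : ℝ} (hA : OscNear G K e A) {K₁ K₂ : Rect} (h1 : K₁ ∈ star₃ G K) (h2 : K₂ ∈ star₃ G K)
    (h12 : K₂ ∈ star G K₁) {M : ℝ} (hM : 1 ≤ M) (hs : Small K₁ e K.size (M * A)) :
    Small K₂ e K.size (2 * stepConst (κ ^ 4) * M * A) := by
  have hκ4 : 1 ≤ κ ^ 4 := one_le_pow₀ hG.1
  have s1 := hG.sized hK h1
  have s2 := hG.sized hK h2
  have h21 := star_symm (star₃_subset _ _ h1) h12
  have hJ : Rect.Joined K₂ K₁ (2 * κ ^ 4 * K.size) :=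
    joined_of_mem_star h21 (by linarith [s1.size_le, s2.size_le])
  refine (Small.step K.size_pos hκ4 s2 s1 hJ he (hA K₂ h2 K₁ h1 h21) hs).mono ?_
  have hA0 := hA.nonneg hK
  have := one_le_stepConst hκ4
  have h3 : A ≤ M * A := le_mul_of_one_le_left hA0 hM
  calc stepConst (κ ^ 4) * (A + M * A) ≤ stepConst (κ ^ 4) * (M * A + M * A) := by gcongr
    _ = _ := by ring

/-- The factor of three propagation steps. -/
noncomputable def chainConst (κ : ℝ) : ℝ := (2 * stepConst (κ ^ 4)) ^ 3

/-- Three applications of `OscNear.step` along a path of edge neighbours, which can be traversed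
either way. The condition `1 ≤ M` allows the new `A` of each step to be absorbed in `M * A`. -/
theorem OscNear.chain (hG : Regular κ G) (hK : K ∈ G) {e : ℝ × ℝ → ℝ} (he : ContDiff ℝ ∞ e)
    {A : ℝ} (hA : OscNear G K e A) (h : K' ∈ star₃ G K) {M : ℝ} (hM : 1 ≤ M) :
    (Small K e K.size (M * A) → Small K' e K.size (chainConst κ * M * A)) ∧
    (Small K' e K.size (M * A) → Small K e K.size (chainConst κ * M * A)) := by
  obtain ⟨K₁, h1, K₂, h2, h3⟩ := mem_star₃.1 h
  have g1 := star_subset _ _ h1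
  have g2 := star_subset _ _ h2
  have m0 := self_mem_star₃ hK
  have m1 := star_subset_star₃ hK h1
  have m2 := mem_star₃_of_two hK h1 h2
  have hT := one_le_stepConst (one_le_pow₀ hG.1 (n := 4))
  set T := stepConst (κ ^ 4) with hTd
  have k1 : 1 ≤ 2 * T * M := by nlinarith
  have k2 : 1 ≤ 2 * T * (2 * T * M) := by nlinarith
  have e3 : 2 * T * (2 * T * (2 * T * M)) * A = chainConst κ * M * A := by
    rw [chainConst]
    ring
  rw [← e3]
  constructor
  · intro hs
    exact hA.step hG hK he m2 h h3 k2 (hA.step hG hK he m1 m2 h2 k1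
      (hA.step hG hK he m0 m1 h1 hM hs))
  · intro hs
    exact hA.step hG hK he m1 m0 (star_symm hK h1) k2 (hA.step hG hK he m2 m1 (star_symm g1 h2) k1
      (hA.step hG hK he h m2 (star_symm g2 h3) hM hs))

end

/-! ### The quasi-interpolant of a smooth function on a cell -/

theorem Patch.lam_sub (p : Patch) {f g : ℝ × ℝ → ℝ} (hf : Continuous f) (hg : Continuous g) :
    p.lam (f - g) = p.lam f - p.lam g := by
  simp only [lam, mean_eq_avg, Rect.avg_sub _ hf hg]
  ring

section

variable {Ω : Set (ℝ × ℝ)} {κ : ℝ} {G : Finset Rect} {K : Rect}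

open Classical in
/-- The coefficient of the quasi-interpolant with respect to the basis function of the cell `F`, if
this does not vanish on `K`. -/
noncomputable def activeCoef (G : Finset Rect) (v : ℝ × ℝ → ℝ) (K F : Rect) : ℝ :=
  if F ∈ interiorCells G then
    if h : ∃ p : Patch, p.IsPatchOf G F then if K ∈ h.choose.cells then h.choose.lam v else 0 else 0
  else 0

/-- Only interior cells whose patch contains `K` contribute on `K`. Each of them is a cell of the
frame by `knotMatch`, and on `K` its basis function is the corresponding local one; the other cells
of the frame get coefficient zero. -/
theorem interpCoef_eq_sum {P : Patch} (hP : P.IsFrame G K) (v : ℝ × ℝ → ℝ) (k : Fin 6) :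
    interpCoef G v K k = ∑ i, ∑ j, activeCoef G v K (P.cell i j) * P.loc i j k := by
  classical
  set f : Rect → ℝ := fun F => if h : ∃ p : Patch, p.IsPatchOf G F then
    h.choose.lam v * h.choose.coefs K k else 0 with hf
  have hmatch : ∀ F (h : ∃ p : Patch, p.IsPatchOf G F), K ∈ h.choose.cells →
      ∃ i j, F = P.cell i j ∧ h.choose.coefs K = P.loc i j := by
    rintro F h ⟨i, j, hij⟩
    obtain ⟨h1, h2⟩ := h.choose_spec
    obtain ⟨mx, my⟩ := hP.knotMatch h2 hij.symm
    refine ⟨i.rev, j.rev, ?_, ?_⟩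
    · rw [Patch.cell_eq_of_match mx my, h1]
    · rw [← Patch.coef_eq_loc mx my, ← Patch.coefs_cell, ← hij]
  have e1 : interpCoef G v K k = ∑ F ∈ interiorCells G, f F := by
    simp only [interpCoef, Finset.sum_apply, hf]
    refine Finset.sum_congr rfl fun F _ => ?_
    split_ifs <;> simp
  have e2 : ∀ i j, activeCoef G v K (P.cell i j) * P.loc i j k =
      if P.cell i j ∈ interiorCells G then f (P.cell i j) else 0 := by
    intro i j
    simp only [activeCoef, hf]
    split_ifs with h1 h2 h3
    · obtain ⟨i', j', h4, h5⟩ := hmatch _ h2 h3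
      obtain ⟨rfl, rfl⟩ := P.cell_inj h4
      rw [h5]
    · rw [Patch.coefs_eq_zero h3]
      simp
    · simp
    · simp
  have hinj : Function.Injective fun x : Fin 3 × Fin 3 => P.cell x.1 x.2 := by
    rintro ⟨i, j⟩ ⟨i', j'⟩ h
    obtain ⟨h1, h2⟩ := P.cell_inj h
    exact Prod.ext h1 h2
  have e3 : ∑ i, ∑ j, (if P.cell i j ∈ interiorCells G then f (P.cell i j) else 0) =
      ∑ F ∈ (Finset.univ.image fun x : Fin 3 × Fin 3 => P.cell x.1 x.2).filter
        (· ∈ interiorCells G), f F := by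
    rw [Finset.sum_filter, Finset.sum_image hinj.injOn, Fintype.sum_prod_type]
  rw [e1]
  simp only [e2]
  rw [e3]
  symm
  refine Finset.sum_subset (fun F hF => (Finset.mem_filter.1 hF).2) fun F hF hn => ?_
  simp only [hf]
  split_ifs with h
  · by_cases hc : K ∈ h.choose.cells
    · obtain ⟨i, j, h4, -⟩ := hmatch F h hc
      exact absurd (Finset.mem_filter.2 ⟨Finset.mem_image.2 ⟨(i, j), Finset.mem_univ _, h4.symm⟩,
        hF⟩) hn
    · rw [Patch.coefs_eq_zero hc]
      simp
  · rfl

/-- If there is a wall on a line through a side of `R`, then the functional of `R` is small on the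
averaged Taylor polynomial of a function vanishing on the walls. -/
theorem sq_blossom_le_of_wall (hG : IsGrid Ω G) (hr : Regular κ G) (hK : K ∈ G)
    {φ : ℝ × ℝ → ℝ} (hφ : IsTest Ω φ) {A : ℝ} (hA : OscNear G K φ A) {R : Rect}
    (hw : ¬ NoWall G K R) {ρ : ℝ} (hρ : 1 ≤ ρ)
    (hx : ∀ x ∈ Icc K.x₀ K.x₁, |R.x₀ - x| ≤ ρ * K.size ∧ |R.x₁ - x| ≤ ρ * K.size)
    (hy : ∀ y ∈ Icc K.y₀ K.y₁, |R.y₀ - y| ≤ ρ * K.size ∧ |R.y₁ - y| ≤ ρ * K.size) :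
    blossom R (K.taylor φ) ^ 2 ≤
      108 * ρ ^ 4 * (κ ^ 4) ^ 6 * (chainConst κ * stepConst (κ ^ 4) * A) := by
  simp only [NoWall, not_forall, not_exists, not_and] at hw
  obtain ⟨W, hW, c, b, b', hs, hn⟩ := hw
  have hκ4 : 1 ≤ κ ^ 4 := one_le_pow₀ hr.1
  have hWG := star₃_subset _ _ hW
  have sW := hr.sized hK hW
  have sK := hr.sized hK (self_mem_star₃ hK)
  have h0 : ∀ t ∈ Icc (W.side (!c) false) (W.side (!c) true),
      φ (pt c (W.side c b) t) = 0 ∧ pdx φ (pt c (W.side c b) t) = 0 ∧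
        pdy φ (pt c (W.side c b) t) = 0 := by
    intro t ht
    -- The wall is outside `Ω`, hence outside the support of `φ` and of its derivatives.
    have hz := hG.not_mem_of_wall hWG hn ht
    exact ⟨hφ.eq_zero hz, hφ.pdx.eq_zero hz, hφ.pdy.eq_zero hz⟩
  have hO := hA W hW W hW (star_self hWG)
  have hl : W.side c b ∈ Icc (W.side c false) (W.side c true) := by
    cases b
    · exact left_mem_Icc.2 (W.side_lt c).le
    · exact right_mem_Icc.2 (W.side_lt c).le
  have fin : ∀ w : Fin 6 → ℝ, Small W (φ - quad w) K.size (stepConst (κ ^ 4) * A) →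
      blossom R w = 0 → blossom R (K.taylor φ) ^ 2 ≤
        108 * ρ ^ 4 * (κ ^ 4) ^ 6 * (chainConst κ * stepConst (κ ^ 4) * A) := by
    intro w hsm hb
    -- The wall profile is close to `φ` on `W`; closeness is carried back along the path to `K`,
    -- where the Taylor polynomial is taken.
    have h1 := ((hA.sub_quad hφ.1 w).chain hr hK (hφ.1.sub (Rect.contDiff_quad w)) hW
      (one_le_stepConst hκ4)).2 hsm
    exact sq_blossom_taylor_le K.size_pos hκ4 hρ sK hφ.1 h1 hb hx hy
  cases c
  · obtain ⟨a, ha⟩ := small_of_wallX K.size_pos hκ4 sW hφ.1 hl h0 hO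
    refine fin _ ha (blossom_wallX ?_ a)
    cases b'
    · exact .inl hs
    · exact .inr hs
  · obtain ⟨a, ha⟩ := small_of_wallY K.size_pos hκ4 sW hφ.1 hl h0 hO
    refine fin _ ha (blossom_wallY ?_ a)
    cases b'
    · exact .inl hs
    · exact .inr hs

/-- The constant in the local estimate. -/
noncomputable def localConst (κ : ℝ) : ℝ :=
  10 ^ 6 * (κ ^ 4) ^ 10 * (10 ^ 4 * (κ ^ 4) ^ 10 * (chainConst κ * stepConst (κ ^ 4)))

/-- With `q` the averaged Taylor polynomial on `K`, compare the nine coefficients on `K` with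
`blossom R q`. For an active cell the difference is `λ_R (φ - q)`, small because `φ - q` is small on
the cross of its patch. For the others the coefficient is zero, and a wall on a side line of `R`
makes `blossom R q` small. -/
theorem small_sub_interp (hG : IsGrid Ω G) (hr : Regular κ G) (hK : K ∈ G)
    {φ : ℝ × ℝ → ℝ} (hφ : IsTest Ω φ) {A : ℝ} (hA : OscNear G K φ A) :
    Small K (φ - quad (interpCoef G φ K)) K.size (localConst κ * A) := by
  classical
  obtain ⟨P, hP, hbd⟩ := Patch.exists_frame hG K
  have hκ := hr.1
  have hκ4 : 1 ≤ κ ^ 4 := one_le_pow₀ hr.1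
  have hA0 := hA.nonneg hK
  have mK := self_mem_star₃ hK
  have sK := hr.sized hK mK
  have hh := K.size_pos
  have hS := one_le_stepConst hκ4
  set S := stepConst (κ ^ 4) with hSd
  have hC : 1 ≤ chainConst κ := one_le_pow₀ (by linarith)
  set q := K.taylor φ with hq
  have cq := Rect.contDiff_quad q
  have hsm := taylor_small hh hκ4 sK hφ.1 (hA K mK K mK (star_self hK))
  set k := κ ^ 4 with hk
  -- A real outer line is one neighbouring cell away, a virtual one at most the size of `K`.
  have hknot : ∀ c b, |P.knot c (endIx b) - K.side c b| ≤ κ * K.size := by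
    intro c b
    have hκs : K.size ≤ κ * K.size := le_mul_of_one_le_left hh.le hκ
    rcases hbd c b with ⟨E, hE, h⟩ | h
    · rw [hP.2 c b E hE h, h.1]
      have h1 := E.side_sub_le_size c
      have h2 := (hr.size_le hK (h.mem_star hE)).2
      have h3 := E.side_lt c
      rw [abs_le]
      cases b <;> simp only [Bool.not_false, Bool.not_true] <;> constructor <;> linarith
    · linarith [K.side_sub_le_size c]
  have hρ : 1 ≤ 2 * κ := by linarith
  have hline : ∀ (c : Bool) (u : Fin 4), ∀ x ∈ Icc (K.side c false) (K.side c true),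
      |P.knot c u - x| ≤ 2 * κ * K.size := by
    intro c u x hx
    have hmono : Monotone (P.knot c) := by
      cases c
      · exact P.hX.monotone
      · exact P.hY.monotone
    have m0 : P.knot c 0 ≤ P.knot c u := hmono (Fin.zero_le u)
    have m3 : P.knot c u ≤ P.knot c 3 := hmono (Fin.le_last u)
    have k0 : |P.knot c 0 - K.side c false| ≤ κ * K.size := hknot c false
    have k3 : |P.knot c 3 - K.side c true| ≤ κ * K.size := hknot c true
    have hκs : K.size ≤ κ * K.size := le_mul_of_one_le_left hh.le hκ
    have hs := K.side_sub_le_size c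
    rw [abs_le] at k0 k3 ⊢
    constructor <;> linarith [hx.1, hx.2, k0.1, k0.2, k3.1, k3.2]
  have nS : 0 ≤ chainConst κ * S * A := by positivity
  have hk10 : k ^ 10 ≥ 1 := one_le_pow₀ hκ4
  have main : ∀ i j, (activeCoef G φ K (P.cell i j) - blossom (P.cell i j) q) ^ 2 ≤
      10 ^ 4 * k ^ 10 * (chainConst κ * S) * A := by
    intro i j
    set R := P.cell i j with hR
    by_cases hgood : R ∈ interiorCells G ∧ ∃ h : ∃ p : Patch, p.IsPatchOf G R, K ∈ h.choose.cells
    · obtain ⟨g1, g2, g3⟩ := hgood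
      have e : activeCoef G φ K R = g2.choose.lam φ := by
        rw [activeCoef, if_pos g1, dif_pos g2, if_pos g3]
      obtain ⟨p1, p2⟩ := g2.choose_spec
      set p := g2.choose with hp
      obtain ⟨i', j', hij⟩ := g3
      have hcross : ∀ a b : Fin 3, a = 1 ∨ b = 1 → p.cell a b ∈ star₃ G K := by
        intro a b hab
        rw [hij]
        exact Patch.cell_mem_star₃ p2 i' j' hab
      have e2 : activeCoef G φ K R - blossom R q = p.lam (φ - quad q) := by
        rw [p.lam_sub hφ.1.continuous cq.continuous, p.lam_quad, p1, e]
      rw [e2]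
      refine (p.sq_lam_le hh hκ4 (hφ.1.sub cq).continuous (B := chainConst κ * S * A)
        (fun a b hab => hr.sized hK (hcross a b hab)) fun a b hab => ?_).trans ?_
      · exact (((hA.sub_quad hφ.1 q).chain hr hK (hφ.1.sub cq) (hcross a b hab) hS).1 hsm).s00
      · have : k ^ 2 ≤ k ^ 10 := pow_le_pow_right₀ hκ4 (by norm_num)
        nlinarith [mul_le_mul_of_nonneg_right this nS]
    · have e : activeCoef G φ K R = 0 := by
        rw [activeCoef]
        split_ifs with h1 h2 h3
        · exact absurd ⟨h1, h2, h3⟩ hgood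
        · rfl
        · rfl
        · rfl
      -- Without walls `R` would be an interior cell of the grid with a patch containing `K`, and
      -- its coefficient would be active.
      have hw : ¬ NoWall G K R := by
        intro hnw
        obtain ⟨f1, f2, f3⟩ := hG.frame_cell_of_noWall hK hP hnw
        have hex := hG.exists_patch f1 f2
        exact hgood ⟨hG.mem_interiorCells f1 f2, hex, f3 _ hex.choose_spec⟩
      have hb := sq_blossom_le_of_wall hG hr hK hφ hA hw hρ
        (fun x hx => ⟨hline false i.castSucc x hx, hline false i.succ x hx⟩)
        (fun y hy => ⟨hline true j.castSucc y hy, hline true j.succ y hy⟩)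
      rw [e, zero_sub, neg_sq]
      refine hb.trans ?_
      -- With `k = κ⁴` the left side is `16 k⁷`; the total factor `108 · 16` is below `10⁴`.
      have h1 : (2 * κ) ^ 4 * k ^ 6 ≤ 16 * k ^ 10 := by
        have : (2 * κ) ^ 4 * k ^ 6 = 16 * (k ^ 7) := by
          rw [hk]
          ring
        rw [this]
        have := pow_le_pow_right₀ hκ4 (show 7 ≤ 10 by norm_num)
        linarith
      nlinarith [mul_le_mul_of_nonneg_right h1 nS, mul_nonneg (zero_le_one.trans hk10) nS]
  have hPK := hP.1
  have hfin := P.small_sub_combination (c := interpCoef G φ K) (q := q) hh hκ4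
    (by rw [hPK]; exact sK) hφ.1 (interpCoef_eq_sum hP φ) main (by
      rw [hPK]
      refine hsm.mono ?_
      have h1 : S ≤ chainConst κ * S := le_mul_of_one_le_left (by linarith) hC
      have h2 : chainConst κ * S ≤ 10 ^ 4 * k ^ 10 * (chainConst κ * S) := by
        refine le_mul_of_one_le_left (by positivity) ?_
        linarith
      exact mul_le_mul_of_nonneg_right (h1.trans h2) hA0)
  rw [hPK] at hfin
  refine hfin.mono (le_of_eq ?_)
  rw [localConst]
  ring

end

/-! ### Square integrals and approximation by test functions -/

/-- The integral of the square, with values in `[0, ∞]`. -/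
noncomputable def l2Sq (U : Set (ℝ × ℝ)) (g : ℝ × ℝ → ℝ) : ℝ≥0∞ := ∫⁻ z in U, ‖g z‖ₑ ^ 2

/-- The double integral of the squared difference, with values in `[0, ∞]`. -/
noncomputable def oscSq (K K' : Rect) (g : ℝ × ℝ → ℝ) : ℝ≥0∞ :=
  ∫⁻ z in K.inner, ∫⁻ w in K'.inner, ‖g z - g w‖ₑ ^ 2

theorem fracSq_zero (U : Set (ℝ × ℝ)) (g : ℝ × ℝ → ℝ) : fracSq 0 U g = l2Sq U g := if_pos rfl

theorem l2Sq_mono {U V : Set (ℝ × ℝ)} (h : U ⊆ V) (g : ℝ × ℝ → ℝ) : l2Sq U g ≤ l2Sq V g :=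
  lintegral_mono_set h

theorem seminormSq_nat {m : ℕ} {U : Set (ℝ × ℝ)} (hU : IsOpen U) {v : ℝ × ℝ → ℝ}
    {g : ℕ × ℕ → ℝ × ℝ → ℝ}
    (h : ∀ α ∈ Finset.HasAntidiagonal.antidiagonal m, IsWeakDeriv U α v (g α)) :
    seminormSq m U v = ∑ α ∈ Finset.HasAntidiagonal.antidiagonal m, l2Sq U (g α) := by
  have hf : ⌊(m : ℝ)⌋₊ = m := Nat.floor_natCast m
  rw [seminormSq_eq hU (by rw [hf]; exact h), hf, sub_self]
  simp only [fracSq_zero]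

theorem MemH.exists_weakDeriv {s : ℝ} {U : Set (ℝ × ℝ)} {v : ℝ × ℝ → ℝ} (hv : MemH s U v) :
    ∃ g : ℕ × ℕ → ℝ × ℝ → ℝ, ∀ α, α.1 + α.2 ≤ ⌊s⌋₊ → IsWeakDeriv U α v (g α) := by
  have key : ∀ m : ℕ, ∃ g : ℕ × ℕ → ℝ × ℝ → ℝ, m ≤ ⌊s⌋₊ →
      ∀ α ∈ Finset.HasAntidiagonal.antidiagonal m, IsWeakDeriv U α v (g α) := by
    intro m
    by_cases hm : m ≤ ⌊s⌋₊
    · obtain ⟨g, hg, -⟩ := RRM.exists_weakDeriv (hv.1 m hm)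
      rw [Nat.floor_natCast] at hg
      exact ⟨g, fun _ => hg⟩
    · exact ⟨fun _ _ => 0, fun h => absurd h hm⟩
  choose g hg using key
  exact ⟨fun α => g (α.1 + α.2) α, fun α hα => hg _ hα α (by simp)⟩

theorem MemHZero.exists_seq {U : Set (ℝ × ℝ)} (hU : IsOpen U) {v : ℝ × ℝ → ℝ} (hv : MemHZero 2 U v)
    {g : ℕ × ℕ → ℝ × ℝ → ℝ} (hg : ∀ α, α.1 + α.2 ≤ 2 → IsWeakDeriv U α v (g α)) :
    ∃ φ : ℕ → ℝ × ℝ → ℝ, (∀ n, IsTest U (φ n)) ∧ ∀ α, α.1 + α.2 ≤ 2 →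
      Filter.Tendsto (fun n => l2Sq U (g α - pderiv α (φ n))) Filter.atTop (nhds 0) := by
  -- The tolerance `1 / n` is `⊤` for `n = 0`, which is harmless.
  have hpos : ∀ n : ℕ, (0 : ℝ≥0∞) < (n : ℝ≥0∞)⁻¹ := fun n =>
    ENNReal.inv_pos.2 (ENNReal.natCast_ne_top n)
  choose φ hφ hs using fun n => hv.2 _ (hpos n)
  refine ⟨φ, hφ, fun α hα => ?_⟩
  have hlim : Filter.Tendsto (fun n : ℕ => ((n : ℝ≥0∞)⁻¹) ^ 2) Filter.atTop (nhds 0) := by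
    have := ENNReal.Tendsto.pow (n := 2) ENNReal.tendsto_inv_nat_nhds_zero
    simpa using this
  refine tendsto_of_tendsto_of_tendsto_of_le_of_le tendsto_const_nhds hlim (fun _ => zero_le)
    fun n => ?_
  have h1 := hs n (α.1 + α.2) hα
  have h2 : seminormSq ((α.1 + α.2 : ℕ) : ℝ) U (v - φ n) ≤ ((n : ℝ≥0∞)⁻¹) ^ 2 := by
    have h3 := pow_le_pow_left' h1 2
    rwa [seminorm, ← ENNReal.rpow_natCast (_ ^ _), ← ENNReal.rpow_mul,
      show (1 / 2 : ℝ) * ((2 : ℕ) : ℝ) = 1 by norm_num, ENNReal.rpow_one] at h3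
  rw [seminormSq_nat hU (g := fun β => g β - pderiv β (φ n)) fun β hβ => (hg β (by
    rw [Finset.HasAntidiagonal.mem_antidiagonal] at hβ
    omega)).sub (isWeakDeriv_of_contDiff U (hφ n).1 β)] at h2
  exact (Finset.single_le_sum (f := fun β => l2Sq U (g β - pderiv β (φ n)))
    (fun _ _ => zero_le) (Finset.HasAntidiagonal.mem_antidiagonal.2 rfl)).trans h2

theorem IsWeakDeriv.aestronglyMeasurable {U V : Set (ℝ × ℝ)} {α : ℕ × ℕ} {v g : ℝ × ℝ → ℝ}
    (h : IsWeakDeriv U α v g) (hVU : V ⊆ U) : AEStronglyMeasurable g (volume.restrict V) :=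
  h.2.1.aestronglyMeasurable.mono_measure (Measure.restrict_mono hVU le_rfl)

theorem Rect.volume_inner_lt_top (K : Rect) : volume K.inner < ⊤ :=
  (measure_mono K.inner_subset_closed).trans_lt K.isCompact_closed.measure_lt_top

theorem enorm_add_sq_le (a b : ℝ) : ‖a + b‖ₑ ^ 2 ≤ 2 * (‖a‖ₑ ^ 2 + ‖b‖ₑ ^ 2) := by
  simp only [Rect.enorm_sq]
  rw [← ENNReal.ofReal_add (sq_nonneg _) (sq_nonneg _),
    show (2 : ℝ≥0∞) = ENNReal.ofReal 2 by simp, ← ENNReal.ofReal_mul (by norm_num)]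
  exact ENNReal.ofReal_le_ofReal (by nlinarith [sq_nonneg (a - b)])

theorem enorm_sub_sq_le (a b c d : ℝ) :
    ‖c - d‖ₑ ^ 2 ≤ 3 * (‖a - c‖ₑ ^ 2 + (‖a - b‖ₑ ^ 2 + ‖b - d‖ₑ ^ 2)) := by
  simp only [Rect.enorm_sq]
  rw [← ENNReal.ofReal_add (sq_nonneg _) (sq_nonneg _),
    ← ENNReal.ofReal_add (sq_nonneg _) (by positivity),
    show (3 : ℝ≥0∞) = ENNReal.ofReal 3 by simp, ← ENNReal.ofReal_mul (by norm_num)]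
  refine ENNReal.ofReal_le_ofReal ?_
  nlinarith [sq_nonneg ((a - c) + (a - b)), sq_nonneg ((a - c) - (b - d)),
    sq_nonneg ((a - b) + (a - c)), sq_nonneg ((a - b) - (b - d)), sq_nonneg ((a - b) + (b - d))]

theorem l2Sq_add_le {U : Set (ℝ × ℝ)} (f : ℝ × ℝ → ℝ) {g : ℝ × ℝ → ℝ}
    (hg : AEStronglyMeasurable g (volume.restrict U)) :
    l2Sq U (f + g) ≤ 2 * (l2Sq U f + l2Sq U g) := by
  rw [l2Sq, l2Sq, l2Sq, ← lintegral_add_right' _ (hg.enorm.pow_const 2),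
    ← lintegral_const_mul' _ _ (by simp)]
  exact lintegral_mono fun z => enorm_add_sq_le _ _

/-- The triangle inequality with `f` as comparison function. It bounds the oscillations of the
approximating test functions in the passage to the limit by the one of `v`, up to terms tending to
zero. -/
theorem oscSq_le (K K' : Rect) {f g : ℝ × ℝ → ℝ}
    (h : AEStronglyMeasurable (f - g) (volume.restrict K.inner))
    (h' : AEStronglyMeasurable (f - g) (volume.restrict K'.inner)) :
    oscSq K K' g ≤ 3 * (volume K'.inner * l2Sq K.inner (f - g) +
      (oscSq K K' f + volume K.inner * l2Sq K'.inner (f - g))) := by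
  have h1 : ∀ z, ∫⁻ w in K'.inner, ‖g z - g w‖ₑ ^ 2 ≤
      3 * (‖(f - g) z‖ₑ ^ 2 * volume K'.inner + (∫⁻ w in K'.inner, ‖f z - f w‖ₑ ^ 2) +
        l2Sq K'.inner (f - g)) := by
    intro z
    rw [l2Sq, ← setLIntegral_const, ← lintegral_add_left' aemeasurable_const,
      ← lintegral_add_right' _ (h'.enorm.pow_const 2), ← lintegral_const_mul' _ _ (by simp)]
    refine lintegral_mono fun w => (enorm_sub_sq_le (f z) (f w) (g z) (g w)).trans (le_of_eq ?_)
    simp only [Pi.sub_apply, add_assoc]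
  refine (lintegral_mono h1).trans (le_of_eq ?_)
  rw [lintegral_const_mul' _ _ (by simp), lintegral_add_right' _ aemeasurable_const,
    lintegral_add_left' ((h.enorm.pow_const 2).mul_const _), setLIntegral_const,
    lintegral_mul_const' _ _ K'.volume_inner_lt_top.ne, l2Sq, oscSq, l2Sq, add_assoc,
    mul_comm (volume K'.inner), mul_comm (volume K.inner)]

theorem tendsto_mean {U : Set (ℝ × ℝ)} {v : ℝ × ℝ → ℝ}
    (hv : LocallyIntegrableOn v U) {φ : ℕ → ℝ × ℝ → ℝ} (hφ : ∀ n, IsTest U (φ n))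
    (hlim : Filter.Tendsto (fun n => l2Sq U (v - φ n)) Filter.atTop (nhds 0)) (p : Patch)
    {i j : Fin 3} (hp : (p.cell i j).inner ⊆ U) :
    Filter.Tendsto (fun n => p.mean (φ n) i j) Filter.atTop (nhds (p.mean v i j)) := by
  set K := p.cell i j with hK
  have hm : AEStronglyMeasurable v (volume.restrict K.inner) :=
    hv.aestronglyMeasurable.mono_measure (Measure.restrict_mono hp le_rfl)
  have h1 : Filter.Tendsto (fun n => ∫ z in K.inner, φ n z) Filter.atTop
      (nhds (∫ z in K.inner, v z)) := by
    refine tendsto_integral_of_L1 v hm (Filter.Eventually.of_forall fun n => ?_) ?_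
    · exact ((hφ n).1.continuous.integrable_of_hasCompactSupport (hφ n).2.1).integrableOn
    · have h2 : ∀ n, (∫⁻ z in K.inner, ‖φ n z - v z‖ₑ) ^ 2 ≤
          volume K.inner * l2Sq U (v - φ n) := by
        intro n
        refine (sq_lintegral_le ((hφ n).1.continuous.aestronglyMeasurable.sub hm).enorm).trans ?_
        rw [Measure.restrict_apply_univ]
        refine mul_le_mul_right ?_ _
        refine (lintegral_mono_set hp).trans (le_of_eq (lintegral_congr fun z => ?_))
        rw [Pi.sub_apply, enorm_sub_rev]
        rfl
      have h3 : Filter.Tendsto (fun n => (∫⁻ z in K.inner, ‖φ n z - v z‖ₑ) ^ 2) Filter.atTop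
          (nhds 0) := by
        refine tendsto_of_tendsto_of_tendsto_of_le_of_le tendsto_const_nhds ?_
          (fun _ => zero_le) h2
        have := ENNReal.Tendsto.const_mul hlim (.inr K.volume_inner_lt_top.ne)
        rwa [mul_zero] at this
      have h4 := h3.ennrpow_const (1 / 2)
      rw [ENNReal.zero_rpow_of_pos (by norm_num)] at h4
      refine h4.congr fun n => ?_
      rw [← ENNReal.rpow_natCast, ← ENNReal.rpow_mul,
        show ((2 : ℕ) : ℝ) * (1 / 2 : ℝ) = 1 by norm_num, ENNReal.rpow_one]
  simp only [Patch.mean, setAverage_eq]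
  exact h1.const_smul _

section

variable {Ω : Set (ℝ × ℝ)} {κ : ℝ} {G : Finset Rect} {K : Rect}

theorem tendsto_interpCoef (hG : IsGrid Ω G) {v : ℝ × ℝ → ℝ}
    (hv : LocallyIntegrableOn v Ω) {φ : ℕ → ℝ × ℝ → ℝ} (hφ : ∀ n, IsTest Ω (φ n))
    (hlim : Filter.Tendsto (fun n => l2Sq Ω (v - φ n)) Filter.atTop (nhds 0)) (K : Rect) :
    Filter.Tendsto (fun n => interpCoef G (φ n) K) Filter.atTop (nhds (interpCoef G v K)) := by
  classical
  unfold interpCoef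
  refine tendsto_finsetSum _ fun F _ => ?_
  by_cases h : ∃ p : Patch, p.IsPatchOf G F
  · simp only [dif_pos h]
    have hm : ∀ i j, Filter.Tendsto (fun n => h.choose.mean (φ n) i j) Filter.atTop
        (nhds (h.choose.mean v i j)) := fun i j =>
      tendsto_mean hv hφ hlim _ (hG.inner_subset (Finset.mem_coe.1 (h.choose_spec.2 ⟨i, j, rfl⟩)))
    refine Filter.Tendsto.smul_const ?_ _
    unfold Patch.lam
    exact (((((hm 0 1).const_mul _).add ((hm 2 1).const_mul _)).add ((hm 1 0).const_mul _)).add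
      ((hm 1 2).const_mul _)).add ((hm 1 1).const_mul _)
  · simp only [dif_neg h]
    exact tendsto_const_nhds

theorem continuous_pderiv_quad (α : ℕ × ℕ) (z : ℝ × ℝ) :
    Continuous fun c : Fin 6 → ℝ => pderiv α (quad c) z := by
  have hx : ∀ (n : ℕ) (c : Fin 6 → ℝ), pdx^[n] (quad c) = quad (coefDx^[n] c) := by
    intro n
    induction n with
    | zero => exact fun _ => rfl
    | succ n ih =>
      intro c
      rw [Function.iterate_succ_apply, pdx_quad, ih, Function.iterate_succ_apply]
  have hy : ∀ (n : ℕ) (c : Fin 6 → ℝ), pdy^[n] (quad c) = quad (coefDy^[n] c) := by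
    intro n
    induction n with
    | zero => exact fun _ => rfl
    | succ n ih =>
      intro c
      rw [Function.iterate_succ_apply, pdy_quad, ih, Function.iterate_succ_apply]
  have cx : Continuous coefDx := by
    refine continuous_pi fun i => ?_
    fin_cases i <;> simp [coefDx] <;> fun_prop
  have cy : Continuous coefDy := by
    refine continuous_pi fun i => ?_
    fin_cases i <;> simp [coefDy] <;> fun_prop
  have cq : Continuous fun c : Fin 6 → ℝ => quad c z := by
    unfold quad
    fun_prop
  simp only [pderiv, hy, hx]
  exact cq.comp ((cx.iterate _).comp (cy.iterate _))

/-- The sum of the oscillations of the second derivatives near a cell. -/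
noncomputable def nearOsc (G : Finset Rect) (K : Rect) (g : ℕ × ℕ → ℝ × ℝ → ℝ) : ℝ≥0∞ :=
  ∑ α ∈ Finset.HasAntidiagonal.antidiagonal 2, ∑ K₁ ∈ star₃ G K, ∑ K₂ ∈ star₃ G K,
    open Classical in if K₂ ∈ star G K₁ then oscSq K₁ K₂ (g α) else 0

theorem oscSq_le_nearOsc {g : ℕ × ℕ → ℝ × ℝ → ℝ} {K₁ K₂ : Rect} (h1 : K₁ ∈ star₃ G K)
    (h2 : K₂ ∈ star₃ G K) (h : K₂ ∈ star G K₁) {α : ℕ × ℕ} (hα : α.1 + α.2 = 2) :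
    oscSq K₁ K₂ (g α) ≤ nearOsc G K g := by
  classical
  have e : oscSq K₁ K₂ (g α) = if K₂ ∈ star G K₁ then oscSq K₁ K₂ (g α) else 0 := (if_pos h).symm
  rw [e]
  refine (Finset.single_le_sum (f := fun K₂ => if K₂ ∈ star G K₁ then oscSq K₁ K₂ (g α) else 0)
    (fun _ _ => zero_le) h2).trans ?_
  refine (Finset.single_le_sum (f := fun K₁ => ∑ K₂ ∈ star₃ G K, if K₂ ∈ star G K₁ then
    oscSq K₁ K₂ (g α) else 0) (fun _ _ => zero_le) h1).trans ?_
  exact Finset.single_le_sum (f := fun α => ∑ K₁ ∈ star₃ G K, ∑ K₂ ∈ star₃ G K,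
    if K₂ ∈ star G K₁ then oscSq K₁ K₂ (g α) else 0) (fun _ _ => zero_le)
    (Finset.HasAntidiagonal.mem_antidiagonal.2 hα)

theorem nearOsc_lt_top (G : Finset Rect) (K : Rect) {φ : ℝ × ℝ → ℝ} (hφ : ContDiff ℝ ∞ φ) :
    nearOsc G K (fun α => pderiv α φ) < ⊤ := by
  classical
  refine ENNReal.sum_lt_top.2 fun α _ => ENNReal.sum_lt_top.2 fun K₁ _ =>
    ENNReal.sum_lt_top.2 fun K₂ _ => ?_
  split_ifs
  · rw [oscSq, ← Rect.ofReal_osc _ _ (contDiff_pderiv hφ α).continuous]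
    exact ENNReal.ofReal_lt_top
  · exact ENNReal.zero_lt_top

theorem oscNear_toReal {φ : ℝ × ℝ → ℝ} (hφ : ContDiff ℝ ∞ φ) :
    OscNear G K φ (nearOsc G K fun α => pderiv α φ).toReal := by
  intro K₁ h1 K₂ h2 h
  have key : ∀ α : ℕ × ℕ, α.1 + α.2 = 2 →
      Rect.osc K₁ K₂ (pderiv α φ) ≤ (nearOsc G K fun α => pderiv α φ).toReal := by
    intro α hα
    have h3 := oscSq_le_nearOsc (g := fun α => pderiv α φ) h1 h2 h hα
    rw [oscSq, ← Rect.ofReal_osc _ _ (contDiff_pderiv hφ α).continuous] at h3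
    exact (ENNReal.ofReal_le_iff_le_toReal (nearOsc_lt_top G K hφ).ne).1 h3
  exact ⟨key (2, 0) rfl, key (1, 1) rfl, key (0, 2) rfl⟩

/-- Collects the three scalings of `Small` in the single power `h^(2 - 2|α|)`. -/
theorem Small.sq_pderiv_le {e : ℝ × ℝ → ℝ} {h B : ℝ} (hh : 0 < h) (hs : Small K e h B)
    {α : ℕ × ℕ} (hα : α.1 + α.2 ≤ 2) :
    K.sq (pderiv α e) ≤ B * h ^ (2 - 2 * ((α.1 + α.2 : ℕ) : ℝ)) := by
  have e0 : h ^ (2 - 2 * ((0 : ℕ) : ℝ)) = h ^ 2 := by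
    rw [← Real.rpow_natCast]
    norm_num
  have e1 : h ^ (2 - 2 * ((1 : ℕ) : ℝ)) = 1 := by
    rw [← Real.rpow_zero h]
    norm_num
  have e2 : h ^ (2 - 2 * ((2 : ℕ) : ℝ)) = (h ^ 2)⁻¹ := by
    rw [← Real.rpow_natCast, ← Real.rpow_neg hh.le]
    norm_num
  have k : ∀ {x : ℝ}, h ^ 2 * x ≤ B → x ≤ B * (h ^ 2)⁻¹ := by
    intro x hx
    rw [← div_eq_mul_inv, le_div_iff₀ (by positivity)]
    linarith
  obtain ⟨a, b⟩ := α
  simp only at hα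
  have ha : a ≤ 2 := by omega
  have hb : b ≤ 2 := by omega
  interval_cases a <;> interval_cases b <;> first | omega | skip
  · exact e0 ▸ hs.s00
  · change _ ≤ B * h ^ (2 - 2 * ((1 : ℕ) : ℝ))
    rw [e1, mul_one]
    exact hs.s01
  · change _ ≤ B * h ^ (2 - 2 * ((2 : ℕ) : ℝ))
    rw [e2]
    exact k hs.s02
  · change _ ≤ B * h ^ (2 - 2 * ((1 : ℕ) : ℝ))
    rw [e1, mul_one]
    exact hs.s10
  · change _ ≤ B * h ^ (2 - 2 * ((2 : ℕ) : ℝ))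
    rw [e2]
    exact k hs.s11
  · change _ ≤ B * h ^ (2 - 2 * ((2 : ℕ) : ℝ))
    rw [e2]
    exact k hs.s20

theorem l2Sq_smooth_le (hG : IsGrid Ω G) (hr : Regular κ G) (hK : K ∈ G) {φ : ℝ × ℝ → ℝ}
    (hφ : IsTest Ω φ) {α : ℕ × ℕ} (hα : α.1 + α.2 ≤ 2) :
    l2Sq K.inner (pderiv α φ - pderiv α (quad (interpCoef G φ K))) ≤
      ENNReal.ofReal (localConst κ * K.size ^ (2 - 2 * ((α.1 + α.2 : ℕ) : ℝ))) *
        nearOsc G K fun α => pderiv α φ := by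
  have hs := small_sub_interp hG hr hK hφ (oscNear_toReal hφ.1)
  have h1 := hs.sq_pderiv_le K.size_pos hα
  have cq := Rect.contDiff_quad (interpCoef G φ K)
  have ce : ContDiff ℝ ∞ (φ - quad (interpCoef G φ K)) := hφ.1.sub cq
  rw [← pderiv_sub hφ.1 cq, l2Sq, ← Rect.ofReal_sq _ (contDiff_pderiv ce α).continuous,
    ← ENNReal.ofReal_toReal (nearOsc_lt_top G K hφ.1).ne, ← ENNReal.ofReal_mul' ENNReal.toReal_nonneg]
  refine ENNReal.ofReal_le_ofReal (h1.trans (le_of_eq ?_))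
  ring

/-- The local error estimate in terms of the oscillation of the second derivatives. -/
theorem l2Sq_interp_le (hG : IsGrid Ω G) (hr : Regular κ G) (hK : K ∈ G) {v : ℝ × ℝ → ℝ}
    (hv : MemHZero 2 Ω v) {g : ℕ × ℕ → ℝ × ℝ → ℝ}
    (hg : ∀ α, α.1 + α.2 ≤ 2 → IsWeakDeriv Ω α v (g α)) {α : ℕ × ℕ} (hα : α.1 + α.2 ≤ 2) :
    l2Sq K.inner (g α - pderiv α (quad (interpCoef G v K))) ≤
      6 * ENNReal.ofReal (localConst κ * K.size ^ (2 - 2 * ((α.1 + α.2 : ℕ) : ℝ))) *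
        nearOsc G K g := by
  classical
  have hΩ : IsOpen Ω := hG.fill ▸ isOpen_interior
  obtain ⟨φ, hφ, hlim⟩ := hv.exists_seq hΩ hg
  have h0 := hg (0, 0) (by norm_num)
  have hvlim : Filter.Tendsto (fun n => l2Sq Ω (v - φ n)) Filter.atTop (nhds 0) := by
    refine (hlim (0, 0) (by norm_num)).congr fun n => lintegral_congr_ae ?_
    filter_upwards [h0.ae_eq hΩ (isWeakDeriv_zero h0.1)] with z hz
    simp only [Pi.sub_apply, hz]
    rfl
  have hc := tendsto_interpCoef hG h0.1 hφ hvlim K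
  have hKΩ := hG.inner_subset hK
  set X := ENNReal.ofReal (localConst κ * K.size ^ (2 - 2 * ((α.1 + α.2 : ℕ) : ℝ))) with hX
  have hXt : X ≠ ⊤ := ENNReal.ofReal_ne_top
  set d : ℕ → ℕ × ℕ → ℝ≥0∞ := fun n β => l2Sq Ω (g β - pderiv β (φ n)) with hd
  have hmeas : ∀ β : ℕ × ℕ, β.1 + β.2 ≤ 2 → ∀ n, ∀ V ⊆ Ω,
      AEStronglyMeasurable (g β - pderiv β (φ n)) (volume.restrict V) := fun β hβ n V hV =>
    ((hg β hβ).aestronglyMeasurable hV).sub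
      (contDiff_pderiv (hφ n).1 β).continuous.aestronglyMeasurable
  -- A bound for the `n`-th approximation in which only the `L²` distances `d n` depend on `n`. In
  -- the limit the factors `2` and `3` of the two triangle inequalities leave `6`.
  set b : ℕ → ℝ≥0∞ := fun n => 2 * (d n α + X * (∑ β ∈ Finset.HasAntidiagonal.antidiagonal 2,
    ∑ K₁ ∈ star₃ G K, ∑ K₂ ∈ star₃ G K, if K₂ ∈ star G K₁ then 3 * (volume K₂.inner * d n β +
      (oscSq K₁ K₂ (g β) + volume K₁.inner * d n β)) else 0)) with hb
  have hle : ∀ n, l2Sq K.inner (g α - pderiv α (quad (interpCoef G (φ n) K))) ≤ b n := by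
    intro n
    have e : g α - pderiv α (quad (interpCoef G (φ n) K)) = (g α - pderiv α (φ n)) +
        (pderiv α (φ n) - pderiv α (quad (interpCoef G (φ n) K))) := by
      abel
    rw [e]
    refine (l2Sq_add_le _ ?_).trans (mul_le_mul_right (add_le_add ?_ ?_) _)
    · exact ((contDiff_pderiv (hφ n).1 α).continuous.sub
        (contDiff_pderiv (Rect.contDiff_quad _) α).continuous).aestronglyMeasurable
    · exact l2Sq_mono hKΩ _
    · refine (l2Sq_smooth_le hG hr hK (hφ n) hα).trans (mul_le_mul_right ?_ _)
      refine Finset.sum_le_sum fun β hβ => Finset.sum_le_sum fun K₁ h1 =>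
        Finset.sum_le_sum fun K₂ h2 => ?_
      have hβ2 : β.1 + β.2 ≤ 2 := (Finset.HasAntidiagonal.mem_antidiagonal.1 hβ).le
      have i1 := hG.inner_subset (star₃_subset _ _ h1)
      have i2 := hG.inner_subset (star₃_subset _ _ h2)
      split_ifs
      · refine (oscSq_le K₁ K₂ (hmeas β hβ2 n _ i1) (hmeas β hβ2 n _ i2)).trans ?_
        exact mul_le_mul_right (add_le_add (mul_le_mul_right (l2Sq_mono i1 _) _)
          (add_le_add le_rfl (mul_le_mul_right (l2Sq_mono i2 _) _))) _
      · exact le_rfl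
  have hblim : Filter.Tendsto b Filter.atTop (nhds (6 * X * nearOsc G K g)) := by
    have h2 : Filter.Tendsto b Filter.atTop (nhds (2 * (0 + X *
        (∑ β ∈ Finset.HasAntidiagonal.antidiagonal 2, ∑ K₁ ∈ star₃ G K, ∑ K₂ ∈ star₃ G K,
          if K₂ ∈ star G K₁ then 3 * (volume K₂.inner * 0 +
            (oscSq K₁ K₂ (g β) + volume K₁.inner * 0)) else 0)))) := by
      refine ENNReal.Tendsto.const_mul ((hlim α hα).add (ENNReal.Tendsto.const_mul ?_ (.inr hXt)))
        (.inr (by simp))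
      refine tendsto_finsetSum _ fun β hβ => tendsto_finsetSum _ fun K₁ _ =>
        tendsto_finsetSum _ fun K₂ _ => ?_
      have hβ2 : β.1 + β.2 ≤ 2 := (Finset.HasAntidiagonal.mem_antidiagonal.1 hβ).le
      split_ifs
      · refine ENNReal.Tendsto.const_mul (Filter.Tendsto.add ?_ (Filter.Tendsto.add
          tendsto_const_nhds ?_)) (.inr (by simp))
        · exact ENNReal.Tendsto.const_mul (hlim β hβ2) (.inr K₂.volume_inner_lt_top.ne)
        · exact ENNReal.Tendsto.const_mul (hlim β hβ2) (.inr K₁.volume_inner_lt_top.ne)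
      · exact tendsto_const_nhds
    convert h2 using 2
    simp only [mul_zero, zero_add, add_zero, nearOsc, ← mul_ite_zero, ← Finset.mul_sum]
    rw [← mul_assoc 2, mul_left_comm, ← mul_assoc, ← mul_assoc]
    congr 1
    rw [show (6 : ℝ≥0∞) = 3 * 2 by norm_num, mul_assoc]
  -- The functionals are continuous in `L²`, so the polynomial coefficients on `K` converge, and
  -- with them the polynomials at every point.
  have hfatou : l2Sq K.inner (g α - pderiv α (quad (interpCoef G v K))) ≤
      Filter.liminf (fun n => l2Sq K.inner (g α - pderiv α (quad (interpCoef G (φ n) K))))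
        Filter.atTop := by
    have hpt : ∀ z, ‖(g α - pderiv α (quad (interpCoef G v K))) z‖ₑ ^ 2 =
        Filter.liminf (fun n => ‖(g α - pderiv α (quad (interpCoef G (φ n) K))) z‖ₑ ^ 2)
          Filter.atTop := by
      intro z
      symm
      refine Filter.Tendsto.liminf_eq (ENNReal.Tendsto.pow ?_)
      refine (continuous_enorm.tendsto _).comp (tendsto_const_nhds.sub ?_)
      exact ((continuous_pderiv_quad α z).tendsto _).comp hc
    rw [l2Sq, lintegral_congr hpt]
    refine lintegral_liminf_le' fun n => ?_
    exact ((((hg α hα).aestronglyMeasurable hKΩ).sub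
      (contDiff_pderiv (Rect.contDiff_quad _) α).continuous.aestronglyMeasurable).enorm).pow_const 2
  refine hfatou.trans ?_
  rw [← hblim.liminf_eq]
  exact Filter.liminf_le_liminf (Filter.Eventually.of_forall hle)

end

/-! ### Oscillations and the seminorm of order `s` -/

/-- The density of the square of the seminorm of order `σ`. -/
noncomputable def dens (σ : ℝ) (U : Set (ℝ × ℝ)) (g : ℝ × ℝ → ℝ) (z : ℝ × ℝ) : ℝ≥0∞ :=
  if σ = 0 then ‖g z‖ₑ ^ 2
  else ∫⁻ w in U, ‖g z - g w‖ₑ ^ 2 / ENNReal.ofReal (eucl z w ^ (2 + 2 * σ))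

theorem fracSq_eq_dens (σ : ℝ) (U : Set (ℝ × ℝ)) (g : ℝ × ℝ → ℝ) :
    fracSq σ U g = ∫⁻ z in U, dens σ U g z := by
  unfold fracSq dens
  split_ifs <;> rfl

/-- The contribution of a cell to the square of the seminorm of order `s`. -/
noncomputable def cellDens (s : ℝ) (U : Set (ℝ × ℝ)) (g : ℕ × ℕ → ℝ × ℝ → ℝ) (K : Rect) : ℝ≥0∞ :=
  ∑ α ∈ Finset.HasAntidiagonal.antidiagonal ⌊s⌋₊, ∫⁻ z in K.inner, dens (s - ⌊s⌋₊) U (g α) z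

theorem le_cellDens {s : ℝ} {U : Set (ℝ × ℝ)} {g : ℕ × ℕ → ℝ × ℝ → ℝ} {K : Rect} {α : ℕ × ℕ}
    (hα : α.1 + α.2 = ⌊s⌋₊) :
    ∫⁻ z in K.inner, dens (s - ⌊s⌋₊) U (g α) z ≤ cellDens s U g K :=
  Finset.single_le_sum (f := fun α => ∫⁻ z in K.inner, dens (s - ⌊s⌋₊) U (g α) z)
    (fun _ _ => zero_le) (Finset.HasAntidiagonal.mem_antidiagonal.2 hα)

theorem l2Sq_le_cellDens {s : ℝ} {U : Set (ℝ × ℝ)} {g : ℕ × ℕ → ℝ × ℝ → ℝ} {K : Rect} {α : ℕ × ℕ}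
    (hα : α.1 + α.2 = ⌊s⌋₊) (hs : s = ⌊s⌋₊) : l2Sq K.inner (g α) ≤ cellDens s U g K := by
  refine le_trans (le_of_eq ?_) (le_cellDens hα)
  refine lintegral_congr fun z => ?_
  rw [dens, if_pos (sub_eq_zero.2 hs)]

theorem Rect.volume_inner_le {K : Rect} {h κ : ℝ} (hK : K.Sized h κ) (hh : 0 < h) (hκ : 1 ≤ κ) :
    volume K.inner ≤ ENNReal.ofReal (κ ^ 2 * h ^ 2) := by
  rw [measure_congr K.inner_ae_eq_closed, ← ENNReal.ofReal_toReal K.isCompact_closed.measure_lt_top.ne]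
  refine ENNReal.ofReal_le_ofReal ?_
  exact K.volume_closed.trans_le (hK.area_le hh hκ)

theorem oscSq_le_l2Sq (K K' : Rect) (g : ℝ × ℝ → ℝ) :
    oscSq K K' g ≤ 2 * (volume K'.inner * l2Sq K.inner g + volume K.inner * l2Sq K'.inner g) := by
  have h1 : ∀ z, ∫⁻ w in K'.inner, ‖g z - g w‖ₑ ^ 2 ≤
      2 * (‖g z‖ₑ ^ 2 * volume K'.inner + l2Sq K'.inner g) := by
    intro z
    rw [l2Sq, ← setLIntegral_const, ← lintegral_add_left' aemeasurable_const,
      ← lintegral_const_mul' _ _ (by simp)]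
    refine lintegral_mono fun w => ?_
    have := enorm_add_sq_le (g z) (-g w)
    rwa [enorm_neg, ← sub_eq_add_neg] at this
  refine (lintegral_mono h1).trans (le_of_eq ?_)
  rw [lintegral_const_mul' _ _ (by simp), lintegral_add_right' _ aemeasurable_const,
    setLIntegral_const, lintegral_mul_const' _ _ K'.volume_inner_lt_top.ne, l2Sq, l2Sq,
    mul_comm (volume K'.inner), mul_comm (volume K.inner)]

theorem Rect.inner_mono {K R : Rect} (h : K.closed ⊆ R.closed) : K.inner ⊆ R.inner := by
  have hi : ∀ K : Rect, K.inner = interior K.closed := fun K => by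
    rw [inner, closed, interior_prod_eq, interior_Icc, interior_Icc]
  rw [hi, hi]
  exact interior_mono h

theorem l2Sq_le_of_subset_union {K K' R : Rect} (h : R.closed ⊆ K.closed ∪ K'.closed)
    (g : ℝ × ℝ → ℝ) : l2Sq R.inner g ≤ l2Sq K.inner g + l2Sq K'.inner g := by
  rw [l2Sq, l2Sq, l2Sq, K.lintegral_inner, K'.lintegral_inner]
  exact (lintegral_mono_set (R.inner_subset_closed.trans h)).trans (lintegral_union_le _ _ _)

section

variable {Ω : Set (ℝ × ℝ)} {κ s : ℝ} {G : Finset Rect} {K : Rect}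

/-- The constant in the bound of oscillations by the seminorm. -/
noncomputable def oscConst (κ : ℝ) : ℝ :=
  2 * κ ^ 8 + (4 * κ ^ 4) ^ 4 + 256 * κ ^ 16 * gradConst (1 / 2)

theorem gradConst_half_pos : 0 < gradConst (1 / 2) := gradConst_pos (by norm_num)

theorem oscSq_le_of_joined {K₁ K₂ : Rect} {d σ : ℝ} (hσ : 0 ≤ σ) (hJ : Rect.Joined K₁ K₂ d)
    (g : ℝ × ℝ → ℝ) :
    oscSq K₁ K₂ g ≤ ENNReal.ofReal ((2 * d) ^ (2 + 2 * σ)) *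
      ∫⁻ z in K₁.inner, ∫⁻ w in K₂.inner,
        ‖g z - g w‖ₑ ^ 2 / ENNReal.ofReal (eucl z w ^ (2 + 2 * σ)) := by
  obtain ⟨R, h1, h2, -, h4⟩ := hJ
  rw [oscSq, ← lintegral_const_mul' _ _ ENNReal.ofReal_ne_top]
  refine setLIntegral_mono' K₁.isOpen_inner.measurableSet fun z hz => ?_
  rw [← lintegral_const_mul' _ _ ENNReal.ofReal_ne_top]
  refine setLIntegral_mono' K₂.isOpen_inner.measurableSet fun w hw => ?_
  obtain ⟨e1, e2⟩ := R.abs_sub_le_size (h1 (K₁.inner_subset_closed hz))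
    (h2 (K₂.inner_subset_closed hw))
  exact sq_le_kernel hσ (eucl_le (e1.trans h4) (e2.trans h4))

/-- The open union rectangle contains points of the common edge; these belong to `Ω` because it is
the interior of the union of the cells. -/
theorem IsGrid.inner_subset_of_joined (hG : IsGrid Ω G) {K₁ K₂ R : Rect} (h1 : K₁ ∈ G) (h2 : K₂ ∈ G)
    (h : R.closed ⊆ K₁.closed ∪ K₂.closed) : R.inner ⊆ Ω := by
  rw [hG.fill]
  refine interior_maximal (fun z hz => ?_) R.isOpen_inner
  rcases h (R.inner_subset_closed hz) with h | h
  · exact mem_biUnion (Finset.mem_coe.2 h1) h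
  · exact mem_biUnion (Finset.mem_coe.2 h2) h

/-- Three regimes with the same power of the size. For `s = 2` the oscillation is at most area times
square integrals. For `2 < s < 3` the Slobodeckij kernel is bounded below on a set of small
diameter. For `s = 3` the gradient of the second derivatives is used on the union of the two cells,
where the weak derivatives exist. `oscConst` has one summand for each. -/
theorem oscSq_le_cellDens (hG : IsGrid Ω G) (hr : Regular κ G) (hK : K ∈ G) (hs : 2 ≤ s)
    (hs' : s ≤ 3) {v : ℝ × ℝ → ℝ} {g : ℕ × ℕ → ℝ × ℝ → ℝ}
    (hg : ∀ α, α.1 + α.2 ≤ ⌊s⌋₊ → IsWeakDeriv Ω α v (g α)) {K₁ K₂ : Rect} (h1 : K₁ ∈ star₃ G K)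
    (h2 : K₂ ∈ star₃ G K) (h12 : K₂ ∈ star G K₁) {α : ℕ × ℕ} (hα : α.1 + α.2 = 2) :
    oscSq K₁ K₂ (g α) ≤ ENNReal.ofReal (oscConst κ * K.size ^ (2 * s - 2)) *
      (cellDens s Ω g K₁ + cellDens s Ω g K₂) := by
  have hκ := hr.1
  have hκ4 : 1 ≤ κ ^ 4 := one_le_pow₀ hr.1
  have hh := K.size_pos
  have s1 := hr.sized hK h1
  have s2 := hr.sized hK h2
  have g1 := star₃_subset _ _ h1
  have g2 := star₃_subset _ _ h2
  have hJ : Rect.Joined K₁ K₂ (2 * κ ^ 4 * K.size) :=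
    joined_of_mem_star h12 (by linarith [s1.size_le, s2.size_le])
  have c1 : 0 ≤ 2 * κ ^ 8 := by positivity
  have c2 : 0 ≤ (4 * κ ^ 4) ^ 4 := by positivity
  have c3 : 0 ≤ 256 * κ ^ 16 * gradConst (1 / 2) := by
    have := gradConst_half_pos
    positivity
  have hle : ∀ {a : ℝ}, a ≤ oscConst κ → ∀ {x : ℝ≥0∞}, ENNReal.ofReal (a * K.size ^ (2 * s - 2)) * x ≤
      ENNReal.ofReal (oscConst κ * K.size ^ (2 * s - 2)) * x := by
    intro a ha x
    refine mul_le_mul_left (ENNReal.ofReal_le_ofReal ?_) _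
    exact mul_le_mul_of_nonneg_right ha (by positivity)
  rcases eq_or_lt_of_le hs with rfl | hs2
  · have hf : ⌊(2 : ℝ)⌋₊ = 2 := Nat.floor_ofNat 2
    have e : ∀ K, l2Sq K.inner (g α) ≤ cellDens 2 Ω g K := fun K =>
      l2Sq_le_cellDens (hα.trans hf.symm) (by rw [hf]; norm_num)
    refine le_trans ?_ (hle (a := 2 * κ ^ 8) (by unfold oscConst; linarith))
    refine (oscSq_le_l2Sq K₁ K₂ (g α)).trans ?_
    have ev : ENNReal.ofReal (2 * κ ^ 8 * K.size ^ (2 * (2 : ℝ) - 2)) =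
        2 * ENNReal.ofReal ((κ ^ 4) ^ 2 * K.size ^ 2) := by
      rw [show (2 * (2 : ℝ) - 2) = ((2 : ℕ) : ℝ) by norm_num, Real.rpow_natCast,
        show 2 * κ ^ 8 * K.size ^ 2 = 2 * ((κ ^ 4) ^ 2 * K.size ^ 2) by ring,
        ENNReal.ofReal_mul (by norm_num)]
      simp
    rw [ev, mul_assoc 2 (ENNReal.ofReal _), mul_add (ENNReal.ofReal _)]
    exact mul_le_mul_right (add_le_add
      (mul_le_mul' (Rect.volume_inner_le s2 hh hκ4) (e K₁))
      (mul_le_mul' (Rect.volume_inner_le s1 hh hκ4) (e K₂))) _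
  rcases eq_or_lt_of_le hs' with rfl | hs3
  · have hf : ⌊(3 : ℝ)⌋₊ = 3 := Nat.floor_ofNat 3
    rw [hf] at hg
    have hJ2 := hJ
    obtain ⟨R, r1, r2, r3, r4⟩ := hJ
    have hRΩ := hG.inner_subset_of_joined g1 g2 r3
    have hgα := hg α (by omega)
    have w1 := (hgα.fst (hg (α + (1, 0)) (by simp only [Prod.fst_add, Prod.snd_add]; omega))).mono hRΩ
    have w2 := (hgα.snd (hg (α + (0, 1)) (by simp only [Prod.fst_add, Prod.snd_add]; omega))).mono hRΩ
    have hgrad := fracSq_le_grad (σ := 1 / 2) (by norm_num) (by norm_num) R w1 w2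
    have e : ∀ (β : ℕ × ℕ), β.1 + β.2 = 3 →
        l2Sq R.inner (g β) ≤ cellDens 3 Ω g K₁ + cellDens 3 Ω g K₂ := fun β hβ =>
      (l2Sq_le_of_subset_union r3 _).trans (add_le_add
        (l2Sq_le_cellDens (hβ.trans hf.symm) (by rw [hf]; norm_num))
        (l2Sq_le_cellDens (hβ.trans hf.symm) (by rw [hf]; norm_num)))
    have e1 := e (α + (1, 0)) (by simp only [Prod.fst_add, Prod.snd_add]; omega)
    have e2 := e (α + (0, 1)) (by simp only [Prod.fst_add, Prod.snd_add]; omega)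
    refine le_trans ?_ (hle (a := 256 * κ ^ 16 * gradConst (1 / 2)) (by unfold oscConst; linarith))
    set X := cellDens 3 Ω g K₁ + cellDens 3 Ω g K₂ with hX
    have k1 := oscSq_le_of_joined (σ := 1 / 2) (by norm_num) hJ2 (g α)
    have k2 : ∫⁻ z in K₁.inner, ∫⁻ w in K₂.inner,
        ‖g α z - g α w‖ₑ ^ 2 / ENNReal.ofReal (eucl z w ^ (2 + 2 * (1 / 2 : ℝ))) ≤
        fracSq (1 / 2) R.inner (g α) := by
      rw [fracSq, if_neg (by norm_num)]
      refine (lintegral_mono fun z => lintegral_mono_set (Rect.inner_mono r2)).trans ?_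
      exact lintegral_mono_set (Rect.inner_mono r1)
    have k3 : fracSq (1 / 2) R.inner (g α) ≤
        ENNReal.ofReal (gradConst (1 / 2) * (2 * κ ^ 4 * K.size)) * (X + X) := by
      refine hgrad.trans (mul_le_mul' (ENNReal.ofReal_le_ofReal ?_) (add_le_add e1 e2))
      rw [show (2 - 2 * (1 / 2) : ℝ) = 1 by norm_num, Real.rpow_one]
      exact mul_le_mul_of_nonneg_left r4 gradConst_half_pos.le
    refine (k1.trans (mul_le_mul_right (k2.trans k3) _)).trans (le_of_eq ?_)
    rw [← two_mul, ← mul_assoc, ← mul_assoc]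
    congr 1
    rw [show (2 : ℝ≥0∞) = ENNReal.ofReal 2 by simp, ← ENNReal.ofReal_mul (by positivity),
      ← ENNReal.ofReal_mul (by have := gradConst_half_pos; positivity)]
    congr 1
    rw [show (2 + 2 * (1 / 2) : ℝ) = ((3 : ℕ) : ℝ) by norm_num, Real.rpow_natCast,
      show (2 * 3 - 2 : ℝ) = ((4 : ℕ) : ℝ) by norm_num, Real.rpow_natCast]
    ring
  · have hf : ⌊s⌋₊ = 2 := (Nat.floor_eq_iff (by linarith)).2 ⟨by exact_mod_cast hs, by
      push_cast; linarith⟩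
    refine le_trans ?_ (hle (a := (4 * κ ^ 4) ^ 4) (by unfold oscConst; linarith))
    have k1 := oscSq_le_of_joined (σ := s - 2) (by linarith) hJ (g α)
    refine k1.trans (mul_le_mul' (ENNReal.ofReal_le_ofReal ?_) ?_)
    · rw [show 2 + 2 * (s - 2) = 2 * s - 2 by ring,
        show 2 * (2 * κ ^ 4 * K.size) = (4 * κ ^ 4) * K.size by ring,
        Real.mul_rpow (by positivity) hh.le]
      refine mul_le_mul_of_nonneg_right ?_ (by positivity)
      rw [← Real.rpow_natCast (4 * κ ^ 4) 4]
      exact Real.rpow_le_rpow_of_exponent_le (show (1 : ℝ) ≤ 4 * κ ^ 4 by linarith)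
        (by push_cast; linarith)
    · refine le_trans ?_ (le_add_of_nonneg_right zero_le)
      refine le_trans ?_ (le_cellDens (hα.trans hf.symm))
      refine lintegral_mono fun z => ?_
      rw [hf, dens, if_neg (by push_cast; linarith)]
      push_cast
      exact lintegral_mono_set (hG.inner_subset g2)

theorem nearOsc_le (hG : IsGrid Ω G) (hr : Regular κ G) (hK : K ∈ G) (hs : 2 ≤ s)
    (hs' : s ≤ 3) {v : ℝ × ℝ → ℝ} {g : ℕ × ℕ → ℝ × ℝ → ℝ}
    (hg : ∀ α, α.1 + α.2 ≤ ⌊s⌋₊ → IsWeakDeriv Ω α v (g α)) :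
    nearOsc G K g ≤ 750 * (ENNReal.ofReal (oscConst κ * K.size ^ (2 * s - 2)) *
      ∑ K₁ ∈ star₃ G K, cellDens s Ω g K₁) := by
  classical
  set X := ENNReal.ofReal (oscConst κ * K.size ^ (2 * s - 2)) with hX
  set S := ∑ K₁ ∈ star₃ G K, cellDens s Ω g K₁ with hS
  have hcard : ((star₃ G K).card : ℝ≥0∞) ≤ 125 := by exact_mod_cast hG.card_star₃_le K
  have h1 : nearOsc G K g ≤ ∑ α ∈ Finset.HasAntidiagonal.antidiagonal 2, ∑ K₁ ∈ star₃ G K,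
      ∑ K₂ ∈ star₃ G K, X * (cellDens s Ω g K₁ + cellDens s Ω g K₂) := by
    refine Finset.sum_le_sum fun α hα => Finset.sum_le_sum fun K₁ h1 =>
      Finset.sum_le_sum fun K₂ h2 => ?_
    split_ifs with h12
    · exact oscSq_le_cellDens hG hr hK hs hs' hg h1 h2 h12
        (Finset.HasAntidiagonal.mem_antidiagonal.1 hα)
    · exact zero_le
  refine h1.trans ?_
  simp only [← Finset.mul_sum, Finset.sum_add_distrib, Finset.sum_const, nsmul_eq_mul, ← hS]
  rw [show (Finset.HasAntidiagonal.antidiagonal 2 : Finset (ℕ × ℕ)).card = 3 from rfl]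
  -- `750 = 3 · 125 · 2`: multi-indices of order two, cells for the free index, and the two terms of
  -- each pair.
  calc X * ((star₃ G K).card * (((3 : ℕ) : ℝ≥0∞) * S) + (star₃ G K).card * (((3 : ℕ) : ℝ≥0∞) * S))
      ≤ X * (125 * (((3 : ℕ) : ℝ≥0∞) * S) + 125 * (((3 : ℕ) : ℝ≥0∞) * S)) := by gcongr
    _ = 750 * (X * S) := by
        push_cast
        ring

/-- The constant in the estimate of the error in the cells. -/
noncomputable def errConst (κ : ℝ) : ℝ := 4500 * localConst κ * oscConst κ + 1

theorem localConst_nonneg (κ : ℝ) : 0 ≤ localConst κ := by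
  have h : 0 ≤ stepConst (κ ^ 4) := by
    unfold stepConst
    positivity
  unfold localConst chainConst
  positivity

theorem oscConst_nonneg (κ : ℝ) : 0 ≤ oscConst κ := by
  have := gradConst_half_pos
  unfold oscConst
  have h8 : 0 ≤ κ ^ 8 := by positivity
  positivity

theorem errConst_pos (κ : ℝ) : 0 < errConst κ := by
  have := mul_nonneg (localConst_nonneg κ) (oscConst_nonneg κ)
  unfold errConst
  linarith

theorem pderiv_quad_of_two_le (c : Fin 6 → ℝ) {α : ℕ × ℕ} (hα : 2 ≤ α.1 + α.2)
    (hα' : α.1 + α.2 ≤ 3) : (∀ z w, pderiv α (quad c) z = pderiv α (quad c) w) ∧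
      (α.1 + α.2 = 3 → pderiv α (quad c) = 0) := by
  have key : ∀ d : Fin 6 → ℝ, pderiv α (quad c) = quad d → d 1 = 0 → d 2 = 0 → d 3 = 0 →
      d 4 = 0 → d 5 = 0 → (α.1 + α.2 = 3 → d 0 = 0) →
      (∀ z w, pderiv α (quad c) z = pderiv α (quad c) w) ∧
      (α.1 + α.2 = 3 → pderiv α (quad c) = 0) := by
    intro d hd h1 h2 h3 h4 h5 h0
    rw [hd]
    refine ⟨fun z w => by simp [quad, h1, h2, h3, h4, h5], fun h => ?_⟩
    funext z
    simp [quad, h1, h2, h3, h4, h5, h0 h]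
  obtain ⟨a, b⟩ := α
  simp only at hα hα' key ⊢
  have ha : a ≤ 3 := by omega
  have hb : b ≤ 3 := by omega
  interval_cases a <;> interval_cases b <;> first | omega | skip
  all_goals
    refine key _ (by simp only [pderiv, Function.iterate_succ_apply, Function.iterate_zero_apply,
      pdx_quad, pdy_quad]; rfl) ?_ ?_ ?_ ?_ ?_ ?_ <;> simp [coefDx, coefDy]

/-- Orders up to two come from the local estimate. Order three occurs only for `s = 3`; the
derivative of the interpolant is then zero and the error is the third derivative of `v` itself,
which accounts for the `+ 1` in `errConst`. -/
theorem l2Sq_error_le (hG : IsGrid Ω G) (hr : Regular κ G) (hK : K ∈ G) (hs : 2 ≤ s)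
    (hs' : s ≤ 3) {v : ℝ × ℝ → ℝ} (hv : MemHZero 2 Ω v) {g : ℕ × ℕ → ℝ × ℝ → ℝ}
    (hg : ∀ α, α.1 + α.2 ≤ ⌊s⌋₊ → IsWeakDeriv Ω α v (g α)) {α : ℕ × ℕ}
    (hα : α.1 + α.2 ≤ ⌊s⌋₊) :
    l2Sq K.inner (g α - pderiv α (quad (interpCoef G v K))) ≤
      ENNReal.ofReal (errConst κ * K.size ^ (2 * (s - ((α.1 + α.2 : ℕ) : ℝ)))) *
        ∑ K₁ ∈ star₃ G K, cellDens s Ω g K₁ := by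
  have hh := K.size_pos
  have h2 : 2 ≤ ⌊s⌋₊ := Nat.le_floor (by exact_mod_cast hs)
  have n1 := localConst_nonneg κ
  have n2 := oscConst_nonneg κ
  rcases le_or_gt (α.1 + α.2) 2 with h | h
  · refine (l2Sq_interp_le hG hr hK hv (fun β hβ => hg β (hβ.trans h2)) h).trans ?_
    refine (mul_le_mul_right (nearOsc_le hG hr hK hs hs' hg) _).trans ?_
    rw [← mul_assoc 750, ← mul_assoc]
    refine mul_le_mul_left ?_ _
    rw [show (6 : ℝ≥0∞) = ENNReal.ofReal 6 by simp, show (750 : ℝ≥0∞) = ENNReal.ofReal 750 by simp,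
      ← ENNReal.ofReal_mul (by norm_num), ← ENNReal.ofReal_mul (by norm_num),
      ← ENNReal.ofReal_mul (by positivity)]
    refine ENNReal.ofReal_le_ofReal ?_
    have e : K.size ^ (2 * (s - ((α.1 + α.2 : ℕ) : ℝ))) =
        K.size ^ (2 - 2 * ((α.1 + α.2 : ℕ) : ℝ)) * K.size ^ (2 * s - 2) := by
      rw [← Real.rpow_add hh]
      congr 1
      ring
    rw [e, errConst]
    have : 0 ≤ K.size ^ (2 - 2 * ((α.1 + α.2 : ℕ) : ℝ)) * K.size ^ (2 * s - 2) := by positivity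
    nlinarith
  · have h3 : ⌊s⌋₊ ≤ 3 := by
      have := Nat.floor_le_floor hs'
      rwa [Nat.floor_ofNat] at this
    have h4 : α.1 + α.2 = 3 := by omega
    have h5 : ⌊s⌋₊ = 3 := by omega
    have h6 : s = 3 := le_antisymm hs' (by
      have := Nat.floor_le (by linarith : 0 ≤ s)
      rw [h5] at this
      exact_mod_cast this)
    rw [(pderiv_quad_of_two_le _ (by omega) h4.le).2 h4, sub_zero]
    have e1 : l2Sq K.inner (g α) ≤ cellDens s Ω g K :=
      l2Sq_le_cellDens (h4.trans h5.symm) (by rw [h5, h6]; norm_num)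
    have e2 : cellDens s Ω g K ≤ ∑ K₁ ∈ star₃ G K, cellDens s Ω g K₁ :=
      Finset.single_le_sum (f := cellDens s Ω g) (fun _ _ => zero_le) (self_mem_star₃ hK)
    refine (e1.trans e2).trans (le_mul_of_one_le_left zero_le ?_)
    rw [h4, h6, show (2 * (3 - ((3 : ℕ) : ℝ))) = 0 by norm_num, Real.rpow_zero, mul_one,
      ENNReal.one_le_ofReal, errConst]
    have := mul_nonneg n1 n2
    linarith

/-- The two kernels differ by the factor `|z - w|^(2(σ - τ))`, bounded on a set of bounded diameter.
-/
theorem kernel_le_kernel {σ τ h : ℝ} (hστ : τ ≤ σ) {g : ℝ × ℝ → ℝ} {z w : ℝ × ℝ}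
    (he : eucl z w ≤ 2 * h) :
    ‖g z - g w‖ₑ ^ 2 / ENNReal.ofReal (eucl z w ^ (2 + 2 * τ)) ≤
      ENNReal.ofReal ((2 * h) ^ (2 * (σ - τ))) *
        (‖g z - g w‖ₑ ^ 2 / ENNReal.ofReal (eucl z w ^ (2 + 2 * σ))) := by
  by_cases hzw : z = w
  · subst hzw
    simp
  · have hpos : 0 < eucl z w := by
      refine Real.sqrt_pos.2 ?_
      by_contra hc
      have h0 : (z.1 - w.1) ^ 2 + (z.2 - w.2) ^ 2 = 0 := le_antisymm (not_lt.1 hc) (by positivity)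
      refine hzw (Prod.ext ?_ ?_)
      · nlinarith [sq_nonneg (z.1 - w.1), sq_nonneg (z.2 - w.2)]
      · nlinarith [sq_nonneg (z.1 - w.1), sq_nonneg (z.2 - w.2)]
    have e1 : eucl z w ^ (2 + 2 * σ) = eucl z w ^ (2 * (σ - τ)) * eucl z w ^ (2 + 2 * τ) := by
      rw [← Real.rpow_add hpos]
      congr 1
      ring
    have hle : eucl z w ^ (2 * (σ - τ)) ≤ (2 * h) ^ (2 * (σ - τ)) :=
      Real.rpow_le_rpow hpos.le he (by linarith)
    have p1 : 0 < eucl z w ^ (2 * (σ - τ)) := Real.rpow_pos_of_pos hpos _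
    rw [e1, ENNReal.ofReal_mul p1.le, div_eq_mul_inv, div_eq_mul_inv,
      ENNReal.mul_inv (.inr ENNReal.ofReal_ne_top) (.inl ENNReal.ofReal_ne_top), mul_left_comm,
      ← mul_assoc (ENNReal.ofReal ((2 * h) ^ _))]
    refine mul_le_mul_right (le_mul_of_one_le_left zero_le ?_) _
    rw [← div_eq_mul_inv]
    rw [ENNReal.le_div_iff_mul_le (.inl (ENNReal.ofReal_pos.2 p1).ne') (.inl ENNReal.ofReal_ne_top),
      one_mul]
    exact ENNReal.ofReal_le_ofReal hle

/-- The constant in the estimate of order `k` in the cells. -/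
noncomputable def cellConst (κ τ : ℝ) : ℝ := 4 * (errConst κ + 2 * gradConst τ * errConst κ + 4)

/-- Write `k = j + τ` with `j` an integer and `0 ≤ τ < 1`. For `τ = 0` this is the `L²` estimate. If
derivatives of order `j + 1` are available, `fracSq_le_grad` interpolates. Otherwise `j = ⌊s⌋`, and
the kernels of orders `k` and `s` are compared directly. -/
theorem seminormSq_error_le (hG : IsGrid Ω G) (hr : Regular κ G) (hK : K ∈ G) (hs : 2 ≤ s)
    (hs' : s ≤ 3) {k : ℝ} (hk : 0 ≤ k) (hks : k ≤ s) {v : ℝ × ℝ → ℝ} (hv : MemHZero 2 Ω v)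
    {g : ℕ × ℕ → ℝ × ℝ → ℝ} (hg : ∀ α, α.1 + α.2 ≤ ⌊s⌋₊ → IsWeakDeriv Ω α v (g α)) :
    seminormSq k K.inner (v - quasiInterp G v) ≤
      ENNReal.ofReal (cellConst κ (k - ⌊k⌋₊) * K.size ^ (2 * (s - k))) *
        ∑ K₁ ∈ star₃ G K, cellDens s Ω g K₁ := by
  have hh := K.size_pos
  set j := ⌊k⌋₊ with hj
  set τ := k - j with hτ
  set c := interpCoef G v K with hc
  set S := ∑ K₁ ∈ star₃ G K, cellDens s Ω g K₁ with hS
  set d : ℕ × ℕ → ℝ × ℝ → ℝ := fun α => g α - pderiv α (quad c) with hd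
  have hj1 : (j : ℝ) ≤ k := Nat.floor_le hk
  have hj2 : k < j + 1 := Nat.lt_floor_add_one k
  have hτ0 : 0 ≤ τ := sub_nonneg.2 hj1
  have hτ1 : τ < 1 := by rw [hτ]; linarith
  have hjs : j ≤ ⌊s⌋₊ := Nat.floor_le_floor hks
  have h2 : 2 ≤ ⌊s⌋₊ := Nat.le_floor (by exact_mod_cast hs)
  have h3 : ⌊s⌋₊ ≤ 3 := by
    have := Nat.floor_le_floor hs'
    rwa [Nat.floor_ofNat] at this
  have hKΩ := hG.inner_subset hK
  have hec := errConst_pos κ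
  have hgc := gradConst_pos hτ1
  have hwd : ∀ α, α.1 + α.2 ≤ ⌊s⌋₊ → IsWeakDeriv K.inner α (v - quasiInterp G v) (d α) := by
    intro α hα
    refine (((hg α hα).mono hKΩ).sub (isWeakDeriv_of_contDiff K.inner
      (Rect.contDiff_quad c) α)).congr K.isOpen_inner fun z hz => ?_
    rw [Pi.sub_apply, Pi.sub_apply, (quasiInterp_rep hG v).restrict K (Finset.mem_coe.2 hK) z hz]
  rw [seminormSq_eq K.isOpen_inner (g := d) fun α hα => hwd α
    ((Finset.HasAntidiagonal.mem_antidiagonal.1 hα).trans_le hjs)]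
  have herr : ∀ α, α.1 + α.2 ≤ ⌊s⌋₊ → l2Sq K.inner (d α) ≤
      ENNReal.ofReal (errConst κ * K.size ^ (2 * (s - ((α.1 + α.2 : ℕ) : ℝ)))) * S :=
    fun α hα => l2Sq_error_le hG hr hK hs hs' hv hg hα
  -- One summand for each of the three cases; the factor `4` of `cellConst` counts the multi-indices
  -- of order `j ≤ 3`.
  set M := errConst κ + 2 * gradConst τ * errConst κ + 4 with hM
  have hM0 : 0 < M := by positivity
  have hge : 0 < 2 * gradConst τ * errConst κ := by positivity
  have hmono : ∀ {a : ℝ}, a ≤ M → ENNReal.ofReal (a * K.size ^ (2 * (s - k))) * S ≤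
      ENNReal.ofReal (M * K.size ^ (2 * (s - k))) * S := by
    intro a ha
    refine mul_le_mul_left (ENNReal.ofReal_le_ofReal ?_) _
    exact mul_le_mul_of_nonneg_right ha (by positivity)
  have key : ∀ α, α.1 + α.2 = j → fracSq τ K.inner (d α) ≤
      ENNReal.ofReal (M * K.size ^ (2 * (s - k))) * S := by
    intro α hα
    rcases eq_or_lt_of_le hτ0 with h0 | h0
    · rw [← h0, fracSq_zero]
      have e := herr α (hα.trans_le hjs)
      rw [hα, show (j : ℝ) = k by linarith] at e
      exact e.trans (hmono (by rw [hM]; linarith))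
    rcases lt_or_eq_of_le hjs with hlt | heq
    · have a1 : (α + (1, 0)).1 + (α + (1, 0)).2 = j + 1 := by
        simp only [Prod.fst_add, Prod.snd_add]
        omega
      have a2 : (α + (0, 1)).1 + (α + (0, 1)).2 = j + 1 := by
        simp only [Prod.fst_add, Prod.snd_add]
        omega
      have w0 := hwd α (by omega)
      have w1 := w0.fst (hwd (α + (1, 0)) (by omega))
      have w2 := w0.snd (hwd (α + (0, 1)) (by omega))
      have e1 := herr (α + (1, 0)) (by omega)
      have e2 := herr (α + (0, 1)) (by omega)
      rw [a1] at e1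
      rw [a2] at e2
      refine (fracSq_le_grad h0 hτ1 K w1 w2).trans ?_
      refine (mul_le_mul_right (add_le_add e1 e2) _).trans ?_
      refine le_trans (le_of_eq ?_) (hmono (a := 2 * gradConst τ * errConst κ)
        (by rw [hM]; linarith))
      rw [← two_mul, ← mul_assoc, ← mul_assoc]
      congr 1
      rw [show (2 : ℝ≥0∞) = ENNReal.ofReal 2 by simp, ← ENNReal.ofReal_mul (by positivity),
        ← ENNReal.ofReal_mul (by positivity)]
      congr 1
      have e : K.size ^ (2 * (s - k)) =
          K.size ^ (2 - 2 * τ) * K.size ^ (2 * (s - ((j + 1 : ℕ) : ℝ))) := by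
        rw [← Real.rpow_add hh]
        congr 1
        rw [hτ]
        push_cast
        ring
      rw [e]
      ring
    · have hσ : τ ≤ s - ⌊s⌋₊ := by
        rw [hτ, ← heq]
        linarith
      have hσ0 : s - ⌊s⌋₊ ≠ 0 := by linarith
      have hc2 := (pderiv_quad_of_two_le c (α := α) (by omega) (by omega)).1
      rw [fracSq, if_neg h0.ne']
      -- Here `j ≥ 2`, so the derivative of the interpolant is constant on the cell and drops out of
      -- the differences.
      have hd' : ∀ z w, d α z - d α w = g α z - g α w := by
        intro z w
        simp only [hd, Pi.sub_apply, hc2 z w]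
        ring
      simp only [hd']
      have e1 : ∫⁻ z in K.inner, ∫⁻ w in K.inner,
          ‖g α z - g α w‖ₑ ^ 2 / ENNReal.ofReal (eucl z w ^ (2 + 2 * τ)) ≤
          ENNReal.ofReal ((2 * K.size) ^ (2 * (s - ⌊s⌋₊ - τ))) *
            ∫⁻ z in K.inner, dens (s - ⌊s⌋₊) Ω (g α) z := by
        rw [← lintegral_const_mul' _ _ ENNReal.ofReal_ne_top]
        refine setLIntegral_mono' K.isOpen_inner.measurableSet fun z hz => ?_
        rw [dens, if_neg hσ0]
        refine le_trans ?_ (mul_le_mul_right (lintegral_mono_set hKΩ) _)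
        rw [← lintegral_const_mul' _ _ ENNReal.ofReal_ne_top]
        refine setLIntegral_mono' K.isOpen_inner.measurableSet fun w hw => ?_
        obtain ⟨e1, e2⟩ := K.abs_sub_le_size (K.inner_subset_closed hz) (K.inner_subset_closed hw)
        exact kernel_le_kernel hσ (eucl_le e1 e2)
      have e2 : ∫⁻ z in K.inner, dens (s - ⌊s⌋₊) Ω (g α) z ≤ S :=
        (le_cellDens (hα.trans heq)).trans
          (Finset.single_le_sum (f := cellDens s Ω g) (fun _ _ => zero_le) (self_mem_star₃ hK))
      refine e1.trans (le_trans (mul_le_mul' (ENNReal.ofReal_le_ofReal ?_) e2)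
        (hmono (a := 4) (by rw [hM]; linarith)))
      rw [show s - ⌊s⌋₊ - τ = s - k by rw [hτ, ← heq]; ring,
        Real.mul_rpow (by norm_num) hh.le]
      refine mul_le_mul_of_nonneg_right ?_ (by positivity)
      have hsk : 2 * (s - k) ≤ ((2 : ℕ) : ℝ) := by
        have : s < ⌊s⌋₊ + 1 := Nat.lt_floor_add_one s
        rw [← heq] at this
        push_cast
        linarith
      calc (2 : ℝ) ^ (2 * (s - k)) ≤ (2 : ℝ) ^ ((2 : ℕ) : ℝ) :=
            Real.rpow_le_rpow_of_exponent_le (by norm_num) hsk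
        _ = 4 := by
            rw [Real.rpow_natCast]
            norm_num
  have hcard : (Finset.HasAntidiagonal.antidiagonal j : Finset (ℕ × ℕ)).card ≤ 4 := by
    rw [Finset.Nat.card_antidiagonal]
    omega
  calc ∑ α ∈ Finset.HasAntidiagonal.antidiagonal j, fracSq τ K.inner (d α)
      ≤ ∑ α ∈ Finset.HasAntidiagonal.antidiagonal j,
        ENNReal.ofReal (M * K.size ^ (2 * (s - k))) * S :=
        Finset.sum_le_sum fun α hα => key α (Finset.HasAntidiagonal.mem_antidiagonal.1 hα)
    _ ≤ 4 * (ENNReal.ofReal (M * K.size ^ (2 * (s - k))) * S) := by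
        rw [Finset.sum_const, nsmul_eq_mul]
        refine mul_le_mul_left ?_ _
        exact_mod_cast hcard
    _ = _ := by
        rw [← mul_assoc, show (4 : ℝ≥0∞) = ENNReal.ofReal 4 by simp,
          ← ENNReal.ofReal_mul (by norm_num), cellConst, mul_assoc]

end

/-! ### Summation over the cells -/

section

variable {Ω : Set (ℝ × ℝ)} {κ s : ℝ} {G : Finset Rect}

theorem IsGrid.sum_lintegral_le (hG : IsGrid Ω G) (f : ℝ × ℝ → ℝ≥0∞) :
    ∑ K ∈ G, ∫⁻ z in K.inner, f z ≤ ∫⁻ z in Ω, f z := by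
  rw [← lintegral_biUnion_finset (fun K hK K' hK' hne => ?_)
    (fun K _ => K.isOpen_inner.measurableSet)]
  · exact lintegral_mono_set (iUnion₂_subset fun K hK => hG.inner_subset hK)
  · refine disjoint_left.2 fun z hz hz' => hne ?_
    exact hG.eq_of_mem_inner hK hK' hz (K'.inner_subset_closed hz')

/-- In `dens` the inner variable ranges over all of `Ω`, so the contributions of disjoint cells add
up without loss, also for fractional `s`. -/
theorem IsGrid.sum_cellDens_le (hG : IsGrid Ω G) {v : ℝ × ℝ → ℝ} {g : ℕ × ℕ → ℝ × ℝ → ℝ}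
    (hg : ∀ α, α.1 + α.2 ≤ ⌊s⌋₊ → IsWeakDeriv Ω α v (g α)) :
    ∑ K ∈ G, cellDens s Ω g K ≤ seminormSq s Ω v := by
  have hΩ : IsOpen Ω := by
    rw [hG.fill]
    exact isOpen_interior
  rw [seminormSq_eq hΩ fun α hα => hg α (Finset.HasAntidiagonal.mem_antidiagonal.1 hα).le]
  unfold cellDens
  rw [Finset.sum_comm]
  refine Finset.sum_le_sum fun α _ => ?_
  rw [fracSq_eq_dens]
  exact hG.sum_lintegral_le _

/-- Exchange the sums by the symmetry of `star₃`; every cell lies in at most 125 neighbourhoods. -/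
theorem IsGrid.sum_star₃_le (hG : IsGrid Ω G) (f : Rect → ℝ≥0∞) :
    ∑ K ∈ G, ∑ K₁ ∈ star₃ G K, f K₁ ≤ 125 * ∑ K ∈ G, f K := by
  classical
  have h : ∀ K K₁, K ∈ G ∧ K₁ ∈ star₃ G K ↔ K ∈ star₃ G K₁ ∧ K₁ ∈ G := fun K K₁ =>
    ⟨fun h => ⟨star₃_symm h.1 h.2, star₃_subset _ _ h.2⟩,
      fun h => ⟨star₃_subset _ _ h.1, star₃_symm h.2 h.1⟩⟩
  rw [Finset.sum_comm' h, Finset.mul_sum]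
  refine Finset.sum_le_sum fun K _ => ?_
  rw [Finset.sum_const, nsmul_eq_mul]
  exact mul_le_mul_left (by exact_mod_cast hG.card_star₃_le K) _

theorem Rect.size_le_meshSize {K : Rect} (hK : K ∈ G) : K.size ≤ meshSize G :=
  le_csSup (G.finite_toSet.image _).bddAbove (mem_image_of_mem _ (Finset.mem_coe.2 hK))

theorem meshSize_nonneg (G : Finset Rect) : 0 ≤ meshSize G :=
  Real.sSup_nonneg (forall_mem_image.2 fun K _ => K.size_pos.le)

theorem cellConst_pos (κ : ℝ) {τ : ℝ} (hτ : τ < 1) : 0 < cellConst κ τ := by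
  have h1 := errConst_pos κ
  have h2 := gradConst_pos hτ
  unfold cellConst
  positivity

theorem brokenSeminorm_error_le (hG : IsGrid Ω G) (hr : Regular κ G) (hs : 2 ≤ s) (hs' : s ≤ 3)
    {k : ℝ} (hk : 0 ≤ k) (hks : k ≤ s) {v : ℝ × ℝ → ℝ} (hv : MemHZero 2 Ω v) (hv' : MemH s Ω v) :
    brokenSeminorm k G (v - quasiInterp G v) ≤
      ENNReal.ofReal (√(125 * cellConst κ (k - ⌊k⌋₊)) * meshSize G ^ (s - k)) *
        seminorm s Ω v := by
  obtain ⟨g, hg⟩ := hv'.exists_weakDeriv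
  have hC := cellConst_pos κ (τ := k - ⌊k⌋₊) (by linarith [Nat.lt_floor_add_one k])
  set C := cellConst κ (k - ⌊k⌋₊)
  have hm := meshSize_nonneg G
  set h := meshSize G
  have h1 : ∑ K ∈ G, seminormSq k K.inner (v - quasiInterp G v) ≤
      ENNReal.ofReal (125 * C * h ^ (2 * (s - k))) * seminormSq s Ω v := by
    calc ∑ K ∈ G, seminormSq k K.inner (v - quasiInterp G v)
        ≤ ∑ K ∈ G, ENNReal.ofReal (C * h ^ (2 * (s - k))) *
            ∑ K₁ ∈ star₃ G K, cellDens s Ω g K₁ := by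
          refine Finset.sum_le_sum fun K hK => ?_
          refine (seminormSq_error_le hG hr hK hs hs' hk hks hv hg).trans
            (mul_le_mul_left (ENNReal.ofReal_le_ofReal ?_) _)
          -- Only here are the sizes of the cells replaced by the mesh size, which is possible since
          -- `s - k ≥ 0`.
          exact mul_le_mul_of_nonneg_left (Real.rpow_le_rpow K.size_pos.le
            (Rect.size_le_meshSize hK) (by linarith)) hC.le
      _ ≤ ENNReal.ofReal (C * h ^ (2 * (s - k))) * (125 * seminormSq s Ω v) := by
          rw [← Finset.mul_sum]
          exact mul_le_mul_right ((hG.sum_star₃_le _).trans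
            (mul_le_mul_right (hG.sum_cellDens_le hg) _)) _
      _ = ENNReal.ofReal (125 * C * h ^ (2 * (s - k))) * seminormSq s Ω v := by
          rw [mul_assoc 125 C, ENNReal.ofReal_mul (by norm_num : (0 : ℝ) ≤ 125),
            ENNReal.ofReal_ofNat]
          ring
  have e : √(125 * C) * h ^ (s - k) = (125 * C * h ^ (2 * (s - k))) ^ (1 / 2 : ℝ) := by
    rw [Real.mul_rpow (by positivity) (by positivity), Real.sqrt_eq_rpow, ← Real.rpow_mul hm]
    ring_nf
  rw [brokenSeminorm, seminorm, e, ← ENNReal.ofReal_rpow_of_nonneg (by positivity) (by norm_num),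
    ← ENNReal.mul_rpow_of_nonneg _ _ (by norm_num)]
  exact ENNReal.rpow_le_rpow h1 (by norm_num)

end

end RRM

theorem theorem3p1 (Ω : Set (ℝ × ℝ)) (hΩ : IsSimplyConnected Ω) (γ₀ s k : ℝ)
    (hs : 2 ≤ s) (hs' : s ≤ 3) (hk : 0 ≤ k) (hks : k ≤ s) :
    ∃ C : ℝ, 0 < C ∧ ∀ G : Finset RRM.Rect, RRM.IsGrid Ω G → RRM.IsShapeRegular γ₀ G →
      ∀ v : ℝ × ℝ → ℝ, RRM.MemHZero 2 Ω v → RRM.MemH s Ω v →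
        RRM.quasiInterp G v ∈ RRM.rrmZero (G : Set RRM.Rect) ∧
        RRM.brokenSeminorm k G (v - RRM.quasiInterp G v) ≤
          ENNReal.ofReal (C * RRM.meshSize G ^ (s - k)) * RRM.seminorm s Ω v := by
  -- The constant is explicit and depends on `γ₀` and `k` only.
  refine ⟨√(125 * RRM.cellConst (max 1 (γ₀ / 2)) (k - ⌊k⌋₊)), ?_, fun G hG hr v hv hv' =>
    ⟨⟨RRM.interpCoef G v, RRM.quasiInterp_rep hG v⟩,
      RRM.brokenSeminorm_error_le hG hr.regular hs hs' hk hks hv hv'⟩⟩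
  have := RRM.cellConst_pos (max 1 (γ₀ / 2)) (τ := k - ⌊k⌋₊) (by linarith [Nat.lt_floor_add_one k])
  positivity
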